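/- **Setting.** Let $n\ge 1$, $0<\nu\le 1$, $0<\gamma\le 1$, $0\le \ell_<<n/2$. For $\rho\ge 0$ let $f_\rho(\xi)=\exp(\rho(|\xi|^\nu\vee 1))$, and let $\widehat{u}$ be the (unitary) Fourier transform of $u$ on $\mathbb R^n$, with $\widehat u_>=\mathbf 1_{|\xi|>1}\widehat u$, $\widehat u_<=\mathbf 1_{|\xi|\le 1}\widehat u$. Put $$K_\rho^k=\{w:\ |w|_k^2=\||\xi|^k f_\rho\widehat w_>\|_2^2+\|f_\rho\widehat w_<\|_2^2<\infty\},$$ $$Y_\rho^\ell=\{\varphi \text{ real}:\ \widehat\varphi\in L^1_{loc},\ |\varphi|_\ell^2=\||\xi|^{\ell+2} f_\rho\widehat \varphi_>\|_2^2+\||\xi|^{\ell_<}f_\rho\widehat \varphi_<\|_2^2<\infty\}.$$ Let $|\rho'|$ be a strictly positive $C^1$ function on $[1,\infty)$ which is integrable and such that $t^{-\gamma}|\rho'|^{-1}$ is nondecreasing and $t^{-2}|\rho'|^{-1}$ is nonincreasing and tends to $0$ at infinity. Let $\rho(t)=\rho_\infty-\int_t^\infty|\rho'(t_1)|\,dt_1$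 (so that $\rho'=|\rho'|$). Norms of time dependent functions at time $t$ are taken with $\rho=\rho(t)$; in particular $|w(t)-w_+|_k$ is taken with $\rho(t)$. For an interval $I$ and a function $H>0$ on $I$ let $$Y(w;I,H,k)=\max\Big\{\sup_{t\in I}H(t)^{-1}|w(t)|_k,\ \Big(\int_I\rho'(t)H(t)^{-2}|w(t)|^2_{k+\nu/2}\,dt\Big)^{1/2}\Big\}.$$ Write $(w,0)\in\mathcal X_\rho^{k,0}(I)$ if $t\mapsto F^{-1}(f_{\rho(t)}\widehat w(t))$ is continuous from $I$ to $K_0^k$ and $Y(w;I,1,k)<\infty$, the latter being the norm of this space. Write $(w,\varphi)\in\mathcal Y_\rho^{k,\ell}(I)$ if $t\mapsto (F^{-1}(f_{\rho(t)}\widehat w(t)),F^{-1}(f_{\rho(t)}\widehat\varphi(t)))$ is continuous and bounded from $I$ to $K_0^k\oplus Y_0^\ell$. The weak-$*$ topology of $\mathcal X_\rho^{k,0}(I)$ is that of $L^\infty(I,K_\rho^k)\cap L^2_{\rho'}(I,K_\rho^{k+\nu/2})$ as the dual of $L^1(I,K_\rho^k)+L^2_{\rho'}(I,K_\rho^{k+\nu/2})$,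 where $L^2_{\rho'}$ is $L^2$ in time with weight $\rho'$. Solutions of the equation $$\partial_tV=(2t^2)^{-1}\big(2\nabla\phi\cdot\nabla+(\Delta\phi)\big)V \tag{6.3}$$ on $I$ are understood in the sense of distributions in the interior of $I\times\mathbb R^n$. **Proposition 6.1.** Let $(\widetilde k,\widetilde\ell,\bar k,k)$ satisfy $$\widetilde\ell>n/2-\nu,\qquad \widetilde k\wedge(\widetilde\ell+\nu/2)\ge\bar k\ge k+1-\nu,\qquad k\ge\nu/2. \tag{6.4}$$ There exist constants $c>0$ and $C$, depending only on $n,\nu,\gamma,\ell_<,\widetilde k,\widetilde\ell,\bar k,k$ and the function $|\rho'|$, such that the following holds. Let $1\le T<\infty$ and let $\rho_\infty$ be such that $\rho\ge0$ on $[T,\infty)$. Let $h_0,h_1$ be positive $C^1$ functions on $[T,\infty)$ with $h_0$ nondecreasing, $h_1$ nonincreasing and tending to zero at infinity, and $h_1\ge t^{-2}\rho'^{-1}h_0$. Let $w_+\in K^{\widetilde k}_{\rho_\infty}$ and let $(W,\phi)$ be such that $(W,h_0^{-1}\phi)\in\mathcal Y_\rho^{\widetilde k,\widetilde\ell}([T,\infty))$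 and, for some constant $c_1\ge0$ and all $t\ge T$, $$|W(t)-w_+|_k\le c_1h_1(t). \tag{6.5}$$ Let $a=\sup_{t\ge T}|W(t)|_{\widetilde k}$, $b=\sup_{t\ge T}h_0(t)^{-1}|\phi(t)|_{\widetilde\ell}$, and assume $b\,h_1(T)\le c$. Then: (1) There is a unique solution $V$ of (6.3) on $[T,\infty)$ such that $(V,0)\in\mathcal X_\rho^{\bar k,0}([T,\infty))$ and $$Y(V;[T,\infty),1,\bar k)\le C\,a, \tag{6.8}$$ $$Y(V-w_+;[T,\infty),h_1,k)\le C\,a\,b. \tag{6.9}$$ It satisfies $V(t)\to w_+$ in $L^2$ as $t\to\infty$, and it is also the only solution with $(V,0)\in\mathcal X_\rho^{\bar k,0}([T,\infty))$ and $V(t)\to w_+$ in $L^2$. (2) For every $t_0>T$ there is a solution $V_{t_0}$ of (6.3) on $[T,t_0]$ with $V_{t_0}(t_0)=W(t_0)$ and $(V_{t_0},0)\in\mathcal X_\rho^{\bar k,0}([T,t_0])$. For any such solutions, as $t_0\to\infty$, $V_{t_0}\to V$ strongly in $\mathcal X_\rho^{k',0}([T,T_1])$ for every $k'<\bar k$,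 and in the weak-$*$ sense in $\mathcal X_\rho^{\bar k,0}([T,T_1])$, for every $T_1$ with $T<T_1<\infty$. Moreover, for all $t_0>T$, $$Y(V-V_{t_0};[T,t_0],1,k)\le C\,(ab+c_1)\,h_1(t_0). \tag{6.10}$$ (3) $V$ is unique in $L^\infty([T,\infty),L^2)$: if $V'\in L^\infty([T,\infty),L^2)$ is a solution of (6.3) on $[T,\infty)$ with $\|V'(t)-w_+\|_2\to0$ as $t\to\infty$, then $V'(t)=V(t)$ for almost every $t\ge T$. -/

import Mathlib

open MeasureTheory Set Filter Topology
open scoped ENNReal NNReal ContDiff FourierTransform SchwartzMap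

noncomputable section

/-- `ℝⁿ` with its Euclidean norm. -/
abbrev Rn (n : ℕ) : Type := EuclideanSpace ℝ (Fin n)

/-- The complex Hilbert space `L²(ℝⁿ)`. -/
abbrev L2 (n : ℕ) : Type := Lp ℂ 2 (volume : Measure (Rn n))

/-! ### Gevrey spaces

Mathlib's Fourier transform has the kernel `exp (-2πi x·ξ)`.  The weights below are functions of
`2π‖ξ‖`, so that every weighted `L²` norm equals the one computed with the unitary transform
`(2π)^(-n/2) ∫ exp (-i x·η) u(x) dx` and the frequency variable `η = 2πξ`. -/

/-- The weight `(|η|_>^p + |η|_<^q) f(η)`, where `f(η) = exp (ρ (|η|^ν ∨ 1))`, `η = 2πξ`, and the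
low and high frequencies are separated at `|η| = 1`. -/
def gevreyWeight {n : ℕ} (ν ρ p q : ℝ) (ξ : Rn n) : ℝ :=
  (if 1 < 2 * Real.pi * ‖ξ‖ then (2 * Real.pi * ‖ξ‖) ^ p else (2 * Real.pi * ‖ξ‖) ^ q) *
    Real.exp (ρ * max ((2 * Real.pi * ‖ξ‖) ^ ν) 1)

/-- The weighted Fourier transform of `w ∈ L²` whose `L²` norm is the norm of `w` in `K_ρ^k`. -/
def kLift {n : ℕ} (ν ρ k : ℝ) (w : L2 n) : Rn n → ℂ :=
  fun ξ => (gevreyWeight ν ρ k 0 ξ : ℂ) * (𝓕 w : L2 n) ξ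

/-- The norm `|w|_k` of `K_ρ^k`; it is `∞` if `w` is not in `K_ρ^k`. -/
def kNorm {n : ℕ} (ν ρ k : ℝ) (w : L2 n) : ℝ≥0∞ :=
  eLpNorm (kLift ν ρ k w) 2 volume

/-- The weighted function whose `L²` norm is the norm in `Y_ρ^ℓ` of the function with Fourier
transform `g`. -/
def yLift {n : ℕ} (ν ρ l lLow : ℝ) (g : Rn n → ℂ) : Rn n → ℂ :=
  fun ξ => (gevreyWeight ν ρ (l + 2) lLow ξ : ℂ) * g ξ

/-- The norm `|φ|_ℓ` of `Y_ρ^ℓ`, in terms of the Fourier transform `g` of `φ`. -/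
def yNorm {n : ℕ} (ν ρ l lLow : ℝ) (g : Rn n → ℂ) : ℝ≥0∞ :=
  eLpNorm (yLift ν ρ l lLow g) 2 volume

/-- The Fourier transform of `u`, in the sense of tempered distributions, is the locally integrable
function `g`. -/
structure HasFourierTransform {n : ℕ} (u g : Rn n → ℂ) : Prop where
  locallyIntegrable_left : LocallyIntegrable u volume
  locallyIntegrable_right : LocallyIntegrable g volume
  integrable_left : ∀ ψ : 𝓢(Rn n, ℂ), Integrable (fun x => ψ x * u x) volume
  integrable_right : ∀ ψ : 𝓢(Rn n, ℂ), Integrable (fun ξ => ψ ξ * g ξ) volume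
  pairing : ∀ ψ : 𝓢(Rn n, ℂ), ∫ x, (𝓕 ψ : 𝓢(Rn n, ℂ)) x * u x = ∫ ξ, ψ ξ * g ξ

/-! ### The time dependent radius -/

/-- Admissible functions `|ρ'|` on `[1, ∞)`. -/
structure IsGevreyRate (γ : ℝ) (r : ℝ → ℝ) : Prop where
  contDiffOn : ContDiffOn ℝ 1 r (Ici 1)
  pos : ∀ t, 1 ≤ t → 0 < r t
  integrableOn : IntegrableOn r (Ici 1) volume
  monotoneOn : MonotoneOn (fun t => t ^ (-γ) * (r t)⁻¹) (Ici 1)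
  antitoneOn : AntitoneOn (fun t => (t ^ 2)⁻¹ * (r t)⁻¹) (Ici 1)
  tendsto : Tendsto (fun t => (t ^ 2)⁻¹ * (r t)⁻¹) atTop (𝓝 0)

/-- `ρ(t) = ρ_∞ - ∫_t^∞ |ρ'|`. -/
def gevreyRadius (r : ℝ → ℝ) (ρinf t : ℝ) : ℝ :=
  ρinf - ∫ s in Ioi t, r s

/-! ### Spaces of functions of time -/

/-- Norm continuity on `I` of a family of functions on `ℝⁿ`, in the sense of `L²(ℝⁿ)`. -/
def L2ContinuousOn {n : ℕ} (I : Set ℝ) (F : ℝ → Rn n → ℂ) : Prop :=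
  ∀ t ∈ I, Tendsto (fun s => eLpNorm (F s - F t) 2 volume) (𝓝[I] t) (𝓝 0)

/-- The measure `|ρ'(t)| dt` on `I`. -/
def rateMeasure (r : ℝ → ℝ) (I : Set ℝ) : Measure ℝ :=
  (volume.restrict I).withDensity (fun t => ENNReal.ofReal (r t))

/-- `y(w; I, H, k) = sup_{t ∈ I} H(t)⁻¹ |w(t)|_k`, the norm being that of `K_{ρ(t)}^k`. -/
def ySup {n : ℕ} (ν : ℝ) (ρ : ℝ → ℝ) (w : ℝ → L2 n) (I : Set ℝ) (H : ℝ → ℝ) (k : ℝ) : ℝ≥0∞ :=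
  ⨆ t ∈ I, (ENNReal.ofReal (H t))⁻¹ * kNorm ν (ρ t) k (w t)

/-- `y₁(w; I, H, k) = (∫_I |ρ'(t)| H(t)⁻² |w(t)|_{k+ν/2}² dt)^{1/2}`. -/
def yInt {n : ℕ} (ν : ℝ) (r ρ : ℝ → ℝ) (w : ℝ → L2 n) (I : Set ℝ) (H : ℝ → ℝ) (k : ℝ) : ℝ≥0∞ :=
  (∫⁻ t, ((ENNReal.ofReal (H t))⁻¹ * kNorm ν (ρ t) (k + ν / 2) (w t)) ^ 2
    ∂(rateMeasure r I)) ^ (1 / 2 : ℝ)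

/-- `Y(w; I, H, k) = y ∨ y₁`. -/
def yMax {n : ℕ} (ν : ℝ) (r ρ : ℝ → ℝ) (w : ℝ → L2 n) (I : Set ℝ) (H : ℝ → ℝ) (k : ℝ) : ℝ≥0∞ :=
  max (ySup ν ρ w I H k) (yInt ν r ρ w I H k)

/-- `(w, 0) ∈ 𝒳_ρ^{k,0}(I)`.  Continuity makes `t ↦ |w(t)|_{k+ν/2}` measurable, so that the
`L²` part of the space is the finiteness of the norm. -/
def MemX {n : ℕ} (ν : ℝ) (r ρ : ℝ → ℝ) (k : ℝ) (I : Set ℝ) (w : ℝ → L2 n) : Prop :=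
  L2ContinuousOn I (fun t => kLift ν (ρ t) k (w t)) ∧ yMax ν r ρ w I (fun _ => 1) k < ⊤

/-- `(w, 0) ∈ 𝒴_ρ^{k,0}(I)`. -/
def MemYAmplitude {n : ℕ} (ν : ℝ) (ρ : ℝ → ℝ) (k : ℝ) (I : Set ℝ) (w : ℝ → L2 n) : Prop :=
  L2ContinuousOn I (fun t => kLift ν (ρ t) k (w t)) ∧ (⨆ t ∈ I, kNorm ν (ρ t) k (w t)) < ⊤

/-- `(0, h⁻¹ φ) ∈ 𝒴_ρ^{0,ℓ}(I)` for a real function `φ` whose Fourier transform at time `t` is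
`φhat t`.  The value `φ t` is the continuous representative, which exists if `ℓ + 2 > n/2`, as
`φhat t` is then integrable. -/
def MemYPhase {n : ℕ} (ν : ℝ) (ρ : ℝ → ℝ) (l lLow : ℝ) (I : Set ℝ) (h : ℝ → ℝ)
    (φ : ℝ → Rn n → ℝ) (φhat : ℝ → Rn n → ℂ) : Prop :=
  (∀ t ∈ I, Continuous (φ t) ∧ HasFourierTransform (fun x => (φ t x : ℂ)) (φhat t)) ∧
  L2ContinuousOn I (fun t => yLift ν (ρ t) l lLow (((h t)⁻¹ : ℂ) • φhat t)) ∧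
  (⨆ t ∈ I, (ENNReal.ofReal (h t))⁻¹ * yNorm ν (ρ t) l lLow (φhat t)) < ⊤

/-- Weak-* convergence of `U τ` to `V` in `𝒳_ρ^{k,0}(I)` as `τ → ∞`, for the duality of
`L^∞(I, K_ρ^k) ∩ L²_{|ρ'|}(I, K_ρ^{k+ν/2})` with
`L¹(I, K_ρ^k) + L²_{|ρ'|}(I, K_ρ^{k+ν/2})`. -/
def WeakStarTendstoX {n : ℕ} (ν : ℝ) (r ρ : ℝ → ℝ) (k : ℝ) (I : Set ℝ)
    (U : ℝ → ℝ → L2 n) (V : ℝ → L2 n) : Prop :=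
  (∀ g : ℝ → L2 n, Integrable g (volume.restrict I) →
    Tendsto (fun τ => ∫ t in I, ∫ ξ, starRingEnd ℂ (g t ξ) * kLift ν (ρ t) k (U τ t - V t) ξ)
      atTop (𝓝 0)) ∧
  (∀ g : ℝ → L2 n, MemLp g 2 (rateMeasure r I) →
    Tendsto (fun τ => ∫ t, (∫ ξ, starRingEnd ℂ (g t ξ) *
      kLift ν (ρ t) (k + ν / 2) (U τ t - V t) ξ) ∂(rateMeasure r I)) atTop (𝓝 0))

/-! ### The transport equation -/

/-- The operator `(2t²)⁻¹ (2∇φ·∇ + (Δφ))` applied to a function `θ` of `x ∈ ℝⁿ`, at `x`. -/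
def transportOp {n : ℕ} (t : ℝ) (φ θ : Rn n → ℝ) (x : Rn n) : ℝ :=
  (2 * t ^ 2)⁻¹ *
    (2 * inner ℝ (gradient φ x) (gradient θ x) + Laplacian.laplacian φ x * θ x)

/-- `V` solves `∂ₜV = (2t²)⁻¹ (2∇φ·∇ + (Δφ)) V` in the sense of distributions in the interior of
`I × ℝⁿ`.  The operator on the right-hand side is antisymmetric. -/
def IsTransportSolution {n : ℕ} (φ : ℝ → Rn n → ℝ) (I : Set ℝ) (V : ℝ → L2 n) : Prop :=
  ∀ θ : ℝ × Rn n → ℝ, ContDiff ℝ ∞ θ → HasCompactSupport θ →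
    tsupport θ ⊆ interior I ×ˢ univ →
    ∫ t in I, ∫ x, (deriv (fun s => θ (s, x)) t
      - transportOp t (φ t) (fun y => θ (t, y)) x) • V t x = 0

end

noncomputable section

open ENNReal (ofReal)
open Real (exp)

/-! ### Elementary inequalities for Gevrey weights -/

theorem exp_mul_one_sub_exp_le {s z d : ℝ} (hs0 : 0 ≤ s) (hs : s ≤ 1) (hz : 0 ≤ z) (hd0 : 0 ≤ d)
    (hd : d ≤ s * z) : exp d * (1 - exp (-2 * d)) ≤ 4 * s * exp z := by
  have h1 : 1 - exp (-2 * d) ≤ 2 * d := by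
    have := Real.add_one_le_exp (-2 * d); linarith
  rcases le_total (1 / 2) s with h | h
  · have h2 : exp d ≤ exp z := Real.exp_le_exp.2 (by nlinarith)
    have h3 : 1 - exp (-2 * d) ≤ 1 := by have := Real.exp_pos (-2 * d); linarith
    have h4 : exp d * (1 - exp (-2 * d)) ≤ exp d * 1 :=
      mul_le_mul_of_nonneg_left h3 (Real.exp_pos _).le
    nlinarith [Real.exp_pos z]
  · have h2 : exp d ≤ exp (z / 2) := Real.exp_le_exp.2 (by nlinarith)
    have h3 : z / 2 ≤ exp (z / 2) := by have := Real.add_one_le_exp (z / 2); linarith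
    have h4 : exp z = exp (z / 2) * exp (z / 2) := by
      rw [← Real.exp_add]; ring_nf
    calc exp d * (1 - exp (-2 * d)) ≤ exp d * (2 * d) :=
          mul_le_mul_of_nonneg_left h1 (Real.exp_pos _).le
      _ ≤ exp (z / 2) * (2 * (s * z)) := by gcongr
      _ = exp (z / 2) * (4 * s * (z / 2)) := by ring
      _ ≤ exp (z / 2) * (4 * s * exp (z / 2)) := by gcongr
      _ = 4 * s * exp z := by rw [h4]; ring

theorem one_sub_rpow_le {u a : ℝ} (hu0 : 0 < u) (hu : u ≤ 1) :
    1 - u ^ a ≤ max a 1 * (1 - u) := by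
  rcases le_total a 1 with h | h
  · have : u ≤ u ^ a := by
      simpa using Real.rpow_le_rpow_of_exponent_ge hu0 hu h
    rw [max_eq_right h]; linarith
  · have := one_add_mul_self_le_rpow_one_add (s := u - 1) (by linarith) h
    rw [max_eq_left h]
    have h2 : (1 + (u - 1)) = u := by ring
    rw [h2] at this
    linarith

/-- The interaction factor `x Z^{1-ν} + 1_{x>1} x^{l+2} (E^{-δ} + X^{-δ})`, `Z = x ∨ 1`. -/
def interFactor (ν l δ x X E : ℝ) : ℝ :=
  x * (max x 1) ^ (1 - ν) + (if 1 < x then x ^ (l + 2) else 0) * (E ^ (-δ) + X ^ (-δ))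

theorem interFactor_comm (ν l δ x X E : ℝ) :
    interFactor ν l δ x X E = interFactor ν l δ x E X := by
  unfold interFactor; ring

theorem exp_rpow_le_mul {ν ρ X E Z : ℝ} (hν : 0 < ν) (hν1 : ν ≤ 1) (hρ : 0 ≤ ρ) (hX : 0 ≤ X)
    (hE : 0 ≤ E) (hZ : 0 ≤ Z) (h : X ≤ E + Z) :
    exp (ρ * X ^ ν) ≤ exp (ρ * E ^ ν) * exp (ρ * Z ^ ν) := by
  rw [← Real.exp_add]
  refine Real.exp_le_exp.2 ?_
  have h1 : X ^ ν ≤ (E + Z) ^ ν := Real.rpow_le_rpow hX h hν.le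
  have h2 := Real.rpow_add_le_add_rpow hE hZ hν.le hν1
  nlinarith

theorem exp_sq_sub_exp_sq_le {ν ρ X E Z : ℝ} (hν : 0 < ν) (hν1 : ν ≤ 1) (hρ : 0 ≤ ρ)
    (hE : 1 ≤ E) (hEX : E ≤ X) (hZ : 1 ≤ Z) (hZX : Z ≤ X) (h : X ≤ E + Z) :
    exp (ρ * X ^ ν) ^ 2 - exp (ρ * E ^ ν) ^ 2 ≤
      4 * (Z / X) ^ (1 - ν) *
        (exp (ρ * X ^ ν) * exp (ρ * E ^ ν) * exp (ρ * Z ^ ν)) := by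
  have hX0 : 0 < X := by linarith
  have hZ0 : 0 < Z := by linarith
  set d := ρ * (X ^ ν - E ^ ν) with hd
  have hd0 : 0 ≤ d := mul_nonneg hρ (sub_nonneg.2 (Real.rpow_le_rpow (by linarith) hEX hν.le))
  have hu : E / X ≤ (E / X) ^ ν := by
    simpa using Real.rpow_le_rpow_of_exponent_ge (by positivity) ((div_le_one hX0).2 hEX) hν1
  have hdiff : X ^ ν - E ^ ν ≤ (Z / X) ^ (1 - ν) * Z ^ ν := by
    have e1 : E ^ ν = X ^ ν * (E / X) ^ ν := by
      rw [Real.div_rpow (by linarith) hX0.le]; field_simp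
    have e2 : (Z / X) ^ (1 - ν) * Z ^ ν = X ^ ν * (Z / X) := by
      rw [Real.div_rpow hZ0.le hX0.le, Real.rpow_sub hZ0, Real.rpow_sub hX0, Real.rpow_one,
        Real.rpow_one]
      field_simp
    rw [e1, e2]
    have e3 : 1 - E / X ≤ Z / X := by
      rw [one_sub_div hX0.ne']
      gcongr
      linarith
    have : 0 ≤ X ^ ν := by positivity
    nlinarith
  have hs1 : (Z / X) ^ (1 - ν) ≤ 1 :=
    Real.rpow_le_one (by positivity) ((div_le_one hX0).2 hZX) (by linarith)
  have key := exp_mul_one_sub_exp_le (s := (Z / X) ^ (1 - ν)) (z := ρ * Z ^ ν) (d := d)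
    (by positivity) hs1 (by positivity) hd0 (by
      calc d ≤ ρ * ((Z / X) ^ (1 - ν) * Z ^ ν) := mul_le_mul_of_nonneg_left hdiff hρ
        _ = _ := by ring)
  have e : exp (ρ * X ^ ν) ^ 2 - exp (ρ * E ^ ν) ^ 2 =
      exp (ρ * X ^ ν) * exp (ρ * E ^ ν) * (exp d * (1 - exp (-2 * d))) := by
    have a1 : exp d * (1 - exp (-2 * d)) = exp d - exp (-d) := by
      rw [mul_sub, ← Real.exp_add]; ring_nf
    rw [a1, sq, sq, mul_sub, mul_assoc, mul_assoc]
    simp only [← Real.exp_add]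
    congr 2 <;> (rw [hd]; ring)
  rw [e]
  calc _ ≤ exp (ρ * X ^ ν) * exp (ρ * E ^ ν) *
        (4 * (Z / X) ^ (1 - ν) * exp (ρ * Z ^ ν)) :=
        mul_le_mul_of_nonneg_left key (by positivity)
    _ = _ := by ring

theorem abs_weight_sub_le_aux {ν ρ κ X E Z a b : ℝ} (hν : 0 < ν) (hν1 : ν ≤ 1) (hρ : 0 ≤ ρ)
    (hκ : 0 ≤ κ) (hE : 1 ≤ E) (hEX : E ≤ X) (hZ : 1 ≤ Z) (hZX : Z ≤ X / 2) (h : X ≤ E + Z)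
    (hb0 : 0 ≤ b) (hb1 : b ≤ 1)
    (hab : |a - b| ≤ |Real.log X - Real.log E|) :
    |a * (X ^ (2 * κ) * exp (ρ * X ^ ν) ^ 2) - b * (E ^ (2 * κ) * exp (ρ * E ^ ν) ^ 2)| ≤
      (6 + max (2 * κ) 1) * (Z / X) ^ (1 - ν) * X ^ (2 * κ) *
        (exp (ρ * X ^ ν) * exp (ρ * E ^ ν) * exp (ρ * Z ^ ν)) := by
  have hX0 : 0 < X := by linarith
  have hE0 : 0 < E := by linarith
  set s := (Z / X) ^ (1 - ν) with hs
  set F := exp (ρ * X ^ ν) * exp (ρ * E ^ ν) * exp (ρ * Z ^ ν) with hF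
  have hF0 : 0 < F := by positivity
  have hZs : Z / X ≤ s := by
    have hZX1 : Z / X ≤ 1 := (div_le_one hX0).2 (by linarith)
    simpa using Real.rpow_le_rpow_of_exponent_ge (x := Z / X) (by positivity) hZX1
      (by linarith : 1 - ν ≤ 1)
  have hs0 : 0 ≤ s := by positivity
  have hfX : exp (ρ * X ^ ν) ^ 2 ≤ F := by
    have := exp_rpow_le_mul (ρ := ρ) hν hν1 hρ hX0.le hE0.le (by linarith) h
    rw [sq, hF, mul_assoc]
    exact mul_le_mul_of_nonneg_left this (Real.exp_pos _).le
  have hXk : 0 < X ^ (2 * κ) := by positivity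
  have hEk : E ^ (2 * κ) ≤ X ^ (2 * κ) := Real.rpow_le_rpow hE0.le hEX (by linarith)
  have hEk0 : 0 < E ^ (2 * κ) := by positivity
  -- the three contributions
  have t1 : |a - b| ≤ 2 * s := by
    have hlog : |Real.log X - Real.log E| = Real.log (X / E) := by
      rw [← Real.log_div hX0.ne' hE0.ne', abs_of_nonneg]
      exact Real.log_nonneg ((one_le_div hE0).2 hEX)
    rw [hlog] at hab
    have h1 := Real.log_le_sub_one_of_pos (x := X / E) (by positivity)
    have h2 : X / E - 1 ≤ 2 * (Z / X) := by
      rw [div_sub_one hE0.ne', ← mul_div_assoc, div_le_div_iff₀ hE0 hX0]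
      nlinarith
    linarith
  have t2 : X ^ (2 * κ) - E ^ (2 * κ) ≤ max (2 * κ) 1 * s * X ^ (2 * κ) := by
    have h1 := one_sub_rpow_le (u := E / X) (a := 2 * κ) (by positivity)
      ((div_le_one hX0).2 hEX)
    have h2 : 1 - E / X ≤ s := by
      refine le_trans ?_ hZs
      rw [one_sub_div hX0.ne']
      gcongr; linarith
    have h3 : E ^ (2 * κ) = X ^ (2 * κ) * (E / X) ^ (2 * κ) := by
      rw [Real.div_rpow hE0.le hX0.le]; field_simp
    have h4 : max (2 * κ) 1 * (1 - E / X) ≤ max (2 * κ) 1 * s :=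
      mul_le_mul_of_nonneg_left h2 (by positivity)
    rw [h3]
    nlinarith
  have t3 := exp_sq_sub_exp_sq_le (ρ := ρ) hν hν1 hρ hE hEX hZ (by linarith) h
  rw [← hs, ← hF] at t3
  have hfE : exp (ρ * E ^ ν) ^ 2 ≤ exp (ρ * X ^ ν) ^ 2 := by
    have : E ^ ν ≤ X ^ ν := Real.rpow_le_rpow hE0.le hEX hν.le
    gcongr
  set fX := exp (ρ * X ^ ν) ^ 2
  set fE := exp (ρ * E ^ ν) ^ 2
  have hfX0 : 0 ≤ fX := by positivity
  have e : a * (X ^ (2 * κ) * fX) - b * (E ^ (2 * κ) * fE) =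
      (a - b) * (X ^ (2 * κ) * fX) + b * ((X ^ (2 * κ) - E ^ (2 * κ)) * fX +
        E ^ (2 * κ) * (fX - fE)) := by ring
  rw [e]
  have n1 : 0 ≤ X ^ (2 * κ) - E ^ (2 * κ) := by linarith
  have n2 : 0 ≤ fX - fE := by linarith
  have m1 : |(a - b) * (X ^ (2 * κ) * fX)| ≤ 2 * s * (X ^ (2 * κ) * F) := by
    rw [abs_mul, abs_of_nonneg (by positivity : 0 ≤ X ^ (2 * κ) * fX)]
    gcongr
  have m2 : (X ^ (2 * κ) - E ^ (2 * κ)) * fX ≤ max (2 * κ) 1 * s * X ^ (2 * κ) * F := by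
    gcongr
  have m3 : E ^ (2 * κ) * (fX - fE) ≤ X ^ (2 * κ) * (4 * s * F) := by
    gcongr
  have m4 : |b * ((X ^ (2 * κ) - E ^ (2 * κ)) * fX + E ^ (2 * κ) * (fX - fE))| ≤
      max (2 * κ) 1 * s * X ^ (2 * κ) * F + X ^ (2 * κ) * (4 * s * F) := by
    rw [abs_of_nonneg (by positivity)]
    have : 0 ≤ (X ^ (2 * κ) - E ^ (2 * κ)) * fX + E ^ (2 * κ) * (fX - fE) := by positivity
    nlinarith
  refine (abs_add_le _ _).trans ?_
  calc _ ≤ 2 * s * (X ^ (2 * κ) * F) +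
        (max (2 * κ) 1 * s * X ^ (2 * κ) * F + X ^ (2 * κ) * (4 * s * F)) := add_le_add m1 m4
    _ = _ := by ring

set_option maxHeartbeats 800000 in
/-- The commutator estimate for a Gevrey weight, pointwise in frequency. -/
theorem abs_weight_sub_mul_le {ν l κ : ℝ} (hν : 0 < ν) (hν1 : ν ≤ 1) (hκ : 0 ≤ κ)
    (hκl : κ ≤ l + ν / 2) :
    ∃ C : ℝ, 0 ≤ C ∧ ∀ ρ x X E a b : ℝ, 0 ≤ ρ → 0 ≤ x → 1 ≤ X → 1 ≤ E → |X - E| ≤ x →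
      0 ≤ a → a ≤ 1 → 0 ≤ b → b ≤ 1 → |a - b| ≤ |Real.log X - Real.log E| →
      |a * (X ^ (2 * κ) * exp (ρ * X ^ ν) ^ 2) -
          b * (E ^ (2 * κ) * exp (ρ * E ^ ν) ^ 2)| * (x * (X + E)) ≤
        C * ((X ^ (κ + ν / 2) * exp (ρ * X ^ ν)) * (E ^ (κ + ν / 2) * exp (ρ * E ^ ν)) *
          (exp (ρ * (max x 1) ^ ν) * interFactor ν l (l + ν) x X E)) := by
  set B := (6 + max (2 * κ) 1) with hB
  have hB0 : 0 ≤ B := by positivity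
  set C1 := 2 * B * 2 ^ (κ + ν / 2) with hC1
  set C2 : ℝ := 2 * 2 ^ (2 * κ + 1) with hC2
  set C3 : ℝ := 2 * (2 ^ (κ + 1 - ν / 2) * 2 ^ (l + ν / 2 - κ)) with hC3
  have hC10 : 0 ≤ C1 := by positivity
  have hC20 : 0 ≤ C2 := by positivity
  have hC30 : 0 ≤ C3 := by positivity
  refine ⟨C1 + C2 + C3, by positivity, ?_⟩
  intro ρ x X E a b hρ hx hX hE hXE ha0 ha1 hb0 hb1 hab
  wlog hEX : E ≤ X generalizing X E a b
  · have := this E X b a hE hX (by rwa [abs_sub_comm]) hb0 hb1 ha0 ha1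
      (by rwa [abs_sub_comm, abs_sub_comm (Real.log E)]) (le_of_not_ge hEX)
    rw [abs_sub_comm, add_comm X E, interFactor_comm, mul_comm (X ^ (κ + ν / 2) * _)]
    exact this
  have hX0 : 0 < X := by linarith
  have hE0 : 0 < E := by linarith
  set Z := max x 1 with hZ
  have hZ1 : 1 ≤ Z := le_max_right _ _
  have hZ0 : 0 < Z := by linarith
  have hxZ : x ≤ Z := le_max_left _ _
  have hXEx : X - E ≤ x := (le_abs_self _).trans hXE
  have hXEZ : X ≤ E + Z := by linarith
  set fX := exp (ρ * X ^ ν) with hfX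
  set fE := exp (ρ * E ^ ν) with hfE
  set fZ := exp (ρ * Z ^ ν) with hfZ
  have hfXle : fX ≤ fE * fZ := exp_rpow_le_mul hν hν1 hρ hX0.le hE0.le hZ0.le hXEZ
  have hfEX : fE ≤ fX := by
    have : E ^ ν ≤ X ^ ν := Real.rpow_le_rpow hE0.le hEX hν.le
    simp only [hfX, hfE]; gcongr
  have hsum : x * (X + E) ≤ 2 * x * X := by nlinarith
  have hS1 : 0 ≤ x * Z ^ (1 - ν) := by positivity
  have hS2 : 0 ≤ (if 1 < x then x ^ (l + 2) else 0) * (E ^ (-(l + ν)) + X ^ (-(l + ν))) := by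
    split_ifs <;> positivity
  have hS0 : 0 ≤ interFactor ν l (l + ν) x X E := add_nonneg hS1 hS2
  have hF0 : 0 ≤ fX * fE * fZ := by positivity
  -- reduce to a scalar inequality
  suffices hmain : ∃ D, 0 ≤ D ∧
      |a * (X ^ (2 * κ) * fX ^ 2) - b * (E ^ (2 * κ) * fE ^ 2)| ≤ D * (fX * fE * fZ) ∧
      D * (2 * x * X) ≤ (C1 + C2 + C3) *
        (X ^ (κ + ν / 2) * E ^ (κ + ν / 2) * interFactor ν l (l + ν) x X E) by
    obtain ⟨D, hD0, hD1, hD2⟩ := hmain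
    calc _ ≤ D * (fX * fE * fZ) * (2 * x * X) := by gcongr
      _ = (D * (2 * x * X)) * (fX * fE * fZ) := by ring
      _ ≤ ((C1 + C2 + C3) *
        (X ^ (κ + ν / 2) * E ^ (κ + ν / 2) * interFactor ν l (l + ν) x X E)) * (fX * fE * fZ) := by
          gcongr
      _ = _ := by ring
  have hXp : 1 ≤ X ^ (κ + ν / 2) := Real.one_le_rpow hX (by positivity)
  have hEp : 1 ≤ E ^ (κ + ν / 2) := Real.one_le_rpow hE (by positivity)
  have hP0 : 0 ≤ X ^ (κ + ν / 2) * E ^ (κ + ν / 2) := by positivity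
  rcases le_or_gt Z (X / 2) with hcase | hcase
  · refine ⟨B * (Z / X) ^ (1 - ν) * X ^ (2 * κ), by positivity,
      abs_weight_sub_le_aux hν hν1 hρ hκ hE hEX hZ1 hcase hXEZ hb0 hb1 hab, ?_⟩
    have hEX2 : X ≤ 2 * E := by linarith
    have e1 : B * (Z / X) ^ (1 - ν) * X ^ (2 * κ) * (2 * x * X) =
        2 * B * (X ^ (κ + ν / 2) * X ^ (κ + ν / 2)) * (x * Z ^ (1 - ν)) := by
      rw [Real.div_rpow hZ0.le hX0.le, ← Real.rpow_add hX0]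
      have : X ^ (κ + ν / 2 + (κ + ν / 2)) = X ^ (2 * κ) * (X / X ^ (1 - ν)) := by
        rw [show κ + ν / 2 + (κ + ν / 2) = 2 * κ + (1 - (1 - ν)) by ring, Real.rpow_add hX0,
          Real.rpow_sub hX0 1, Real.rpow_one]
      rw [this]; ring
    have e2 : X ^ (κ + ν / 2) ≤ 2 ^ (κ + ν / 2) * E ^ (κ + ν / 2) := by
      rw [← Real.mul_rpow (by norm_num) hE0.le]
      exact Real.rpow_le_rpow hX0.le hEX2 (by positivity)
    rw [e1]
    calc _ ≤ 2 * B * (X ^ (κ + ν / 2) * (2 ^ (κ + ν / 2) * E ^ (κ + ν / 2))) *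
          (x * Z ^ (1 - ν)) := by gcongr
      _ = C1 * (X ^ (κ + ν / 2) * E ^ (κ + ν / 2) * (x * Z ^ (1 - ν))) := by rw [hC1]; ring
      _ ≤ (C1 + C2 + C3) * (X ^ (κ + ν / 2) * E ^ (κ + ν / 2) *
          interFactor ν l (l + ν) x X E) := by
        gcongr
        · linarith
        · exact le_add_of_nonneg_right hS2
  · have hdiff : |a * (X ^ (2 * κ) * fX ^ 2) - b * (E ^ (2 * κ) * fE ^ 2)| ≤
        X ^ (2 * κ) * (fX * fE * fZ) := by
      have h1 : X ^ (2 * κ) * fX ^ 2 ≤ X ^ (2 * κ) * (fX * fE * fZ) := by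
        gcongr
        rw [sq, mul_assoc]
        gcongr
      have h2 : E ^ (2 * κ) * fE ^ 2 ≤ X ^ (2 * κ) * fX ^ 2 := by
        gcongr
      have h3 : 0 ≤ E ^ (2 * κ) * fE ^ 2 := by positivity
      have h4 : a * (X ^ (2 * κ) * fX ^ 2) ≤ X ^ (2 * κ) * fX ^ 2 :=
        mul_le_of_le_one_left (h3.trans h2) ha1
      have h5 : b * (E ^ (2 * κ) * fE ^ 2) ≤ E ^ (2 * κ) * fE ^ 2 := mul_le_of_le_one_left h3 hb1
      have h6 : 0 ≤ a * (X ^ (2 * κ) * fX ^ 2) := mul_nonneg ha0 (h3.trans h2)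
      have h7 : 0 ≤ b * (E ^ (2 * κ) * fE ^ 2) := mul_nonneg hb0 h3
      rw [abs_le]
      constructor <;> linarith
    refine ⟨X ^ (2 * κ), by positivity, hdiff, ?_⟩
    rcases le_or_gt x 1 with hx1 | hx1
    · have hZe : Z = 1 := max_eq_right hx1
      have hX2 : X ≤ 2 := by linarith
      have e1 : X ^ (2 * κ) * (2 * x * X) = 2 * X ^ (2 * κ + 1) * x := by
        rw [Real.rpow_add hX0, Real.rpow_one]; ring
      have e2 : X ^ (2 * κ + 1) ≤ 2 ^ (2 * κ + 1) :=
        Real.rpow_le_rpow hX0.le hX2 (by positivity)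
      have e3 : x ≤ interFactor ν l (l + ν) x X E := by
        have : x * Z ^ (1 - ν) = x := by rw [hZe]; simp
        unfold interFactor
        rw [← hZ, this]
        exact le_add_of_nonneg_right hS2
      rw [e1]
      calc _ ≤ 2 * 2 ^ (2 * κ + 1) * x := by gcongr
        _ = C2 * (1 * 1 * x) := by rw [hC2]; ring
        _ ≤ _ := by
          gcongr
          linarith
    · have hZe : Z = x := max_eq_left hx1.le
      rw [hZe] at hcase
      have hX2 : X ≤ 2 * x := by linarith
      have hx0 : 0 < x := by linarith
      have hE2 : E ≤ 2 * x := by linarith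
      have e1 : X ^ (2 * κ) * (2 * x * X) =
          2 * x * (X ^ (κ + ν / 2) * X ^ (κ + 1 - ν / 2)) := by
        rw [← Real.rpow_add hX0, show κ + ν / 2 + (κ + 1 - ν / 2) = 2 * κ + 1 by ring,
          Real.rpow_add hX0, Real.rpow_one]; ring
      have e2 : X ^ (κ + 1 - ν / 2) ≤ 2 ^ (κ + 1 - ν / 2) * x ^ (κ + 1 - ν / 2) := by
        rw [← Real.mul_rpow (by norm_num) hx0.le]
        exact Real.rpow_le_rpow hX0.le hX2 (by linarith)
      have e3 : x ^ (κ + 1 - ν / 2) = x ^ (l + 1) * x ^ (-(l + ν / 2 - κ)) := by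
        rw [← Real.rpow_add hx0]; ring_nf
      have e4 : x ^ (-(l + ν / 2 - κ)) ≤ 2 ^ (l + ν / 2 - κ) * E ^ (-(l + ν / 2 - κ)) := by
        rw [Real.rpow_neg hx0.le, Real.rpow_neg hE0.le, ← div_eq_mul_inv, inv_eq_one_div,
          div_le_div_iff₀ (by positivity) (by positivity), one_mul,
          ← Real.mul_rpow (by norm_num) hx0.le]
        exact Real.rpow_le_rpow hE0.le hE2 (by linarith)
      have e5 : E ^ (-(l + ν / 2 - κ)) = E ^ (κ + ν / 2) * E ^ (-(l + ν)) := by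
        rw [← Real.rpow_add hE0]; ring_nf
      have e6 : x * x ^ (l + 1) = x ^ (l + 2) := by
        rw [show l + 2 = 1 + (l + 1) by ring, Real.rpow_add hx0 1 (l + 1), Real.rpow_one]
      have e7 : x ^ (l + 2) * E ^ (-(l + ν)) ≤ interFactor ν l (l + ν) x X E := by
        unfold interFactor
        rw [if_pos hx1]
        have : 0 ≤ x ^ (l + 2) * X ^ (-(l + ν)) := by positivity
        linarith
      rw [e1]
      calc _ ≤ 2 * x * (X ^ (κ + ν / 2) * (2 ^ (κ + 1 - ν / 2) * (x ^ (l + 1) *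
            (2 ^ (l + ν / 2 - κ) * E ^ (-(l + ν / 2 - κ)))))) := by
              rw [e3] at e2
              gcongr
              exact e2.trans (by gcongr)
        _ = C3 * (X ^ (κ + ν / 2) * E ^ (κ + ν / 2) * (x ^ (l + 2) * E ^ (-(l + ν)))) := by
              rw [e5, hC3, ← e6]; ring
        _ ≤ _ := by
          gcongr
          linarith

/-- The estimate for the interaction without commutator, pointwise in frequency. -/
theorem rpow_mul_le_interFactor {ν l k σ : ℝ} (hν1 : ν ≤ 1) (hk : 0 ≤ k)
    (hσ : 0 ≤ σ) (hσ1 : σ ≤ 1) (hkl : k - σ ≤ l) (hl : 0 ≤ l) (hσl : σ ≤ l + ν + k) :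
    ∃ C : ℝ, 0 ≤ C ∧ ∀ x X E : ℝ, 0 ≤ x → 1 ≤ X → 1 ≤ E → |X - E| ≤ x →
      X ^ (2 * k) * (x * (X + E)) ≤
        C * (X ^ (k + σ) * E ^ (k + 1 - σ) * interFactor ν l (l + ν) x X E) := by
  set C1 : ℝ := 2 * 2 ^ (k + σ) * 2 ^ (k + 1 - σ) * 2 with hC1
  set C2 : ℝ := 4 ^ (2 * k) * 8 with hC2
  set C3 : ℝ := 8 * 2 ^ l with hC3
  have hC10 : 0 ≤ C1 := by positivity
  have hC20 : 0 ≤ C2 := by positivity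
  have hC30 : 0 ≤ C3 := by positivity
  refine ⟨C1 + C2 + C3, by positivity, ?_⟩
  intro x X E hx hX hE hXE
  have hX0 : 0 < X := by linarith
  have hE0 : 0 < E := by linarith
  set Z := max x 1 with hZ
  have hZ1 : 1 ≤ Z := le_max_right _ _
  have hxZ : x ≤ Z := le_max_left _ _
  obtain ⟨hXE1, hXE2⟩ := abs_le.1 hXE
  have hS2 : 0 ≤ (if 1 < x then x ^ (l + 2) else 0) * (E ^ (-(l + ν)) + X ^ (-(l + ν))) := by
    split_ifs <;> positivity
  have hS1 : x ≤ interFactor ν l (l + ν) x X E := by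
    unfold interFactor
    have : 1 ≤ Z ^ (1 - ν) := Real.one_le_rpow hZ1 (by linarith)
    rw [← hZ]
    nlinarith
  have hS0 : 0 ≤ interFactor ν l (l + ν) x X E := hx.trans hS1
  have hXp : 1 ≤ X ^ (k + σ) := Real.one_le_rpow hX (by positivity)
  have hEp : 1 ≤ E ^ (k + 1 - σ) := Real.one_le_rpow hE (by linarith)
  have split : X ^ (2 * k) = X ^ (k + σ) * X ^ (k - σ) := by
    rw [← Real.rpow_add hX0]; ring_nf
  have split' : X ^ (2 * k) * X = X ^ (k + σ) * X ^ (k + 1 - σ) := by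
    rw [← Real.rpow_add hX0, show k + σ + (k + 1 - σ) = 2 * k + 1 by ring, Real.rpow_add hX0,
      Real.rpow_one]
  rcases le_or_gt Z (max X E / 2) with hcase | hcase
  · have h1 : X ≤ 2 * E := by rcases max_cases X E with h | h <;> linarith
    have h2 : E ≤ 2 * X := by rcases max_cases X E with h | h <;> linarith
    have e2 : X ^ (k + 1 - σ) ≤ 2 ^ (k + 1 - σ) * E ^ (k + 1 - σ) := by
      rw [← Real.mul_rpow (by norm_num) hE0.le]
      exact Real.rpow_le_rpow hX0.le h1 (by linarith)
    have hone : (1 : ℝ) ≤ 2 ^ (k + σ) := Real.one_le_rpow (by norm_num) (by positivity)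
    calc X ^ (2 * k) * (x * (X + E)) ≤ X ^ (2 * k) * (x * (X + 2 * X)) := by gcongr
      _ = 3 * (X ^ (2 * k) * X) * x := by ring
      _ = 3 * (X ^ (k + σ) * X ^ (k + 1 - σ)) * x := by rw [split']
      _ ≤ 3 * (X ^ (k + σ) * (2 ^ (k + 1 - σ) * E ^ (k + 1 - σ))) *
          interFactor ν l (l + ν) x X E := by gcongr
      _ = (3 * 1 * 2 ^ (k + 1 - σ)) * (X ^ (k + σ) * E ^ (k + 1 - σ) *
          interFactor ν l (l + ν) x X E) := by ring
      _ ≤ (4 * 2 ^ (k + σ) * 2 ^ (k + 1 - σ)) * (X ^ (k + σ) * E ^ (k + 1 - σ) *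
          interFactor ν l (l + ν) x X E) := by gcongr; norm_num
      _ ≤ (C1 + C2 + C3) * _ := by
        gcongr
        rw [hC1]; linarith
  · rcases le_or_gt x 1 with hx1 | hx1
    · have hZe : Z = 1 := max_eq_right hx1
      have hX2 : X ≤ 4 := by have := le_max_left X E; linarith
      have hE2 : E ≤ 4 := by have := le_max_right X E; linarith
      calc X ^ (2 * k) * (x * (X + E)) ≤ 4 ^ (2 * k) * (x * (4 + 4)) := by gcongr
        _ = C2 * (1 * 1 * x) := by rw [hC2]; ring
        _ ≤ _ := by
          gcongr
          linarith
    · have hZe : Z = x := max_eq_left hx1.le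
      have hx0 : 0 < x := by linarith
      rw [hZe] at hcase
      have hX2 : X ≤ 2 * x := by have := le_max_left X E; linarith
      have hE2 : E ≤ 2 * x := by have := le_max_right X E; linarith
      have e6 : x * x = x ^ (l + 2) * x ^ (-l) := by
        rw [← Real.rpow_add hx0, show l + 2 + -l = (1 : ℝ) + 1 by ring, Real.rpow_add hx0,
          Real.rpow_one]
      have inv : ∀ Y, 0 < Y → Y ≤ 2 * x → x ^ (-l) ≤ 2 ^ l * Y ^ (-l) := by
        intro Y hY0 hY
        rw [Real.rpow_neg hx0.le, Real.rpow_neg hY0.le, ← div_eq_mul_inv, inv_eq_one_div,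
          div_le_div_iff₀ (by positivity) (by positivity), one_mul,
          ← Real.mul_rpow (by norm_num) hx0.le]
        exact Real.rpow_le_rpow hY0.le hY hl
      have hkey : x ^ (-l) * X ^ (k - σ) ≤
          2 ^ l * (E ^ (k + 1 - σ) * (E ^ (-(l + ν)) + X ^ (-(l + ν)))) := by
        rcases le_total E X with hEX | hEX
        · calc x ^ (-l) * X ^ (k - σ) ≤ 2 ^ l * X ^ (-l) * X ^ (k - σ) := by
                have := inv X hX0 hX2; gcongr
            _ = 2 ^ l * X ^ (k - σ - l) := by
                rw [mul_assoc, ← Real.rpow_add hX0]; ring_nf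
            _ ≤ 2 ^ l * E ^ (k - σ - l) := by
                have := Real.rpow_le_rpow_of_nonpos hE0 hEX (by linarith : k - σ - l ≤ 0)
                gcongr
            _ ≤ 2 ^ l * E ^ (k + 1 - σ + -(l + ν)) := by
                have := Real.rpow_le_rpow_of_exponent_le hE
                  (by linarith : k - σ - l ≤ k + 1 - σ + -(l + ν))
                gcongr
            _ = 2 ^ l * (E ^ (k + 1 - σ) * E ^ (-(l + ν))) := by rw [Real.rpow_add hE0]
            _ ≤ _ := by
                gcongr
                exact le_add_of_nonneg_right (by positivity)
        · have h1 : E ^ (-l) ≤ E ^ (k + 1 - σ) * E ^ (σ - k - (l + ν)) := by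
            rw [← Real.rpow_add hE0]
            exact Real.rpow_le_rpow_of_exponent_le hE (by linarith)
          have h2 : E ^ (σ - k - (l + ν)) ≤ X ^ (σ - k - (l + ν)) :=
            Real.rpow_le_rpow_of_nonpos hX0 hEX (by linarith)
          have h3 : X ^ (σ - k - (l + ν)) * X ^ (k - σ) = X ^ (-(l + ν)) := by
            rw [← Real.rpow_add hX0]; ring_nf
          calc x ^ (-l) * X ^ (k - σ) ≤ 2 ^ l * E ^ (-l) * X ^ (k - σ) := by
                have := inv E hE0 hE2; gcongr
            _ ≤ 2 ^ l * (E ^ (k + 1 - σ) * X ^ (σ - k - (l + ν))) * X ^ (k - σ) := by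
                gcongr
                exact h1.trans (by gcongr)
            _ = 2 ^ l * (E ^ (k + 1 - σ) * X ^ (-(l + ν))) := by rw [← h3]; ring
            _ ≤ _ := by
                gcongr
                exact le_add_of_nonneg_left (by positivity)
      have e7 : x ^ (l + 2) * (E ^ (-(l + ν)) + X ^ (-(l + ν))) ≤
          interFactor ν l (l + ν) x X E := by
        unfold interFactor
        rw [if_pos hx1]
        exact le_add_of_nonneg_left (by positivity)
      calc X ^ (2 * k) * (x * (X + E)) ≤ X ^ (2 * k) * (x * (2 * x + 2 * x)) := by gcongr
        _ = 4 * X ^ (k + σ) * x ^ (l + 2) * (x ^ (-l) * X ^ (k - σ)) := by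
            rw [split, show x * (2 * x + 2 * x) = 4 * (x * x) by ring, e6]; ring
        _ ≤ 4 * X ^ (k + σ) * x ^ (l + 2) *
            (2 ^ l * (E ^ (k + 1 - σ) * (E ^ (-(l + ν)) + X ^ (-(l + ν))))) := by gcongr
        _ = 4 * 2 ^ l * (X ^ (k + σ) * E ^ (k + 1 - σ) *
            (x ^ (l + 2) * (E ^ (-(l + ν)) + X ^ (-(l + ν))))) := by ring
        _ ≤ 8 * 2 ^ l * (X ^ (k + σ) * E ^ (k + 1 - σ) * interFactor ν l (l + ν) x X E) := by
            gcongr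
            norm_num
        _ ≤ _ := by
            gcongr
            linarith

/-- The logarithmic cut-off `(1 - ε log X) ∨ 0`. -/
def logCut (ε X : ℝ) : ℝ := max (1 - ε * Real.log X) 0

theorem logCut_nonneg (ε X : ℝ) : 0 ≤ logCut ε X := le_max_right _ _

theorem logCut_le_one {ε X : ℝ} (hε : 0 ≤ ε) (hX : 1 ≤ X) : logCut ε X ≤ 1 :=
  max_le (by have := mul_nonneg hε (Real.log_nonneg hX); linarith) zero_le_one

theorem logCut_eq_zero {ε X : ℝ} (hε : 0 < ε) (hX : exp (1 / ε) ≤ X) : logCut ε X = 0 := by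
  have : 1 / ε ≤ Real.log X := by
    rw [← Real.log_exp (1 / ε)]
    exact Real.log_le_log (Real.exp_pos _) hX
  refine max_eq_right ?_
  have := (div_le_iff₀ hε).1 this
  linarith

theorem abs_logCut_sub_le {ε : ℝ} (hε : 0 ≤ ε) (X E : ℝ) :
    |logCut ε X - logCut ε E| ≤ ε * |Real.log X - Real.log E| := by
  refine (abs_max_sub_max_le_abs _ _ _).trans (le_of_eq ?_)
  rw [show 1 - ε * Real.log X - (1 - ε * Real.log E) = -(ε * (Real.log X - Real.log E)) by ring,
    abs_neg, abs_mul, abs_of_nonneg hε]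

theorem abs_logCut_sub_mul_le {ε x X E : ℝ} (hε : 0 ≤ ε) (hx : 0 ≤ x) (hX : 1 ≤ X) (hE : 1 ≤ E)
    (h : |X - E| ≤ x) :
    |logCut ε X - logCut ε E| * (x * (X + E)) ≤ 4 * ε * (x * (max x 1) ^ 2) := by
  wlog hEX : E ≤ X generalizing X E
  · have := this hE hX (by rwa [abs_sub_comm]) (le_of_not_ge hEX)
    rw [abs_sub_comm, add_comm]; exact this
  have hE0 : 0 < E := by linarith
  have hX0 : 0 < X := by linarith
  set Z := max x 1
  have hZ1 : 1 ≤ Z := le_max_right _ _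
  have hxZ : x ≤ Z := le_max_left _ _
  have hXEx : X - E ≤ x := (le_abs_self _).trans h
  have hlog : |Real.log X - Real.log E| = Real.log (X / E) := by
    rw [← Real.log_div hX0.ne' hE0.ne', abs_of_nonneg]
    exact Real.log_nonneg ((one_le_div hE0).2 hEX)
  have h1 : Real.log (X / E) ≤ (X - E) / E := by
    have := Real.log_le_sub_one_of_pos (x := X / E) (by positivity)
    rwa [div_sub_one hE0.ne'] at this
  have h2 : Real.log (X / E) * (X + E) ≤ 4 * Z ^ 2 := by
    have a1 : (X - E) / E * E = X - E := by field_simp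
    have a2 : (X - E) / E ≤ Z := by
      rw [div_le_iff₀ hE0]; nlinarith
    have a3 : 0 ≤ (X - E) / E := div_nonneg (by linarith) hE0.le
    have a4 : (X - E) / E * (X + E) = (X - E) / E * (X - E) + 2 * (X - E) := by
      linear_combination 2 * a1
    calc _ ≤ (X - E) / E * (X + E) := by gcongr
      _ = (X - E) / E * (X - E) + 2 * (X - E) := a4
      _ ≤ Z * Z + 2 * (Z * Z) := by
          gcongr
          · linarith
          · nlinarith
      _ ≤ _ := by nlinarith
  calc _ ≤ ε * Real.log (X / E) * (x * (X + E)) := by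
        have := abs_logCut_sub_le hε X E
        rw [hlog] at this
        gcongr
    _ = ε * x * (Real.log (X / E) * (X + E)) := by ring
    _ ≤ ε * x * (4 * Z ^ 2) := by gcongr
    _ = _ := by ring

variable {n : ℕ}

/-! ### Interaction integrals -/

/-- `|η| ∨ 1` with `η = 2πξ`. -/
def jap (ξ : Rn n) : ℝ := max (2 * Real.pi * ‖ξ‖) 1

theorem one_le_jap (ξ : Rn n) : 1 ≤ jap ξ := le_max_right _ _

theorem jap_pos (ξ : Rn n) : 0 < jap ξ := zero_lt_one.trans_le (one_le_jap ξ)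

theorem continuous_jap : Continuous (jap : Rn n → ℝ) := by
  unfold jap; fun_prop

theorem measurable_jap : Measurable (jap : Rn n → ℝ) := continuous_jap.measurable

theorem freq_nonneg (ξ : Rn n) : 0 ≤ 2 * Real.pi * ‖ξ‖ := by positivity

theorem freq_le_jap (ξ : Rn n) : 2 * Real.pi * ‖ξ‖ ≤ jap ξ := le_max_left _ _

theorem jap_rpow (ξ : Rn n) {ν : ℝ} (hν : 0 < ν) :
    max ((2 * Real.pi * ‖ξ‖) ^ ν) 1 = jap ξ ^ ν := by
  unfold jap
  rcases le_total (2 * Real.pi * ‖ξ‖) 1 with h | h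
  · rw [max_eq_right h, Real.one_rpow, max_eq_right]
    exact Real.rpow_le_one (freq_nonneg ξ) h hν.le
  · rw [max_eq_left h, max_eq_left]
    exact Real.one_le_rpow h hν.le

theorem gevreyWeight_zero {ν : ℝ} (hν : 0 < ν) (ρ k : ℝ) (ξ : Rn n) :
    gevreyWeight ν ρ k 0 ξ = jap ξ ^ k * exp (ρ * jap ξ ^ ν) := by
  unfold gevreyWeight
  rw [jap_rpow ξ hν]
  congr 1
  split_ifs with h
  · unfold jap; rw [max_eq_left h.le]
  · unfold jap; rw [max_eq_right (not_lt.1 h), Real.rpow_zero, Real.one_rpow]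

theorem measurable_gevreyWeight (ν ρ p q : ℝ) :
    Measurable (gevreyWeight ν ρ p q : Rn n → ℝ) := by
  unfold gevreyWeight
  refine Measurable.mul ?_ (by fun_prop)
  exact Measurable.ite (measurableSet_lt measurable_const (by fun_prop)) (by fun_prop) (by fun_prop)

theorem abs_jap_sub_le (ξ η : Rn n) : |jap ξ - jap η| ≤ 2 * Real.pi * ‖ξ - η‖ := by
  refine (abs_max_sub_max_le_abs _ _ _).trans ?_
  rw [← mul_sub, abs_mul, abs_of_pos Real.two_pi_pos]
  exact mul_le_mul_of_nonneg_left (abs_norm_sub_norm_le _ _) Real.two_pi_pos.le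

/-- `|ξ|² - |η|²` in angular frequencies. -/
def sqDiff (p : Rn n × Rn n) : ℝ := (2 * Real.pi * ‖p.1‖) ^ 2 - (2 * Real.pi * ‖p.2‖) ^ 2

theorem continuous_sqDiff : Continuous (sqDiff : Rn n × Rn n → ℝ) := by
  unfold sqDiff; fun_prop

theorem abs_sqDiff_le (p : Rn n × Rn n) :
    |sqDiff p| ≤ (2 * Real.pi * ‖p.1 - p.2‖) * (jap p.1 + jap p.2) := by
  have e : sqDiff p = (2 * Real.pi * (‖p.1‖ - ‖p.2‖)) *
      (2 * Real.pi * ‖p.1‖ + 2 * Real.pi * ‖p.2‖) := by unfold sqDiff; ring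
  rw [e, abs_mul, abs_mul, abs_of_pos Real.two_pi_pos,
    abs_of_nonneg (add_nonneg (freq_nonneg _) (freq_nonneg _))]
  have h1 := abs_norm_sub_norm_le p.1 p.2
  have h2 := freq_le_jap p.1
  have h3 := freq_le_jap p.2
  gcongr

/-- The `L²` norm of a function with values in `[0, ∞]`. -/
def n2 (f : Rn n → ℝ≥0∞) : ℝ≥0∞ := (∫⁻ ξ, f ξ ^ (2 : ℝ)) ^ (1 / 2 : ℝ)

theorem eLpNorm_two_eq_n2 (g : Rn n → ℂ) : eLpNorm g 2 volume = n2 fun ξ => ‖g ξ‖ₑ := by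
  rw [eLpNorm_eq_lintegral_rpow_enorm_toReal (by norm_num) (by norm_num)]
  simp [n2]

theorem n2_mono {f g : Rn n → ℝ≥0∞} (h : ∀ᵐ ξ, f ξ ≤ g ξ) : n2 f ≤ n2 g := by
  unfold n2
  refine ENNReal.rpow_le_rpow (lintegral_mono_ae ?_) (by norm_num)
  filter_upwards [h] with ξ hξ
  exact ENNReal.rpow_le_rpow hξ (by norm_num)

theorem lintegral_mul_le_n2 {f g : Rn n → ℝ≥0∞} (hf : AEMeasurable f) (hg : AEMeasurable g) :
    ∫⁻ ξ, f ξ * g ξ ≤ n2 f * n2 g := by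
  have := ENNReal.lintegral_mul_le_Lp_mul_Lq volume Real.HolderConjugate.two_two hf hg
  simpa [n2] using this

theorem n2_comp_add_right (f : Rn n → ℝ≥0∞) (η : Rn n) : n2 (fun ξ => f (ξ + η)) = n2 f := by
  unfold n2
  rw [lintegral_add_right_eq_self (fun ξ => f ξ ^ (2 : ℝ)) η]

theorem n2_comp_sub_left (f : Rn n → ℝ≥0∞) (η : Rn n) : n2 (fun ξ => f (η - ξ)) = n2 f := by
  unfold n2
  rw [lintegral_sub_left_eq_self (fun ξ => f ξ ^ (2 : ℝ)) η]

theorem ae_sub_of_ae {p : Rn n → Prop} (h : ∀ᵐ ξ, p ξ) :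
    ∀ᵐ q : Rn n × Rn n ∂(volume.prod volume), p (q.1 - q.2) :=
  (quasiMeasurePreserving_sub_of_right_invariant (volume : Measure (Rn n)) volume).ae h

theorem AEMeasurable.comp_sub {β : Type*} [MeasurableSpace β] {G : Rn n → β} (hG : AEMeasurable G) :
    AEMeasurable (fun q : Rn n × Rn n => G (q.1 - q.2)) (volume.prod volume) :=
  hG.comp_quasiMeasurePreserving
    (quasiMeasurePreserving_sub_of_right_invariant (volume : Measure (Rn n)) volume)

/-- Young's inequality with the `L¹` factor depending on the difference. -/
theorem lintegral_young {P Q G : Rn n → ℝ≥0∞} (hP : Measurable P) (hQ : Measurable Q)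
    (hG : AEMeasurable G) :
    ∫⁻ p : Rn n × Rn n, P p.1 * (G (p.1 - p.2) * Q p.2) ∂(volume.prod volume) ≤
      (∫⁻ ζ, G ζ) * (n2 P * n2 Q) := by
  wlog hGm : Measurable G generalizing G
  · have h := this hG.measurable_mk.aemeasurable hG.measurable_mk
    rw [← lintegral_congr_ae hG.ae_eq_mk] at h
    refine le_trans (le_of_eq (lintegral_congr_ae ?_)) h
    filter_upwards [ae_sub_of_ae hG.ae_eq_mk] with p hp
    rw [hp]
  rw [lintegral_prod_symm _ (by fun_prop)]
  calc ∫⁻ η, ∫⁻ ξ, P ξ * (G (ξ - η) * Q η) = ∫⁻ η, ∫⁻ ζ, P (ζ + η) * (G ζ * Q η) := by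
        refine lintegral_congr fun η => ?_
        rw [← lintegral_add_right_eq_self (fun ξ => P ξ * (G (ξ - η) * Q η)) η]
        simp
    _ = ∫⁻ ζ, ∫⁻ η, P (ζ + η) * (G ζ * Q η) := by
        rw [lintegral_lintegral_swap]
        fun_prop
    _ ≤ ∫⁻ ζ, G ζ * (n2 P * n2 Q) := by
        refine lintegral_mono fun ζ => ?_
        calc ∫⁻ η, P (ζ + η) * (G ζ * Q η) = ∫⁻ η, G ζ * (P (η + ζ) * Q η) := by
              refine lintegral_congr fun η => ?_
              rw [add_comm]; ring
          _ = G ζ * ∫⁻ η, P (η + ζ) * Q η := by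
              rw [lintegral_const_mul _ (by fun_prop)]
          _ ≤ G ζ * (n2 P * n2 Q) := by
              gcongr
              refine (lintegral_mul_le_n2 (by fun_prop) (by fun_prop)).trans ?_
              rw [n2_comp_add_right]
    _ = _ := by rw [lintegral_mul_const'' _ hG]

/-- The interaction integral with an extra weight on the second variable. -/
theorem lintegral_young_snd {P Q G H : Rn n → ℝ≥0∞} (hP : Measurable P) (hQ : Measurable Q)
    (hG : AEMeasurable G) (hH : Measurable H) :
    ∫⁻ p : Rn n × Rn n, P p.1 * (G (p.1 - p.2) * H p.2 * Q p.2) ∂(volume.prod volume) ≤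
      n2 G * n2 H * (n2 P * n2 Q) := by
  wlog hGm : Measurable G generalizing G
  · have h := this hG.measurable_mk.aemeasurable hG.measurable_mk
    have e : n2 (hG.mk G) = n2 G := le_antisymm (n2_mono (hG.ae_eq_mk.mono fun x hx => hx.ge))
      (n2_mono (hG.ae_eq_mk.mono fun x hx => hx.le))
    rw [e] at h
    refine le_trans (le_of_eq (lintegral_congr_ae ?_)) h
    filter_upwards [ae_sub_of_ae hG.ae_eq_mk] with p hp
    rw [hp]
  rw [lintegral_prod_symm _ (by fun_prop)]
  calc ∫⁻ η, ∫⁻ ξ, P ξ * (G (ξ - η) * H η * Q η)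
      ≤ ∫⁻ η, n2 P * n2 G * (H η * Q η) := by
        refine lintegral_mono fun η => ?_
        calc ∫⁻ ξ, P ξ * (G (ξ - η) * H η * Q η) = (∫⁻ ξ, P ξ * G (ξ - η)) * (H η * Q η) := by
              rw [← lintegral_mul_const _ (by fun_prop)]
              refine lintegral_congr fun ξ => ?_
              ring
          _ ≤ n2 P * n2 G * (H η * Q η) := by
              gcongr
              refine (lintegral_mul_le_n2 (by fun_prop) (by fun_prop)).trans ?_
              have := n2_comp_add_right G (-η)
              simp only [← sub_eq_add_neg] at this
              rw [this]
    _ = n2 P * n2 G * ∫⁻ η, H η * Q η := lintegral_const_mul _ (by fun_prop)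
    _ ≤ n2 P * n2 G * (n2 H * n2 Q) := by
        gcongr; exact lintegral_mul_le_n2 hH.aemeasurable hQ.aemeasurable
    _ = _ := by ring

/-- The interaction integral with an extra weight on the first variable. -/
theorem lintegral_young_fst {P Q G H : Rn n → ℝ≥0∞} (hP : Measurable P) (hQ : Measurable Q)
    (hG : AEMeasurable G) (hH : Measurable H) :
    ∫⁻ p : Rn n × Rn n, P p.1 * (G (p.1 - p.2) * H p.1 * Q p.2) ∂(volume.prod volume) ≤
      n2 G * n2 H * (n2 P * n2 Q) := by
  wlog hGm : Measurable G generalizing G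
  · have h := this hG.measurable_mk.aemeasurable hG.measurable_mk
    have e : n2 (hG.mk G) = n2 G := le_antisymm (n2_mono (hG.ae_eq_mk.mono fun x hx => hx.ge))
      (n2_mono (hG.ae_eq_mk.mono fun x hx => hx.le))
    rw [e] at h
    refine le_trans (le_of_eq (lintegral_congr_ae ?_)) h
    filter_upwards [ae_sub_of_ae hG.ae_eq_mk] with p hp
    rw [hp]
  rw [lintegral_prod _ (by fun_prop)]
  calc ∫⁻ ξ, ∫⁻ η, P ξ * (G (ξ - η) * H ξ * Q η)
      ≤ ∫⁻ ξ, n2 Q * n2 G * (H ξ * P ξ) := by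
        refine lintegral_mono fun ξ => ?_
        calc ∫⁻ η, P ξ * (G (ξ - η) * H ξ * Q η) = (∫⁻ η, Q η * G (ξ - η)) * (H ξ * P ξ) := by
              rw [← lintegral_mul_const _ (by fun_prop)]
              refine lintegral_congr fun η => ?_
              ring
          _ ≤ n2 Q * n2 G * (H ξ * P ξ) := by
              gcongr
              refine (lintegral_mul_le_n2 (by fun_prop) (by fun_prop)).trans ?_
              rw [n2_comp_sub_left]
    _ = n2 Q * n2 G * ∫⁻ ξ, H ξ * P ξ := lintegral_const_mul _ (by fun_prop)
    _ ≤ n2 Q * n2 G * (n2 H * n2 P) := by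
        gcongr; exact lintegral_mul_le_n2 hH.aemeasurable hP.aemeasurable
    _ = _ := by ring

theorem one_add_norm_le_jap (ξ : Rn n) : (1 + ‖ξ‖) / 2 ≤ jap ξ := by
  have h1 := one_le_jap ξ
  have h2 := freq_le_jap ξ
  have h3 : ‖ξ‖ ≤ 2 * Real.pi * ‖ξ‖ := by
    have := Real.pi_gt_three
    have := norm_nonneg ξ
    nlinarith
  linarith

theorem n2_jap_rpow_lt_top {δ : ℝ} (hδ : (n : ℝ) / 2 < δ) :
    n2 (fun ξ : Rn n => ofReal (jap ξ ^ (-δ))) < ⊤ := by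
  have hδ0 : 0 ≤ δ := by have : (0 : ℝ) ≤ n := n.cast_nonneg; linarith
  unfold n2
  refine ENNReal.rpow_lt_top_of_nonneg (by norm_num) (ne_of_lt ?_)
  have h := finite_integral_one_add_norm (μ := (volume : Measure (Rn n))) (r := 2 * δ)
    (by simp; linarith)
  calc ∫⁻ ξ : Rn n, ofReal (jap ξ ^ (-δ)) ^ (2 : ℝ)
      ≤ ∫⁻ ξ : Rn n, ofReal (2 ^ (2 * δ)) * ofReal ((1 + ‖ξ‖) ^ (-(2 * δ))) := by
        refine lintegral_mono fun ξ => ?_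
        have hj := jap_pos ξ
        rw [ENNReal.ofReal_rpow_of_pos (by positivity), ← ENNReal.ofReal_mul (by positivity)]
        refine ENNReal.ofReal_le_ofReal ?_
        rw [← Real.rpow_mul hj.le, show -δ * 2 = -(2 * δ) by ring]
        have h1 : jap ξ ^ (-(2 * δ)) ≤ ((1 + ‖ξ‖) / 2) ^ (-(2 * δ)) :=
          Real.rpow_le_rpow_of_nonpos (by positivity) (one_add_norm_le_jap ξ) (by linarith)
        refine h1.trans (le_of_eq ?_)
        rw [Real.div_rpow (by positivity) (by norm_num), Real.rpow_neg (by norm_num : (0 : ℝ) ≤ 2)]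
        field_simp
    _ = ofReal (2 ^ (2 * δ)) * ∫⁻ ξ : Rn n, ofReal ((1 + ‖ξ‖) ^ (-(2 * δ))) :=
        lintegral_const_mul _ (by fun_prop)
    _ < ⊤ := ENNReal.mul_lt_top ENNReal.ofReal_lt_top h

/-- A square integrable majorant of `Z^{2-ν}` over the weight of the phase. -/
def phaseMajorant (δ lLow : ℝ) (ξ : Rn n) : ℝ :=
  if 1 < 2 * Real.pi * ‖ξ‖ then jap ξ ^ (-δ) else (2 * Real.pi * ‖ξ‖) ^ (-lLow)

theorem measurable_phaseMajorant (δ lLow : ℝ) :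
    Measurable (phaseMajorant δ lLow : Rn n → ℝ) := by
  unfold phaseMajorant
  have := measurable_jap (n := n)
  exact Measurable.ite (measurableSet_lt measurable_const (by fun_prop)) (by fun_prop) (by fun_prop)

theorem phaseMajorant_nonneg (δ lLow : ℝ) (ξ : Rn n) : 0 ≤ phaseMajorant δ lLow ξ := by
  unfold phaseMajorant
  have := jap_pos ξ
  split_ifs <;> positivity

theorem n2_phaseMajorant_lt_top (hn : 1 ≤ n) {δ lLow : ℝ} (hδ : (n : ℝ) / 2 < δ)
    (hl : lLow < (n : ℝ) / 2) :
    n2 (fun ξ : Rn n => ofReal (phaseMajorant δ lLow ξ)) < ⊤ := by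
  unfold n2
  refine ENNReal.rpow_lt_top_of_nonneg (by norm_num) (ne_of_lt ?_)
  have h1 : ∫⁻ ξ : Rn n, ofReal (jap ξ ^ (-δ)) ^ (2 : ℝ) < ⊤ := by
    have := n2_jap_rpow_lt_top hδ
    unfold n2 at this
    rwa [ENNReal.rpow_lt_top_iff_of_pos (by norm_num)] at this
  have h2 : ∫⁻ ξ in Metric.ball (0 : Rn n) 1,
      ofReal ((2 * Real.pi * ‖ξ‖) ^ (-(2 * lLow))) < ⊤ := by
    have hm : Measurable fun ξ : Rn n => (2 * Real.pi * ‖ξ‖) ^ (-(2 * lLow)) := by fun_prop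
    have := integrableOn_ball_of_norm_le_rpow (μ := (volume : Measure (Rn n))) (r := 1)
      (f := fun ξ : Rn n => (2 * Real.pi * ‖ξ‖) ^ (-(2 * lLow)))
      (C := (2 * Real.pi) ^ (-(2 * lLow))) (α := 2 * lLow) (by simpa using hn)
      (by simp; linarith) (Eventually.of_forall fun ξ => by
        rw [Real.norm_of_nonneg (by positivity),
          Real.mul_rpow Real.two_pi_pos.le (norm_nonneg _)])
      hm.aestronglyMeasurable
    have h := this.2
    rw [hasFiniteIntegral_iff_enorm] at h
    refine lt_of_le_of_lt (lintegral_mono fun ξ => ?_) h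
    rw [Real.enorm_eq_ofReal (by positivity)]
  calc ∫⁻ ξ : Rn n, ofReal (phaseMajorant δ lLow ξ) ^ (2 : ℝ)
      ≤ ∫⁻ ξ : Rn n, (ofReal (jap ξ ^ (-δ)) ^ (2 : ℝ) +
        (Metric.ball (0 : Rn n) 1).indicator
          (fun ξ => ofReal ((2 * Real.pi * ‖ξ‖) ^ (-(2 * lLow)))) ξ) := by
        refine lintegral_mono fun ξ => ?_
        unfold phaseMajorant
        split_ifs with h
        · exact le_self_add
        · have hb : ξ ∈ Metric.ball (0 : Rn n) 1 := by
            rw [mem_ball_zero_iff]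
            have := Real.pi_gt_three
            have := norm_nonneg ξ
            nlinarith
          rw [indicator_of_mem hb]
          refine le_trans (le_of_eq ?_) le_add_self
          rw [ENNReal.ofReal_rpow_of_nonneg (by positivity) (by norm_num),
            ← Real.rpow_mul (freq_nonneg ξ), show -lLow * 2 = -(2 * lLow) by ring]
    _ = (∫⁻ ξ : Rn n, ofReal (jap ξ ^ (-δ)) ^ (2 : ℝ)) + ∫⁻ ξ in Metric.ball (0 : Rn n) 1,
          ofReal ((2 * Real.pi * ‖ξ‖) ^ (-(2 * lLow))) := by
        have := measurable_jap (n := n)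
        rw [lintegral_add_left (by fun_prop), lintegral_indicator Metric.isOpen_ball.measurableSet]
    _ < ⊤ := ENNReal.add_lt_top.2 ⟨h1, h2⟩

theorem japPow_le_phaseMajorant_mul {ν l lLow ρ : ℝ} (hν : 0 < ν) {ξ : Rn n} (hξ : ξ ≠ 0) :
    jap ξ ^ (2 - ν) * exp (ρ * jap ξ ^ ν) ≤
      phaseMajorant (l + ν) lLow ξ * gevreyWeight ν ρ (l + 2) lLow ξ := by
  unfold phaseMajorant gevreyWeight
  rw [jap_rpow ξ hν, ← mul_assoc]
  gcongr
  have hpos : 0 < 2 * Real.pi * ‖ξ‖ := mul_pos Real.two_pi_pos (norm_pos_iff.2 hξ)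
  split_ifs with h
  · have e : jap ξ = 2 * Real.pi * ‖ξ‖ := max_eq_left h.le
    rw [← e, ← Real.rpow_add (jap_pos ξ)]
    exact le_of_eq (by ring_nf)
  · have e : jap ξ = 1 := max_eq_right (not_lt.1 h)
    rw [← Real.rpow_add hpos, neg_add_cancel, Real.rpow_zero, e, Real.one_rpow]

theorem ae_ne_zero (hn : 1 ≤ n) : ∀ᵐ ξ : Rn n, ξ ≠ 0 := by
  have : Nontrivial (Rn n) := by
    apply Module.nontrivial_of_finrank_pos (R := ℝ)
    simp; omega
  exact Measure.ae_ne volume 0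

theorem enorm_gevreyWeight_mul {ν ρ p q : ℝ} (ξ : Rn n) (z : ℂ) :
    ‖((gevreyWeight ν ρ p q ξ : ℝ) : ℂ) * z‖ₑ = ofReal (gevreyWeight ν ρ p q ξ) * ‖z‖ₑ := by
  rw [enorm_mul]
  congr 1
  have h0 : 0 ≤ gevreyWeight ν ρ p q ξ := by
    unfold gevreyWeight
    refine mul_nonneg ?_ (Real.exp_pos _).le
    have := freq_nonneg ξ
    split_ifs <;> positivity
  rw [← ofReal_norm, Complex.norm_real, Real.norm_of_nonneg h0]

/-- The Fourier transform of the phase is integrable with the weight `Z^{2-ν} f`. -/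
theorem lintegral_japPow_mul_le (hn : 1 ≤ n) {ν l lLow : ℝ} (hν : 0 < ν)
    (hδ : (n : ℝ) / 2 < l + ν) (hl : lLow < (n : ℝ) / 2) :
    ∃ C : ℝ≥0, ∀ (ρ : ℝ) (g : Rn n → ℂ), AEStronglyMeasurable g volume →
      ∫⁻ ξ, ofReal (jap ξ ^ (2 - ν) * exp (ρ * jap ξ ^ ν)) * ‖g ξ‖ₑ ≤
        C * yNorm ν ρ l lLow g := by
  have hfin := n2_phaseMajorant_lt_top hn hδ hl
  refine ⟨(n2 (fun ξ : Rn n => ofReal (phaseMajorant (l + ν) lLow ξ))).toNNReal, ?_⟩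
  intro ρ g hg
  rw [ENNReal.coe_toNNReal hfin.ne, yNorm, eLpNorm_two_eq_n2]
  have hm := measurable_phaseMajorant (n := n) (l + ν) lLow
  have hw := measurable_gevreyWeight (n := n) ν ρ (l + 2) lLow
  refine le_trans (lintegral_mono_ae ?_) (lintegral_mul_le_n2 (by fun_prop) ?_)
  · filter_upwards [ae_ne_zero hn] with ξ hξ
    unfold yLift
    rw [enorm_gevreyWeight_mul, ← mul_assoc,
      ← ENNReal.ofReal_mul (phaseMajorant_nonneg (l + ν) lLow ξ)]
    exact mul_le_mul' (ENNReal.ofReal_le_ofReal (japPow_le_phaseMajorant_mul hν hξ)) le_rfl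
  · unfold yLift
    exact ((Complex.measurable_ofReal.comp hw).aestronglyMeasurable.mul hg).enorm

/-- The pointwise splitting of the interaction factor into the three Young kernels. -/
theorem ofReal_interFactor_mul_le {ν l lLow : ℝ} (hν : 0 < ν) (ρ : ℝ)
    (g : Rn n → ℂ) (ξ η : Rn n) :
    ofReal (exp (ρ * jap (ξ - η) ^ ν) *
        interFactor ν l (l + ν) (2 * Real.pi * ‖ξ - η‖) (jap ξ) (jap η)) * ‖g (ξ - η)‖ₑ ≤
      ofReal (jap (ξ - η) ^ (2 - ν) * exp (ρ * jap (ξ - η) ^ ν)) * ‖g (ξ - η)‖ₑ +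
        (‖yLift ν ρ l lLow g (ξ - η)‖ₑ * ofReal (jap η ^ (-(l + ν))) +
          ‖yLift ν ρ l lLow g (ξ - η)‖ₑ * ofReal (jap ξ ^ (-(l + ν)))) := by
  set ζ := ξ - η
  have hζ := jap_pos ζ
  have h1 := jap_pos ξ
  have h2 := jap_pos η
  set x := 2 * Real.pi * ‖ζ‖ with hx
  have hx0 : 0 ≤ x := freq_nonneg ζ
  have hxj : max x 1 = jap ζ := rfl
  set f := exp (ρ * jap ζ ^ ν)
  have hf : 0 < f := Real.exp_pos _
  have hlin : f * interFactor ν l (l + ν) x (jap ξ) (jap η) ≤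
      jap ζ ^ (2 - ν) * f + (gevreyWeight ν ρ (l + 2) lLow ζ * jap η ^ (-(l + ν)) +
        gevreyWeight ν ρ (l + 2) lLow ζ * jap ξ ^ (-(l + ν))) := by
    unfold interFactor
    rw [hxj]
    have t1 : x * jap ζ ^ (1 - ν) ≤ jap ζ ^ (2 - ν) := by
      rw [show 2 - ν = 1 + (1 - ν) by ring, Real.rpow_add hζ, Real.rpow_one]
      gcongr
      exact freq_le_jap ζ
    have t2 : (if 1 < x then x ^ (l + 2) else 0) * f ≤ gevreyWeight ν ρ (l + 2) lLow ζ := by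
      unfold gevreyWeight
      rw [jap_rpow ζ hν]
      gcongr
      rw [← hx]
      split_ifs
      · exact le_rfl
      · positivity
    have t3 : 0 ≤ jap η ^ (-(l + ν)) + jap ξ ^ (-(l + ν)) := by positivity
    nlinarith [mul_le_mul_of_nonneg_right t2 t3, mul_le_mul_of_nonneg_right t1 hf.le]
  have hw0 : 0 ≤ gevreyWeight ν ρ (l + 2) lLow ζ := by
    unfold gevreyWeight
    refine mul_nonneg ?_ (Real.exp_pos _).le
    split_ifs <;> positivity
  refine (mul_le_mul' (ENNReal.ofReal_le_ofReal hlin) le_rfl).trans (le_of_eq ?_)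
  unfold yLift
  rw [enorm_gevreyWeight_mul, ENNReal.ofReal_add (by positivity) (by positivity),
    ENNReal.ofReal_add (by positivity) (by positivity), ENNReal.ofReal_mul hw0,
    ENNReal.ofReal_mul hw0]
  ring

/-- The interaction integral is controlled by the norm of the phase. -/
theorem lintegral_interFactor_le (hn : 1 ≤ n) {ν l lLow : ℝ} (hν : 0 < ν)
    (hδ : (n : ℝ) / 2 < l + ν) (hl : lLow < (n : ℝ) / 2) :
    ∃ C : ℝ≥0, ∀ (ρ : ℝ) (g : Rn n → ℂ) (P Q : Rn n → ℝ≥0∞), AEStronglyMeasurable g volume →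
      Measurable P → Measurable Q →
      ∫⁻ p : Rn n × Rn n, P p.1 * (ofReal (exp (ρ * jap (p.1 - p.2) ^ ν) *
        interFactor ν l (l + ν) (2 * Real.pi * ‖p.1 - p.2‖) (jap p.1) (jap p.2)) *
          ‖g (p.1 - p.2)‖ₑ * Q p.2) ∂(volume.prod volume) ≤
        C * yNorm ν ρ l lLow g * (n2 P * n2 Q) := by
  obtain ⟨C₁, hC₁⟩ := lintegral_japPow_mul_le hn hν hδ hl
  have hfin := n2_jap_rpow_lt_top (n := n) hδ
  set C₂ := (n2 (fun ξ : Rn n => ofReal (jap ξ ^ (-(l + ν))))).toNNReal with hC₂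
  have hC₂' : (C₂ : ℝ≥0∞) = n2 (fun ξ : Rn n => ofReal (jap ξ ^ (-(l + ν)))) :=
    ENNReal.coe_toNNReal hfin.ne
  refine ⟨C₁ + 2 * C₂, ?_⟩
  intro ρ g P Q hg hP hQ
  have hj := measurable_jap (n := n)
  set G₁ : Rn n → ℝ≥0∞ := fun ζ =>
    ofReal (jap ζ ^ (2 - ν) * exp (ρ * jap ζ ^ ν)) * ‖g ζ‖ₑ with hG₁
  set G₂ : Rn n → ℝ≥0∞ := fun ζ => ‖yLift ν ρ l lLow g ζ‖ₑ with hG₂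
  set H : Rn n → ℝ≥0∞ := fun ζ => ofReal (jap ζ ^ (-(l + ν))) with hH
  have hG₁m : AEMeasurable G₁ := by
    have := hg.enorm
    fun_prop
  have hG₂m : AEMeasurable G₂ := by
    unfold G₂ yLift
    exact ((Complex.measurable_ofReal.comp
      (measurable_gevreyWeight (n := n) ν ρ (l + 2) lLow)).aestronglyMeasurable.mul hg).enorm
  have hHm : Measurable H := by fun_prop
  have hpt : ∀ p : Rn n × Rn n, P p.1 * (ofReal (exp (ρ * jap (p.1 - p.2) ^ ν) *
        interFactor ν l (l + ν) (2 * Real.pi * ‖p.1 - p.2‖) (jap p.1) (jap p.2)) *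
          ‖g (p.1 - p.2)‖ₑ * Q p.2) ≤
      P p.1 * (G₁ (p.1 - p.2) * Q p.2) + (P p.1 * (G₂ (p.1 - p.2) * H p.2 * Q p.2) +
        P p.1 * (G₂ (p.1 - p.2) * H p.1 * Q p.2)) := by
    intro p
    have hle := ofReal_interFactor_mul_le (l := l) (lLow := lLow) hν ρ g p.1 p.2
    calc _ ≤ P p.1 * ((G₁ (p.1 - p.2) + (G₂ (p.1 - p.2) * H p.2 + G₂ (p.1 - p.2) * H p.1)) *
          Q p.2) := mul_le_mul' le_rfl (mul_le_mul' hle le_rfl)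
      _ = _ := by ring
  refine (lintegral_mono hpt).trans ?_
  have hG₁c : AEMeasurable (fun q : Rn n × Rn n => G₁ (q.1 - q.2)) (volume.prod volume) :=
    hG₁m.comp_sub
  have hG₂c : AEMeasurable (fun q : Rn n × Rn n => G₂ (q.1 - q.2)) (volume.prod volume) :=
    hG₂m.comp_sub
  have hP' : AEMeasurable (fun q : Rn n × Rn n => P q.1) (volume.prod volume) := by fun_prop
  have hQ' : AEMeasurable (fun q : Rn n × Rn n => Q q.2) (volume.prod volume) := by fun_prop
  have hH' : AEMeasurable (fun q : Rn n × Rn n => H q.2) (volume.prod volume) :=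
    (hHm.comp measurable_snd).aemeasurable
  have m1 : AEMeasurable (fun a : Rn n × Rn n => P a.1 * (G₁ (a.1 - a.2) * Q a.2))
      (volume.prod volume) := hP'.mul (hG₁c.mul hQ')
  have m2 : AEMeasurable (fun a : Rn n × Rn n => P a.1 * (G₂ (a.1 - a.2) * H a.2 * Q a.2))
      (volume.prod volume) := hP'.mul ((hG₂c.mul hH').mul hQ')
  rw [lintegral_add_left' m1, lintegral_add_left' m2]
  have b1 := lintegral_young hP hQ hG₁m
  have b2 := lintegral_young_snd hP hQ hG₂m hHm
  have b3 := lintegral_young_fst hP hQ hG₂m hHm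
  have b4 : n2 G₂ = yNorm ν ρ l lLow g := by rw [yNorm, eLpNorm_two_eq_n2]
  rw [← hC₂', b4] at b2 b3
  have b5 := hC₁ ρ g hg
  calc _ ≤ (C₁ * yNorm ν ρ l lLow g) * (n2 P * n2 Q) +
        (yNorm ν ρ l lLow g * C₂ * (n2 P * n2 Q) + yNorm ν ρ l lLow g * C₂ * (n2 P * n2 Q)) := by
          refine add_le_add (b1.trans ?_) (add_le_add b2 b3)
          gcongr
    _ = _ := by push_cast; ring

/-! ### Weighted bilinear estimates -/

/-- The norm of `K_ρ^k` in terms of the Fourier transform. -/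
def kN (ν ρ k : ℝ) (v : Rn n → ℂ) : ℝ≥0∞ :=
  n2 fun ξ => ofReal (jap ξ ^ k * exp (ρ * jap ξ ^ ν)) * ‖v ξ‖ₑ

theorem kNorm_eq_kN {ν : ℝ} (hν : 0 < ν) (ρ k : ℝ) (w : L2 n) :
    kNorm ν ρ k w = kN ν ρ k (𝓕 w : L2 n) := by
  unfold kNorm kN kLift
  rw [eLpNorm_two_eq_n2]
  congr 1
  ext ξ
  rw [enorm_gevreyWeight_mul, gevreyWeight_zero hν]

/-- The square of a Gevrey weight. -/
def sqW (ν ρ κ : ℝ) (ξ : Rn n) : ℝ := jap ξ ^ (2 * κ) * exp (ρ * jap ξ ^ ν) ^ 2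

theorem measurable_sqW (ν ρ κ : ℝ) : Measurable (sqW ν ρ κ : Rn n → ℝ) := by
  unfold sqW
  have := measurable_jap (n := n)
  fun_prop

theorem sqW_pos (ν ρ κ : ℝ) (ξ : Rn n) : 0 < sqW ν ρ κ ξ := by
  unfold sqW
  have := jap_pos ξ
  positivity

theorem measurable_weight_mul {ν ρ k : ℝ} {v : Rn n → ℂ} (hv : Measurable v) :
    Measurable fun ξ => ofReal (jap ξ ^ k * exp (ρ * jap ξ ^ ν)) * ‖v ξ‖ₑ := by
  have := measurable_jap (n := n)
  fun_prop

/-- `C` is a constant in the commutator estimate of order `κ`. -/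
def CommutatorBound (n : ℕ) (ν l lLow κ : ℝ) (C : ℝ≥0) : Prop :=
  ∀ (ρ : ℝ) (a : Rn n → ℝ) (g v : Rn n → ℂ), 0 ≤ ρ → (∀ ξ, 0 ≤ a ξ) →
    (∀ ξ, a ξ ≤ 1) → (∀ ξ η, |a ξ - a η| ≤ |Real.log (jap ξ) - Real.log (jap η)|) →
    AEStronglyMeasurable g volume → Measurable v →
    ∫⁻ p : Rn n × Rn n, ‖v p.1‖ₑ *
        (ofReal (|a p.1 * sqW ν ρ κ p.1 - a p.2 * sqW ν ρ κ p.2| * |sqDiff p|) *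
          ‖g (p.1 - p.2)‖ₑ * ‖v p.2‖ₑ) ∂(volume.prod volume) ≤
      C * yNorm ν ρ l lLow g * kN ν ρ (κ + ν / 2) v ^ 2

/-- `C` is a constant in the transport estimate of order `k` with shift `σ`. -/
def TransportBound (n : ℕ) (ν l lLow k σ : ℝ) (C : ℝ≥0) : Prop :=
  ∀ (ρ : ℝ) (P : Rn n → ℝ≥0∞) (g v : Rn n → ℂ), 0 ≤ ρ → Measurable P →
    AEStronglyMeasurable g volume → Measurable v →
    ∫⁻ p : Rn n × Rn n, P p.1 *
        (ofReal (jap p.1 ^ (k - σ) * exp (ρ * jap p.1 ^ ν) * |sqDiff p|) *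
          ‖g (p.1 - p.2)‖ₑ * ‖v p.2‖ₑ) ∂(volume.prod volume) ≤
      C * yNorm ν ρ l lLow g * (n2 P * kN ν ρ (k + 1 - σ) v)

/-- The commutator estimate. -/
theorem lintegral_commutator_le (hn : 1 ≤ n) {ν l lLow κ : ℝ} (hν : 0 < ν) (hν1 : ν ≤ 1)
    (hδ : (n : ℝ) / 2 < l + ν) (hl : lLow < (n : ℝ) / 2) (hκ : 0 ≤ κ) (hκl : κ ≤ l + ν / 2) :
    ∃ C : ℝ≥0, CommutatorBound n ν l lLow κ C := by
  obtain ⟨C₁, hC₁0, hC₁⟩ := abs_weight_sub_mul_le (l := l) hν hν1 hκ hκl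
  obtain ⟨C₂, hC₂⟩ := lintegral_interFactor_le hn hν hδ hl
  refine ⟨C₁.toNNReal * C₂, ?_⟩
  intro ρ a g v hρ ha0 ha1 ha hg hv
  set P : Rn n → ℝ≥0∞ := fun ξ =>
    ofReal (jap ξ ^ (κ + ν / 2) * exp (ρ * jap ξ ^ ν)) * ‖v ξ‖ₑ with hP
  have hPm : Measurable P := measurable_weight_mul hv
  have key := hC₂ ρ g P P hg hPm hPm
  have hpt : ∀ p : Rn n × Rn n, ‖v p.1‖ₑ *
          (ofReal (|a p.1 * sqW ν ρ κ p.1 - a p.2 * sqW ν ρ κ p.2| * |sqDiff p|) *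
            ‖g (p.1 - p.2)‖ₑ * ‖v p.2‖ₑ) ≤
      ofReal C₁ * (P p.1 * (ofReal (exp (ρ * jap (p.1 - p.2) ^ ν) *
        interFactor ν l (l + ν) (2 * Real.pi * ‖p.1 - p.2‖) (jap p.1) (jap p.2)) *
          ‖g (p.1 - p.2)‖ₑ * P p.2)) := by
    intro p
    have h1 := jap_pos p.1
    have h2 := jap_pos p.2
    have hpt1 := hC₁ ρ (2 * Real.pi * ‖p.1 - p.2‖) (jap p.1) (jap p.2) (a p.1) (a p.2) hρ
      (freq_nonneg _) (one_le_jap _) (one_le_jap _) (abs_jap_sub_le _ _) (ha0 _) (ha1 _) (ha0 _)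
      (ha1 _) (ha _ _)
    have hpt2 : |a p.1 * sqW ν ρ κ p.1 - a p.2 * sqW ν ρ κ p.2| * |sqDiff p| ≤
        C₁ * ((jap p.1 ^ (κ + ν / 2) * exp (ρ * jap p.1 ^ ν)) *
          (jap p.2 ^ (κ + ν / 2) * exp (ρ * jap p.2 ^ ν)) *
          (exp (ρ * jap (p.1 - p.2) ^ ν) *
            interFactor ν l (l + ν) (2 * Real.pi * ‖p.1 - p.2‖) (jap p.1) (jap p.2))) :=
      (mul_le_mul_of_nonneg_left (abs_sqDiff_le p) (abs_nonneg _)).trans hpt1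
    calc _ ≤ ‖v p.1‖ₑ * (ofReal (C₁ * ((jap p.1 ^ (κ + ν / 2) *
          exp (ρ * jap p.1 ^ ν)) * (jap p.2 ^ (κ + ν / 2) * exp (ρ * jap p.2 ^ ν)) *
          (exp (ρ * jap (p.1 - p.2) ^ ν) *
            interFactor ν l (l + ν) (2 * Real.pi * ‖p.1 - p.2‖) (jap p.1) (jap p.2)))) *
            ‖g (p.1 - p.2)‖ₑ * ‖v p.2‖ₑ) := by gcongr
      _ = _ := by
        rw [ENNReal.ofReal_mul hC₁0, ENNReal.ofReal_mul (by positivity),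
          ENNReal.ofReal_mul (by positivity), hP]
        ring
  refine (lintegral_mono hpt).trans ?_
  rw [lintegral_const_mul' _ _ ENNReal.ofReal_ne_top]
  calc _ ≤ ofReal C₁ * (C₂ * yNorm ν ρ l lLow g * (n2 P * n2 P)) := by gcongr
    _ = _ := by
      rw [ENNReal.coe_mul]
      change _ = (ofReal C₁ * C₂) * yNorm ν ρ l lLow g * (n2 P) ^ 2
      ring

/-- The estimate of the interaction without commutator. -/
theorem lintegral_transport_le (hn : 1 ≤ n) {ν l lLow k σ : ℝ} (hν : 0 < ν) (hν1 : ν ≤ 1)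
    (hδ : (n : ℝ) / 2 < l + ν) (hl : lLow < (n : ℝ) / 2) (hk : 0 ≤ k)
    (hσ : 0 ≤ σ) (hσ1 : σ ≤ 1) (hkl : k - σ ≤ l) (hl0 : 0 ≤ l) (hσl : σ ≤ l + ν + k) :
    ∃ C : ℝ≥0, TransportBound n ν l lLow k σ C := by
  obtain ⟨C₁, hC₁0, hC₁⟩ := rpow_mul_le_interFactor (l := l) hν1 hk hσ hσ1 hkl hl0 hσl
  obtain ⟨C₂, hC₂⟩ := lintegral_interFactor_le hn hν hδ hl
  refine ⟨C₁.toNNReal * C₂, ?_⟩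
  intro ρ P g v hρ hPm hg hv
  set Q : Rn n → ℝ≥0∞ := fun ξ =>
    ofReal (jap ξ ^ (k + 1 - σ) * exp (ρ * jap ξ ^ ν)) * ‖v ξ‖ₑ with hQ
  have hQm : Measurable Q := measurable_weight_mul hv
  have key := hC₂ ρ g P Q hg hPm hQm
  have hpt : ∀ p : Rn n × Rn n, P p.1 *
          (ofReal (jap p.1 ^ (k - σ) * exp (ρ * jap p.1 ^ ν) * |sqDiff p|) *
            ‖g (p.1 - p.2)‖ₑ * ‖v p.2‖ₑ) ≤
      ofReal C₁ * (P p.1 * (ofReal (exp (ρ * jap (p.1 - p.2) ^ ν) *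
        interFactor ν l (l + ν) (2 * Real.pi * ‖p.1 - p.2‖) (jap p.1) (jap p.2)) *
          ‖g (p.1 - p.2)‖ₑ * Q p.2)) := by
    intro p
    have h1 := jap_pos p.1
    have h2 := jap_pos p.2
    have h3 := jap_pos (p.1 - p.2)
    have hpt1 := hC₁ (2 * Real.pi * ‖p.1 - p.2‖) (jap p.1) (jap p.2)
      (freq_nonneg _) (one_le_jap _) (one_le_jap _) (abs_jap_sub_le _ _)
    have hexp : exp (ρ * jap p.1 ^ ν) ≤
        exp (ρ * jap p.2 ^ ν) * exp (ρ * jap (p.1 - p.2) ^ ν) := by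
      refine exp_rpow_le_mul hν hν1 hρ h1.le h2.le h3.le ?_
      have := (le_abs_self _).trans (abs_jap_sub_le p.1 p.2)
      have := freq_le_jap (p.1 - p.2)
      linarith
    have hI0 : 0 ≤ interFactor ν l (l + ν) (2 * Real.pi * ‖p.1 - p.2‖) (jap p.1) (jap p.2) := by
      unfold interFactor
      have := freq_nonneg (p.1 - p.2)
      split_ifs <;> positivity
    have hpow : jap p.1 ^ (k - σ) * |sqDiff p| ≤ C₁ * (jap p.2 ^ (k + 1 - σ) *
        interFactor ν l (l + ν) (2 * Real.pi * ‖p.1 - p.2‖) (jap p.1) (jap p.2)) := by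
      have e : jap p.1 ^ (2 * k) = jap p.1 ^ (k + σ) * jap p.1 ^ (k - σ) := by
        rw [← Real.rpow_add h1]; ring_nf
      rw [e] at hpt1
      have hpos : 0 < jap p.1 ^ (k + σ) := by positivity
      refine le_of_mul_le_mul_left ?_ hpos
      calc _ = jap p.1 ^ (k + σ) * jap p.1 ^ (k - σ) * |sqDiff p| := by ring
        _ ≤ jap p.1 ^ (k + σ) * jap p.1 ^ (k - σ) *
            ((2 * Real.pi * ‖p.1 - p.2‖) * (jap p.1 + jap p.2)) := by
          gcongr; exact abs_sqDiff_le p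
        _ ≤ _ := hpt1
        _ = _ := by ring
    have hpt2 : jap p.1 ^ (k - σ) * exp (ρ * jap p.1 ^ ν) * |sqDiff p| ≤
        C₁ * ((jap p.2 ^ (k + 1 - σ) * exp (ρ * jap p.2 ^ ν)) *
          (exp (ρ * jap (p.1 - p.2) ^ ν) *
            interFactor ν l (l + ν) (2 * Real.pi * ‖p.1 - p.2‖) (jap p.1) (jap p.2))) := by
      calc _ = (jap p.1 ^ (k - σ) * |sqDiff p|) * exp (ρ * jap p.1 ^ ν) := by ring
        _ ≤ _ := mul_le_mul hpow hexp (Real.exp_pos _).le (by positivity)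
        _ = _ := by ring
    calc _ ≤ P p.1 * (ofReal (C₁ * ((jap p.2 ^ (k + 1 - σ) * exp (ρ * jap p.2 ^ ν)) *
          (exp (ρ * jap (p.1 - p.2) ^ ν) *
            interFactor ν l (l + ν) (2 * Real.pi * ‖p.1 - p.2‖) (jap p.1) (jap p.2)))) *
            ‖g (p.1 - p.2)‖ₑ * ‖v p.2‖ₑ) := by gcongr
      _ = _ := by
        rw [ENNReal.ofReal_mul hC₁0, ENNReal.ofReal_mul (by positivity), hQ]
        ring
  refine (lintegral_mono hpt).trans ?_
  rw [lintegral_const_mul' _ _ ENNReal.ofReal_ne_top]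
  calc _ ≤ ofReal C₁ * (C₂ * yNorm ν ρ l lLow g * (n2 P * n2 Q)) := by gcongr
    _ = _ := by
      rw [ENNReal.coe_mul]
      change _ = (ofReal C₁ * C₂) * yNorm ν ρ l lLow g * (n2 P * n2 Q)
      ring

/-! ### Multiplication operators -/

/-- Bounded measurable real functions. -/
def BddMeas (g : Rn n → ℝ) : Prop := Measurable g ∧ ∃ C, ∀ ξ, |g ξ| ≤ C

theorem BddMeas.memLp {g : Rn n → ℝ} (h : BddMeas g) (v : L2 n) :
    MemLp (fun ξ => (g ξ : ℂ) * v ξ) 2 volume := by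
  obtain ⟨hm, C, hC⟩ := h
  refine MemLp.of_le_mul (c := C) (Lp.memLp v)
    ((Complex.measurable_ofReal.comp hm).aestronglyMeasurable.mul
      (Lp.stronglyMeasurable v).aestronglyMeasurable) (Eventually.of_forall fun ξ => ?_)
  rw [norm_mul, Complex.norm_real, Real.norm_eq_abs]
  exact mul_le_mul_of_nonneg_right (hC ξ) (norm_nonneg _)

theorem norm_toLp_mul_le {g : Rn n → ℝ} (h : BddMeas g) {C : ℝ} (hC : ∀ ξ, |g ξ| ≤ C) (v : L2 n) :
    ‖(h.memLp v).toLp‖ ≤ C * ‖v‖ := by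
  refine Lp.norm_le_mul_norm_of_ae_le_mul ?_
  filter_upwards [(h.memLp v).coeFn_toLp] with ξ hξ
  rw [hξ, norm_mul, Complex.norm_real, Real.norm_eq_abs]
  exact mul_le_mul_of_nonneg_right (hC ξ) (norm_nonneg _)

open Classical in
/-- Multiplication by a bounded measurable real function, as an operator in `L²`. -/
def mulOp (g : Rn n → ℝ) : L2 n →L[ℂ] L2 n :=
  if h : BddMeas g then
    LinearMap.mkContinuousOfExistsBound
      { toFun := fun v => (h.memLp v).toLp
        map_add' := fun u v => by
          rw [← MemLp.toLp_add]
          refine MemLp.toLp_congr _ _ ?_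
          filter_upwards [Lp.coeFn_add u v] with ξ hξ
          simp only [Pi.add_apply, hξ]; ring
        map_smul' := fun c v => by
          rw [RingHom.id_apply, ← MemLp.toLp_const_smul]
          refine MemLp.toLp_congr _ _ ?_
          filter_upwards [Lp.coeFn_smul c v] with ξ hξ
          simp only [Pi.smul_apply, hξ, smul_eq_mul]; ring }
      (h.2.imp fun _ hC v => norm_toLp_mul_le h hC v)
  else 0

theorem coeFn_mulOp {g : Rn n → ℝ} (h : BddMeas g) (v : L2 n) :
    mulOp g v =ᵐ[volume] fun ξ => (g ξ : ℂ) * v ξ := by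
  unfold mulOp
  rw [dif_pos h]
  exact (h.memLp v).coeFn_toLp

theorem norm_mulOp_apply_le {g : Rn n → ℝ} (h : BddMeas g) {C : ℝ} (hC : ∀ ξ, |g ξ| ≤ C)
    (v : L2 n) : ‖mulOp g v‖ ≤ C * ‖v‖ := by
  unfold mulOp
  rw [dif_pos h]
  exact norm_toLp_mul_le h hC v

theorem norm_mulOp_le {g : Rn n → ℝ} (h : BddMeas g) {C : ℝ} (hC0 : 0 ≤ C) (hC : ∀ ξ, |g ξ| ≤ C) :
    ‖mulOp g‖ ≤ C :=
  ContinuousLinearMap.opNorm_le_bound _ hC0 (norm_mulOp_apply_le h hC)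

theorem enorm_eq_n2 (v : L2 n) : ‖v‖ₑ = n2 fun ξ => ‖v ξ‖ₑ := by
  rw [← eLpNorm_two_eq_n2, Lp.enorm_def]

theorem n2_congr {f g : Rn n → ℝ≥0∞} (h : f =ᵐ[volume] g) : n2 f = n2 g :=
  le_antisymm (n2_mono (h.mono fun _ hx => hx.le)) (n2_mono (h.mono fun _ hx => hx.ge))

theorem enorm_mulOp {g : Rn n → ℝ} (h : BddMeas g) (v : L2 n) :
    ‖mulOp g v‖ₑ = n2 fun ξ => ofReal |g ξ| * ‖v ξ‖ₑ := by
  rw [enorm_eq_n2]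
  refine n2_congr ?_
  filter_upwards [coeFn_mulOp h v] with ξ hξ
  rw [hξ, enorm_mul, ← ofReal_norm, Complex.norm_real, Real.norm_eq_abs]

theorem BddMeas.mul {g h : Rn n → ℝ} (hg : BddMeas g) (hh : BddMeas h) :
    BddMeas fun ξ => g ξ * h ξ := by
  obtain ⟨hgm, C, hC⟩ := hg
  obtain ⟨hhm, D, hD⟩ := hh
  refine ⟨hgm.mul hhm, C * D, fun ξ => ?_⟩
  rw [abs_mul]
  exact mul_le_mul (hC ξ) (hD ξ) (abs_nonneg _) ((abs_nonneg _).trans (hC ξ))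

theorem BddMeas.sub {g h : Rn n → ℝ} (hg : BddMeas g) (hh : BddMeas h) :
    BddMeas fun ξ => g ξ - h ξ := by
  obtain ⟨hgm, C, hC⟩ := hg
  obtain ⟨hhm, D, hD⟩ := hh
  exact ⟨hgm.sub hhm, C + D, fun ξ => (abs_sub _ _).trans (add_le_add (hC ξ) (hD ξ))⟩

theorem mulOp_mulOp {g h : Rn n → ℝ} (hg : BddMeas g) (hh : BddMeas h) (v : L2 n) :
    mulOp g (mulOp h v) = mulOp (fun ξ => g ξ * h ξ) v := by
  refine Lp.ext ?_
  filter_upwards [coeFn_mulOp hg (mulOp h v), coeFn_mulOp hh v, coeFn_mulOp (hg.mul hh) v]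
    with ξ h1 h2 h3
  rw [h1, h2, h3]; push_cast; ring

theorem mulOp_sub {g h : Rn n → ℝ} (hg : BddMeas g) (hh : BddMeas h) :
    mulOp g - mulOp h = mulOp fun ξ => g ξ - h ξ := by
  ext1 v
  refine Lp.ext ?_
  rw [sub_apply]
  filter_upwards [coeFn_mulOp hg v, coeFn_mulOp hh v, coeFn_mulOp (hg.sub hh) v,
    Lp.coeFn_sub (mulOp g v) (mulOp h v)] with ξ h1 h2 h3 h4
  rw [h4, Pi.sub_apply, h1, h2, h3]; push_cast; ring

theorem mulOp_smul {g : Rn n → ℝ} (hg : BddMeas g) (c : ℝ) :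
    mulOp (fun ξ => c * g ξ) = c • mulOp g := by
  have hcg : BddMeas fun ξ => c * g ξ := by
    obtain ⟨hm, C, hC⟩ := hg
    refine ⟨hm.const_mul c, |c| * C, fun ξ => ?_⟩
    rw [abs_mul]
    exact mul_le_mul_of_nonneg_left (hC ξ) (abs_nonneg _)
  ext1 v
  refine Lp.ext ?_
  rw [smul_apply]
  filter_upwards [coeFn_mulOp hg v, coeFn_mulOp hcg v, Lp.coeFn_smul c (mulOp g v)]
    with ξ h1 h2 h3
  rw [h3, Pi.smul_apply, h1, h2, Complex.real_smul]; push_cast; ring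

theorem inner_mulOp {g : Rn n → ℝ} (hg : BddMeas g) (u v : L2 n) :
    inner ℂ (mulOp g u) v = inner ℂ u (mulOp g v) := by
  rw [L2.inner_def, L2.inner_def]
  refine integral_congr_ae ?_
  filter_upwards [coeFn_mulOp hg u, coeFn_mulOp hg v] with ξ h1 h2
  rw [h1, h2, RCLike.inner_apply, RCLike.inner_apply]
  simp only [map_mul, Complex.conj_ofReal]
  ring

/-! ### Integral operators -/

/-- The sesquilinear form with kernel `k`. -/
def kform (k : Rn n × Rn n → ℂ) (w u : L2 n) : ℂ :=
  ∫ p : Rn n × Rn n, starRingEnd ℂ (w p.1) * (k p * u p.2) ∂(volume.prod volume)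

/-- The kernel `k` defines a bounded form in `L²` with bound `C`. -/
def KBdd (k : Rn n × Rn n → ℂ) (C : ℝ≥0) : Prop :=
  AEStronglyMeasurable k (volume.prod volume) ∧ ∀ w u : L2 n,
    ∫⁻ p : Rn n × Rn n, ‖w p.1‖ₑ * (‖k p‖ₑ * ‖u p.2‖ₑ) ∂(volume.prod volume) ≤ C * (‖w‖ₑ * ‖u‖ₑ)

theorem KBdd.of_le {k : Rn n × Rn n → ℂ} {G : Rn n → ℝ≥0∞} {C : ℝ≥0}
    (hk : AEStronglyMeasurable k (volume.prod volume)) (hG : AEMeasurable G)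
    (h : ∀ᵐ p ∂((volume : Measure (Rn n)).prod volume), ‖k p‖ₑ ≤ G (p.1 - p.2))
    (hC : ∫⁻ ζ, G ζ ≤ C) : KBdd k C := by
  refine ⟨hk, fun w u => ?_⟩
  have hw : Measurable fun ξ => ‖w ξ‖ₑ := (Lp.stronglyMeasurable w).measurable.enorm
  have hu : Measurable fun ξ => ‖u ξ‖ₑ := (Lp.stronglyMeasurable u).measurable.enorm
  calc _ ≤ ∫⁻ p : Rn n × Rn n, ‖w p.1‖ₑ * (G (p.1 - p.2) * ‖u p.2‖ₑ) ∂(volume.prod volume) := by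
        refine lintegral_mono_ae ?_
        filter_upwards [h] with p hp
        gcongr
    _ ≤ _ := lintegral_young hw hu hG
    _ ≤ _ := by rw [← enorm_eq_n2, ← enorm_eq_n2]; gcongr

theorem aesm_fst {f : Rn n → ℂ} (hf : AEStronglyMeasurable f volume) :
    AEStronglyMeasurable (fun p : Rn n × Rn n => f p.1) (volume.prod volume) :=
  hf.comp_quasiMeasurePreserving Measure.quasiMeasurePreserving_fst

theorem aesm_snd {f : Rn n → ℂ} (hf : AEStronglyMeasurable f volume) :
    AEStronglyMeasurable (fun p : Rn n × Rn n => f p.2) (volume.prod volume) :=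
  hf.comp_quasiMeasurePreserving Measure.quasiMeasurePreserving_snd

theorem KBdd.integrable {k : Rn n × Rn n → ℂ} {C : ℝ≥0} (h : KBdd k C) (w u : L2 n) :
    Integrable (fun p : Rn n × Rn n => starRingEnd ℂ (w p.1) * (k p * u p.2))
      (volume.prod volume) := by
  refine ⟨?_, ?_⟩
  · exact (Complex.continuous_conj.comp_aestronglyMeasurable
      (aesm_fst (Lp.aestronglyMeasurable w))).mul (h.1.mul (aesm_snd (Lp.aestronglyMeasurable u)))
  · rw [hasFiniteIntegral_iff_enorm]
    refine lt_of_le_of_lt (le_of_eq ?_) (lt_of_le_of_lt (h.2 w u)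
      (ENNReal.mul_lt_top ENNReal.coe_lt_top (ENNReal.mul_lt_top enorm_lt_top enorm_lt_top)))
    refine lintegral_congr fun p => ?_
    rw [enorm_mul, enorm_mul, RCLike.enorm_conj]

theorem KBdd.norm_kform_le {k : Rn n × Rn n → ℂ} {C : ℝ≥0} (h : KBdd k C) (w u : L2 n) :
    ‖kform k w u‖ ≤ C * ‖w‖ * ‖u‖ := by
  have h1 : ‖kform k w u‖ₑ ≤ C * (‖w‖ₑ * ‖u‖ₑ) := by
    refine (enorm_integral_le_lintegral_enorm _).trans (le_trans (le_of_eq ?_) (h.2 w u))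
    refine lintegral_congr fun p => ?_
    rw [enorm_mul, enorm_mul, RCLike.enorm_conj]
  have h2 : (C : ℝ≥0∞) * (‖w‖ₑ * ‖u‖ₑ) = ((C * (‖w‖₊ * ‖u‖₊) : ℝ≥0) : ℝ≥0∞) := by
    push_cast; rfl
  rw [h2, enorm_le_coe, ← NNReal.coe_le_coe] at h1
  simpa [mul_assoc] using h1

theorem KBdd.exists_op {k : Rn n × Rn n → ℂ} {C : ℝ≥0} (h : KBdd k C) :
    ∃ S : L2 n →L[ℂ] L2 n, ∀ w u, inner ℂ w (S u) = kform k w u := by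
  have addl : ∀ w w' u, kform k (w + w') u = kform k w u + kform k w' u := by
    intro w w' u
    unfold kform
    rw [← integral_add (h.integrable w u) (h.integrable w' u)]
    refine integral_congr_ae ?_
    filter_upwards [Measure.quasiMeasurePreserving_fst.ae (Lp.coeFn_add w w')] with p hp
    rw [hp, Pi.add_apply, map_add]; ring
  have addr : ∀ w u u', kform k w (u + u') = kform k w u + kform k w u' := by
    intro w u u'
    unfold kform
    rw [← integral_add (h.integrable w u) (h.integrable w u')]
    refine integral_congr_ae ?_
    filter_upwards [Measure.quasiMeasurePreserving_snd.ae (Lp.coeFn_add u u')] with p hp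
    rw [hp, Pi.add_apply]; ring
  have smull : ∀ (c : ℂ) w u, kform k (c • w) u = starRingEnd ℂ c * kform k w u := by
    intro c w u
    unfold kform
    rw [← integral_const_mul]
    refine integral_congr_ae ?_
    filter_upwards [Measure.quasiMeasurePreserving_fst.ae (Lp.coeFn_smul c w)] with p hp
    rw [hp, Pi.smul_apply, smul_eq_mul, map_mul]; ring
  have smulr : ∀ (c : ℂ) w u, kform k w (c • u) = c * kform k w u := by
    intro c w u
    unfold kform
    rw [← integral_const_mul]
    refine integral_congr_ae ?_
    filter_upwards [Measure.quasiMeasurePreserving_snd.ae (Lp.coeFn_smul c u)] with p hp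
    rw [hp, Pi.smul_apply, smul_eq_mul]; ring
  let B : L2 n →L⋆[ℂ] L2 n →L[ℂ] ℂ := LinearMap.mkContinuous₂
    (LinearMap.mk₂'ₛₗ (starRingEnd ℂ) (RingHom.id ℂ) (fun w u => kform k w u)
      addl (fun c w u => by rw [smull, smul_eq_mul]) addr
      (fun c w u => by rw [smulr, RingHom.id_apply, smul_eq_mul])) C
    (fun w u => h.norm_kform_le w u)
  refine ⟨ContinuousLinearMap.adjoint (InnerProductSpace.continuousLinearMapOfBilin B), ?_⟩
  intro w u
  rw [ContinuousLinearMap.adjoint_inner_right,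
    InnerProductSpace.continuousLinearMapOfBilin_apply]
  rfl

open Classical in
/-- The operator in `L²` with kernel `k`. -/
def kOp (k : Rn n × Rn n → ℂ) : L2 n →L[ℂ] L2 n :=
  if h : ∃ C, KBdd k C then h.choose_spec.exists_op.choose else 0

theorem inner_kOp {k : Rn n × Rn n → ℂ} {C : ℝ≥0} (h : KBdd k C) (w u : L2 n) :
    inner ℂ w (kOp k u) = kform k w u := by
  have h' : ∃ C, KBdd k C := ⟨C, h⟩
  unfold kOp
  rw [dif_pos h']
  exact h'.choose_spec.exists_op.choose_spec w u

theorem norm_le_of_inner_le {S : L2 n →L[ℂ] L2 n} {C : ℝ≥0}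
    (h : ∀ w u, ‖inner ℂ w (S u)‖ ≤ C * ‖w‖ * ‖u‖) : ‖S‖ ≤ C := by
  refine ContinuousLinearMap.opNorm_le_bound _ C.2 fun u => ?_
  have := h (S u) u
  rw [inner_self_eq_norm_sq_to_K, norm_pow] at this
  simp only [Complex.coe_algebraMap, Complex.norm_real, norm_norm] at this
  rcases eq_or_ne (‖S u‖) 0 with h0 | h0
  · rw [h0]; positivity
  · have hpos : 0 < ‖S u‖ := lt_of_le_of_ne (norm_nonneg _) (Ne.symm h0)
    nlinarith

theorem norm_kOp_sub_le {k k' : Rn n × Rn n → ℂ} {C D E : ℝ≥0} (h : KBdd k C) (h' : KBdd k' D)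
    (hd : KBdd (k - k') E) : ‖kOp k - kOp k'‖ ≤ E := by
  refine norm_le_of_inner_le fun w u => ?_
  rw [sub_apply, inner_sub_right, inner_kOp h, inner_kOp h']
  refine le_trans (le_of_eq ?_) (hd.norm_kform_le w u)
  congr 1
  unfold kform
  rw [← integral_sub (h.integrable w u) (h'.integrable w u)]
  refine integral_congr_ae (Eventually.of_forall fun p => ?_)
  simp only [Pi.sub_apply]; ring

/-- Antihermitian kernels. -/
def AntiHerm (k : Rn n × Rn n → ℂ) : Prop :=
  ∀ᵐ p ∂((volume : Measure (Rn n)).prod volume), starRingEnd ℂ (k p.swap) = -k p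

theorem integral_swap_conj (F : Rn n × Rn n → ℂ) :
    starRingEnd ℂ (∫ p, F p ∂((volume : Measure (Rn n)).prod volume)) =
      ∫ p, starRingEnd ℂ (F p.swap) ∂((volume : Measure (Rn n)).prod volume) := by
  rw [← integral_conj, ← integral_prod_swap]

/-- The real part of a weighted antihermitian form is a commutator. -/
theorem ofReal_abs_re_form_le {k : Rn n × Rn n → ℂ} (hk : AntiHerm k) {M : Rn n → ℝ}
    {v : Rn n → ℂ} (hint : Integrable (fun p : Rn n × Rn n => starRingEnd ℂ (v p.1) *
      (k p * ((M p.2 : ℂ) * v p.2))) (volume.prod volume)) :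
    ofReal |2 * (∫ p : Rn n × Rn n, starRingEnd ℂ (v p.1) *
      (k p * ((M p.2 : ℂ) * v p.2)) ∂(volume.prod volume)).re| ≤
      ∫⁻ p : Rn n × Rn n, ‖v p.1‖ₑ * (ofReal |M p.1 - M p.2| * ‖k p‖ₑ * ‖v p.2‖ₑ)
        ∂(volume.prod volume) := by
  set F : Rn n × Rn n → ℂ := fun p => starRingEnd ℂ (v p.1) * (k p * ((M p.2 : ℂ) * v p.2))
    with hF
  set I := ∫ p, F p ∂((volume : Measure (Rn n)).prod volume) with hI
  have hsw : Integrable (fun p => starRingEnd ℂ (F p.swap)) (volume.prod volume) :=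
    (Complex.conjCLE : ℂ →L[ℝ] ℂ).integrable_comp hint.swap
  have h1 : ((2 * I.re : ℝ) : ℂ) = ∫ p, (F p + starRingEnd ℂ (F p.swap))
      ∂((volume : Measure (Rn n)).prod volume) := by
    rw [integral_add hint hsw, ← integral_swap_conj, ← hI, Complex.add_conj]
  have h2 : ofReal |2 * I.re| = ‖((2 * I.re : ℝ) : ℂ)‖ₑ := by
    rw [← ofReal_norm, Complex.norm_real, Real.norm_eq_abs]
  rw [h2, h1]
  refine (enorm_integral_le_lintegral_enorm _).trans (lintegral_mono_ae ?_)
  filter_upwards [hk] with p hp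
  have e : F p + starRingEnd ℂ (F p.swap) =
      starRingEnd ℂ (v p.1) * (((M p.2 - M p.1 : ℝ) : ℂ) * k p * v p.2) := by
    have e2 : starRingEnd ℂ (F p.swap) = v p.2 * (-k p * ((M p.1 : ℂ) * starRingEnd ℂ (v p.1))) := by
      simp only [hF, map_mul, Prod.fst_swap, Prod.snd_swap, Complex.conj_conj, Complex.conj_ofReal]
      rw [hp]
    rw [e2]
    simp only [hF]
    push_cast; ring
  rw [e, enorm_mul, enorm_mul, enorm_mul, RCLike.enorm_conj, ← ofReal_norm (((_ : ℝ) : ℂ)),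
    Complex.norm_real, Real.norm_eq_abs, abs_sub_comm]

/-! ### The radius -/

theorem gevreyRadius_eq {γ : ℝ} {r : ℝ → ℝ} (hr : IsGevreyRate γ r) (ρinf : ℝ) {t : ℝ}
    (ht : 1 ≤ t) : gevreyRadius r ρinf t = (ρinf - ∫ s in Ioi 1, r s) + ∫ s in (1 : ℝ)..t, r s := by
  have hint : IntegrableOn r (Ioi 1) := hr.integrableOn.mono_set Ioi_subset_Ici_self
  have h := setIntegral_union (s := Ioc 1 t) (t := Ioi t) (f := r) (μ := volume)
    (Set.disjoint_left.2 fun x hx hx' => not_lt.2 hx.2 hx') measurableSet_Ioi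
    (hint.mono_set Ioc_subset_Ioi_self) (hint.mono_set (Ioi_subset_Ioi ht))
  rw [Ioc_union_Ioi_eq_Ioi ht] at h
  rw [gevreyRadius, intervalIntegral.integral_of_le ht, h]
  ring

theorem intervalIntegrable_rate {γ : ℝ} {r : ℝ → ℝ} (hr : IsGevreyRate γ r) {t : ℝ}
    (ht : 1 ≤ t) : IntervalIntegrable r volume 1 t :=
  (intervalIntegrable_iff_integrableOn_Icc_of_le ht).2 (hr.integrableOn.mono_set Icc_subset_Ici_self)

theorem hasDerivAt_gevreyRadius {γ : ℝ} {r : ℝ → ℝ} (hr : IsGevreyRate γ r) (ρinf : ℝ) {t : ℝ}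
    (ht : 1 < t) : HasDerivAt (gevreyRadius r ρinf) (r t) t := by
  have hc : ContinuousOn r (Ioi 1) := hr.contDiffOn.continuousOn.mono Ioi_subset_Ici_self
  have h1 : HasDerivAt (fun u => ∫ s in (1 : ℝ)..u, r s) (r t) t :=
    intervalIntegral.integral_hasDerivAt_right (intervalIntegrable_rate hr ht.le)
      (hc.stronglyMeasurableAtFilter isOpen_Ioi t ht) (hc.continuousAt (Ioi_mem_nhds ht))
  refine (h1.const_add (ρinf - ∫ s in Ioi 1, r s)).congr_of_eventuallyEq ?_
  filter_upwards [Ioi_mem_nhds ht] with u hu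
  exact gevreyRadius_eq hr ρinf (le_of_lt hu)

theorem continuousOn_gevreyRadius {γ : ℝ} {r : ℝ → ℝ} (hr : IsGevreyRate γ r) (ρinf : ℝ) :
    ContinuousOn (gevreyRadius r ρinf) (Ici 1) := by
  intro t ht
  rcases eq_or_lt_of_le (mem_Ici.1 ht) with rfl | h
  · have h2 : ContinuousOn (fun u => ∫ s in (1 : ℝ)..u, r s) (uIcc 1 2) :=
      intervalIntegral.continuousOn_primitive_interval (by
        rw [uIcc_of_le (by norm_num)]
        exact hr.integrableOn.mono_set Icc_subset_Ici_self)
    rw [uIcc_of_le (by norm_num)] at h2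
    have h3 : ContinuousWithinAt (fun u => (ρinf - ∫ s in Ioi 1, r s) + ∫ s in (1 : ℝ)..u, r s)
        (Icc 1 2) 1 := (h2 1 ⟨le_rfl, by norm_num⟩).const_add _
    have h4 : ContinuousWithinAt (gevreyRadius r ρinf) (Icc 1 2) 1 :=
      h3.congr (fun y hy => gevreyRadius_eq hr ρinf hy.1) (gevreyRadius_eq hr ρinf le_rfl)
    exact h4.mono_of_mem_nhdsWithin (Icc_mem_nhdsGE (by norm_num))
  · exact (hasDerivAt_gevreyRadius hr ρinf h).continuousAt.continuousWithinAt

/-- The data of the linear transport problem. -/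
structure PhaseSetup (ν l lLow : ℝ) (r ρ : ℝ → ℝ) (T : ℝ) (h₀ h₁ : ℝ → ℝ)
    (φ : ℝ → Rn n → ℝ) (φhat : ℝ → Rn n → ℂ) (b : ℝ≥0) : Prop where
  hn : 1 ≤ n
  hν : 0 < ν
  hν1 : ν ≤ 1
  hδ : (n : ℝ) / 2 < l + ν
  hLow : lLow < (n : ℝ) / 2
  hT : 1 ≤ T
  rpos : ∀ t, T ≤ t → 0 < r t
  rcont : ContinuousOn r (Ici T)
  ρ_nonneg : ∀ t, T ≤ t → 0 ≤ ρ t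
  ρcont : ContinuousOn ρ (Ici T)
  ρderiv : ∀ t, T < t → HasDerivAt ρ (r t) t
  h₀pos : ∀ t, T ≤ t → 0 < h₀ t
  h₀cont : ContinuousOn h₀ (Ici T)
  h₁pos : ∀ t, T ≤ t → 0 < h₁ t
  h₁cont : ContinuousOn h₁ (Ici T)
  h₁diff : ∀ t, T < t → DifferentiableAt ℝ h₁ t
  h₁anti : AntitoneOn h₁ (Ici T)
  couple : ∀ t, T ≤ t → (t ^ 2)⁻¹ * h₀ t ≤ r t * h₁ t
  phase : MemYPhase ν ρ l lLow (Ici T) h₀ φ φhat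
  bound : ∀ t, T ≤ t → yNorm ν (ρ t) l lLow (φhat t) ≤ b * ofReal (h₀ t)

variable {ν l lLow : ℝ} {r ρ : ℝ → ℝ} {T : ℝ} {h₀ h₁ : ℝ → ℝ} {φ : ℝ → Rn n → ℝ}
  {φhat : ℝ → Rn n → ℂ} {b : ℝ≥0}

local notation "Phase" => PhaseSetup ν l lLow r ρ T h₀ h₁ φ φhat b

namespace PhaseSetup

theorem strictMonoOn (S : Phase) : StrictMonoOn ρ (Ici T) := by
  refine strictMonoOn_of_deriv_pos (convex_Ici T) S.ρcont fun t ht => ?_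
  rw [interior_Ici] at ht
  rw [(S.ρderiv t ht).deriv]
  exact S.rpos t (le_of_lt ht)

theorem ρ_pos (S : Phase) {t : ℝ} (ht : T < t) : 0 < ρ t :=
  (S.ρ_nonneg T le_rfl).trans_lt (S.strictMonoOn self_mem_Ici (mem_Ici.2 ht.le) ht)

theorem ρ_mono (S : Phase) {s t : ℝ} (hs : T ≤ s)
    (hst : s ≤ t) : ρ s ≤ ρ t :=
  S.strictMonoOn.monotoneOn (mem_Ici.2 hs) (mem_Ici.2 (hs.trans hst)) hst

theorem aesm (S : Phase) {t : ℝ} (ht : T ≤ t) :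
    AEStronglyMeasurable (φhat t) volume :=
  (S.phase.1 t ht).2.locallyIntegrable_right.aestronglyMeasurable

end PhaseSetup

/-! ### Continuity in time of the phase -/

theorem yNorm_mono {ν : ℝ} {ρ ρ' : ℝ} (l lLow : ℝ) (h : ρ ≤ ρ') (g : Rn n → ℂ) :
    yNorm ν ρ l lLow g ≤ yNorm ν ρ' l lLow g := by
  unfold yNorm yLift
  rw [eLpNorm_two_eq_n2, eLpNorm_two_eq_n2]
  refine n2_mono (Eventually.of_forall fun ξ => ?_)
  rw [enorm_gevreyWeight_mul, enorm_gevreyWeight_mul]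
  gcongr
  unfold gevreyWeight
  have := freq_nonneg ξ
  split_ifs <;> gcongr

theorem PhaseSetup.tendsto_yNorm (S : Phase) {ρ₀ T' t : ℝ} (hT' : T ≤ T')
    (hρ₀ : ρ₀ ≤ ρ T') (ht : T' ≤ t) :
    Tendsto (fun s => yNorm ν ρ₀ l lLow (φhat s - φhat t)) (𝓝[Ici T'] t) (𝓝 0) := by
  have hν := S.hν
  have htT : T ≤ t := hT'.trans ht
  set y : ℝ → Rn n → ℂ := fun s => yLift ν (ρ s) l lLow (((h₀ s)⁻¹ : ℂ) • φhat s) with hy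
  set e : ℝ → Rn n → ℝ := fun s ξ => h₀ s * exp (-((ρ s - ρ₀) * jap ξ ^ ν)) with he
  have hyc : Tendsto (fun s => eLpNorm (y s - y t) 2 volume) (𝓝[Ici T'] t) (𝓝 0) :=
    (S.phase.2.1 t htT).mono_left (nhdsWithin_mono _ (Ici_subset_Ici.2 hT'))
  have hρc : Tendsto ρ (𝓝[Ici T'] t) (𝓝 (ρ t)) :=
    (S.ρcont t htT).mono_left (nhdsWithin_mono _ (Ici_subset_Ici.2 hT'))
  have hh₀c : Tendsto h₀ (𝓝[Ici T'] t) (𝓝 (h₀ t)) :=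
    (S.h₀cont t htT).mono_left (nhdsWithin_mono _ (Ici_subset_Ici.2 hT'))
  have hym : ∀ s, T ≤ s → AEStronglyMeasurable (y s) volume := fun s hs =>
    (Complex.measurable_ofReal.comp
      (measurable_gevreyWeight (n := n) ν (ρ s) (l + 2) lLow)).aestronglyMeasurable.mul
        ((S.aesm hs).const_smul _)
  have hej := measurable_jap (n := n)
  have hem : ∀ s, Measurable (e s) := fun s => by simp only [he]; fun_prop
  have hebd : ∀ s, T' ≤ s → ∀ ξ, |e s ξ| ≤ h₀ s := by
    intro s hs ξ
    have h1 : 0 < h₀ s := S.h₀pos s (hT'.trans hs)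
    have h2 : 0 ≤ ρ s - ρ₀ := by
      have := S.ρ_mono hT' hs
      linarith
    have h3 := jap_pos ξ
    have h4 : exp (-((ρ s - ρ₀) * jap ξ ^ ν)) ≤ 1 :=
      Real.exp_le_one_iff.2 (neg_nonpos.2 (by positivity))
    rw [he, abs_of_nonneg (by positivity)]
    exact mul_le_of_le_one_right h1.le h4
  have hlift : ∀ s, T' ≤ s → ∀ ξ, (gevreyWeight ν ρ₀ (l + 2) lLow ξ : ℂ) * φhat s ξ =
      (e s ξ : ℂ) * y s ξ := by
    intro s hs ξ
    have h1 : h₀ s ≠ 0 := (S.h₀pos s (hT'.trans hs)).ne'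
    have h2 : gevreyWeight ν ρ₀ (l + 2) lLow ξ =
        exp (-((ρ s - ρ₀) * jap ξ ^ ν)) * gevreyWeight ν (ρ s) (l + 2) lLow ξ := by
      unfold gevreyWeight
      rw [jap_rpow ξ hν, mul_left_comm, ← Real.exp_add]
      ring_nf
    have h3 : (h₀ s : ℂ) ≠ 0 := by exact_mod_cast h1
    simp only [hy, he, yLift, Pi.smul_apply, smul_eq_mul]
    rw [h2]
    push_cast
    field_simp
  -- the first contribution
  have t1 : Tendsto (fun s => ofReal (h₀ s) * eLpNorm (y s - y t) 2 volume)
      (𝓝[Ici T'] t) (𝓝 0) := by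
    have := ENNReal.Tendsto.mul (ENNReal.tendsto_ofReal hh₀c) (Or.inr (by simp)) hyc
      (Or.inr ENNReal.ofReal_ne_top)
    simpa using this
  -- the second contribution
  have hyt : eLpNorm (y t) 2 volume < ⊤ := by
    have h1 := S.phase.2.2
    have h2 : (ofReal (h₀ t))⁻¹ * yNorm ν (ρ t) l lLow (φhat t) < ⊤ :=
      lt_of_le_of_lt (le_biSup (fun t => (ofReal (h₀ t))⁻¹ *
        yNorm ν (ρ t) l lLow (φhat t)) (mem_Ici.2 htT)) h1
    have h3 : y t = ((h₀ t)⁻¹ : ℂ) • yLift ν (ρ t) l lLow (φhat t) := by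
      ext ξ; simp only [hy, yLift, Pi.smul_apply, smul_eq_mul]; ring
    rw [h3, eLpNorm_const_smul]
    refine lt_of_le_of_lt (le_of_eq ?_) h2
    rw [yNorm]
    congr 1
    have h5 := S.h₀pos t htT
    rw [← ENNReal.ofReal_inv_of_pos h5, ← ofReal_norm, ← Complex.ofReal_inv, Complex.norm_real,
      Real.norm_of_nonneg (by positivity)]
  obtain ⟨Y, hYm, hYe⟩ : ∃ Y : Rn n → ℝ≥0∞, Measurable Y ∧ (fun ξ => ‖y t ξ‖ₑ) =ᵐ[volume] Y :=
    ⟨(hym t htT).enorm.mk _, (hym t htT).enorm.measurable_mk, (hym t htT).enorm.ae_eq_mk⟩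
  have t2' : Tendsto (fun s => n2 fun ξ => ofReal |e s ξ - e t ξ| * Y ξ)
      (𝓝[Ici T'] t) (𝓝 0) := by
    have hfin : ∫⁻ ξ, Y ξ ^ (2 : ℝ) ≠ ⊤ := by
      rw [eLpNorm_two_eq_n2, n2_congr hYe, n2, ENNReal.rpow_lt_top_iff_of_pos (by norm_num)] at hyt
      exact hyt.ne
    have key : Tendsto (fun s => ∫⁻ ξ, (ofReal |e s ξ - e t ξ| * Y ξ) ^ (2 : ℝ))
        (𝓝[Ici T'] t) (𝓝 (∫⁻ _ : Rn n, (0 : ℝ≥0∞))) := by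
      refine tendsto_lintegral_filter_of_dominated_convergence
        (fun ξ => (ofReal (2 * h₀ t + 1) * Y ξ) ^ (2 : ℝ)) ?_ ?_ ?_ ?_
      · refine Eventually.of_forall fun s => ?_
        have a2 := hem s
        have a3 := hem t
        fun_prop
      · filter_upwards [self_mem_nhdsWithin, hh₀c.eventually (Iio_mem_nhds (lt_add_one (h₀ t)))]
          with s hs hs2
        refine Eventually.of_forall fun ξ => ?_
        gcongr
        have a1 := hebd s hs ξ
        have a2 := hebd t ht ξ
        have a3 := abs_sub (e s ξ) (e t ξ)
        have : h₀ s < h₀ t + 1 := hs2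
        linarith
      · simp_rw [ENNReal.mul_rpow_of_nonneg _ _ (by norm_num : (0 : ℝ) ≤ 2)]
        rw [lintegral_const_mul' _ _ (by simp)]
        exact ENNReal.mul_ne_top (by simp) hfin
      · filter_upwards [hYe] with ξ hξ
        have hξ' : Y ξ ≠ ⊤ := by rw [← hξ]; exact enorm_ne_top
        have c1 : Tendsto (fun s => e s ξ) (𝓝[Ici T'] t) (𝓝 (e t ξ)) := by
          simp only [he]
          exact hh₀c.mul (Real.continuous_exp.continuousAt.tendsto.comp
            (((hρc.sub_const _).mul_const _).neg))
        have c2 : Tendsto (fun s => ofReal |e s ξ - e t ξ|) (𝓝[Ici T'] t) (𝓝 0) := by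
          have := (c1.sub_const (e t ξ)).abs
          rw [sub_self, abs_zero] at this
          simpa using ENNReal.tendsto_ofReal this
        have c3 : Tendsto (fun s => ofReal |e s ξ - e t ξ| * Y ξ)
            (𝓝[Ici T'] t) (𝓝 0) := by
          simpa using ENNReal.Tendsto.mul_const c2 (Or.inr hξ')
        have c4 := (ENNReal.continuous_rpow_const (y := 2)).continuousAt.tendsto.comp c3
        simpa [Function.comp_def] using c4
    have k2 := (ENNReal.continuous_rpow_const (y := 1 / 2)).continuousAt.tendsto.comp key
    simpa [n2, Function.comp_def] using k2
  have t2 : Tendsto (fun s => n2 fun ξ => ofReal |e s ξ - e t ξ| * ‖y t ξ‖ₑ)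
      (𝓝[Ici T'] t) (𝓝 0) := by
    refine t2'.congr fun s => n2_congr ?_
    filter_upwards [hYe] with ξ hξ
    rw [hξ]
  have t3 := t1.add t2
  rw [add_zero] at t3
  refine tendsto_of_tendsto_of_tendsto_of_le_of_le' tendsto_const_nhds t3
    (Eventually.of_forall fun _ => zero_le) ?_
  filter_upwards [self_mem_nhdsWithin] with s hs
  have hsT : T ≤ s := hT'.trans hs
  have hdec : yLift ν ρ₀ l lLow (φhat s - φhat t) =
      (fun ξ => (e s ξ : ℂ) * (y s - y t) ξ) + fun ξ => ((e s ξ - e t ξ : ℝ) : ℂ) * y t ξ := by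
    ext ξ
    simp only [yLift, Pi.add_apply, Pi.sub_apply]
    rw [mul_sub, hlift s hs, hlift t ht]
    push_cast; ring
  have m1 : AEStronglyMeasurable (fun ξ => (e s ξ : ℂ) * (y s - y t) ξ) volume :=
    (Complex.measurable_ofReal.comp (hem s)).aestronglyMeasurable.mul ((hym s hsT).sub (hym t htT))
  have m2 : AEStronglyMeasurable (fun ξ => ((e s ξ - e t ξ : ℝ) : ℂ) * y t ξ) volume :=
    (Complex.measurable_ofReal.comp ((hem s).sub (hem t))).aestronglyMeasurable.mul (hym t htT)
  rw [yNorm, hdec]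
  refine (eLpNorm_add_le m1 m2 (by norm_num)).trans (add_le_add ?_ ?_)
  · refine (eLpNorm_le_mul_eLpNorm_of_ae_le_mul (g := y s - y t) (c := h₀ s)
      (Eventually.of_forall fun ξ => ?_) 2)
    rw [norm_mul, Complex.norm_real, Real.norm_eq_abs]
    exact mul_le_mul_of_nonneg_right (hebd s hs ξ) (norm_nonneg _)
  · rw [eLpNorm_two_eq_n2]
    refine le_of_eq (congrArg n2 (funext fun ξ => ?_))
    rw [enorm_mul, ← ofReal_norm ((_ : ℝ) : ℂ), Complex.norm_real, Real.norm_eq_abs]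

/-! ### Kernels of the transport operator -/

/-- The kernel of `2∇φ·∇ + Δφ` in Fourier space, where `g` is the Fourier transform of `φ`. -/
def aKer (g : Rn n → ℂ) (p : Rn n × Rn n) : ℂ := -(sqDiff p : ℂ) * g (p.1 - p.2)

/-- The sharp low-frequency cut-off. -/
def lowCut (N : ℝ) (ξ : Rn n) : ℝ := if jap ξ ≤ N then 1 else 0

theorem measurable_lowCut (N : ℝ) : Measurable (lowCut N : Rn n → ℝ) :=
  Measurable.ite (measurableSet_le measurable_jap measurable_const) measurable_const
    measurable_const

theorem lowCut_nonneg (N : ℝ) (ξ : Rn n) : 0 ≤ lowCut N ξ := by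
  unfold lowCut; split_ifs <;> norm_num

theorem lowCut_le_one (N : ℝ) (ξ : Rn n) : lowCut N ξ ≤ 1 := by
  unfold lowCut; split_ifs <;> norm_num

theorem bddMeas_lowCut (N : ℝ) : BddMeas (lowCut N : Rn n → ℝ) :=
  ⟨measurable_lowCut N, 1, fun ξ => by
    rw [abs_of_nonneg (lowCut_nonneg N ξ)]; exact lowCut_le_one N ξ⟩

/-- The truncated kernel. -/
def kerN (N : ℝ) (g : Rn n → ℂ) (p : Rn n × Rn n) : ℂ :=
  ((lowCut N p.1 * lowCut N p.2 : ℝ) : ℂ) * aKer g p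

/-- `1 + |η|²`. -/
def japSq (ξ : Rn n) : ℝ := 1 + (2 * Real.pi * ‖ξ‖) ^ 2

/-- The kernel composed with `(1 + |η|²)⁻¹` on the right. -/
def kerJ (g : Rn n → ℂ) (p : Rn n × Rn n) : ℂ := aKer g p * (((japSq p.2)⁻¹ : ℝ) : ℂ)

theorem aesm_comp_sub {g : Rn n → ℂ} (hg : AEStronglyMeasurable g volume) :
    AEStronglyMeasurable (fun p : Rn n × Rn n => g (p.1 - p.2)) (volume.prod volume) :=
  hg.comp_quasiMeasurePreserving
    (quasiMeasurePreserving_sub_of_right_invariant (volume : Measure (Rn n)) volume)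

theorem aesm_aKer {g : Rn n → ℂ} (hg : AEStronglyMeasurable g volume) :
    AEStronglyMeasurable (aKer g) (volume.prod volume) := by
  have h : Continuous fun p : Rn n × Rn n => -(sqDiff p : ℂ) := by
    have := continuous_sqDiff (n := n)
    fun_prop
  exact h.aestronglyMeasurable.mul (aesm_comp_sub hg)

theorem aesm_kerN (N : ℝ) {g : Rn n → ℂ} (hg : AEStronglyMeasurable g volume) :
    AEStronglyMeasurable (kerN N g) (volume.prod volume) := by
  have h : Measurable fun p : Rn n × Rn n => ((lowCut N p.1 * lowCut N p.2 : ℝ) : ℂ) :=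
    Complex.measurable_ofReal.comp (((measurable_lowCut N).comp measurable_fst).mul
      ((measurable_lowCut N).comp measurable_snd))
  exact h.aestronglyMeasurable.mul (aesm_aKer hg)

theorem continuous_japSq : Continuous (japSq : Rn n → ℝ) := by
  unfold japSq; fun_prop

theorem one_le_japSq (ξ : Rn n) : 1 ≤ japSq ξ := by
  unfold japSq
  nlinarith [sq_nonneg (2 * Real.pi * ‖ξ‖)]

theorem aesm_kerJ {g : Rn n → ℂ} (hg : AEStronglyMeasurable g volume) :
    AEStronglyMeasurable (kerJ g) (volume.prod volume) := by
  have h : Continuous fun p : Rn n × Rn n => (((japSq p.2)⁻¹ : ℝ) : ℂ) := by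
    refine Complex.continuous_ofReal.comp ((continuous_japSq.comp continuous_snd).inv₀ fun p => ?_)
    have := one_le_japSq p.2
    simp only [Function.comp_apply]
    linarith
  exact (aesm_aKer hg).mul h.aestronglyMeasurable

theorem norm_aKer (g : Rn n → ℂ) (p : Rn n × Rn n) :
    ‖aKer g p‖ = |sqDiff p| * ‖g (p.1 - p.2)‖ := by
  unfold aKer
  rw [norm_mul, norm_neg, Complex.norm_real, Real.norm_eq_abs]

theorem enorm_aKer (g : Rn n → ℂ) (p : Rn n × Rn n) :
    ‖aKer g p‖ₑ = ofReal |sqDiff p| * ‖g (p.1 - p.2)‖ₑ := by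
  rw [← ofReal_norm, norm_aKer, ENNReal.ofReal_mul (abs_nonneg _), ofReal_norm]

theorem norm_kerN_le (N : ℝ) (hN : 0 ≤ N) (g : Rn n → ℂ) (p : Rn n × Rn n) :
    ‖kerN N g p‖ ≤ 2 * N * jap (p.1 - p.2) * ‖g (p.1 - p.2)‖ := by
  unfold kerN
  rw [norm_mul, norm_aKer, Complex.norm_real, Real.norm_eq_abs, ← mul_assoc]
  have hj := jap_pos (p.1 - p.2)
  refine mul_le_mul_of_nonneg_right ?_ (norm_nonneg _)
  unfold lowCut
  split_ifs with h1 h2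
  · have a1 := abs_sqDiff_le p
    have a2 := freq_le_jap (p.1 - p.2)
    have a3 : 0 ≤ jap p.1 + jap p.2 := (add_pos (jap_pos _) (jap_pos _)).le
    calc |(1 : ℝ) * 1| * |sqDiff p| = |sqDiff p| := by simp
      _ ≤ _ := a1
      _ ≤ jap (p.1 - p.2) * (N + N) := by gcongr
      _ = _ := by ring
  all_goals (simp; positivity)

theorem norm_kerJ_le (g : Rn n → ℂ) (p : Rn n × Rn n) :
    ‖kerJ g p‖ ≤ 3 * jap (p.1 - p.2) ^ (2 : ℝ) * ‖g (p.1 - p.2)‖ := by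
  unfold kerJ
  have hJ := one_le_japSq p.2
  rw [norm_mul, norm_aKer, Complex.norm_real, Real.norm_of_nonneg (by positivity),
    mul_right_comm]
  refine mul_le_mul_of_nonneg_right ?_ (norm_nonneg _)
  rw [← div_eq_mul_inv, div_le_iff₀ (by linarith)]
  have a1 := abs_sqDiff_le p
  have a2 := freq_le_jap (p.1 - p.2)
  have a3 := (le_abs_self _).trans (abs_jap_sub_le p.1 p.2)
  have a4 := one_le_jap (p.1 - p.2)
  have a5 := freq_nonneg (p.1 - p.2)
  have a6 : jap p.2 ≤ japSq p.2 := by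
    unfold jap japSq
    refine max_le ?_ ?_ <;> nlinarith [sq_nonneg (2 * Real.pi * ‖p.2‖ - 1),
      sq_nonneg (2 * Real.pi * ‖p.2‖)]
  have a7 := one_le_jap p.2
  set x := 2 * Real.pi * ‖p.1 - p.2‖
  set Z := jap (p.1 - p.2)
  have b1 : jap p.1 + jap p.2 ≤ 3 * Z * japSq p.2 := by nlinarith
  rw [show (2 : ℝ) = ((2 : ℕ) : ℝ) by norm_num, Real.rpow_natCast]
  calc |sqDiff p| ≤ x * (jap p.1 + jap p.2) := a1
    _ ≤ Z * (3 * Z * japSq p.2) := by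
      have := jap_pos p.1
      gcongr
    _ = _ := by ring

theorem kerN_sub (N : ℝ) (g g' : Rn n → ℂ) : kerN N g - kerN N g' = kerN N (g - g') := by
  ext p; simp only [kerN, aKer, Pi.sub_apply]; ring

theorem kerJ_sub (g g' : Rn n → ℂ) : kerJ g - kerJ g' = kerJ (g - g') := by
  ext p; simp only [kerJ, aKer, Pi.sub_apply]; ring

theorem KBdd_of_norm_le {k : Rn n × Rn n → ℂ} {g : Rn n → ℂ} {m A : ℝ} {C : ℝ≥0} (hA : 0 ≤ A)
    (hk : AEStronglyMeasurable k (volume.prod volume)) (hg : AEStronglyMeasurable g volume)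
    (h : ∀ p, ‖k p‖ ≤ A * jap (p.1 - p.2) ^ m * ‖g (p.1 - p.2)‖)
    (hC : ofReal A * ∫⁻ ζ, ofReal (jap ζ ^ m) * ‖g ζ‖ₑ ≤ C) : KBdd k C := by
  have hj := measurable_jap (n := n)
  refine KBdd.of_le (G := fun ζ => ofReal A * (ofReal (jap ζ ^ m) * ‖g ζ‖ₑ)) hk ?_
    (Eventually.of_forall fun p => ?_) ?_
  · have := hg.enorm
    fun_prop
  · rw [← ofReal_norm]
    refine (ENNReal.ofReal_le_ofReal (h p)).trans (le_of_eq ?_)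
    have := jap_pos (p.1 - p.2)
    rw [ENNReal.ofReal_mul (by positivity), ENNReal.ofReal_mul hA, ofReal_norm, mul_assoc]
  · rwa [lintegral_const_mul' _ _ ENNReal.ofReal_ne_top]

/-- Powers are dominated by Gevrey weights. -/
theorem exists_jap_rpow_le {ν ρ₀ : ℝ} (hν : 0 < ν) (hρ₀ : 0 < ρ₀) (m : ℝ) :
    ∃ K : ℝ, 0 ≤ K ∧ ∀ ξ : Rn n,
      jap ξ ^ m ≤ K * (jap ξ ^ (2 - ν) * exp (ρ₀ * jap ξ ^ ν)) := by
  obtain ⟨j, hj⟩ := exists_nat_ge ((m - (2 - ν)) / ν)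
  refine ⟨j.factorial / ρ₀ ^ j, by positivity, fun ξ => ?_⟩
  have h0 := jap_pos ξ
  have h1 := one_le_jap ξ
  have e1 : jap ξ ^ m = jap ξ ^ (2 - ν) * jap ξ ^ (m - (2 - ν)) := by
    rw [← Real.rpow_add h0]; ring_nf
  have e2 : jap ξ ^ (m - (2 - ν)) ≤ (jap ξ ^ ν) ^ j := by
    rw [← Real.rpow_natCast, ← Real.rpow_mul h0.le]
    refine Real.rpow_le_rpow_of_exponent_le h1 ?_
    rw [div_le_iff₀ hν] at hj
    linarith
  have e3 := Real.pow_div_factorial_le_exp (ρ₀ * jap ξ ^ ν) (by positivity) j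
  rw [mul_pow, div_le_iff₀ (by positivity)] at e3
  have e4 : (jap ξ ^ ν) ^ j ≤ j.factorial / ρ₀ ^ j * exp (ρ₀ * jap ξ ^ ν) := by
    rw [div_mul_eq_mul_div, le_div_iff₀ (by positivity)]
    linarith
  rw [e1]
  calc _ ≤ jap ξ ^ (2 - ν) * (j.factorial / ρ₀ ^ j * exp (ρ₀ * jap ξ ^ ν)) := by
        gcongr; exact e2.trans e4
    _ = _ := by ring

/-! ### Operator norm continuity of the transport operators -/

theorem lintegral_jap_rpow_le (hn : 1 ≤ n) {ν l lLow : ℝ} (hν : 0 < ν)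
    (hδ : (n : ℝ) / 2 < l + ν) (hl : lLow < (n : ℝ) / 2) {m ρ₀ K : ℝ} (hK0 : 0 ≤ K)
    (hK : ∀ ξ : Rn n, jap ξ ^ m ≤ K * (jap ξ ^ (2 - ν) * exp (ρ₀ * jap ξ ^ ν))) :
    ∃ C : ℝ≥0, ∀ g : Rn n → ℂ, AEStronglyMeasurable g volume →
      ∫⁻ ξ, ofReal (jap ξ ^ m) * ‖g ξ‖ₑ ≤ C * yNorm ν ρ₀ l lLow g := by
  obtain ⟨C, hC⟩ := lintegral_japPow_mul_le hn hν hδ hl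
  refine ⟨K.toNNReal * C, fun g hg => ?_⟩
  calc ∫⁻ ξ, ofReal (jap ξ ^ m) * ‖g ξ‖ₑ
      ≤ ∫⁻ ξ, ofReal K *
        (ofReal (jap ξ ^ (2 - ν) * exp (ρ₀ * jap ξ ^ ν)) * ‖g ξ‖ₑ) := by
        refine lintegral_mono fun ξ => ?_
        rw [← mul_assoc, ← ENNReal.ofReal_mul hK0]
        exact mul_le_mul' (ENNReal.ofReal_le_ofReal (hK ξ)) le_rfl
    _ = ofReal K * ∫⁻ ξ,
        ofReal (jap ξ ^ (2 - ν) * exp (ρ₀ * jap ξ ^ ν)) * ‖g ξ‖ₑ :=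
        lintegral_const_mul' _ _ ENNReal.ofReal_ne_top
    _ ≤ ofReal K * (C * yNorm ν ρ₀ l lLow g) := by gcongr; exact hC ρ₀ g hg
    _ = _ := by rw [ENNReal.coe_mul, ← mul_assoc]; rfl

namespace PhaseSetup

theorem yNorm_lt_top (S : Phase) {t ρ₀ : ℝ} (ht : T ≤ t)
    (hρ₀ : ρ₀ ≤ ρ t) : yNorm ν ρ₀ l lLow (φhat t) < ⊤ :=
  ((yNorm_mono l lLow hρ₀ _).trans (S.bound t ht)).trans_lt
    (ENNReal.mul_lt_top ENNReal.coe_lt_top ENNReal.ofReal_lt_top)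

theorem lintegral_jap_rpow_lt_top (S : Phase) {t : ℝ}
    (ht : T < t) (m : ℝ) : ∫⁻ ξ, ofReal (jap ξ ^ m) * ‖φhat t ξ‖ₑ < ⊤ := by
  obtain ⟨K, hK0, hK⟩ := exists_jap_rpow_le (n := n) S.hν (S.ρ_pos ht) m
  obtain ⟨C, hC⟩ := lintegral_jap_rpow_le S.hn S.hν S.hδ S.hLow hK0 hK
  exact (hC _ (S.aesm ht.le)).trans_lt
    (ENNReal.mul_lt_top ENNReal.coe_lt_top (S.yNorm_lt_top ht.le le_rfl))

theorem integrable_φhat (S : Phase) {t : ℝ} (ht : T ≤ t) :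
    Integrable (φhat t) := by
  obtain ⟨C, hC⟩ := lintegral_jap_rpow_le (n := n) S.hn S.hν S.hδ S.hLow (m := 0) (ρ₀ := 0)
    zero_le_one (fun ξ => by
      have := Real.one_le_rpow (one_le_jap ξ) (by linarith [S.hν1] : 0 ≤ 2 - ν)
      simpa using this)
  refine ⟨S.aesm ht, ?_⟩
  rw [hasFiniteIntegral_iff_enorm]
  have := hC _ (S.aesm ht)
  simp only [Real.rpow_zero, ENNReal.ofReal_one, one_mul] at this
  exact this.trans_lt
    (ENNReal.mul_lt_top ENNReal.coe_lt_top (S.yNorm_lt_top ht (S.ρ_nonneg t ht)))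

/-- A linear family of kernels controlled by the norm of the phase depends continuously on time. -/
theorem continuousOn_kOp (S : Phase)
    {k : (Rn n → ℂ) → Rn n × Rn n → ℂ} (hsub : ∀ g g', k g - k g' = k (g - g')) {ρ₀ T' : ℝ}
    (hT' : T ≤ T') (hρ₀ : ρ₀ ≤ ρ T') {K : ℝ≥0}
    (hK : ∀ g, AEStronglyMeasurable g volume → ∀ C : ℝ≥0, K * yNorm ν ρ₀ l lLow g ≤ C →
      KBdd (k g) C) :
    ContinuousOn (fun t => kOp (k (φhat t))) (Ici T') := by
  intro t ht
  have ht' : T' ≤ t := ht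
  have hlim := S.tendsto_yNorm hT' hρ₀ ht'
  have hbd : ∀ s, T' ≤ s → ∃ C, KBdd (k (φhat s)) C := by
    intro s hs
    have hfin : K * yNorm ν ρ₀ l lLow (φhat s) < ⊤ := ENNReal.mul_lt_top ENNReal.coe_lt_top
      (S.yNorm_lt_top (hT'.trans hs) (hρ₀.trans (S.ρ_mono hT' hs)))
    exact ⟨(K * yNorm ν ρ₀ l lLow (φhat s)).toNNReal, hK _ (S.aesm (hT'.trans hs)) _
      (ENNReal.coe_toNNReal hfin.ne).ge⟩
  rw [ContinuousWithinAt, tendsto_iff_norm_sub_tendsto_zero]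
  have hlim2 : Tendsto (fun s => (K * yNorm ν ρ₀ l lLow (φhat s - φhat t)).toReal)
      (𝓝[Ici T'] t) (𝓝 0) := by
    have h1 : Tendsto (fun s => (K : ℝ≥0∞) * yNorm ν ρ₀ l lLow (φhat s - φhat t))
        (𝓝[Ici T'] t) (𝓝 0) := by
      simpa using ENNReal.Tendsto.const_mul hlim (Or.inr ENNReal.coe_ne_top)
    have h2 := (ENNReal.tendsto_toReal ENNReal.zero_ne_top).comp h1
    rw [ENNReal.toReal_zero] at h2
    exact h2
  refine squeeze_zero' (Eventually.of_forall fun _ => norm_nonneg _) ?_ hlim2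
  filter_upwards [self_mem_nhdsWithin, hlim.eventually (gt_mem_nhds zero_lt_one)] with s hs hs2
  obtain ⟨C, hC⟩ := hbd s hs
  obtain ⟨D, hD⟩ := hbd t ht'
  have hfin : K * yNorm ν ρ₀ l lLow (φhat s - φhat t) < ⊤ :=
    ENNReal.mul_lt_top ENNReal.coe_lt_top (hs2.trans ENNReal.one_lt_top)
  have hE : KBdd (k (φhat s) - k (φhat t))
      (K * yNorm ν ρ₀ l lLow (φhat s - φhat t)).toNNReal := by
    rw [hsub]
    exact hK _ ((S.aesm (hT'.trans hs)).sub (S.aesm (hT'.trans ht'))) _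
      (ENNReal.coe_toNNReal hfin.ne).ge
  exact norm_kOp_sub_le hC hD hE

theorem exists_KBdd_kerN (hn : 1 ≤ n) (hν : 0 < ν) (hν1 : ν ≤ 1)
    (hδ : (n : ℝ) / 2 < l + ν) (hl : lLow < (n : ℝ) / 2) {N : ℝ} (hN : 0 ≤ N) :
    ∃ K : ℝ≥0, ∀ g : Rn n → ℂ, AEStronglyMeasurable g volume → ∀ C : ℝ≥0,
      K * yNorm ν 0 l lLow g ≤ C → KBdd (kerN N g) C := by
  obtain ⟨C₀, hC₀⟩ := lintegral_jap_rpow_le (n := n) hn hν hδ hl (m := 1) (ρ₀ := 0) zero_le_one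
    (fun ξ => by
      have := Real.rpow_le_rpow_of_exponent_le (one_le_jap ξ) (by linarith : (1 : ℝ) ≤ 2 - ν)
      simpa using this)
  refine ⟨(2 * N).toNNReal * C₀, fun g hg C hC => ?_⟩
  refine KBdd_of_norm_le (m := 1) (A := 2 * N) (by positivity) (aesm_kerN N hg) hg
    (fun p => by rw [Real.rpow_one]; exact norm_kerN_le N hN g p) (le_trans ?_ hC)
  rw [ENNReal.coe_mul, mul_assoc]
  exact mul_le_mul' le_rfl (hC₀ g hg)

theorem exists_KBdd_kerJ (hn : 1 ≤ n) (hν : 0 < ν)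
    (hδ : (n : ℝ) / 2 < l + ν) (hl : lLow < (n : ℝ) / 2) {ρ₀ : ℝ} (hρ₀ : 0 < ρ₀) :
    ∃ K : ℝ≥0, ∀ g : Rn n → ℂ, AEStronglyMeasurable g volume → ∀ C : ℝ≥0,
      K * yNorm ν ρ₀ l lLow g ≤ C → KBdd (kerJ g) C := by
  obtain ⟨K, hK0, hK⟩ := exists_jap_rpow_le (n := n) hν hρ₀ 2
  obtain ⟨C₀, hC₀⟩ := lintegral_jap_rpow_le (n := n) hn hν hδ hl hK0 hK
  refine ⟨(3 : ℝ).toNNReal * C₀, fun g hg C hC => ?_⟩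
  refine KBdd_of_norm_le (m := 2) (A := 3) (by positivity) (aesm_kerJ hg) hg
    (norm_kerJ_le g) (le_trans ?_ hC)
  rw [ENNReal.coe_mul, mul_assoc]
  exact mul_le_mul' le_rfl (hC₀ g hg)

theorem continuousOn_kOp_kerN (S : Phase) {N : ℝ}
    (hN : 0 ≤ N) : ContinuousOn (fun t => kOp (kerN N (φhat t))) (Ici T) := by
  obtain ⟨K, hK⟩ := exists_KBdd_kerN (n := n) S.hn S.hν S.hν1 S.hδ S.hLow hN
  exact S.continuousOn_kOp (kerN_sub N) le_rfl (S.ρ_nonneg T le_rfl) hK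

theorem KBdd_kerN (S : Phase) {N : ℝ}
    (hN : 0 ≤ N) {t : ℝ} (ht : T ≤ t) : ∃ C, KBdd (kerN N (φhat t)) C := by
  obtain ⟨K, hK⟩ := exists_KBdd_kerN (n := n) S.hn S.hν S.hν1 S.hδ S.hLow hN
  have hfin : K * yNorm ν 0 l lLow (φhat t) < ⊤ :=
    ENNReal.mul_lt_top ENNReal.coe_lt_top (S.yNorm_lt_top ht (S.ρ_nonneg t ht))
  exact ⟨_, hK _ (S.aesm ht) _ (ENNReal.coe_toNNReal hfin.ne).ge⟩

theorem continuousOn_kOp_kerJ (S : Phase) :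
    ContinuousOn (fun t => kOp (kerJ (φhat t))) (Ioi T) := by
  intro t ht
  have ht' : T < t := ht
  set T' := (T + t) / 2 with hT'
  have h1 : T < T' := by rw [hT']; linarith
  have h2 : T' < t := by rw [hT']; linarith
  obtain ⟨K, hK⟩ := exists_KBdd_kerJ (n := n) S.hn S.hν S.hδ S.hLow (S.ρ_pos h1)
  have := S.continuousOn_kOp kerJ_sub h1.le le_rfl hK
  exact (this.continuousAt (Ici_mem_nhds h2)).continuousWithinAt

theorem KBdd_kerJ (S : Phase)
    {t : ℝ} (ht : T < t) : ∃ C, KBdd (kerJ (φhat t)) C := by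
  obtain ⟨K, hK⟩ := exists_KBdd_kerJ (n := n) S.hn S.hν S.hδ S.hLow (S.ρ_pos ht)
  have hfin : K * yNorm ν (ρ t) l lLow (φhat t) < ⊤ :=
    ENNReal.mul_lt_top ENNReal.coe_lt_top (S.yNorm_lt_top ht.le le_rfl)
  exact ⟨_, hK _ (S.aesm ht.le) _ (ENNReal.coe_toNNReal hfin.ne).ge⟩

end PhaseSetup

/-! ### Functions with an integrable Fourier transform -/

/-- A smooth compactly supported real function as a complex Schwartz function. -/
def schwartzOfReal (χ : Rn n → ℝ) (h₁ : ContDiff ℝ ∞ χ) (h₂ : HasCompactSupport χ) : 𝓢(Rn n, ℂ) :=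
  HasCompactSupport.toSchwartzMap (f := fun x => (χ x : ℂ)) (h₂.comp_left Complex.ofReal_zero)
    (Complex.ofRealCLM.contDiff.comp h₁)

theorem schwartzOfReal_apply (χ : Rn n → ℝ) (h₁ : ContDiff ℝ ∞ χ) (h₂ : HasCompactSupport χ)
    (x : Rn n) : schwartzOfReal χ h₁ h₂ x = (χ x : ℂ) := rfl

theorem integral_fourier_mul {f g : Rn n → ℂ} (hf : Integrable f) (hg : Integrable g) :
    ∫ x, 𝓕 f x * g x = ∫ x, f x * 𝓕 g x := by
  have := VectorFourier.integral_fourierIntegral_smul_eq_flip (L := innerₗ (Rn n)) (μ := volume)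
    (ν := volume) (e := Real.fourierChar) Real.continuous_fourierChar continuous_inner hf hg
  simpa [flip_innerₗ] using! this

theorem eq_fourierInv_of_hasFourierTransform {u : Rn n → ℝ} {g : Rn n → ℂ} (hu : Continuous u)
    (h : HasFourierTransform (fun x => (u x : ℂ)) g) (hg : Integrable g) (x : Rn n) :
    (u x : ℂ) = 𝓕⁻ g x := by
  have hcont : Continuous (𝓕⁻ g) := by
    have h1 : Continuous (𝓕 g) :=
      VectorFourier.fourierIntegral_continuous Real.continuous_fourierChar
        (by exact continuous_inner) hg
    have h2 : 𝓕⁻ g = fun x => 𝓕 g (-x) := by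
      ext x; exact Real.fourierInv_eq_fourier_neg g x
    rw [h2]
    exact h1.comp continuous_neg
  have hae : ∀ᵐ x, (u x : ℂ) = 𝓕⁻ g x := by
    refine ae_eq_of_integral_contDiff_smul_eq h.locallyIntegrable_left
      hcont.locallyIntegrable fun χ hχ1 hχ2 => ?_
    set X := schwartzOfReal χ hχ1 hχ2
    have e1 := h.pairing (𝓕⁻ X)
    have e2 : (𝓕 (𝓕⁻ X) : 𝓢(Rn n, ℂ)) = X := FourierInvPair.fourier_fourierInv_eq X
    rw [e2] at e1
    have e3 : ∫ x, χ x • (u x : ℂ) = ∫ ξ, (𝓕⁻ X : 𝓢(Rn n, ℂ)) ξ * g ξ := by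
      rw [← e1]
      refine integral_congr_ae (Eventually.of_forall fun x => ?_)
      simp only [Complex.real_smul]
      rfl
    rw [e3]
    have e4 : ∫ x, χ x • 𝓕⁻ g x = ∫ x, X (-x) * 𝓕 g x := by
      rw [← integral_neg_eq_self]
      refine integral_congr_ae (Eventually.of_forall fun x => ?_)
      simp only [Complex.real_smul]
      rw [Real.fourierInv_eq_fourier_neg, neg_neg]
      rfl
    have hXi : Integrable fun x => X (-x) := X.integrable.comp_neg
    rw [e4, ← integral_fourier_mul hXi hg]
    refine integral_congr_ae (Eventually.of_forall fun x => ?_)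
    simp only
    rw [SchwartzMap.fourierInv_coe, Real.fourierInv_eq_fourier_comp_neg]
  have := (Continuous.ae_eq_iff_eq volume (Complex.continuous_ofReal.comp hu) hcont).1 hae
  exact congrFun this x

theorem conj_of_hasFourierTransform {u : Rn n → ℝ} {g : Rn n → ℂ}
    (h : HasFourierTransform (fun x => (u x : ℂ)) g) (hg : Integrable g) :
    ∀ᵐ ξ, starRingEnd ℂ (g (-ξ)) = g ξ := by
  have hgc : Integrable fun ξ => starRingEnd ℂ (g (-ξ)) :=
    (Complex.conjCLE : ℂ →L[ℝ] ℂ).integrable_comp hg.comp_neg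
  refine ae_eq_of_integral_contDiff_smul_eq hgc.locallyIntegrable hg.locallyIntegrable
    fun χ hχ1 hχ2 => ?_
  have hχ1' : ContDiff ℝ ∞ fun x => χ (-x) := hχ1.comp contDiff_neg
  have hχ2' : HasCompactSupport fun x => χ (-x) := hχ2.comp_homeomorph (Homeomorph.neg (Rn n))
  set X := schwartzOfReal χ hχ1 hχ2 with hX
  set X' := schwartzOfReal _ hχ1' hχ2' with hX'
  have e1 := h.pairing X
  have e2 := h.pairing X'
  have hF : ∀ x, (𝓕 X' : 𝓢(Rn n, ℂ)) x = starRingEnd ℂ ((𝓕 X : 𝓢(Rn n, ℂ)) x) := by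
    intro x
    rw [SchwartzMap.fourier_coe, SchwartzMap.fourier_coe]
    have : (X' : Rn n → ℂ) = fun y => X (-y) := rfl
    rw [this, ← Real.fourierInv_eq_fourier_comp_neg, Real.fourierInv_eq, Real.fourier_eq,
      ← integral_conj]
    refine integral_congr_ae (Eventually.of_forall fun y => ?_)
    simp only [Circle.smul_def, smul_eq_mul, map_mul]
    congr 1
    · rw [← Circle.coe_inv_eq_conj, ← AddChar.map_neg_eq_inv, neg_neg]
    · rw [hX, schwartzOfReal_apply, Complex.conj_ofReal]
  have e3 : ∫ ξ, χ ξ • starRingEnd ℂ (g (-ξ)) = starRingEnd ℂ (∫ ξ, X' ξ * g ξ) := by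
    rw [← integral_conj, ← integral_neg_eq_self]
    refine integral_congr_ae (Eventually.of_forall fun ξ => ?_)
    simp only [neg_neg, map_mul, Complex.real_smul]
    rw [hX', schwartzOfReal_apply, Complex.conj_ofReal]
  have e4 : ∫ ξ, χ ξ • g ξ = ∫ ξ, X ξ * g ξ := rfl
  rw [e3, e4, ← e1, ← e2, ← integral_conj]
  refine integral_congr_ae (Eventually.of_forall fun x => ?_)
  simp only [map_mul]
  rw [hF, Complex.conj_conj, Complex.conj_ofReal]

theorem antiHerm_aKer {g : Rn n → ℂ} (hg : ∀ᵐ ξ, starRingEnd ℂ (g (-ξ)) = g ξ) :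
    AntiHerm (aKer g) := by
  unfold AntiHerm
  filter_upwards [ae_sub_of_ae hg] with p hp
  unfold aKer
  rw [Prod.fst_swap, Prod.snd_swap, map_mul, map_neg, Complex.conj_ofReal, ← neg_sub p.1 p.2, hp]
  have : sqDiff p.swap = -sqDiff p := by unfold sqDiff; simp
  rw [this]; push_cast; ring

theorem antiHerm_kerN (N : ℝ) {g : Rn n → ℂ} (hg : ∀ᵐ ξ, starRingEnd ℂ (g (-ξ)) = g ξ) :
    AntiHerm (kerN N g) := by
  unfold AntiHerm
  filter_upwards [antiHerm_aKer hg] with p hp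
  unfold kerN
  rw [map_mul, hp, Complex.conj_ofReal, Prod.fst_swap, Prod.snd_swap, mul_comm (lowCut N p.2)]
  ring

theorem PhaseSetup.conj_φhat (S : Phase) {t : ℝ} (ht : T ≤ t) :
    ∀ᵐ ξ, starRingEnd ℂ (φhat t (-ξ)) = φhat t ξ :=
  conj_of_hasFourierTransform (S.phase.1 t ht).2 (S.integrable_φhat ht)

/-- Antihermitian kernels define antihermitian operators. -/
theorem AntiHerm.inner_kOp_left {k : Rn n × Rn n → ℂ} (hk : AntiHerm k) {C : ℝ≥0} (h : KBdd k C)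
    (w u : L2 n) : inner ℂ (kOp k w) u = -inner ℂ w (kOp k u) := by
  rw [← inner_conj_symm, inner_kOp h, inner_kOp h]
  unfold kform
  rw [integral_swap_conj, ← integral_neg]
  refine integral_congr_ae ?_
  filter_upwards [hk] with p hp
  rw [map_mul, map_mul, Complex.conj_conj, hp, Prod.fst_swap, Prod.snd_swap]
  ring

/-! ### Linear evolution equations with antihermitian generators -/

/-- The radial retraction onto the ball of radius `R`. -/
def radialRetract {E : Type*} [NormedAddCommGroup E] [NormedSpace ℝ E] (R : ℝ) (x : E) : E :=
  (R / max R ‖x‖) • x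

theorem radialRetract_of_le {E : Type*} [NormedAddCommGroup E] [NormedSpace ℝ E] {R : ℝ}
    (hR : 0 < R) {x : E} (hx : ‖x‖ ≤ R) : radialRetract R x = x := by
  rw [radialRetract, max_eq_left hx, div_self hR.ne', one_smul]

theorem norm_radialRetract_le {E : Type*} [NormedAddCommGroup E] [NormedSpace ℝ E] {R : ℝ}
    (hR : 0 < R) (x : E) : ‖radialRetract R x‖ ≤ R := by
  have hm : 0 < max R ‖x‖ := lt_max_of_lt_left hR
  rw [radialRetract, norm_smul, Real.norm_of_nonneg (by positivity), div_mul_eq_mul_div,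
    div_le_iff₀ hm]
  exact mul_le_mul_of_nonneg_left (le_max_right _ _) hR.le

theorem norm_radialRetract_sub_le {E : Type*} [NormedAddCommGroup E] [NormedSpace ℝ E] {R : ℝ}
    (hR : 0 < R) (x y : E) : ‖radialRetract R x - radialRetract R y‖ ≤ 2 * ‖x - y‖ := by
  have hmx : 0 < max R ‖x‖ := lt_max_of_lt_left hR
  have hmy : 0 < max R ‖y‖ := lt_max_of_lt_left hR
  have h1 : radialRetract R x - radialRetract R y =
      (R / max R ‖x‖) • (x - y) + (R / max R ‖x‖ - R / max R ‖y‖) • y := by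
    simp only [radialRetract, smul_sub, sub_smul]; abel
  have h2 : R / max R ‖x‖ ≤ 1 := (div_le_one hmx).2 (le_max_left _ _)
  have h3 : |max R ‖y‖ - max R ‖x‖| ≤ ‖x - y‖ := by
    refine (abs_max_sub_max_le_max _ _ _ _).trans ?_
    simp only [sub_self, abs_zero]
    refine max_le (norm_nonneg _) ?_
    rw [norm_sub_rev]; exact abs_norm_sub_norm_le y x
  have h4 : |R / max R ‖x‖ - R / max R ‖y‖| * ‖y‖ ≤ ‖x - y‖ := by
    have : R / max R ‖x‖ - R / max R ‖y‖ =
        (R / max R ‖x‖) * ((max R ‖y‖ - max R ‖x‖) / max R ‖y‖) := by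
      field_simp
    rw [this, abs_mul, abs_of_nonneg (by positivity : 0 ≤ R / max R ‖x‖), abs_div, abs_of_pos hmy,
      mul_assoc, div_mul_eq_mul_div |max R ‖y‖ - max R ‖x‖|]
    have h5 : |max R ‖y‖ - max R ‖x‖| * ‖y‖ / max R ‖y‖ ≤ ‖x - y‖ := by
      rw [div_le_iff₀ hmy]
      exact mul_le_mul h3 (le_max_right _ _) (norm_nonneg _) (norm_nonneg _)
    exact (mul_le_of_le_one_left (by positivity) h2).trans h5
  rw [h1]
  refine (norm_add_le _ _).trans ?_
  rw [norm_smul, norm_smul, Real.norm_of_nonneg (by positivity), Real.norm_eq_abs]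
  nlinarith [mul_le_of_le_one_left (norm_nonneg (x - y)) h2]

theorem hasDerivWithinAt_re_inner {u v : ℝ → L2 n} {u' v' : L2 n} {s : Set ℝ} {t : ℝ}
    (hu : HasDerivWithinAt u u' s t) (hv : HasDerivWithinAt v v' s t) :
    HasDerivWithinAt (fun t => (inner ℂ (u t) (v t)).re)
      ((inner ℂ (u t) v').re + (inner ℂ u' (v t)).re) s t := by
  have h := hu.inner ℂ hv
  have h2 : HasDerivWithinAt (fun t => Complex.reCLM (inner ℂ (u t) (v t)))
      (Complex.reCLM (inner ℂ (u t) v' + inner ℂ u' (v t))) s t :=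
    Complex.reCLM.hasFDerivAt.comp_hasDerivWithinAt t h
  rw [map_add] at h2
  exact h2

theorem L2.ofReal_smul (c : ℝ) (x : L2 n) : (c : ℂ) • x = c • x :=
  (RCLike.real_smul_eq_coe_smul (K := ℂ) c x).symm

theorem hasDerivWithinAt_clm_apply {A : ℝ → L2 n →L[ℂ] L2 n} {A' : L2 n →L[ℂ] L2 n} {u : ℝ → L2 n}
    {u' : L2 n} {s : Set ℝ} {t : ℝ} (hA : HasDerivWithinAt A A' s t)
    (hu : HasDerivWithinAt u u' s t) :
    HasDerivWithinAt (fun t => A t (u t)) (A' (u t) + A t u') s t := by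
  have h1 : HasDerivWithinAt (fun t => (A t).restrictScalars ℝ) (A'.restrictScalars ℝ) s t :=
    (ContinuousLinearMap.restrictScalarsL ℂ (L2 n) (L2 n) ℝ ℝ).hasFDerivAt.comp_hasDerivWithinAt t hA
  exact h1.clm_apply hu

/-- Backward solvability of `u' = L(t) u` for bounded antihermitian generators. -/
theorem exists_linear_ode {L : ℝ → L2 n →L[ℂ] L2 n} {a b : ℝ} (hab : a ≤ b)
    (hL : ContinuousOn L (Icc a b))
    (hanti : ∀ t ∈ Icc a b, ∀ x, (inner ℂ x (L t x)).re = 0) (x₀ : L2 n) :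
    ∃ u : ℝ → L2 n, u b = x₀ ∧ ∀ t ∈ Icc a b, HasDerivWithinAt u (L t (u t)) (Icc a b) t := by
  obtain ⟨K, hK⟩ := isCompact_Icc.exists_bound_of_continuousOn hL
  have hK' : ∀ t ∈ Icc a b, ‖L t‖ ≤ max K 0 := fun t ht => (hK t ht).trans (le_max_left _ _)
  set K' := max K 0
  have hK0 : 0 ≤ K' := le_max_right _ _
  set R := ‖x₀‖ + 1
  have hR : 0 < R := by positivity
  let f : ℝ → L2 n → L2 n := fun t x => L t (radialRetract R x)
  have hpl : IsPicardLindelof f (⟨b, right_mem_Icc.2 hab⟩ : Icc a b) x₀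
      (Real.toNNReal (K' * R * (b - a))) 0 (Real.toNNReal (K' * R)) (Real.toNNReal (K' * 2)) := by
    refine ⟨fun t ht => ?_, fun x _ => ?_, fun t ht x _ => ?_, ?_⟩
    · refine LipschitzOnWith.of_dist_le_mul fun x _ y _ => ?_
      rw [dist_eq_norm, dist_eq_norm, ← map_sub, Real.coe_toNNReal _ (by positivity), mul_assoc]
      exact (L t).le_of_opNorm_le_of_le (hK' t ht) (norm_radialRetract_sub_le hR x y)
    · exact hL.clm_apply continuousOn_const
    · rw [Real.coe_toNNReal _ (by positivity)]
      exact (L t).le_of_opNorm_le_of_le (hK' t ht) (norm_radialRetract_le hR x)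
    · have h0 : 0 ≤ b - a := sub_nonneg.2 hab
      rw [Real.coe_toNNReal _ (by positivity), Real.coe_toNNReal _ (by positivity)]
      simp [h0]
  obtain ⟨u, hu0, hu⟩ := hpl.exists_eq_forall_mem_Icc_hasDerivWithinAt₀
  refine ⟨u, hu0, ?_⟩
  have hcons : ∀ t ∈ Icc a b, ‖u t‖ = ‖x₀‖ := by
    have hd : ∀ t ∈ Icc a b,
        HasDerivWithinAt (fun t => (inner ℂ (u t) (u t)).re) 0 (Icc a b) t := by
      intro t ht
      have h := hasDerivWithinAt_re_inner (hu t ht) (hu t ht)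
      convert! h using 1
      have h1 : (inner ℂ (u t) (f t (u t))).re = 0 := by
        have : f t (u t) = ((R / max R ‖u t‖ : ℝ) : ℂ) • L t (u t) := by
          simp only [f, radialRetract]
          rw [← map_smul, L2.ofReal_smul]
        rw [this, inner_smul_right, Complex.re_ofReal_mul, hanti t ht, mul_zero]
      have h2 : (inner ℂ (f t (u t)) (u t)).re = (inner ℂ (u t) (f t (u t))).re :=
        inner_re_symm (𝕜 := ℂ) _ _
      rw [h2, h1, add_zero]
    have hQ : ∀ t ∈ Icc a b, (inner ℂ (u t) (u t)).re = (inner ℂ (u a) (u a)).re :=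
      constant_of_has_deriv_right_zero (fun t ht => (hd t ht).continuousWithinAt) fun t ht =>
        (hd t (Ico_subset_Icc_self ht)).mono_of_mem_nhdsWithin (Icc_mem_nhdsGE_of_mem ht)
    intro t ht
    have h3 := (hQ t ht).trans (hQ b (right_mem_Icc.2 hab)).symm
    rw [show u b = x₀ from hu0] at h3
    have h4 : ∀ x : L2 n, (inner ℂ x x).re = ‖x‖ ^ 2 := fun x =>
      inner_self_eq_norm_sq (𝕜 := ℂ) x
    rw [h4, h4] at h3
    exact (pow_left_inj₀ (norm_nonneg _) (norm_nonneg _) two_ne_zero).1 h3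
  intro t ht
  have h := hu t ht
  simp only [f] at h
  rwa [radialRetract_of_le hR ((hcons t ht).le.trans (by simp [R]))] at h

/-! ### Weighted energies -/

/-- Measurable cutoff functions with values in `[0, 1]` and bounded support. -/
structure IsCut (χ : Rn n → ℝ) : Prop where
  measurable : Measurable χ
  nonneg : ∀ ξ, 0 ≤ χ ξ
  le_one : ∀ ξ, χ ξ ≤ 1
  bounded : ∃ R, ∀ ξ, χ ξ ≠ 0 → jap ξ ≤ R

theorem isCut_lowCut (N : ℝ) : IsCut (lowCut N : Rn n → ℝ) where
  measurable := measurable_lowCut N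
  nonneg := lowCut_nonneg N
  le_one := lowCut_le_one N
  bounded := ⟨N, fun ξ h => by
    by_contra h'
    exact h (if_neg h')⟩

theorem isCut_logCut {ε : ℝ} (hε : 0 < ε) : IsCut (fun ξ : Rn n => logCut ε (jap ξ)) where
  measurable := by
    unfold logCut
    exact ((measurable_const.sub ((Real.measurable_log.comp measurable_jap).const_mul ε)).max
      measurable_const)
  nonneg := fun _ => logCut_nonneg _ _
  le_one := fun ξ => logCut_le_one hε.le (one_le_jap ξ)
  bounded := ⟨exp (1 / ε), fun ξ h => by
    by_contra h'
    exact h (logCut_eq_zero hε (not_le.1 h').le)⟩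

theorem jap_rpow_le {ξ : Rn n} {R : ℝ} (h : jap ξ ≤ R) (κ : ℝ) : jap ξ ^ κ ≤ R ^ |κ| := by
  have h1 := one_le_jap ξ
  exact (Real.rpow_le_rpow_of_exponent_le h1 (le_abs_self κ)).trans
    (Real.rpow_le_rpow (jap_pos ξ).le h (abs_nonneg κ))

theorem sqW_eq (ν ρ κ : ℝ) (ξ : Rn n) :
    sqW ν ρ κ ξ = jap ξ ^ (2 * κ) * exp (ρ * (2 * jap ξ ^ ν)) := by
  rw [sqW, ← Real.exp_nat_mul]; congr 2; push_cast; ring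

theorem sqW_add_half (ν ρ κ : ℝ) (ξ : Rn n) :
    sqW ν ρ (κ + ν / 2) ξ = jap ξ ^ ν * sqW ν ρ κ ξ := by
  rw [sqW, sqW, show 2 * (κ + ν / 2) = ν + 2 * κ by ring, Real.rpow_add (jap_pos ξ)]; ring

theorem IsCut.exists_bound {χ : Rn n → ℝ} (hχ : IsCut χ) (ν κ s₀ : ℝ) :
    ∃ C, 0 ≤ C ∧ ∀ ρ, |ρ| ≤ s₀ → ∀ ξ, |χ ξ * sqW ν ρ κ ξ| ≤ C := by
  obtain ⟨R, hR⟩ := hχ.bounded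
  refine ⟨|R| ^ |2 * κ| * exp (|s₀| * (2 * |R| ^ |ν|)), by positivity, fun ρ hρ ξ => ?_⟩
  rw [abs_mul, abs_of_nonneg (hχ.nonneg ξ), abs_of_pos (sqW_pos ν ρ κ ξ)]
  by_cases h : χ ξ = 0
  · rw [h, zero_mul]; positivity
  have hj : jap ξ ≤ |R| := (hR ξ h).trans (le_abs_self R)
  refine (mul_le_of_le_one_left (sqW_pos ν ρ κ ξ).le (hχ.le_one ξ)).trans ?_
  rw [sqW_eq]
  have h1 := jap_rpow_le hj (2 * κ)
  have h2 := jap_rpow_le hj ν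
  have h3 : 0 ≤ jap ξ ^ ν := (Real.rpow_pos_of_pos (jap_pos ξ) _).le
  gcongr
  exact (le_abs_self ρ).trans (hρ.trans (le_abs_self _))

theorem IsCut.bddMeas {χ : Rn n → ℝ} (hχ : IsCut χ) (ν ρ κ : ℝ) :
    BddMeas fun ξ => χ ξ * sqW ν ρ κ ξ := by
  obtain ⟨C, -, hC⟩ := hχ.exists_bound ν κ |ρ|
  exact ⟨hχ.measurable.mul (measurable_sqW ν ρ κ), C, hC ρ le_rfl⟩

/-- Multiplication by the square of the weight, cut off by `χ`. -/
def sqOp (χ : Rn n → ℝ) (ν ρ κ : ℝ) : L2 n →L[ℂ] L2 n := mulOp fun ξ => χ ξ * sqW ν ρ κ ξ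

theorem IsCut.hasDerivAt_sqOp {χ : Rn n → ℝ} (hχ : IsCut χ) (ν κ ρ : ℝ) :
    HasDerivAt (fun ρ => sqOp χ ν ρ κ) ((2 : ℝ) • sqOp χ ν ρ (κ + ν / 2)) ρ := by
  obtain ⟨C, hC0, hC⟩ := hχ.exists_bound ν κ |ρ|
  obtain ⟨R, hR⟩ := hχ.bounded
  set Y := 2 * |R| ^ |ν| with hY
  have hY0 : 0 ≤ Y := by positivity
  rw [hasDerivAt_iff_isLittleO_nhds_zero]
  have hO : (fun h : ℝ => sqOp χ ν (ρ + h) κ - sqOp χ ν ρ κ - h • (2 : ℝ) • sqOp χ ν ρ (κ + ν / 2))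
      =O[𝓝 0] fun h => h ^ 2 := by
    refine Asymptotics.IsBigO.of_bound (C * Y ^ 2) ?_
    have hev : ∀ᶠ h : ℝ in 𝓝 0, |h| * Y < 1 := by
      have : Tendsto (fun h : ℝ => |h| * Y) (𝓝 0) (𝓝 (|0| * Y)) :=
        (continuous_abs.mul continuous_const).tendsto 0
      rw [abs_zero, zero_mul] at this
      exact this.eventually (gt_mem_nhds zero_lt_one)
    filter_upwards [hev] with h hh
    have e1 : sqOp χ ν (ρ + h) κ - sqOp χ ν ρ κ - h • (2 : ℝ) • sqOp χ ν ρ (κ + ν / 2) =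
        mulOp fun ξ => χ ξ * sqW ν (ρ + h) κ ξ - χ ξ * sqW ν ρ κ ξ -
          (h * 2) * (χ ξ * sqW ν ρ (κ + ν / 2) ξ) := by
      have hb : BddMeas fun ξ => (h * 2) * (χ ξ * sqW ν ρ (κ + ν / 2) ξ) :=
        BddMeas.mul ⟨measurable_const, |h * 2|, fun _ => le_rfl⟩ (hχ.bddMeas ν ρ (κ + ν / 2))
      rw [← mulOp_sub ((hχ.bddMeas ν (ρ + h) κ).sub (hχ.bddMeas ν ρ κ)) hb,
        ← mulOp_sub (hχ.bddMeas ν (ρ + h) κ) (hχ.bddMeas ν ρ κ),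
        mulOp_smul (hχ.bddMeas ν ρ (κ + ν / 2)), smul_smul]
      rfl
    have hb : BddMeas fun ξ => χ ξ * sqW ν (ρ + h) κ ξ - χ ξ * sqW ν ρ κ ξ -
          (h * 2) * (χ ξ * sqW ν ρ (κ + ν / 2) ξ) :=
      ((hχ.bddMeas ν (ρ + h) κ).sub (hχ.bddMeas ν ρ κ)).sub
        (BddMeas.mul ⟨measurable_const, |h * 2|, fun _ => le_rfl⟩ (hχ.bddMeas ν ρ (κ + ν / 2)))
    rw [e1, Real.norm_eq_abs, abs_of_nonneg (sq_nonneg h)]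
    refine norm_mulOp_le hb (by positivity) fun ξ => ?_
    have e2 : χ ξ * sqW ν (ρ + h) κ ξ - χ ξ * sqW ν ρ κ ξ -
        (h * 2) * (χ ξ * sqW ν ρ (κ + ν / 2) ξ) =
        (χ ξ * sqW ν ρ κ ξ) *
          (exp (h * (2 * jap ξ ^ ν)) - 1 - h * (2 * jap ξ ^ ν)) := by
      rw [sqW_add_half, sqW_eq, sqW_eq, add_mul, Real.exp_add]; ring
    rw [e2, abs_mul]
    by_cases h0 : χ ξ = 0
    · rw [h0, zero_mul, abs_zero, zero_mul]; positivity
    have hj : jap ξ ≤ |R| := (hR ξ h0).trans (le_abs_self R)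
    have h2 : 2 * jap ξ ^ ν ≤ Y := by
      have := jap_rpow_le hj ν
      rw [hY]; linarith
    have h3 : 0 ≤ 2 * jap ξ ^ ν := by
      have := Real.rpow_pos_of_pos (jap_pos ξ) ν
      positivity
    have h4 : |h * (2 * jap ξ ^ ν)| ≤ |h| * Y := by
      rw [abs_mul, abs_of_nonneg h3]; gcongr
    have h5 : |exp (h * (2 * jap ξ ^ ν)) - 1 - h * (2 * jap ξ ^ ν)| ≤ (h * (2 * jap ξ ^ ν)) ^ 2 :=
      Real.abs_exp_sub_one_sub_id_le (h4.trans hh.le)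
    have h6 : (h * (2 * jap ξ ^ ν)) ^ 2 ≤ Y ^ 2 * h ^ 2 := by
      rw [← sq_abs (h * (2 * jap ξ ^ ν))]
      calc _ ≤ (|h| * Y) ^ 2 := by gcongr
        _ = _ := by rw [mul_pow, sq_abs]; ring
    calc _ ≤ C * (Y ^ 2 * h ^ 2) :=
          mul_le_mul (hC ρ le_rfl ξ) (h5.trans h6) (abs_nonneg _) hC0
      _ = _ := by ring
  refine hO.trans_isLittleO ?_
  simpa using (Asymptotics.isLittleO_pow_pow (𝕜 := ℝ) one_lt_two).congr_right (fun x => pow_one x)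

theorem IsCut.continuous_sqOp {χ : Rn n → ℝ} (hχ : IsCut χ) (ν κ : ℝ) :
    Continuous fun ρ => sqOp χ ν ρ κ :=
  continuous_iff_continuousAt.2 fun ρ => (hχ.hasDerivAt_sqOp ν κ ρ).continuousAt

/-- The square of the norm of `v`, cut off by `χ`. -/
def energy (χ : Rn n → ℝ) (ν ρ κ : ℝ) (v : L2 n) : ℝ := (inner ℂ v (sqOp χ ν ρ κ v)).re

theorem IsCut.ofReal_energy {χ : Rn n → ℝ} (hχ : IsCut χ) (ν ρ κ : ℝ) (v : L2 n) :
    ofReal (energy χ ν ρ κ v) =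
      ∫⁻ ξ, ofReal (χ ξ * sqW ν ρ κ ξ) * ‖v ξ‖ₑ ^ 2 := by
  have hb := hχ.bddMeas ν ρ κ
  have h1 : energy χ ν ρ κ v = ∫ ξ, (χ ξ * sqW ν ρ κ ξ) * ‖v ξ‖ ^ 2 := by
    have hi := L2.integrable_inner (𝕜 := ℂ) v (sqOp χ ν ρ κ v)
    rw [energy, L2.inner_def, ← Complex.reCLM_apply, ← Complex.reCLM.integral_comp_comm hi]
    refine integral_congr_ae ?_
    filter_upwards [coeFn_mulOp hb v] with ξ hξ
    rw [Complex.reCLM_apply, sqOp, hξ, RCLike.inner_apply, mul_assoc, Complex.re_ofReal_mul,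
      Complex.mul_conj, Complex.ofReal_re, Complex.normSq_eq_norm_sq]
  have hnn : ∀ ξ, 0 ≤ χ ξ * sqW ν ρ κ ξ := fun ξ => mul_nonneg (hχ.nonneg ξ) (sqW_pos ν ρ κ ξ).le
  have hi : Integrable (fun ξ => (χ ξ * sqW ν ρ κ ξ) * ‖v ξ‖ ^ 2) := by
    obtain ⟨C, hC⟩ := hb.2
    exact ((Lp.memLp v).integrable_norm_pow (p := 2) two_ne_zero).bdd_mul hb.1.aestronglyMeasurable
      (Eventually.of_forall hC)
  rw [h1, ofReal_integral_eq_lintegral_ofReal hi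
    (Eventually.of_forall fun ξ => mul_nonneg (hnn ξ) (by positivity))]
  refine lintegral_congr fun ξ => ?_
  rw [ENNReal.ofReal_mul (hnn ξ), ENNReal.ofReal_pow (norm_nonneg _), ofReal_norm]

theorem kN_sq (ν ρ κ : ℝ) (v : Rn n → ℂ) :
    kN ν ρ κ v ^ 2 = ∫⁻ ξ, ofReal (sqW ν ρ κ ξ) * ‖v ξ‖ₑ ^ 2 := by
  rw [kN, n2, ← ENNReal.rpow_natCast, ← ENNReal.rpow_mul]
  norm_num
  refine lintegral_congr fun ξ => ?_
  have h := Real.rpow_pos_of_pos (jap_pos ξ) κ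
  rw [mul_pow, ← ENNReal.ofReal_pow (by positivity), mul_pow, sqW, mul_comm 2 κ,
    Real.rpow_mul (jap_pos ξ).le, Real.rpow_two]

theorem IsCut.energy_nonneg {χ : Rn n → ℝ} (hχ : IsCut χ) (ν ρ κ : ℝ) (v : L2 n) :
    0 ≤ energy χ ν ρ κ v := by
  have hnn : ∀ ξ, 0 ≤ χ ξ * sqW ν ρ κ ξ := fun ξ => mul_nonneg (hχ.nonneg ξ) (sqW_pos ν ρ κ ξ).le
  have hi := L2.integrable_inner (𝕜 := ℂ) v (sqOp χ ν ρ κ v)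
  rw [energy, L2.inner_def, ← Complex.reCLM_apply, ← Complex.reCLM.integral_comp_comm hi]
  refine integral_nonneg_of_ae ?_
  filter_upwards [coeFn_mulOp (hχ.bddMeas ν ρ κ) v] with ξ hξ
  rw [Complex.reCLM_apply, sqOp, hξ, RCLike.inner_apply, mul_assoc, Complex.re_ofReal_mul,
    Complex.mul_conj, Complex.ofReal_re]
  exact mul_nonneg (hnn ξ) (Complex.normSq_nonneg _)

theorem IsCut.ofReal_energy_le {χ : Rn n → ℝ} (hχ : IsCut χ) (ν ρ κ : ℝ) (v : L2 n) :
    ofReal (energy χ ν ρ κ v) ≤ kN ν ρ κ v ^ 2 := by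
  rw [hχ.ofReal_energy, kN_sq]
  refine lintegral_mono fun ξ => ?_
  gcongr
  exact mul_le_of_le_one_left (sqW_pos ν ρ κ ξ).le (hχ.le_one ξ)

theorem lowCut_mul_self (N : ℝ) (ξ : Rn n) : lowCut N ξ * lowCut N ξ = lowCut N ξ := by
  unfold lowCut; split_ifs <;> simp

theorem ofReal_energy_lowCut {N : ℝ} {v : L2 n} (hv : mulOp (lowCut N) v = v) (ν ρ κ : ℝ) :
    ofReal (energy (lowCut N) ν ρ κ v) = kN ν ρ κ v ^ 2 := by
  rw [(isCut_lowCut N).ofReal_energy, kN_sq]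
  refine lintegral_congr_ae ?_
  have h := coeFn_mulOp (bddMeas_lowCut N) v
  rw [hv] at h
  filter_upwards [h] with ξ hξ
  by_cases h1 : jap ξ ≤ N
  · simp [lowCut, h1]
  · have : v ξ = 0 := by rw [hξ]; simp [lowCut, h1]
    simp [this]

theorem hasDerivWithinAt_energy {χ : Rn n → ℝ} (hχ : IsCut χ) (ν κ : ℝ) {ρ : ℝ → ℝ} {r' t : ℝ}
    {s : Set ℝ} (hρ : HasDerivWithinAt ρ r' s t) {u : ℝ → L2 n} {u' : L2 n}
    (hu : HasDerivWithinAt u u' s t) :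
    HasDerivWithinAt (fun t => energy χ ν (ρ t) κ (u t))
      (2 * r' * energy χ ν (ρ t) (κ + ν / 2) (u t) +
        2 * (inner ℂ (u t) (sqOp χ ν (ρ t) κ u')).re) s t := by
  have h1 : HasDerivWithinAt (fun t => sqOp χ ν (ρ t) κ)
      (r' • (2 : ℝ) • sqOp χ ν (ρ t) (κ + ν / 2)) s t :=
    (hχ.hasDerivAt_sqOp ν κ (ρ t)).scomp_hasDerivWithinAt t hρ
  have h2 := hasDerivWithinAt_clm_apply h1 hu
  refine (hasDerivWithinAt_re_inner hu h2).congr_deriv ?_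
  have h3 : (inner ℂ u' (sqOp χ ν (ρ t) κ (u t))).re = (inner ℂ (u t) (sqOp χ ν (ρ t) κ u')).re := by
    rw [sqOp, ← inner_mulOp (hχ.bddMeas ν (ρ t) κ)]
    exact inner_re_symm (𝕜 := ℂ) _ _
  have h4 : (r' • (2 : ℝ) • sqOp χ ν (ρ t) (κ + ν / 2)) (u t) =
      ((r' * 2 : ℝ) : ℂ) • sqOp χ ν (ρ t) (κ + ν / 2) (u t) := by
    rw [smul_smul, L2.ofReal_smul]; rfl
  rw [h3, inner_add_right, Complex.add_re, h4, inner_smul_right, Complex.re_ofReal_mul, energy]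
  ring

/-! ### Truncated evolution -/

theorem enorm_kform_le (k : Rn n × Rn n → ℂ) (w u : L2 n) :
    ‖kform k w u‖ₑ ≤
      ∫⁻ p : Rn n × Rn n, ‖w p.1‖ₑ * (‖k p‖ₑ * ‖u p.2‖ₑ) ∂(volume.prod volume) := by
  refine (enorm_integral_le_lintegral_enorm _).trans_eq (lintegral_congr fun p => ?_)
  rw [enorm_mul, enorm_mul, RCLike.enorm_conj]

theorem L2.measurable (v : L2 n) : Measurable (v : Rn n → ℂ) := (Lp.stronglyMeasurable v).measurable

theorem ae_fst {p : Rn n → Prop} (h : ∀ᵐ ξ, p ξ) :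
    ∀ᵐ q : Rn n × Rn n ∂(volume.prod volume), p q.1 := Measure.quasiMeasurePreserving_fst.ae h

theorem ae_snd {p : Rn n → Prop} (h : ∀ᵐ ξ, p ξ) :
    ∀ᵐ q : Rn n × Rn n ∂(volume.prod volume), p q.2 := Measure.quasiMeasurePreserving_snd.ae h

theorem enorm_kerN_le (N : ℝ) (g : Rn n → ℂ) (p : Rn n × Rn n) :
    ‖kerN N g p‖ₑ ≤ ofReal |sqDiff p| * ‖g (p.1 - p.2)‖ₑ := by
  rw [kerN, enorm_mul, enorm_aKer]
  refine mul_le_of_le_one_left zero_le ?_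
  rw [← ofReal_norm, Complex.norm_real, Real.norm_eq_abs, abs_of_nonneg
    (mul_nonneg (lowCut_nonneg N _) (lowCut_nonneg N _)), ENNReal.ofReal_le_one]
  exact mul_le_one₀ (lowCut_le_one N _) (lowCut_nonneg N _) (lowCut_le_one N _)

theorem kN_mono_right {κ κ' : ℝ} (h : κ ≤ κ') (ν ρ : ℝ) (v : Rn n → ℂ) :
    kN ν ρ κ v ≤ kN ν ρ κ' v := by
  refine n2_mono (Eventually.of_forall fun ξ => ?_)
  gcongr
  exact one_le_jap ξ

theorem kN_mono_left {ρ ρ' : ℝ} (h : ρ ≤ ρ') (ν κ : ℝ) (v : Rn n → ℂ) :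
    kN ν ρ κ v ≤ kN ν ρ' κ v := by
  refine n2_mono (Eventually.of_forall fun ξ => ?_)
  have h1 := Real.rpow_pos_of_pos (jap_pos ξ) κ
  have h2 := Real.rpow_pos_of_pos (jap_pos ξ) ν
  gcongr

namespace PhaseSetup

/-- The bound of the commutator of the weight with the truncated generator. -/
theorem ofReal_commutator_le (S : Phase) {κ : ℝ} {C : ℝ≥0}
    (hC : CommutatorBound n ν l lLow κ C) {N : ℝ} (hN : 0 ≤ N) {t : ℝ} (ht : T ≤ t) (v : L2 n) :
    ofReal |2 * (inner ℂ v (sqOp (lowCut N) ν (ρ t) κ (kOp (kerN N (φhat t)) v))).re| ≤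
      C * yNorm ν (ρ t) l lLow (φhat t) * kN ν (ρ t) (κ + ν / 2) v ^ 2 := by
  obtain ⟨D, hD⟩ := S.KBdd_kerN hN ht
  have hb := (isCut_lowCut (n := n) N).bddMeas ν (ρ t) κ
  have hanti := antiHerm_kerN N (S.conj_φhat ht)
  set K := kOp (kerN N (φhat t))
  set M : Rn n → ℝ := fun ξ => lowCut N ξ * sqW ν (ρ t) κ ξ
  have h1 : (inner ℂ v (sqOp (lowCut N) ν (ρ t) κ (K v))).re = -(inner ℂ v (K (mulOp M v))).re := by
    rw [sqOp, ← inner_mulOp hb]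
    have h2 := hanti.inner_kOp_left hD (mulOp M v) v
    have h3 : (inner ℂ (K (mulOp M v)) v).re = (inner ℂ v (K (mulOp M v))).re :=
      inner_re_symm (𝕜 := ℂ) _ _
    rw [← h3, h2, Complex.neg_re, neg_neg]
  have hae : (fun p : Rn n × Rn n => starRingEnd ℂ (v p.1) * (kerN N (φhat t) p * (mulOp M v) p.2))
      =ᵐ[volume.prod volume] fun p => starRingEnd ℂ (v p.1) *
        (kerN N (φhat t) p * ((M p.2 : ℂ) * v p.2)) := by
    filter_upwards [ae_snd (coeFn_mulOp hb v)] with p hp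
    rw [hp]
  have hint := (hD.integrable v (mulOp M v)).congr hae
  rw [h1, mul_neg, abs_neg, inner_kOp hD, kform, integral_congr_ae hae]
  refine (ofReal_abs_re_form_le hanti hint).trans ?_
  refine le_trans (lintegral_mono fun p => ?_)
    (hC (ρ t) (fun _ => 1) (φhat t) v (S.ρ_nonneg t ht) (fun _ => zero_le_one) (fun _ => le_rfl)
      (fun ξ η => by simp) (S.aesm ht) (L2.measurable v))
  by_cases h : jap p.1 ≤ N ∧ jap p.2 ≤ N
  · have e1 : M p.1 = 1 * sqW ν (ρ t) κ p.1 := by simp [M, lowCut, h.1]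
    have e2 : M p.2 = 1 * sqW ν (ρ t) κ p.2 := by simp [M, lowCut, h.2]
    rw [e1, e2, ENNReal.ofReal_mul (abs_nonneg _)]
    refine mul_le_mul' le_rfl (mul_le_mul' ?_ le_rfl)
    rw [mul_assoc]
    exact mul_le_mul' le_rfl (enorm_kerN_le N (φhat t) p)
  · have e0 : kerN N (φhat t) p = 0 := by
      rw [not_and_or] at h
      rcases h with h | h <;> simp [kerN, lowCut, h]
    rw [e0]; simp

/-- The bound of the truncated generator between weighted spaces. -/
theorem enorm_inner_sqOp_kOp_le (S : Phase) {k : ℝ} {C : ℝ≥0}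
    (hC : TransportBound n ν l lLow k (ν / 2) C) {N : ℝ} (hN : 0 ≤ N) {t : ℝ} (ht : T ≤ t)
    (d v : L2 n) :
    ‖inner ℂ d (sqOp (lowCut N) ν (ρ t) k (kOp (kerN N (φhat t)) v))‖ₑ ≤
      C * yNorm ν (ρ t) l lLow (φhat t) *
        (kN ν (ρ t) (k + ν / 2) d * kN ν (ρ t) (k + 1 - ν / 2) v) := by
  obtain ⟨D, hD⟩ := S.KBdd_kerN hN ht
  have hb := (isCut_lowCut (n := n) N).bddMeas ν (ρ t) k
  rw [sqOp, ← inner_mulOp hb, inner_kOp hD]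
  refine (enorm_kform_le _ _ _).trans ?_
  refine le_trans (lintegral_mono_ae ?_)
    (hC (ρ t) (fun ξ => ofReal (jap ξ ^ (k + ν / 2) * exp (ρ t * jap ξ ^ ν)) * ‖d ξ‖ₑ)
      (φhat t) v (S.ρ_nonneg t ht) (measurable_weight_mul (L2.measurable d)) (S.aesm ht)
      (L2.measurable v))
  filter_upwards [ae_fst (coeFn_mulOp hb d)] with p hp
  have hj := jap_pos p.1
  have h1 := Real.rpow_pos_of_pos hj (k + ν / 2)
  have h2 := Real.rpow_pos_of_pos hj (k - ν / 2)
  rw [hp, enorm_mul]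
  have h3 : ‖((lowCut N p.1 * sqW ν (ρ t) k p.1 : ℝ) : ℂ)‖ₑ ≤
      ofReal (jap p.1 ^ (k + ν / 2) * exp (ρ t * jap p.1 ^ ν)) *
        ofReal (jap p.1 ^ (k - ν / 2) * exp (ρ t * jap p.1 ^ ν)) := by
    rw [← ofReal_norm, Complex.norm_real, Real.norm_eq_abs, abs_of_nonneg
      (mul_nonneg (lowCut_nonneg N _) (sqW_pos _ _ _ _).le), ← ENNReal.ofReal_mul (by positivity)]
    refine ENNReal.ofReal_le_ofReal ?_
    refine (mul_le_of_le_one_left (sqW_pos _ _ _ _).le (lowCut_le_one N _)).trans_eq ?_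
    rw [sqW, show 2 * k = (k + ν / 2) + (k - ν / 2) by ring, Real.rpow_add hj]; ring
  rw [ENNReal.ofReal_mul (p := jap p.1 ^ (k - ν / 2) * exp (ρ t * jap p.1 ^ ν)) (by positivity)]
  calc _ ≤ (ofReal (jap p.1 ^ (k + ν / 2) * exp (ρ t * jap p.1 ^ ν)) *
        ofReal (jap p.1 ^ (k - ν / 2) * exp (ρ t * jap p.1 ^ ν))) * ‖d p.1‖ₑ *
        ((ofReal |sqDiff p| * ‖φhat t (p.1 - p.2)‖ₑ) * ‖v p.2‖ₑ) := by
        gcongr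
        exact enorm_kerN_le N (φhat t) p
    _ = _ := by ring

/-- The difference of two truncated generators acts through the high frequencies only. -/
theorem enorm_inner_kOp_sub_le (S : Phase) {C : ℝ≥0}
    (hC : TransportBound n ν l lLow 0 0 C) {N M : ℝ} (hN : 0 ≤ N) (hNM : N ≤ M) {t : ℝ}
    (ht : T ≤ t) (d : L2 n) {v : L2 n} (hv : mulOp (lowCut N) v = v) :
    ‖inner ℂ d (kOp (kerN M (φhat t)) v - kOp (kerN N (φhat t)) v)‖ₑ ≤
      C * yNorm ν (ρ t) l lLow (φhat t) *
        (ofReal (exp (-(ρ t * N ^ ν))) * ‖d‖ₑ * kN ν (ρ t) 1 v) := by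
  obtain ⟨D, hD⟩ := S.KBdd_kerN hN ht
  obtain ⟨E, hE⟩ := S.KBdd_kerN (hN.trans hNM) ht
  have hv' := coeFn_mulOp (bddMeas_lowCut N) v
  rw [hv] at hv'
  rw [inner_sub_right, inner_kOp hD, inner_kOp hE, kform, kform,
    ← integral_sub (hE.integrable d v) (hD.integrable d v)]
  refine (enorm_integral_le_lintegral_enorm _).trans ?_
  set P : Rn n → ℝ≥0∞ := fun ξ => ofReal (exp (-(ρ t * N ^ ν))) * ‖d ξ‖ₑ with hP
  have hPm : Measurable P := (L2.measurable d).enorm.const_mul _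
  have hPn : n2 P = ofReal (exp (-(ρ t * N ^ ν))) * ‖d‖ₑ := by
    have hb : BddMeas fun _ : Rn n => exp (-(ρ t * N ^ ν)) :=
      ⟨measurable_const, _, fun _ => le_rfl⟩
    have h1 := enorm_mulOp hb d
    rw [abs_of_pos (Real.exp_pos _)] at h1
    have h2 : (mulOp fun _ : Rn n => exp (-(ρ t * N ^ ν))) d =
        ((exp (-(ρ t * N ^ ν)) : ℝ) : ℂ) • d := by
      apply Lp.ext
      filter_upwards [coeFn_mulOp hb d, Lp.coeFn_smul ((exp (-(ρ t * N ^ ν)) : ℝ) : ℂ) d]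
        with ξ h3 h4
      rw [h3, h4]; rfl
    rw [← h1, h2, enorm_smul, ← ofReal_norm, Complex.norm_real, Real.norm_of_nonneg
      (Real.exp_pos _).le]
  have hmain := hC (ρ t) P (φhat t) v (S.ρ_nonneg t ht) hPm (S.aesm ht) (L2.measurable v)
  rw [hPn] at hmain
  simp only [sub_zero, zero_add] at hmain
  refine le_trans (lintegral_mono_ae ?_) hmain
  filter_upwards [ae_snd hv'] with p hp
  by_cases h2 : jap p.2 ≤ N
  swap
  · have : v p.2 = 0 := by rw [hp]; simp [lowCut, h2]
    simp [this]
  by_cases h1 : jap p.1 ≤ N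
  · have : kerN M (φhat t) p = kerN N (φhat t) p := by
      simp [kerN, lowCut, h1, h2, h1.trans hNM, h2.trans hNM]
    simp [this]
  have e0 : kerN N (φhat t) p = 0 := by simp [kerN, lowCut, h1]
  rw [e0, zero_mul, mul_zero, sub_zero, enorm_mul, enorm_mul, RCLike.enorm_conj, hP,
    Real.rpow_zero, one_mul]
  have h3 : (1 : ℝ≥0∞) ≤ ofReal (exp (-(ρ t * N ^ ν))) *
      ofReal (exp (ρ t * jap p.1 ^ ν)) := by
    rw [← ENNReal.ofReal_mul (Real.exp_pos _).le, ← Real.exp_add, ENNReal.one_le_ofReal,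
      Real.one_le_exp_iff]
    have := Real.rpow_le_rpow hN (not_le.1 h1).le S.hν.le
    nlinarith [S.ρ_nonneg t ht]
  rw [ENNReal.ofReal_mul (Real.exp_pos _).le]
  calc ‖d p.1‖ₑ * (‖kerN M (φhat t) p‖ₑ * ‖v p.2‖ₑ)
      ≤ 1 * (‖d p.1‖ₑ * ((ofReal |sqDiff p| * ‖φhat t (p.1 - p.2)‖ₑ) * ‖v p.2‖ₑ)) := by
        rw [one_mul]; gcongr; exact enorm_kerN_le M (φhat t) p
    _ ≤ (ofReal (exp (-(ρ t * N ^ ν))) *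
      ofReal (exp (ρ t * jap p.1 ^ ν))) *
        (‖d p.1‖ₑ * ((ofReal |sqDiff p| * ‖φhat t (p.1 - p.2)‖ₑ) * ‖v p.2‖ₑ)) := by gcongr
    _ = _ := by ring

end PhaseSetup

/-- Solutions of the evolution equation truncated at frequency `N`. -/
structure IsApprox (φhat : ℝ → Rn n → ℂ) (T t₀ N : ℝ) (u : ℝ → L2 n) : Prop where
  deriv : ∀ t ∈ Icc T t₀,
    HasDerivWithinAt u ((2 * t ^ 2)⁻¹ • kOp (kerN N (φhat t)) (u t)) (Icc T t₀) t
  trunc : ∀ t ∈ Icc T t₀, mulOp (lowCut N) (u t) = u t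

theorem IsApprox.continuousOn {φhat : ℝ → Rn n → ℂ} {T t₀ N : ℝ} {u : ℝ → L2 n}
    (h : IsApprox φhat T t₀ N u) : ContinuousOn u (Icc T t₀) :=
  fun t ht => (h.deriv t ht).continuousWithinAt

theorem IsApprox.sub {φhat : ℝ → Rn n → ℂ} {T t₀ N : ℝ} {u v : ℝ → L2 n}
    (hu : IsApprox φhat T t₀ N u) (hv : IsApprox φhat T t₀ N v) :
    IsApprox φhat T t₀ N (u - v) where
  deriv t ht := by
    have := (hu.deriv t ht).sub (hv.deriv t ht)
    rwa [← smul_sub, ← map_sub] at this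
  trunc t ht := by rw [Pi.sub_apply, map_sub, hu.trunc t ht, hv.trunc t ht]

namespace PhaseSetup

theorem re_inner_kOp_kerN (S : Phase) {N : ℝ} (hN : 0 ≤ N)
    {t : ℝ} (ht : T ≤ t) (v : L2 n) : (inner ℂ v (kOp (kerN N (φhat t)) v)).re = 0 := by
  obtain ⟨D, hD⟩ := S.KBdd_kerN hN ht
  have h2 := (antiHerm_kerN N (S.conj_φhat ht)).inner_kOp_left hD v v
  have h3 : (inner ℂ (kOp (kerN N (φhat t)) v) v).re = (inner ℂ v (kOp (kerN N (φhat t)) v)).re :=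
    inner_re_symm (𝕜 := ℂ) _ _
  rw [h2, Complex.neg_re] at h3
  linarith

theorem mulOp_lowCut_kOp (S : Phase) {N : ℝ} (hN : 0 ≤ N)
    {t : ℝ} (ht : T ≤ t) (v : L2 n) :
    mulOp (lowCut N) (kOp (kerN N (φhat t)) v) = kOp (kerN N (φhat t)) v := by
  obtain ⟨D, hD⟩ := S.KBdd_kerN hN ht
  refine ext_inner_left ℂ fun w => ?_
  rw [← inner_mulOp (bddMeas_lowCut N), inner_kOp hD, inner_kOp hD]
  refine integral_congr_ae ?_
  filter_upwards [ae_fst (coeFn_mulOp (bddMeas_lowCut N) w)] with p hp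
  rw [hp]
  by_cases h : jap p.1 ≤ N
  · simp [lowCut, h]
  · simp [kerN, lowCut, h]

theorem exists_isApprox (S : Phase) {N : ℝ} (hN : 0 ≤ N)
    {t₀ : ℝ} (ht₀ : T ≤ t₀) (z : L2 n) :
    ∃ u, IsApprox φhat T t₀ N u ∧ u t₀ = mulOp (lowCut N) z := by
  have hpos : ∀ t ∈ Icc T t₀, 0 < 2 * t ^ 2 := fun t ht => by
    have : 0 < t := zero_lt_one.trans_le (S.hT.trans ht.1)
    positivity
  have hL : ContinuousOn (fun t : ℝ => (2 * t ^ 2)⁻¹ • kOp (kerN N (φhat t))) (Icc T t₀) :=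
    (ContinuousOn.inv₀ (by fun_prop) fun t ht => (hpos t ht).ne').smul
      ((S.continuousOn_kOp_kerN hN).mono Icc_subset_Ici_self)
  obtain ⟨u, hu0, hu⟩ := exists_linear_ode ht₀ hL (fun t ht x => by
    change (inner ℂ x ((2 * t ^ 2)⁻¹ • kOp (kerN N (φhat t)) x)).re = 0
    rw [← L2.ofReal_smul, inner_smul_right, Complex.re_ofReal_mul,
      S.re_inner_kOp_kerN hN ht.1, mul_zero]) (mulOp (lowCut N) z)
  have hsq : mulOp (lowCut N) (mulOp (lowCut N) z) = mulOp (lowCut N) z := by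
    rw [mulOp_mulOp (bddMeas_lowCut N) (bddMeas_lowCut N)]
    congr 2; ext ξ; exact lowCut_mul_self N ξ
  refine ⟨u, ⟨fun t ht => hu t ht, fun t ht => ?_⟩, hu0⟩
  have hd : ∀ t ∈ Icc T t₀, HasDerivWithinAt (fun t => u t - mulOp (lowCut N) (u t)) 0 (Icc T t₀) t := by
    intro t ht
    have h1 := (hu t ht).sub (hasDerivWithinAt_clm_apply (hasDerivWithinAt_const t _
      (mulOp (n := n) (lowCut N))) (hu t ht))
    refine h1.congr_deriv ?_
    change (2 * t ^ 2)⁻¹ • kOp (kerN N (φhat t)) (u t) - (0 + mulOp (lowCut N)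
      ((2 * t ^ 2)⁻¹ • kOp (kerN N (φhat t)) (u t))) = 0
    rw [zero_add, ← L2.ofReal_smul, map_smul, S.mulOp_lowCut_kOp hN ht.1, sub_self]
  have hQ := constant_of_has_deriv_right_zero (fun t ht => (hd t ht).continuousWithinAt) fun t ht =>
        (hd t (Ico_subset_Icc_self ht)).mono_of_mem_nhdsWithin (Icc_mem_nhdsGE_of_mem ht)
  have h3 := (hQ t ht).trans (hQ t₀ (right_mem_Icc.2 ht₀)).symm
  rw [hu0, hsq, sub_self, sub_eq_zero] at h3
  exact h3.symm

end PhaseSetup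

/-! ### Energy estimates for the truncated evolution -/

theorem IsCut.continuousOn_energy {χ : Rn n → ℝ} (hχ : IsCut χ) (ν κ : ℝ) {ρ : ℝ → ℝ}
    {u : ℝ → L2 n} {s : Set ℝ} (hρ : ContinuousOn ρ s) (hu : ContinuousOn u s) :
    ContinuousOn (fun t => energy χ ν (ρ t) κ (u t)) s :=
  Complex.continuous_re.comp_continuousOn
    (hu.inner ((((hχ.continuous_sqOp ν κ).comp_continuousOn hρ)).clm_apply hu))

theorem lintegral_rateMeasure {r : ℝ → ℝ} {I : Set ℝ} (hI : MeasurableSet I)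
    (hr : ContinuousOn r I) (f : ℝ → ℝ≥0∞) :
    ∫⁻ t, f t ∂(rateMeasure r I) = ∫⁻ t in I, ofReal (r t) * f t :=
  lintegral_withDensity_eq_lintegral_mul_non_measurable₀ _
    (ENNReal.measurable_ofReal.comp_aemeasurable (hr.aemeasurable hI))
    (Eventually.of_forall fun _ => ENNReal.ofReal_lt_top) f

/-- Conversion of a weighted time integral of a continuous nonnegative function. -/
theorem ofReal_intervalIntegral_rate {r f : ℝ → ℝ} {t₁ t₂ : ℝ} (h : t₁ ≤ t₂)
    (hr : ContinuousOn r (Icc t₁ t₂)) (hr0 : ∀ t ∈ Icc t₁ t₂, 0 ≤ r t)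
    (hf : ContinuousOn f (Icc t₁ t₂)) (hf0 : ∀ t ∈ Icc t₁ t₂, 0 ≤ f t) :
    ofReal (∫ t in t₁..t₂, r t * f t) =
      ∫⁻ t, ofReal (f t) ∂(rateMeasure r (Icc t₁ t₂)) := by
  rw [intervalIntegral.integral_of_le h, ← integral_Icc_eq_integral_Ioc,
    ofReal_integral_eq_lintegral_ofReal ((hr.fun_mul hf).integrableOn_Icc)
      ((ae_restrict_iff' measurableSet_Icc).2 (Eventually.of_forall fun t ht =>
        mul_nonneg (hr0 t ht) (hf0 t ht))), lintegral_rateMeasure measurableSet_Icc hr]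
  refine setLIntegral_congr_fun measurableSet_Icc fun t ht => ?_
  rw [ENNReal.ofReal_mul (hr0 t ht)]

theorem AntitoneOn.hasDerivAt_nonpos {f : ℝ → ℝ} {T t f' : ℝ} (hf : AntitoneOn f (Ici T))
    (ht : T < t) (h : HasDerivAt f f' t) : f' ≤ 0 := by
  have h1 : Tendsto (slope f t) (𝓝[>] t) (𝓝 f') :=
    (hasDerivAt_iff_tendsto_slope.1 h).mono_left (nhdsWithin_mono t fun s hs => ne_of_gt hs)
  refine le_of_tendsto h1 ?_
  filter_upwards [self_mem_nhdsWithin] with s hs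
  have hs' : t < s := hs
  rw [slope_def_field]
  exact div_nonpos_of_nonpos_of_nonneg
    (sub_nonpos.2 (hf ht.le (ht.le.trans hs'.le) hs'.le)) (sub_nonneg.2 hs'.le)

namespace PhaseSetup

theorem two_mul_sq_inv (S : Phase) {t : ℝ} (ht : T ≤ t) :
    (2 * t ^ 2)⁻¹ * h₀ t ≤ r t * h₁ t / 2 ∧ 0 < (2 * t ^ 2)⁻¹ := by
  have h1 := S.couple t ht
  have h2 : 0 < t := zero_lt_one.trans_le (S.hT.trans ht)
  refine ⟨?_, by positivity⟩
  rw [mul_inv, mul_assoc]; linarith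

theorem yNorm_le_ofReal (S : Phase) {t : ℝ} (ht : T ≤ t)
    (C : ℝ≥0) : C * yNorm ν (ρ t) l lLow (φhat t) ≤ ofReal (C * b * h₀ t) := by
  rw [ENNReal.ofReal_mul (by positivity), ENNReal.ofReal_mul (by positivity),
    ENNReal.ofReal_coe_nnreal, ENNReal.ofReal_coe_nnreal, mul_assoc]
  gcongr
  exact S.bound t ht

theorem abs_commutator_le (S : Phase) {κ : ℝ} {C : ℝ≥0}
    (hC : CommutatorBound n ν l lLow κ C) {N : ℝ} (hN : 0 ≤ N) {t : ℝ} (ht : T ≤ t) {v : L2 n}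
    (hv : mulOp (lowCut N) v = v) :
    |2 * (inner ℂ v (sqOp (lowCut N) ν (ρ t) κ (kOp (kerN N (φhat t)) v))).re| ≤
      C * b * h₀ t * energy (lowCut N) ν (ρ t) (κ + ν / 2) v := by
  have h0 := (S.h₀pos t ht).le
  have he := (isCut_lowCut (n := n) N).energy_nonneg ν (ρ t) (κ + ν / 2) v
  rw [← ENNReal.ofReal_le_ofReal_iff (by positivity), ENNReal.ofReal_mul (by positivity),
    ofReal_energy_lowCut hv]
  refine (S.ofReal_commutator_le hC hN ht v).trans ?_
  gcongr
  exact S.yNorm_le_ofReal ht C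

/-- The weighted energy controls its own dissipation, which comes from the growth of the radius. -/
theorem energy_add_integral_le (S : Phase) {κ : ℝ} {C : ℝ≥0}
    (hC : CommutatorBound n ν l lLow κ C) (hsmall : C * b * h₁ T ≤ 2) {N : ℝ} (hN : 0 ≤ N)
    {t₀ : ℝ} {u : ℝ → L2 n} (hu : IsApprox φhat T t₀ N u) {t₁ t₂ : ℝ} (ht₁ : T ≤ t₁)
    (h12 : t₁ ≤ t₂) (ht₂ : t₂ ≤ t₀) :
    energy (lowCut N) ν (ρ t₁) κ (u t₁) +
      ∫ t in t₁..t₂, r t * energy (lowCut N) ν (ρ t) (κ + ν / 2) (u t) ≤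
      energy (lowCut N) ν (ρ t₂) κ (u t₂) := by
  have hsub : Icc t₁ t₂ ⊆ Icc T t₀ := Icc_subset_Icc ht₁ ht₂
  have hχ := isCut_lowCut (n := n) N
  have hρc : ContinuousOn ρ (Icc t₁ t₂) := S.ρcont.mono fun t ht => ht₁.trans ht.1
  have hrc : ContinuousOn r (Icc t₁ t₂) := S.rcont.mono fun t ht => ht₁.trans ht.1
  have huc := hu.continuousOn.mono hsub
  have hmain := intervalIntegral.integral_le_sub_of_hasDeriv_right_of_le h12
    (hχ.continuousOn_energy ν κ hρc huc)
    (g' := fun t => 2 * r t * energy (lowCut N) ν (ρ t) (κ + ν / 2) (u t) +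
        2 * (inner ℂ (u t) (sqOp (lowCut N) ν (ρ t) κ
          ((2 * t ^ 2)⁻¹ • kOp (kerN N (φhat t)) (u t)))).re)
    (fun t ht => by
      have htT : T < t := ht₁.trans_lt ht.1
      have htI : t ∈ Ico T t₀ := ⟨htT.le, ht.2.trans_le ht₂⟩
      refine hasDerivWithinAt_energy hχ ν κ (S.ρderiv t htT).hasDerivWithinAt ?_
      exact ((hu.deriv t (Ico_subset_Icc_self htI)).mono_of_mem_nhdsWithin
        (Icc_mem_nhdsGE_of_mem htI)).mono Ioi_subset_Ici_self)
    (φ := fun t => r t * energy (lowCut N) ν (ρ t) (κ + ν / 2) (u t))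
    (hrc.mul (hχ.continuousOn_energy ν _ hρc huc)).integrableOn_Icc
    (fun t ht => by
      have htT : T < t := ht₁.trans_lt ht.1
      have htI : t ∈ Icc T t₀ := ⟨htT.le, (ht.2.trans_le ht₂).le⟩
      obtain ⟨hc1, hc2⟩ := S.two_mul_sq_inv htT.le
      have hcom := S.abs_commutator_le hC hN htT.le (hu.trunc t htI)
      have he := hχ.energy_nonneg ν (ρ t) (κ + ν / 2) (u t)
      have hr := S.rpos t htT.le
      have hh : h₁ t ≤ h₁ T := S.h₁anti self_mem_Ici htT.le htT.le
      set e := energy (lowCut N) ν (ρ t) (κ + ν / 2) (u t)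
      rw [← L2.ofReal_smul, map_smul, inner_smul_right, Complex.re_ofReal_mul]
      set x := (inner ℂ (u t) (sqOp (lowCut N) ν (ρ t) κ (kOp (kerN N (φhat t)) (u t)))).re
      have h1 : (2 * t ^ 2)⁻¹ * |2 * x| ≤ r t * e := by
        calc (2 * t ^ 2)⁻¹ * |2 * x| ≤ (2 * t ^ 2)⁻¹ * (C * b * h₀ t * e) := by gcongr
          _ = (C * b) * ((2 * t ^ 2)⁻¹ * h₀ t) * e := by ring
          _ ≤ (C * b) * (r t * h₁ t / 2) * e := by gcongr
          _ = (C * b * h₁ t) / 2 * (r t * e) := by ring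
          _ ≤ (C * b * h₁ T) / 2 * (r t * e) := by gcongr
          _ ≤ 1 * (r t * e) := by gcongr; linarith
          _ = r t * e := one_mul _
      have h2 := neg_abs_le (2 * x)
      nlinarith)
  linarith

/-- Norm form of the energy inequality. -/
theorem kN_sq_add_lintegral_le (S : Phase) {κ : ℝ} {C : ℝ≥0}
    (hC : CommutatorBound n ν l lLow κ C) (hsmall : C * b * h₁ T ≤ 2) {N : ℝ} (hN : 0 ≤ N)
    {t₀ : ℝ} {u : ℝ → L2 n} (hu : IsApprox φhat T t₀ N u) {t₁ t₂ : ℝ} (ht₁ : T ≤ t₁)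
    (h12 : t₁ ≤ t₂) (ht₂ : t₂ ≤ t₀) :
    kN ν (ρ t₁) κ (u t₁) ^ 2 +
      ∫⁻ t, kN ν (ρ t) (κ + ν / 2) (u t) ^ 2 ∂(rateMeasure r (Icc t₁ t₂)) ≤
      kN ν (ρ t₂) κ (u t₂) ^ 2 := by
  have hsub : Icc t₁ t₂ ⊆ Icc T t₀ := Icc_subset_Icc ht₁ ht₂
  have hχ := isCut_lowCut (n := n) N
  have hρc : ContinuousOn ρ (Icc t₁ t₂) := S.ρcont.mono fun t ht => ht₁.trans ht.1
  have hrc : ContinuousOn r (Icc t₁ t₂) := S.rcont.mono fun t ht => ht₁.trans ht.1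
  have h := ENNReal.ofReal_le_ofReal (S.energy_add_integral_le hC hsmall hN hu ht₁ h12 ht₂)
  rw [ENNReal.ofReal_add (hχ.energy_nonneg _ _ _ _)
    (intervalIntegral.integral_nonneg h12 fun t ht => mul_nonneg (S.rpos t (ht₁.trans ht.1)).le
      (hχ.energy_nonneg _ _ _ _)),
    ofReal_intervalIntegral_rate h12 hrc (fun t ht => (S.rpos t (ht₁.trans ht.1)).le)
      (hχ.continuousOn_energy ν _ hρc (hu.continuousOn.mono hsub))
      (fun t ht => hχ.energy_nonneg _ _ _ _),
    ofReal_energy_lowCut (hu.trunc t₁ (hsub (left_mem_Icc.2 h12))),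
    ofReal_energy_lowCut (hu.trunc t₂ (hsub (right_mem_Icc.2 h12)))] at h
  refine le_trans (le_of_eq ?_) h
  congr 1
  rw [lintegral_rateMeasure measurableSet_Icc hrc, lintegral_rateMeasure measurableSet_Icc hrc]
  refine setLIntegral_congr_fun measurableSet_Icc fun t ht => ?_
  rw [ofReal_energy_lowCut (hu.trunc t (hsub ht))]

theorem norm_approx (S : Phase) {N : ℝ} (hN : 0 ≤ N)
    {t₀ : ℝ} {u : ℝ → L2 n} (hu : IsApprox φhat T t₀ N u) {t : ℝ} (ht : t ∈ Icc T t₀) :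
    ‖u t‖ = ‖u t₀‖ := by
  have hd : ∀ t ∈ Icc T t₀, HasDerivWithinAt (fun t => (inner ℂ (u t) (u t)).re) 0 (Icc T t₀) t := by
    intro t ht
    refine (hasDerivWithinAt_re_inner (hu.deriv t ht) (hu.deriv t ht)).congr_deriv ?_
    have h2 : (inner ℂ ((2 * t ^ 2)⁻¹ • kOp (kerN N (φhat t)) (u t)) (u t)).re =
        (inner ℂ (u t) ((2 * t ^ 2)⁻¹ • kOp (kerN N (φhat t)) (u t))).re :=
      inner_re_symm (𝕜 := ℂ) _ _
    rw [h2, ← L2.ofReal_smul, inner_smul_right, Complex.re_ofReal_mul,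
      S.re_inner_kOp_kerN hN ht.1, mul_zero, add_zero]
  have hQ := constant_of_has_deriv_right_zero (fun t ht => (hd t ht).continuousWithinAt) fun t ht =>
        (hd t (Ico_subset_Icc_self ht)).mono_of_mem_nhdsWithin (Icc_mem_nhdsGE_of_mem ht)
  have h3 := (hQ t ht).trans (hQ t₀ (right_mem_Icc.2 (ht.1.trans ht.2))).symm
  have h4 : ∀ x : L2 n, (inner ℂ x x).re = ‖x‖ ^ 2 := fun x => inner_self_eq_norm_sq (𝕜 := ℂ) x
  rw [h4, h4] at h3
  exact (pow_left_inj₀ (norm_nonneg _) (norm_nonneg _) two_ne_zero).1 h3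

theorem sqrt_energy_eq {N : ℝ} {v : L2 n} (hv : mulOp (lowCut N) v = v) (ν ρ κ : ℝ) :
    kN ν ρ κ v = ofReal √(energy (lowCut N) ν ρ κ v) := by
  have h := ofReal_energy_lowCut hv ν ρ κ
  rw [← Real.sq_sqrt ((isCut_lowCut N).energy_nonneg ν ρ κ v),
    ENNReal.ofReal_pow (Real.sqrt_nonneg _)] at h
  exact ((ENNReal.pow_right_strictMono two_ne_zero).injective h).symm

/-- The growth of the distance to a fixed function is controlled by the dissipation. -/
theorem drift_add_integral_le (S : Phase) {k kBar : ℝ}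
    {C : ℝ≥0} (hC : TransportBound n ν l lLow k (ν / 2) C) (hkk : k + 1 - ν ≤ kBar)
    {N : ℝ} (hN : 0 ≤ N) {t₀ : ℝ} {u : ℝ → L2 n} (hu : IsApprox φhat T t₀ N u) {z : L2 n}
    (hz : mulOp (lowCut N) z = z) {t₁ : ℝ} (ht₁ : T ≤ t₁) (h12 : t₁ ≤ t₀) :
    (h₁ t₁ ^ 2)⁻¹ * energy (lowCut N) ν (ρ t₁) k (u t₁ - z) +
      ∫ t in t₁..t₀, r t * ((h₁ t ^ 2)⁻¹ * energy (lowCut N) ν (ρ t) (k + ν / 2) (u t - z)) ≤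
      (h₁ t₀ ^ 2)⁻¹ * energy (lowCut N) ν (ρ t₀) k (u t₀ - z) + (C * b) ^ 2 *
        ∫ t in t₁..t₀, r t * energy (lowCut N) ν (ρ t) (kBar + ν / 2) (u t) := by
  have hsub : Icc t₁ t₀ ⊆ Icc T t₀ := Icc_subset_Icc ht₁ le_rfl
  have hχ := isCut_lowCut (n := n) N
  have hρc : ContinuousOn ρ (Icc t₁ t₀) := S.ρcont.mono fun t ht => ht₁.trans ht.1
  have hrc : ContinuousOn r (Icc t₁ t₀) := S.rcont.mono fun t ht => ht₁.trans ht.1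
  have hhc : ContinuousOn (fun t => (h₁ t ^ 2)⁻¹) (Icc t₁ t₀) :=
    ((S.h₁cont.mono fun t (ht : t ∈ Icc t₁ t₀) => ht₁.trans ht.1).pow 2).inv₀ fun t ht =>
      (pow_pos (S.h₁pos t (ht₁.trans ht.1)) 2).ne'
  have huc := hu.continuousOn.mono hsub
  have hdc : ContinuousOn (fun t => u t - z) (Icc t₁ t₀) := huc.sub continuousOn_const
  have hi1 := (hrc.fun_mul (hhc.fun_mul (hχ.continuousOn_energy ν (k + ν / 2) hρc hdc)))
  have hi2 := (hrc.fun_mul (hχ.continuousOn_energy ν (kBar + ν / 2) hρc huc))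
  have hmain := intervalIntegral.integral_le_sub_of_hasDeriv_right_of_le h12
    (hhc.fun_mul (hχ.continuousOn_energy ν k hρc hdc))
    (g' := fun t => (-(2 * h₁ t * deriv h₁ t) / (h₁ t ^ 2) ^ 2) *
        energy (lowCut N) ν (ρ t) k (u t - z) + (h₁ t ^ 2)⁻¹ *
        (2 * r t * energy (lowCut N) ν (ρ t) (k + ν / 2) (u t - z) +
        2 * (inner ℂ (u t - z) (sqOp (lowCut N) ν (ρ t) k
          ((2 * t ^ 2)⁻¹ • kOp (kerN N (φhat t)) (u t)))).re))
    (fun t ht => by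
      have htT : T < t := ht₁.trans_lt ht.1
      have htI : t ∈ Ico T t₀ := ⟨htT.le, ht.2⟩
      refine HasDerivWithinAt.mul ?_ (hasDerivWithinAt_energy hχ ν k
        (S.ρderiv t htT).hasDerivWithinAt ?_)
      · have h := (((S.h₁diff t htT).hasDerivAt.pow 2).inv (pow_pos (S.h₁pos t htT.le) 2).ne')
        exact HasDerivWithinAt.congr_deriv (f := fun t => (h₁ t ^ 2)⁻¹) h.hasDerivWithinAt (by simp)
      · exact (((hu.deriv t (Ico_subset_Icc_self htI)).mono_of_mem_nhdsWithin
          (Icc_mem_nhdsGE_of_mem htI)).mono Ioi_subset_Ici_self).sub_const z)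
    (φ := fun t => r t * ((h₁ t ^ 2)⁻¹ * energy (lowCut N) ν (ρ t) (k + ν / 2) (u t - z)) -
      (C * b) ^ 2 * (r t * energy (lowCut N) ν (ρ t) (kBar + ν / 2) (u t)))
    (hi1.sub (continuousOn_const.fun_mul hi2)).integrableOn_Icc
    (fun t ht => by
      have htT : T < t := ht₁.trans_lt ht.1
      have htI : t ∈ Icc T t₀ := ⟨htT.le, ht.2.le⟩
      obtain ⟨hc1, hc2⟩ := S.two_mul_sq_inv htT.le
      have hr := S.rpos t htT.le
      have hh := S.h₁pos t htT.le
      have h0 := S.h₀pos t htT.le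
      have hd' : deriv h₁ t ≤ 0 := S.h₁anti.hasDerivAt_nonpos htT (S.h₁diff t htT).hasDerivAt
      have ht1 : mulOp (lowCut N) (u t - z) = u t - z := by rw [map_sub, hu.trunc t htI, hz]
      have hen := hχ.energy_nonneg ν (ρ t) k (u t - z)
      have he := hχ.energy_nonneg ν (ρ t) (k + ν / 2) (u t - z)
      have hU := hχ.energy_nonneg ν (ρ t) (kBar + ν / 2) (u t)
      have hbd := S.enorm_inner_sqOp_kOp_le hC hN htT.le (u t - z) (u t)
      have hbd2 := (hbd.trans (mul_le_mul' (S.yNorm_le_ofReal htT.le C) (mul_le_mul' le_rfl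
        (kN_mono_right (show k + 1 - ν / 2 ≤ kBar + ν / 2 by linarith) ν (ρ t) (u t)))))
      rw [sqrt_energy_eq ht1, sqrt_energy_eq (hu.trunc t htI),
        ← ENNReal.ofReal_mul (Real.sqrt_nonneg _), ← ENNReal.ofReal_mul (by positivity),
        ← ofReal_norm, ENNReal.ofReal_le_ofReal_iff (by positivity)] at hbd2
      rw [← L2.ofReal_smul, map_smul, inner_smul_right, Complex.re_ofReal_mul]
      have hx := (Complex.abs_re_le_norm _).trans hbd2
      set x := (inner ℂ (u t - z) (sqOp (lowCut N) ν (ρ t) k (kOp (kerN N (φhat t)) (u t)))).re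
      rw [← Real.sq_sqrt he, ← Real.sq_sqrt hU]
      set D := √(energy (lowCut N) ν (ρ t) (k + ν / 2) (u t - z))
      set W := √(energy (lowCut N) ν (ρ t) (kBar + ν / 2) (u t))
      have hD : 0 ≤ D := Real.sqrt_nonneg _
      have hW : 0 ≤ W := Real.sqrt_nonneg _
      have h1 : 0 ≤ (-(2 * h₁ t * deriv h₁ t) / (h₁ t ^ 2) ^ 2) *
          energy (lowCut N) ν (ρ t) k (u t - z) := by
        refine mul_nonneg (div_nonneg ?_ (by positivity)) hen
        nlinarith
      have h2 : (2 * t ^ 2)⁻¹ * |x| ≤ C * b * (r t * h₁ t / 2) * (D * W) := by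
        calc (2 * t ^ 2)⁻¹ * |x| ≤ (2 * t ^ 2)⁻¹ * (C * b * h₀ t * (D * W)) := by gcongr
          _ = (C * b) * ((2 * t ^ 2)⁻¹ * h₀ t) * (D * W) := by ring
          _ ≤ (C * b) * (r t * h₁ t / 2) * (D * W) := by gcongr
      have h3 := neg_abs_le x
      have h4 : -(C * b * (r t * h₁ t / 2) * (D * W)) ≤ (2 * t ^ 2)⁻¹ * x := by nlinarith
      have h5 : r t * ((h₁ t ^ 2)⁻¹ * D ^ 2) - (C * b) ^ 2 * (r t * W ^ 2) ≤
          (h₁ t ^ 2)⁻¹ * (2 * r t * D ^ 2 + 2 * -(C * b * (r t * h₁ t / 2) * (D * W))) := by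
        have e1 : (h₁ t ^ 2)⁻¹ * (2 * r t * D ^ 2 + 2 * -(C * b * (r t * h₁ t / 2) * (D * W))) -
            (r t * ((h₁ t ^ 2)⁻¹ * D ^ 2) - (C * b) ^ 2 * (r t * W ^ 2)) =
            r t * (((h₁ t)⁻¹ * D - C * b * W / 2) ^ 2 + 3 / 4 * (C * b * W) ^ 2) := by
          field_simp; ring
        have : 0 ≤ r t * (((h₁ t)⁻¹ * D - C * b * W / 2) ^ 2 + 3 / 4 * (C * b * W) ^ 2) := by
          positivity
        linarith
      have h6 : (h₁ t ^ 2)⁻¹ * (2 * r t * D ^ 2 + 2 * -(C * b * (r t * h₁ t / 2) * (D * W))) ≤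
          (h₁ t ^ 2)⁻¹ * (2 * r t * D ^ 2 + 2 * ((2 * t ^ 2)⁻¹ * x)) := by
        gcongr
      linarith)
  rw [intervalIntegral.integral_sub (hi1.intervalIntegrable_of_Icc h12)
    ((continuousOn_const.fun_mul hi2).intervalIntegrable_of_Icc h12),
    intervalIntegral.integral_const_mul] at hmain
  linarith

/-- Two truncated evolutions with the same data are close. -/
theorem norm_sub_sq_le (S : Phase) {kBar : ℝ}
    {C : ℝ≥0} (hC : TransportBound n ν l lLow 0 0 C) (hkBar : 1 - ν / 2 ≤ kBar)
    {N M : ℝ} (hN : 1 ≤ N) (hNM : N ≤ M) {t₀ : ℝ} {u v : ℝ → L2 n} (hu : IsApprox φhat T t₀ N u)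
    (hv : IsApprox φhat T t₀ M v) {Z : ℝ} (hZu : ‖u t₀‖ ≤ Z) (hZv : ‖v t₀‖ ≤ Z) {t₁ : ℝ}
    (ht₁ : t₁ ∈ Icc T t₀) :
    ‖v t₁ - u t₁‖ ^ 2 ≤ ‖v t₀ - u t₀‖ ^ 2 + 2 * C * b * h₁ T * Z / N ^ (ν / 2) *
      (1 + ∫ t in t₁..t₀, r t * energy (lowCut N) ν (ρ t) (kBar + ν / 2) (u t)) := by
  have hN0 : 0 ≤ N := zero_le_one.trans hN
  have hM0 : 0 ≤ M := hN0.trans hNM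
  have h12 := ht₁.2
  have hZ : 0 ≤ Z := (norm_nonneg _).trans hZu
  have hsub : Icc t₁ t₀ ⊆ Icc T t₀ := Icc_subset_Icc ht₁.1 le_rfl
  have hχ := isCut_lowCut (n := n) N
  have hρc : ContinuousOn ρ (Icc t₁ t₀) := S.ρcont.mono fun t ht => ht₁.1.trans ht.1
  have hrc : ContinuousOn r (Icc t₁ t₀) := S.rcont.mono fun t ht => ht₁.1.trans ht.1
  have huc := hu.continuousOn.mono hsub
  have hvc := hv.continuousOn.mono hsub
  have hi2 := (hrc.fun_mul (hχ.continuousOn_energy ν (kBar + ν / 2) hρc huc))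
  set s := N ^ (ν / 2) with hs
  have hs0 : 0 < s := Real.rpow_pos_of_pos (zero_lt_one.trans_le hN) _
  have hsN : N ^ ν = s ^ 2 := by
    rw [hs, ← Real.rpow_natCast, ← Real.rpow_mul hN0]; congr 1; push_cast; ring
  have hh1 := S.h₁pos T le_rfl
  set A : ℝ := 2 * C * b * h₁ T * Z with hA
  have hA0 : 0 ≤ A := by positivity
  have h4 : ∀ x : L2 n, (inner ℂ x x).re = ‖x‖ ^ 2 := fun x => inner_self_eq_norm_sq (𝕜 := ℂ) x
  have hmain := intervalIntegral.integral_le_sub_of_hasDeriv_right_of_le h12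
    (g := fun t => (inner ℂ (v t - u t) (v t - u t)).re -
      A / (4 * s) * exp (-2 * s ^ 2 * ρ t))
    ((Complex.continuous_re.comp_continuousOn ((hvc.sub huc).inner (hvc.sub huc))).sub
      (continuousOn_const.mul (Real.continuous_exp.comp_continuousOn (continuousOn_const.mul hρc))))
    (g' := fun t => ((inner ℂ (v t - u t) ((2 * t ^ 2)⁻¹ • kOp (kerN M (φhat t)) (v t) -
        (2 * t ^ 2)⁻¹ • kOp (kerN N (φhat t)) (u t))).re +
        (inner ℂ ((2 * t ^ 2)⁻¹ • kOp (kerN M (φhat t)) (v t) -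
        (2 * t ^ 2)⁻¹ • kOp (kerN N (φhat t)) (u t)) (v t - u t)).re) -
        A / (4 * s) * (exp (-2 * s ^ 2 * ρ t) * (-2 * s ^ 2 * r t)))
    (fun t ht => by
      have htT : T < t := ht₁.1.trans_lt ht.1
      have htI : t ∈ Ico T t₀ := ⟨htT.le, ht.2⟩
      have hm : ∀ {w : ℝ → L2 n} {w' : L2 n}, HasDerivWithinAt w w' (Icc T t₀) t →
          HasDerivWithinAt w w' (Ioi t) t := fun h =>
        (h.mono_of_mem_nhdsWithin (Icc_mem_nhdsGE_of_mem htI)).mono Ioi_subset_Ici_self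
      have hd := (hm (hv.deriv t (Ico_subset_Icc_self htI))).sub
        (hm (hu.deriv t (Ico_subset_Icc_self htI)))
      exact (hasDerivWithinAt_re_inner hd hd).sub
        ((((S.ρderiv t htT).const_mul (-2 * s ^ 2)).exp.const_mul (A / (4 * s))).hasDerivWithinAt))
    (φ := fun t => -(A / (2 * s)) * (r t * energy (lowCut N) ν (ρ t) (kBar + ν / 2) (u t)))
    (continuousOn_const.fun_mul hi2).integrableOn_Icc
    (fun t ht => by
      have htT : T < t := ht₁.1.trans_lt ht.1
      have htI : t ∈ Icc T t₀ := ⟨htT.le, ht.2.le⟩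
      obtain ⟨hc1, hc2⟩ := S.two_mul_sq_inv htT.le
      have hr := S.rpos t htT.le
      have hh : h₁ t ≤ h₁ T := S.h₁anti self_mem_Ici htT.le htT.le
      have h0 := S.h₀pos t htT.le
      have hU := hχ.energy_nonneg ν (ρ t) (kBar + ν / 2) (u t)
      have hdn : ‖v t - u t‖ ≤ 2 * Z := by
        refine (norm_sub_le _ _).trans ?_
        rw [S.norm_approx hM0 hv htI, S.norm_approx hN0 hu htI]; linarith
      have hbd := S.enorm_inner_kOp_sub_le hC hN0 hNM htT.le (v t - u t) (hu.trunc t htI)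
      have hbd2 := (hbd.trans (mul_le_mul' (S.yNorm_le_ofReal htT.le C) (mul_le_mul' le_rfl
        (kN_mono_right (show 1 ≤ kBar + ν / 2 by linarith) ν (ρ t) (u t)))))
      rw [sqrt_energy_eq (hu.trunc t htI), ← ofReal_norm, ← ofReal_norm,
        ← ENNReal.ofReal_mul (Real.exp_pos _).le, ← ENNReal.ofReal_mul (by positivity),
        ← ENNReal.ofReal_mul (by positivity),
        ENNReal.ofReal_le_ofReal_iff (by positivity), hsN] at hbd2
      have hx := (Complex.abs_re_le_norm _).trans hbd2
      have e1 : (2 * t ^ 2)⁻¹ • kOp (kerN M (φhat t)) (v t) -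
          (2 * t ^ 2)⁻¹ • kOp (kerN N (φhat t)) (u t) = (((2 * t ^ 2)⁻¹ : ℝ) : ℂ) •
          (kOp (kerN M (φhat t)) (v t - u t) +
            (kOp (kerN M (φhat t)) (u t) - kOp (kerN N (φhat t)) (u t))) := by
        rw [L2.ofReal_smul, map_sub, smul_add, smul_sub, smul_sub]; abel
      have e2 : (inner ℂ ((2 * t ^ 2)⁻¹ • kOp (kerN M (φhat t)) (v t) -
        (2 * t ^ 2)⁻¹ • kOp (kerN N (φhat t)) (u t)) (v t - u t)).re = (inner ℂ (v t - u t)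
        ((2 * t ^ 2)⁻¹ • kOp (kerN M (φhat t)) (v t) -
        (2 * t ^ 2)⁻¹ • kOp (kerN N (φhat t)) (u t))).re := inner_re_symm (𝕜 := ℂ) _ _
      rw [e2, e1, inner_smul_right, Complex.re_ofReal_mul, inner_add_right, Complex.add_re,
        S.re_inner_kOp_kerN hM0 htT.le, zero_add, ← Real.sq_sqrt hU]
      set x := (inner ℂ (v t - u t)
        (kOp (kerN M (φhat t)) (u t) - kOp (kerN N (φhat t)) (u t))).re
      set W := √(energy (lowCut N) ν (ρ t) (kBar + ν / 2) (u t))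
      have hW : 0 ≤ W := Real.sqrt_nonneg _
      have e3 : exp (-2 * s ^ 2 * ρ t) = exp (-(ρ t * s ^ 2)) ^ 2 := by
        rw [← Real.exp_nat_mul]; congr 1; push_cast; ring
      rw [e3]
      set y := exp (-(ρ t * s ^ 2))
      have hy : 0 < y := Real.exp_pos _
      have h2 : (2 * t ^ 2)⁻¹ * |x| ≤ A / 2 * r t * (y * W) := by
        calc (2 * t ^ 2)⁻¹ * |x| ≤ (2 * t ^ 2)⁻¹ * (C * b * h₀ t * (y * ‖v t - u t‖ * W)) := by
              gcongr
          _ = ((2 * t ^ 2)⁻¹ * h₀ t) * (C * b * (y * ‖v t - u t‖ * W)) := by ring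
          _ ≤ (r t * h₁ T / 2) * (C * b * (y * (2 * Z) * W)) := by
              have : (2 * t ^ 2)⁻¹ * h₀ t ≤ r t * h₁ T / 2 := hc1.trans (by gcongr)
              gcongr
          _ = _ := by rw [hA]; ring
      have h3 := neg_abs_le x
      have h5 : -(A / 2 * r t * (y * W)) ≤ (2 * t ^ 2)⁻¹ * x := by nlinarith
      have h6 : -(A / (2 * s)) * (r t * W ^ 2) ≤
          2 * -(A / 2 * r t * (y * W)) - A / (4 * s) * (y ^ 2 * (-2 * s ^ 2 * r t)) := by
        have e4 : 2 * -(A / 2 * r t * (y * W)) - A / (4 * s) * (y ^ 2 * (-2 * s ^ 2 * r t)) -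
            -(A / (2 * s)) * (r t * W ^ 2) = A * r t / (2 * s) * (s * y - W) ^ 2 := by
          field_simp; ring
        have : 0 ≤ A * r t / (2 * s) * (s * y - W) ^ 2 := by positivity
        linarith
      linarith)
  rw [intervalIntegral.integral_const_mul] at hmain
  simp only [h4] at hmain
  have hI : 0 ≤ ∫ t in t₁..t₀, r t * energy (lowCut N) ν (ρ t) (kBar + ν / 2) (u t) :=
    intervalIntegral.integral_nonneg h12 fun t ht => mul_nonneg (S.rpos t (ht₁.1.trans ht.1)).le
      (hχ.energy_nonneg _ _ _ _)
  set I := ∫ t in t₁..t₀, r t * energy (lowCut N) ν (ρ t) (kBar + ν / 2) (u t)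
  have h7 : exp (-2 * s ^ 2 * ρ t₁) ≤ 1 := by
    rw [Real.exp_le_one_iff]
    have := S.ρ_nonneg t₁ ht₁.1
    nlinarith [mul_nonneg (sq_nonneg s) this]
  have h8 := Real.exp_pos (-2 * s ^ 2 * ρ t₀)
  have h9 : A / (4 * s) * exp (-2 * s ^ 2 * ρ t₁) ≤ A / s := by
    calc _ ≤ A / (4 * s) * 1 := by gcongr
      _ ≤ A / s := by rw [mul_one]; gcongr; linarith
  have h10 : 0 ≤ A / (4 * s) * exp (-2 * s ^ 2 * ρ t₀) := by positivity
  have h11 : A / (2 * s) * I ≤ A / s * I := by gcongr; linarith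
  calc ‖v t₁ - u t₁‖ ^ 2 ≤ ‖v t₀ - u t₀‖ ^ 2 + A / s + A / s * I := by linarith
    _ = _ := by ring

end PhaseSetup

/-! ### Semicontinuity of the norms -/

theorem tendsto_mulOp {ι : Type*} {F : Filter ι} [F.IsCountablyGenerated] {g : ι → Rn n → ℝ}
    {g₀ : Rn n → ℝ} (hg : ∀ i, BddMeas (g i)) (hg₀ : BddMeas g₀) {C : ℝ}
    (hC : ∀ i ξ, |g i ξ| ≤ C) (hlim : ∀ ξ, Tendsto (fun i => g i ξ) F (𝓝 (g₀ ξ))) (v : L2 n) :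
    Tendsto (fun i => mulOp (g i) v) F (𝓝 (mulOp g₀ v)) := by
  rw [tendsto_iff_edist_tendsto_0]
  have h1 : ∀ i, edist (mulOp (g i) v) (mulOp g₀ v) =
      (∫⁻ ξ, (ofReal |g i ξ - g₀ ξ| * ‖v ξ‖ₑ) ^ (2 : ℝ)) ^ (1 / 2 : ℝ) := fun i => by
    rw [edist_eq_enorm_sub, ← sub_apply, mulOp_sub (hg i) hg₀,
      enorm_mulOp ((hg i).sub hg₀), n2]
  simp only [h1]
  obtain ⟨C₀, hC₀⟩ := hg₀.2
  have h2 : Tendsto (fun i => ∫⁻ ξ, (ofReal |g i ξ - g₀ ξ| * ‖v ξ‖ₑ) ^ (2 : ℝ)) F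
      (𝓝 (∫⁻ _ : Rn n, 0)) := by
    refine tendsto_lintegral_filter_of_dominated_convergence
      (fun ξ => (ofReal (|C| + |C₀|) * ‖v ξ‖ₑ) ^ (2 : ℝ)) ?_ ?_ ?_ ?_
    · refine Eventually.of_forall fun i => ?_
      exact ((((hg i).1.sub hg₀.1).abs.ennreal_ofReal).mul (L2.measurable v).enorm).pow_const _
    · refine Eventually.of_forall fun i => Eventually.of_forall fun ξ => ?_
      gcongr
      refine (abs_sub _ _).trans (add_le_add ?_ ?_)
      · exact (hC i ξ).trans (le_abs_self _)
      · exact (hC₀ ξ).trans (le_abs_self _)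
    · simp_rw [ENNReal.mul_rpow_of_nonneg _ _ (zero_le_two (α := ℝ))]
      rw [lintegral_const_mul _ ((L2.measurable v).enorm.pow_const _)]
      refine (ENNReal.mul_lt_top (by simp) ?_).ne
      have h3 := enorm_eq_n2 v
      rw [n2] at h3
      by_contra h4
      rw [not_lt_top_iff.1 h4] at h3
      simp at h3
    · refine Eventually.of_forall fun ξ => ?_
      have h5 : Tendsto (fun i => ofReal |g i ξ - g₀ ξ|) F (𝓝 0) := by
        rw [← ENNReal.ofReal_zero]
        refine (ENNReal.continuous_ofReal.tendsto 0).comp ?_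
        have := ((hlim ξ).sub_const (g₀ ξ)).abs
        rwa [sub_self, abs_zero] at this
      have h6 := (ENNReal.Tendsto.mul_const h5 (Or.inr (enorm_ne_top (x := v ξ)))).ennrpow_const
        (2 : ℝ)
      simpa using h6
  have h7 := h2.ennrpow_const (1 / 2 : ℝ)
  simpa using h7

theorem lowCut_mono {N M : ℝ} (h : N ≤ M) (ξ : Rn n) : lowCut N ξ ≤ lowCut M ξ := by
  unfold lowCut
  split_ifs with h1 h2
  · exact le_rfl
  · exact absurd (h1.trans h) h2
  · exact zero_le_one
  · exact le_rfl

theorem mulOp_one (v : L2 n) : mulOp (fun _ => 1) v = v := by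
  have hb : BddMeas fun _ : Rn n => (1 : ℝ) := ⟨measurable_const, 1, fun _ => by simp⟩
  apply Lp.ext
  filter_upwards [coeFn_mulOp hb v] with ξ h
  rw [h]; simp

theorem tendsto_lowCut_one (ξ : Rn n) : Tendsto (fun N => lowCut N ξ) atTop (𝓝 1) := by
  refine tendsto_const_nhds.congr' ?_
  filter_upwards [eventually_ge_atTop (jap ξ)] with N hN
  simp [lowCut, hN]

theorem tendsto_mulOp_lowCut (v : L2 n) :
    Tendsto (fun N => mulOp (lowCut N) v) atTop (𝓝 v) := by
  have h := tendsto_mulOp (F := atTop) (fun N : ℝ => bddMeas_lowCut (n := n) N)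
    (g₀ := fun _ => 1) ⟨measurable_const, 1, fun _ => by simp⟩ (C := 1)
    (fun N ξ => by rw [abs_of_nonneg (lowCut_nonneg N ξ)]; exact lowCut_le_one N ξ)
    tendsto_lowCut_one v
  rwa [mulOp_one] at h

theorem norm_mulOp_lowCut_le (N : ℝ) (v : L2 n) : ‖mulOp (lowCut N) v‖ ≤ ‖v‖ := by
  have := norm_mulOp_apply_le (bddMeas_lowCut N) (C := 1)
    (fun ξ => by rw [abs_of_nonneg (lowCut_nonneg N ξ)]; exact lowCut_le_one N ξ) v
  rwa [one_mul] at this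

theorem mulOp_lowCut_idem (N : ℝ) (z : L2 n) :
    mulOp (lowCut N) (mulOp (lowCut N) z) = mulOp (lowCut N) z := by
  rw [mulOp_mulOp (bddMeas_lowCut N) (bddMeas_lowCut N)]
  congr 2; ext ξ; exact lowCut_mul_self N ξ

theorem kN_mulOp_le {g : Rn n → ℝ} (hg : BddMeas g) (h1 : ∀ ξ, |g ξ| ≤ 1) (ν ρ κ : ℝ) (v : L2 n) :
    kN ν ρ κ (mulOp g v) ≤ kN ν ρ κ v := by
  refine n2_mono ?_
  filter_upwards [coeFn_mulOp hg v] with ξ hξ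
  rw [hξ, enorm_mul]
  gcongr
  refine mul_le_of_le_one_left zero_le ?_
  rw [← ofReal_norm, Complex.norm_real, Real.norm_eq_abs, ENNReal.ofReal_le_one]
  exact h1 ξ

theorem kN_lowCut_le (N ν ρ κ : ℝ) (v : L2 n) : kN ν ρ κ (mulOp (lowCut N) v) ≤ kN ν ρ κ v :=
  kN_mulOp_le (bddMeas_lowCut N) (fun ξ => by
    rw [abs_of_nonneg (lowCut_nonneg N ξ)]; exact lowCut_le_one N ξ) ν ρ κ v

/-- A norm is the supremum of the energies cut off by an increasing family. -/
theorem kN_sq_eq_iSup {χ : ℕ → Rn n → ℝ} (hχ : ∀ j, IsCut (χ j)) (hmono : ∀ ξ, Monotone fun j => χ j ξ)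
    (hlim : ∀ ξ, Tendsto (fun j => χ j ξ) atTop (𝓝 1)) (ν ρ κ : ℝ) (v : L2 n) :
    kN ν ρ κ v ^ 2 = ⨆ j, ofReal (energy (χ j) ν ρ κ v) := by
  simp_rw [(hχ _).ofReal_energy]
  rw [kN_sq, ← lintegral_iSup]
  · refine lintegral_congr fun ξ => ?_
    rw [← ENNReal.iSup_mul]
    congr 1
    have hm : Monotone fun j => ofReal (χ j ξ * sqW ν ρ κ ξ) := fun i j hij =>
      ENNReal.ofReal_le_ofReal (mul_le_mul_of_nonneg_right (hmono ξ hij) (sqW_pos ν ρ κ ξ).le)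
    have h1 := tendsto_atTop_iSup hm
    have h2 : Tendsto (fun j => ofReal (χ j ξ * sqW ν ρ κ ξ)) atTop
        (𝓝 (ofReal (1 * sqW ν ρ κ ξ))) :=
      (ENNReal.continuous_ofReal.tendsto _).comp ((hlim ξ).mul_const _)
    rw [tendsto_nhds_unique h1 h2, one_mul]
  · intro j
    exact (((hχ j).measurable.mul (measurable_sqW ν ρ κ)).ennreal_ofReal).mul
      ((L2.measurable v).enorm.pow_const _)
  · intro i j hij ξ
    simp only
    gcongr
    · exact (sqW_pos ν ρ κ ξ).le
    · exact hmono ξ hij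

theorem kN_sq_eq_iSup_lowCut (ν ρ κ : ℝ) (v : L2 n) :
    kN ν ρ κ v ^ 2 = ⨆ j : ℕ, ofReal (energy (lowCut j) ν ρ κ v) :=
  kN_sq_eq_iSup (fun j => isCut_lowCut (j : ℝ))
    (fun ξ i j hij => lowCut_mono (by exact_mod_cast hij) ξ)
    (fun ξ => (tendsto_lowCut_one ξ).comp tendsto_natCast_atTop_atTop) ν ρ κ v

theorem tendsto_clm_apply {ι : Type*} {F : Filter ι} {A : ι → L2 n →L[ℂ] L2 n}
    {A₀ : L2 n →L[ℂ] L2 n} {v : ι → L2 n} {v₀ : L2 n} (hA : Tendsto A F (𝓝 A₀))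
    (hv : Tendsto v F (𝓝 v₀)) : Tendsto (fun i => A i (v i)) F (𝓝 (A₀ v₀)) :=
  ((isBoundedBilinearMap_apply (𝕜 := ℂ) (E := L2 n) (F := L2 n)).continuous.tendsto (A₀, v₀)).comp
    (hA.prodMk_nhds hv)

theorem IsCut.tendsto_energy {χ : Rn n → ℝ} (hχ : IsCut χ) (ν κ : ℝ) {ι : Type*} {F : Filter ι}
    {ρ : ι → ℝ} {ρ₀ : ℝ} {v : ι → L2 n} {v₀ : L2 n} (hρ : Tendsto ρ F (𝓝 ρ₀))
    (hv : Tendsto v F (𝓝 v₀)) :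
    Tendsto (fun i => energy χ ν (ρ i) κ (v i)) F (𝓝 (energy χ ν ρ₀ κ v₀)) :=
  (Complex.continuous_re.tendsto _).comp (hv.inner
    (tendsto_clm_apply (((hχ.continuous_sqOp ν κ).tendsto ρ₀).comp hρ) hv))

theorem kN_sq_le_liminf (ν κ : ℝ) {ι : Type*} {F : Filter ι} [F.NeBot]
    {ρ : ι → ℝ} {ρ₀ : ℝ} {v : ι → L2 n} {v₀ : L2 n} (hρ : Tendsto ρ F (𝓝 ρ₀))
    (hv : Tendsto v F (𝓝 v₀)) :
    kN ν ρ₀ κ v₀ ^ 2 ≤ liminf (fun i => kN ν (ρ i) κ (v i) ^ 2) F := by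
  rw [kN_sq_eq_iSup_lowCut]
  refine iSup_le fun j => ?_
  have h := (ENNReal.continuous_ofReal.tendsto _).comp
    ((isCut_lowCut (n := n) (j : ℝ)).tendsto_energy ν κ hρ hv)
  rw [← h.liminf_eq]
  exact liminf_le_liminf (Eventually.of_forall fun i => (isCut_lowCut (j : ℝ)).ofReal_energy_le _ _ _ _)

theorem kN_le_of_tendsto (ν κ : ℝ) {ι : Type*} {F : Filter ι} [F.NeBot]
    {ρ : ι → ℝ} {ρ₀ : ℝ} {v : ι → L2 n} {v₀ : L2 n} (hρ : Tendsto ρ F (𝓝 ρ₀))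
    (hv : Tendsto v F (𝓝 v₀)) {B : ℝ≥0∞} (hB : ∀ᶠ i in F, kN ν (ρ i) κ (v i) ≤ B) :
    kN ν ρ₀ κ v₀ ≤ B := by
  rw [← ENNReal.pow_le_pow_left_iff two_ne_zero]
  refine (kN_sq_le_liminf ν κ hρ hv).trans ?_
  refine (liminf_le_liminf (hB.mono fun i hi => pow_le_pow_left' hi 2)).trans ?_
  rw [liminf_const]

theorem aemeasurable_kN_sq (ν κ : ℝ) {ρ : ℝ → ℝ} {v : ℝ → L2 n} {I : Set ℝ} (hI : MeasurableSet I)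
    (hρ : ContinuousOn ρ I) (hv : ContinuousOn v I) :
    AEMeasurable (fun t => kN ν (ρ t) κ (v t) ^ 2) (volume.restrict I) := by
  simp_rw [kN_sq_eq_iSup_lowCut]
  exact AEMeasurable.iSup fun j => ENNReal.measurable_ofReal.comp_aemeasurable
    (((isCut_lowCut (j : ℝ)).continuousOn_energy ν κ hρ hv).aemeasurable hI)

theorem lintegral_kN_sq_le_liminf (ν κ : ℝ) {r ρ H : ℝ → ℝ} {v : ℝ → L2 n} {u : ℕ → ℝ → L2 n}
    {I : Set ℝ} (hI : MeasurableSet I) (hr : ContinuousOn r I) (hρ : ContinuousOn ρ I)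
    (hH : ContinuousOn H I)
    (hu : ∀ j, ContinuousOn (u j) I) (hlim : ∀ t ∈ I, Tendsto (fun j => u j t) atTop (𝓝 (v t))) :
    ∫⁻ t, ofReal (H t) * kN ν (ρ t) κ (v t) ^ 2 ∂(rateMeasure r I) ≤
      liminf (fun j => ∫⁻ t, ofReal (H t) * kN ν (ρ t) κ (u j t) ^ 2 ∂(rateMeasure r I))
        atTop := by
  simp_rw [lintegral_rateMeasure hI hr]
  refine le_trans ?_ (lintegral_liminf_le' fun j =>
    (ENNReal.measurable_ofReal.comp_aemeasurable (hr.aemeasurable hI)).mul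
      ((ENNReal.measurable_ofReal.comp_aemeasurable (hH.aemeasurable hI)).mul
        (aemeasurable_kN_sq ν κ hI hρ (hu j))))
  refine setLIntegral_mono_ae' hI (Eventually.of_forall fun t ht => ?_)
  simp only [← mul_assoc]
  rw [ENNReal.liminf_const_mul_of_ne_top (by finiteness)]
  gcongr
  exact kN_sq_le_liminf ν κ tendsto_const_nhds (hlim t ht)

/-! ### The limit evolution -/

/-- `v` is the limit of the truncated evolutions with data `z` at time `t₀`. -/
structure IsLimitEvolution (φhat : ℝ → Rn n → ℂ) (T t₀ : ℝ) (z : L2 n) (v : ℝ → L2 n) : Prop where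
  continuousOn : ContinuousOn v (Icc T t₀)
  approx : ∃ u : ℕ → ℝ → L2 n, (∀ j : ℕ, IsApprox φhat T t₀ (j + 1) (u j) ∧
    u j t₀ = mulOp (lowCut (j + 1)) z) ∧
    ∀ t ∈ Icc T t₀, Tendsto (fun j => u j t) atTop (𝓝 (v t))

theorem tendsto_mulOp_lowCut_nat (v : L2 n) :
    Tendsto (fun j : ℕ => mulOp (lowCut ((j : ℝ) + 1)) v) atTop (𝓝 v) :=
  (tendsto_mulOp_lowCut v).comp
    (tendsto_atTop_add_const_right _ _ tendsto_natCast_atTop_atTop)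

theorem IsLimitEvolution.final {φhat : ℝ → Rn n → ℂ} {T t₀ : ℝ} {z : L2 n} {v : ℝ → L2 n}
    (h : IsLimitEvolution φhat T t₀ z v) (ht₀ : T ≤ t₀) : v t₀ = z := by
  obtain ⟨u, hu, hlim⟩ := h.approx
  refine tendsto_nhds_unique (hlim t₀ (right_mem_Icc.2 ht₀)) ?_
  simp_rw [(hu _).2]
  exact tendsto_mulOp_lowCut_nat z

theorem IsLimitEvolution.sub {φhat : ℝ → Rn n → ℂ} {T t₀ : ℝ} {z z' : L2 n} {v v' : ℝ → L2 n}
    (h : IsLimitEvolution φhat T t₀ z v) (h' : IsLimitEvolution φhat T t₀ z' v') :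
    IsLimitEvolution φhat T t₀ (z - z') (v - v') where
  continuousOn := h.continuousOn.sub h'.continuousOn
  approx := by
    obtain ⟨u, hu, hlim⟩ := h.approx
    obtain ⟨u', hu', hlim'⟩ := h'.approx
    refine ⟨fun j => u j - u' j, fun j => ⟨(hu j).1.sub (hu' j).1, ?_⟩, fun t ht =>
      (hlim t ht).sub (hlim' t ht)⟩
    rw [map_sub, ← (hu j).2, ← (hu' j).2]
    rfl

theorem ofReal_inv_sq_mul {h e : ℝ} (hh : 0 < h) :
    ofReal ((h ^ 2)⁻¹ * e) = (ofReal h)⁻¹ ^ 2 * ofReal e := by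
  rw [ENNReal.ofReal_mul (by positivity), ENNReal.ofReal_inv_of_pos (by positivity),
    ENNReal.ofReal_pow hh.le, ENNReal.inv_pow]

namespace PhaseSetup

theorem exists_isLimitEvolution (S : Phase) {kBar : ℝ}
    {C C₀ : ℝ≥0} (hC : CommutatorBound n ν l lLow kBar C) (hsmall : C * b * h₁ T ≤ 2)
    (hC₀ : TransportBound n ν l lLow 0 0 C₀) (hkBar : 1 - ν / 2 ≤ kBar) {t₀ : ℝ} (ht₀ : T ≤ t₀)
    {z : L2 n} (hz : kN ν (ρ t₀) kBar z < ⊤) : ∃ v, IsLimitEvolution φhat T t₀ z v := by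
  have hN : ∀ j : ℕ, (1 : ℝ) ≤ (j : ℝ) + 1 := fun j => by
    have : (0 : ℝ) ≤ j := Nat.cast_nonneg j
    linarith
  have hN0 : ∀ j : ℕ, (0 : ℝ) ≤ (j : ℝ) + 1 := fun j => zero_le_one.trans (hN j)
  choose u hu hu0 using fun j : ℕ => S.exists_isApprox (hN0 j) ht₀ z
  set Q := (kN ν (ρ t₀) kBar z ^ 2).toReal
  have hQ : ∀ j : ℕ, ∀ t₁ ∈ Icc T t₀, ∫ t in t₁..t₀, r t *
      energy (lowCut ((j : ℝ) + 1)) ν (ρ t) (kBar + ν / 2) (u j t) ≤ Q := by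
    intro j t₁ ht₁
    have h1 := S.energy_add_integral_le hC hsmall (hN0 j) (hu j) ht₁.1 ht₁.2 le_rfl
    have h2 := (isCut_lowCut (n := n) ((j : ℝ) + 1)).energy_nonneg ν (ρ t₁) kBar (u j t₁)
    have h3 : energy (lowCut ((j : ℝ) + 1)) ν (ρ t₀) kBar (u j t₀) ≤ Q := by
      refine (ENNReal.ofReal_le_iff_le_toReal (ENNReal.pow_lt_top hz).ne).1 ?_
      refine ((isCut_lowCut _).ofReal_energy_le _ _ _ _).trans ?_
      rw [hu0]
      gcongr
      exact kN_lowCut_le _ _ _ _ _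
    linarith
  have hh1 := S.h₁pos T le_rfl
  set A : ℝ := 2 * C₀ * b * h₁ T * ‖z‖ with hA
  have hA0 : 0 ≤ A := by positivity
  have hQ0 : 0 ≤ Q := ENNReal.toReal_nonneg
  have hdiff : ∀ i j : ℕ, i ≤ j → ∀ t ∈ Icc T t₀, ‖u j t - u i t‖ ^ 2 ≤
      ‖mulOp (lowCut ((j : ℝ) + 1)) z - mulOp (lowCut ((i : ℝ) + 1)) z‖ ^ 2 +
        A / ((i : ℝ) + 1) ^ (ν / 2) * (1 + Q) := by
    intro i j hij t ht
    have h1 := S.norm_sub_sq_le hC₀ hkBar (hN i)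
      (add_le_add_left (Nat.cast_le.2 hij) 1 : (i : ℝ) + 1 ≤ j + 1) (hu i) (hu j) (Z := ‖z‖)
      (by rw [hu0]; exact norm_mulOp_lowCut_le _ _) (by rw [hu0]; exact norm_mulOp_lowCut_le _ _) ht
    rw [hu0, hu0] at h1
    refine h1.trans ?_
    have := Real.rpow_pos_of_pos (zero_lt_one.trans_le (hN i)) (ν / 2)
    gcongr
    exact hQ i t ht
  have hunif : UniformCauchySeqOn u atTop (Icc T t₀) := by
    rw [Metric.uniformCauchySeqOn_iff]
    intro ε hε
    have hc := (tendsto_mulOp_lowCut_nat z).cauchySeq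
    rw [Metric.cauchySeq_iff] at hc
    obtain ⟨N₁, hN₁⟩ := hc (ε / 2) (half_pos hε)
    have hdec : Tendsto (fun i : ℕ => A / ((i : ℝ) + 1) ^ (ν / 2) * (1 + Q)) atTop (𝓝 0) := by
      have h1 : Tendsto (fun i : ℕ => ((i : ℝ) + 1) ^ (ν / 2)) atTop atTop :=
        (tendsto_rpow_atTop (half_pos S.hν)).comp
          (tendsto_atTop_add_const_right _ _ tendsto_natCast_atTop_atTop)
      simpa using (h1.const_div_atTop A).mul_const (1 + Q)
    obtain ⟨N₂, hN₂⟩ := eventually_atTop.1 (hdec.eventually (gt_mem_nhds (show 0 < ε ^ 2 / 2 by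
      positivity)))
    have key : ∀ i j : ℕ, max N₁ N₂ ≤ i → i ≤ j → ∀ t ∈ Icc T t₀, ‖u j t - u i t‖ < ε := by
      intro i j hi hij t ht
      have h1 := hdiff i j hij t ht
      have h2 := hN₂ i ((le_max_right _ _).trans hi)
      have h3 := hN₁ j ((le_max_left _ _).trans (hi.trans hij)) i ((le_max_left _ _).trans hi)
      rw [dist_eq_norm] at h3
      have h4 := pow_lt_pow_left₀ h3 (norm_nonneg _) two_ne_zero
      refine lt_of_pow_lt_pow_left₀ 2 hε.le ?_
      nlinarith
    refine ⟨max N₁ N₂, fun i hi j hj t ht => ?_⟩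
    rw [dist_eq_norm]
    rcases le_total i j with h | h
    · rw [norm_sub_rev]; exact key i j hi h t ht
    · exact key j i hj h t ht
  have hptw : ∀ t ∈ Icc T t₀, ∃ y, Tendsto (fun j => u j t) atTop (𝓝 y) := fun t ht =>
    cauchySeq_tendsto_of_complete (hunif.cauchySeq ht)
  choose! v hv using hptw
  have hun := hunif.tendstoUniformlyOn_of_tendsto hv
  exact ⟨v, hun.continuousOn (Frequently.of_forall fun j => (hu j).continuousOn), u,
    fun j => ⟨hu j, hu0 j⟩, hv⟩

theorem _root_.IsLimitEvolution.norm_eq (S : Phase) {t₀ : ℝ}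
    {z : L2 n} {v : ℝ → L2 n} (hv : IsLimitEvolution φhat T t₀ z v) {t : ℝ} (ht : t ∈ Icc T t₀) :
    ‖v t‖ = ‖z‖ := by
  obtain ⟨u, hu, hlim⟩ := hv.approx
  refine tendsto_nhds_unique (hlim t ht).norm ?_
  have h0 : ∀ j : ℕ, (0 : ℝ) ≤ (j : ℝ) + 1 := fun j => by positivity
  simp_rw [fun j => S.norm_approx (h0 j) (hu j).1 ht, (hu _).2]
  exact (tendsto_mulOp_lowCut_nat z).norm

theorem _root_.IsLimitEvolution.kN_le (S : Phase) {κ : ℝ}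
    {C : ℝ≥0} (hC : CommutatorBound n ν l lLow κ C) (hsmall : C * b * h₁ T ≤ 2) {t₀ : ℝ}
    {z : L2 n} {v : ℝ → L2 n} (hv : IsLimitEvolution φhat T t₀ z v) {t : ℝ} (ht : t ∈ Icc T t₀) :
    kN ν (ρ t) κ (v t) ≤ kN ν (ρ t₀) κ z := by
  obtain ⟨u, hu, hlim⟩ := hv.approx
  refine kN_le_of_tendsto ν κ tendsto_const_nhds (hlim t ht) (Eventually.of_forall fun j => ?_)
  have h1 := le_self_add.trans (S.kN_sq_add_lintegral_le hC hsmall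
    (by positivity : (0 : ℝ) ≤ (j : ℝ) + 1) (hu j).1 ht.1 ht.2 le_rfl)
  rw [ENNReal.pow_le_pow_left_iff two_ne_zero, (hu j).2] at h1
  exact h1.trans (kN_lowCut_le _ _ _ _ _)

theorem _root_.IsLimitEvolution.lintegral_kN_le (S : Phase)
    {κ : ℝ} {C : ℝ≥0} (hC : CommutatorBound n ν l lLow κ C) (hsmall : C * b * h₁ T ≤ 2) {t₀ : ℝ}
    (ht₀ : T ≤ t₀) {z : L2 n} {v : ℝ → L2 n} (hv : IsLimitEvolution φhat T t₀ z v) :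
    ∫⁻ t, kN ν (ρ t) (κ + ν / 2) (v t) ^ 2 ∂(rateMeasure r (Icc T t₀)) ≤
      kN ν (ρ t₀) κ z ^ 2 := by
  obtain ⟨u, hu, hlim⟩ := hv.approx
  have h1 := lintegral_kN_sq_le_liminf ν (κ + ν / 2) (H := fun _ => 1) measurableSet_Icc
    (S.rcont.mono Icc_subset_Ici_self) (S.ρcont.mono Icc_subset_Ici_self) continuousOn_const
    (fun j => (hu j).1.continuousOn) hlim
  simp only [ENNReal.ofReal_one, one_mul] at h1
  refine h1.trans ((liminf_le_liminf (Eventually.of_forall fun j => ?_)).trans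
    (liminf_const (kN ν (ρ t₀) κ z ^ 2)).le)
  have h1 := le_add_self.trans (S.kN_sq_add_lintegral_le hC hsmall
    (by positivity : (0 : ℝ) ≤ (j : ℝ) + 1) (hu j).1 le_rfl ht₀ le_rfl)
  refine h1.trans ?_
  rw [(hu j).2]
  exact pow_le_pow_left' (kN_lowCut_le _ _ _ _ _) 2

/-- Both parts of the drift estimate, for a truncated evolution. -/
theorem approx_drift_le (S : Phase) {k kBar : ℝ}
    {C C' : ℝ≥0} (hC : CommutatorBound n ν l lLow kBar C) (hsmall : C * b * h₁ T ≤ 2)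
    (hC' : TransportBound n ν l lLow k (ν / 2) C') (hkk : k + 1 - ν ≤ kBar)
    {N : ℝ} (hN : 0 ≤ N) {t₀ : ℝ} {u : ℝ → L2 n} (hu : IsApprox φhat T t₀ N u) {z : L2 n}
    (hz : mulOp (lowCut N) z = z) (huz : u t₀ = z) {t₁ : ℝ} (ht₁ : T ≤ t₁) (h12 : t₁ ≤ t₀) :
    (ofReal (h₁ t₁))⁻¹ ^ 2 * kN ν (ρ t₁) k (u t₁ - z : L2 n) ^ 2 +
      ∫⁻ t, ofReal ((h₁ t ^ 2)⁻¹) * kN ν (ρ t) (k + ν / 2) (u t - z : L2 n) ^ 2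
        ∂(rateMeasure r (Icc t₁ t₀)) ≤ (C' * b * kN ν (ρ t₀) kBar z) ^ 2 := by
  have hsub : Icc t₁ t₀ ⊆ Icc T t₀ := Icc_subset_Icc ht₁ le_rfl
  have hχ := isCut_lowCut (n := n) N
  have hρc : ContinuousOn ρ (Icc t₁ t₀) := S.ρcont.mono fun t ht => ht₁.trans ht.1
  have hrc : ContinuousOn r (Icc t₁ t₀) := S.rcont.mono fun t ht => ht₁.trans ht.1
  have hhc : ContinuousOn (fun t => (h₁ t ^ 2)⁻¹) (Icc t₁ t₀) :=
    ((S.h₁cont.mono fun t (ht : t ∈ Icc t₁ t₀) => ht₁.trans ht.1).pow 2).inv₀ fun t ht =>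
      (pow_pos (S.h₁pos t (ht₁.trans ht.1)) 2).ne'
  have htr : ∀ t ∈ Icc T t₀, mulOp (lowCut N) (u t - z) = u t - z := fun t ht => by
    rw [map_sub, hu.trunc t ht, hz]
  have h1 := S.drift_add_integral_le hC' hkk hN hu hz ht₁ h12
  have h2 := S.energy_add_integral_le hC hsmall hN hu ht₁ h12 le_rfl
  have h3 := hχ.energy_nonneg ν (ρ t₁) kBar (u t₁)
  have h4 : energy (lowCut N) ν (ρ t₀) k (u t₀ - z) = 0 := by
    rw [huz, sub_self, energy, inner_zero_left, Complex.zero_re]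
  rw [h4, mul_zero, zero_add] at h1
  have h5 := h1.trans (mul_le_mul_of_nonneg_left (show _ ≤ energy (lowCut N) ν (ρ t₀) kBar z by
    rw [huz] at h2; linarith) (sq_nonneg ((C' : ℝ) * b)))
  have h6 := ENNReal.ofReal_le_ofReal h5
  have hnn : ∀ t ∈ Icc t₁ t₀, 0 ≤ (h₁ t ^ 2)⁻¹ * energy (lowCut N) ν (ρ t) (k + ν / 2) (u t - z) :=
    fun t ht => mul_nonneg (by positivity) (hχ.energy_nonneg _ _ _ _)
  rw [ENNReal.ofReal_add (mul_nonneg (by positivity) (hχ.energy_nonneg _ _ _ _))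
    (intervalIntegral.integral_nonneg h12 fun t ht => mul_nonneg (S.rpos t (ht₁.trans ht.1)).le
      (hnn t ht)),
    ofReal_intervalIntegral_rate h12 hrc (fun t ht => (S.rpos t (ht₁.trans ht.1)).le)
      (hhc.fun_mul (hχ.continuousOn_energy ν _ hρc
        ((hu.continuousOn.mono hsub).fun_sub continuousOn_const))) hnn,
    ofReal_inv_sq_mul (S.h₁pos t₁ ht₁),
    ofReal_energy_lowCut (htr t₁ (hsub (left_mem_Icc.2 h12))), ENNReal.ofReal_mul (sq_nonneg _),
    ofReal_energy_lowCut hz, ENNReal.ofReal_pow (by positivity),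
    ENNReal.ofReal_mul (by positivity), ENNReal.ofReal_coe_nnreal, ENNReal.ofReal_coe_nnreal] at h6
  rw [mul_pow (C' * b : ℝ≥0∞)]
  refine le_trans (le_of_eq ?_) h6
  congr 1
  rw [lintegral_rateMeasure measurableSet_Icc hrc, lintegral_rateMeasure measurableSet_Icc hrc]
  refine setLIntegral_congr_fun measurableSet_Icc fun t ht => ?_
  rw [ENNReal.ofReal_mul (by positivity), ofReal_energy_lowCut (htr t (hsub ht))]

theorem _root_.IsLimitEvolution.drift_le (S : Phase)
    {k kBar : ℝ} {C C' : ℝ≥0} (hC : CommutatorBound n ν l lLow kBar C)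
    (hsmall : C * b * h₁ T ≤ 2) (hC' : TransportBound n ν l lLow k (ν / 2) C')
    (hkk : k + 1 - ν ≤ kBar) {t₀ : ℝ} {z : L2 n} {v : ℝ → L2 n}
    (hv : IsLimitEvolution φhat T t₀ z v) {t : ℝ} (ht : t ∈ Icc T t₀) :
    (ofReal (h₁ t))⁻¹ * kN ν (ρ t) k (v t - z : L2 n) ≤ C' * b * kN ν (ρ t₀) kBar z := by
  obtain ⟨u, hu, hlim⟩ := hv.approx
  have hpos : ofReal (h₁ t) ≠ 0 := by simpa using S.h₁pos t ht.1
  rw [mul_comm, ← div_eq_mul_inv, ENNReal.div_le_iff hpos ENNReal.ofReal_ne_top]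
  refine kN_le_of_tendsto ν k tendsto_const_nhds
    ((hlim t ht).sub (tendsto_mulOp_lowCut_nat z)) (Eventually.of_forall fun j => ?_)
  have h1 := le_self_add.trans (S.approx_drift_le hC hsmall hC' hkk
    (by positivity : (0 : ℝ) ≤ (j : ℝ) + 1) (hu j).1 (mulOp_lowCut_idem _ z) (hu j).2 ht.1 ht.2)
  rw [← mul_pow, ENNReal.pow_le_pow_left_iff two_ne_zero, mul_comm, ← div_eq_mul_inv,
    ENNReal.div_le_iff hpos ENNReal.ofReal_ne_top] at h1
  refine h1.trans ?_
  gcongr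
  exact kN_lowCut_le _ _ _ _ _

theorem _root_.IsLimitEvolution.lintegral_drift_le
    (S : Phase)
    {k kBar : ℝ} {C C' : ℝ≥0} (hC : CommutatorBound n ν l lLow kBar C)
    (hsmall : C * b * h₁ T ≤ 2) (hC' : TransportBound n ν l lLow k (ν / 2) C')
    (hkk : k + 1 - ν ≤ kBar) {t₀ : ℝ} (ht₀ : T ≤ t₀) {z : L2 n} {v : ℝ → L2 n}
    (hv : IsLimitEvolution φhat T t₀ z v) :
    ∫⁻ t, ofReal ((h₁ t ^ 2)⁻¹) * kN ν (ρ t) (k + ν / 2) (v t - z : L2 n) ^ 2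
        ∂(rateMeasure r (Icc T t₀)) ≤ (C' * b * kN ν (ρ t₀) kBar z) ^ 2 := by
  obtain ⟨u, hu, hlim⟩ := hv.approx
  have hhc : ContinuousOn (fun t => (h₁ t ^ 2)⁻¹) (Icc T t₀) :=
    ((S.h₁cont.mono fun t (ht : t ∈ Icc T t₀) => ht.1).pow 2).inv₀ fun t ht =>
      (pow_pos (S.h₁pos t ht.1) 2).ne'
  refine (lintegral_kN_sq_le_liminf ν (k + ν / 2) (v := fun t => v t - z)
    (u := fun j t => u j t - mulOp (lowCut ((j : ℝ) + 1)) z) measurableSet_Icc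
    (S.rcont.mono Icc_subset_Ici_self) (S.ρcont.mono Icc_subset_Ici_self) hhc
    (fun j => (hu j).1.continuousOn.sub continuousOn_const)
    fun t ht => (hlim t ht).sub (tendsto_mulOp_lowCut_nat z)).trans ?_
  refine (liminf_le_liminf (Eventually.of_forall fun j => ?_)).trans
    (liminf_const ((C' * b * kN ν (ρ t₀) kBar z) ^ 2)).le
  have h1 := le_add_self.trans (S.approx_drift_le hC hsmall hC' hkk
    (by positivity : (0 : ℝ) ≤ (j : ℝ) + 1) (hu j).1 (mulOp_lowCut_idem _ z) (hu j).2 le_rfl ht₀)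
  refine h1.trans ?_
  gcongr
  exact kN_lowCut_le _ _ _ _ _

end PhaseSetup

/-! ### Mild solutions -/

theorem bddMeas_invJapSq : BddMeas fun ξ : Rn n => (japSq ξ)⁻¹ :=
  ⟨continuous_japSq.measurable.inv, 1, fun ξ => by
    have := one_le_japSq ξ
    rw [abs_of_pos (by positivity)]
    exact inv_le_one_of_one_le₀ this⟩

theorem IsCut.bddMeas_mul_japSq {χ : Rn n → ℝ} (hχ : IsCut χ) : BddMeas fun ξ => χ ξ * japSq ξ := by
  obtain ⟨R, hR⟩ := hχ.bounded
  refine ⟨hχ.measurable.mul continuous_japSq.measurable, 1 + R ^ 2, fun ξ => ?_⟩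
  have h1 := one_le_japSq ξ
  rw [abs_of_nonneg (mul_nonneg (hχ.nonneg ξ) (by linarith))]
  by_cases h : χ ξ = 0
  · rw [h, zero_mul]; positivity
  refine (mul_le_of_le_one_left (by linarith) (hχ.le_one ξ)).trans ?_
  have h2 : 2 * Real.pi * ‖ξ‖ ≤ R := (freq_le_jap ξ).trans (hR ξ h)
  have h3 := freq_nonneg ξ
  unfold japSq
  gcongr

/-- The right-hand side of the evolution equation after smoothing by `(1 + |ξ|²)⁻¹`. -/
def smoothedRhs (φhat : ℝ → Rn n → ℂ) (t : ℝ) (v : L2 n) : L2 n :=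
  (-(2 * t ^ 2)⁻¹) • ContinuousLinearMap.adjoint (kOp (kerJ (φhat t))) v

/-- `v` is almost everywhere a mild solution of the evolution equation on `(a, b)`, and `E` is the
continuous representative of `(1 + |ξ|²)⁻¹ v`. -/
structure IsMild (φhat : ℝ → Rn n → ℂ) (a b : ℝ) (v E : ℝ → L2 n) (Λ : ℝ) : Prop where
  meas : AEStronglyMeasurable v (volume.restrict (Ioo a b))
  bdd : ∀ᵐ t ∂(volume.restrict (Ioo a b)), ‖v t‖ ≤ Λ
  eqv : ∀ᵐ t ∂(volume.restrict (Ioo a b)), mulOp (fun ξ => (japSq ξ)⁻¹) (v t) = E t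
  integ : ∀ t₁ ∈ Ioo a b, ∀ t₂ ∈ Ioo a b,
    E t₂ - E t₁ = ∫ t in t₁..t₂, smoothedRhs φhat t (v t)

theorem abs_re_le_norm_mul (x y : L2 n) : |(inner ℂ x y).re| ≤ ‖x‖ * ‖y‖ :=
  (Complex.abs_re_le_norm _).trans (norm_inner_le_norm x y)

/-- A quadratic form with Lipschitz coefficients evaluated along a Lipschitz curve. -/
theorem abs_re_inner_sub_le {A B : L2 n →L[ℂ] L2 n} {x y : L2 n} {Y M : ℝ} (hx : ‖x‖ ≤ Y)
    (hy : ‖y‖ ≤ Y) (hA : ‖A‖ ≤ M) (hB : ‖B‖ ≤ M) :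
    |(inner ℂ x (A x)).re - (inner ℂ y (B y)).re| ≤
      2 * (M * Y) * ‖x - y‖ + Y ^ 2 * ‖A - B‖ := by
  have hY : 0 ≤ Y := (norm_nonneg _).trans hx
  have hM : 0 ≤ M := (norm_nonneg _).trans hA
  have e : (inner ℂ x (A x)).re - (inner ℂ y (B y)).re =
      (inner ℂ (x - y) (A x)).re + (inner ℂ y ((A - B) x)).re + (inner ℂ y (B (x - y))).re := by
    rw [inner_sub_left, sub_apply, inner_sub_right, map_sub, inner_sub_right]
    simp only [Complex.sub_re]; ring
  rw [e]
  have h1 : |(inner ℂ (x - y) (A x)).re| ≤ ‖x - y‖ * (M * Y) :=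
    (abs_re_le_norm_mul _ _).trans (by gcongr; exact A.le_of_opNorm_le_of_le hA hx)
  have h2 : |(inner ℂ y ((A - B) x)).re| ≤ Y * (‖A - B‖ * Y) :=
    (abs_re_le_norm_mul _ _).trans (by gcongr; exact (A - B).le_of_opNorm_le_of_le le_rfl hx)
  have h3 : |(inner ℂ y (B (x - y))).re| ≤ Y * (M * ‖x - y‖) :=
    (abs_re_le_norm_mul _ _).trans (by gcongr; exact B.le_of_opNorm_le_of_le hB le_rfl)
  calc _ ≤ |(inner ℂ (x - y) (A x)).re| + |(inner ℂ y ((A - B) x)).re| +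
        |(inner ℂ y (B (x - y))).re| := abs_add_three _ _ _
    _ ≤ _ := by nlinarith

namespace PhaseSetup

theorem continuousOn_adjoint (S : Phase) :
    ContinuousOn (fun t => ContinuousLinearMap.adjoint (kOp (kerJ (φhat t)))) (Ioi T) :=
  (ContinuousLinearMap.adjoint (𝕜 := ℂ) (E := L2 n) (F := L2 n)).continuous.comp_continuousOn
    S.continuousOn_kOp_kerJ

/-- The smoothed right-hand side is bounded on compact time intervals. -/
theorem exists_norm_smoothedRhs_le (S : Phase) {t₁ t₂ : ℝ}
    (ht₁ : T < t₁) : ∃ K : ℝ, 0 ≤ K ∧ ∀ t ∈ Icc t₁ t₂, ∀ v, ‖smoothedRhs φhat t v‖ ≤ K * ‖v‖ := by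
  have hsub : Icc t₁ t₂ ⊆ Ioi T := fun t ht => ht₁.trans_le ht.1
  obtain ⟨K, hK⟩ := isCompact_Icc.exists_bound_of_continuousOn (S.continuousOn_adjoint.mono hsub)
  refine ⟨|K|, abs_nonneg K, fun t ht v => ?_⟩
  have ht1 : 1 ≤ t := S.hT.trans (hsub ht).le
  rw [smoothedRhs, norm_smul, norm_neg, Real.norm_of_nonneg (by positivity)]
  have h1 : (2 * t ^ 2)⁻¹ ≤ 1 := inv_le_one_of_one_le₀ (by nlinarith)
  have h2 := (ContinuousLinearMap.adjoint (kOp (kerJ (φhat t)))).le_of_opNorm_le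
    ((hK t ht).trans (le_abs_self K)) v
  calc _ ≤ 1 * (|K| * ‖v‖) := by gcongr
    _ = _ := one_mul _

theorem aestronglyMeasurable_smoothedRhs (S : Phase) {J : Set ℝ}
    (hJ : MeasurableSet J) (hJT : J ⊆ Ioi T) {v : ℝ → L2 n}
    (hv : AEStronglyMeasurable v (volume.restrict J)) :
    AEStronglyMeasurable (fun t => smoothedRhs φhat t (v t)) (volume.restrict J) := by
  have h1 : ContinuousOn (fun t : ℝ => -(2 * t ^ 2)⁻¹) J := by
    refine (ContinuousOn.inv₀ (by fun_prop) fun t ht => ?_).neg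
    have : 0 < t := zero_lt_one.trans_le (S.hT.trans (hJT ht).le)
    positivity
  exact (h1.aestronglyMeasurable hJ).smul
    ((isBoundedBilinearMap_apply (𝕜 := ℂ) (E := L2 n) (F := L2 n)).continuous.comp_aestronglyMeasurable
      (((S.continuousOn_adjoint.mono hJT).aestronglyMeasurable hJ).prodMk hv))

theorem energy_mulOp_of_eqv {χ : Rn n → ℝ} (hχ : IsCut χ) {R : ℝ}
    (hR : ∀ ξ, χ ξ ≠ 0 → jap ξ ≤ R) (σ κ : ℝ) {v E : L2 n}
    (h : mulOp (fun ξ => (japSq ξ)⁻¹) v = E) :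
    energy χ ν σ κ (mulOp (fun ξ => lowCut R ξ * japSq ξ) E) = energy χ ν σ κ v := by
  have hbL := (isCut_lowCut (n := n) R).bddMeas_mul_japSq
  have e : mulOp (fun ξ => lowCut R ξ * japSq ξ) E = mulOp (lowCut R) v := by
    rw [← h, mulOp_mulOp hbL bddMeas_invJapSq]
    congr 2; ext ξ
    have := one_le_japSq ξ
    field_simp
  have hsq : sqOp χ ν σ κ (mulOp (lowCut R) v) = sqOp χ ν σ κ v := by
    rw [sqOp, mulOp_mulOp (hχ.bddMeas _ _ _) (bddMeas_lowCut R)]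
    congr 2; ext ξ
    by_cases h : χ ξ = 0
    · simp [h]
    · simp [lowCut, hR ξ h]
  rw [e, energy, energy, hsq, sqOp, ← inner_mulOp (hχ.bddMeas _ _ _), ← sqOp, hsq]
  rw [sqOp, inner_mulOp (hχ.bddMeas _ _ _)]

theorem norm_sub_le_of_hasDerivWithinAt {F F' : ℝ → L2 n →L[ℂ] L2 n} {t₁ t₂ L : ℝ}
    (h : ∀ t ∈ Icc t₁ t₂, HasDerivWithinAt F (F' t) (Icc t₁ t₂) t)
    (hL : ∀ t ∈ Icc t₁ t₂, ‖F' t‖ ≤ L) :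
    ∀ s ∈ Icc t₁ t₂, ∀ t ∈ Icc t₁ t₂, ‖F t - F s‖ ≤ L * ‖t - s‖ := fun _ hs _ ht =>
  (convex_Icc t₁ t₂).norm_image_sub_le_of_norm_hasDerivWithin_le h hL hs ht

theorem _root_.IsCut.exists_lipschitz_sqOp {χ : Rn n → ℝ} (hχ : IsCut χ) (κ : ℝ) {t₁ t₂ : ℝ}
    {σ σ' : ℝ → ℝ} (hσ : ∀ t ∈ Icc t₁ t₂, HasDerivAt σ (σ' t) t)
    (hσ' : ContinuousOn σ' (Icc t₁ t₂)) :
    ∃ L, ∀ s ∈ Icc t₁ t₂, ∀ t ∈ Icc t₁ t₂,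
      ‖sqOp χ ν (σ t) κ - sqOp χ ν (σ s) κ‖ ≤ L * ‖t - s‖ := by
  have hσc : ContinuousOn σ (Icc t₁ t₂) := fun t ht => (hσ t ht).continuousAt.continuousWithinAt
  have hS2 : ContinuousOn (fun t => sqOp χ ν (σ t) (κ + ν / 2)) (Icc t₁ t₂) :=
    (hχ.continuous_sqOp ν (κ + ν / 2)).comp_continuousOn hσc
  have hS3 : ContinuousOn (fun t => (2 : ℝ) • sqOp χ ν (σ t) (κ + ν / 2)) (Icc t₁ t₂) :=
    hS2.fun_const_smul 2
  have hS4 : ContinuousOn (fun t => σ' t • (2 : ℝ) • sqOp χ ν (σ t) (κ + ν / 2)) (Icc t₁ t₂) :=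
    hσ'.smul hS3
  obtain ⟨L, hL⟩ := isCompact_Icc.exists_bound_of_continuousOn hS4
  exact ⟨L, norm_sub_le_of_hasDerivWithinAt (fun t ht =>
    (hχ.hasDerivAt_sqOp ν κ (σ t)).scomp_hasDerivWithinAt t (hσ t ht).hasDerivWithinAt) hL⟩

theorem _root_.IsMild.intervalIntegrable (S : Phase)
    {a a' Λ : ℝ} (ha : T ≤ a) {v E : ℝ → L2 n} (hv : IsMild φhat a a' v E Λ)
    {t₁ t₂ : ℝ} (ht₁ : t₁ ∈ Ioo a a') (ht₂ : t₂ ∈ Ioo a a') (h12 : t₁ ≤ t₂) :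
    IntervalIntegrable (fun t => smoothedRhs φhat t (v t)) volume t₁ t₂ ∧
      ∃ K, 0 ≤ K ∧ ∀ s ∈ Icc t₁ t₂, ∀ t ∈ Icc t₁ t₂, ‖E t - E s‖ ≤ K * |t - s| := by
  have hsub : Icc t₁ t₂ ⊆ Ioo a a' := fun t ht => ⟨ht₁.1.trans_le ht.1, ht.2.trans_lt ht₂.2⟩
  have hsubT : Ioo a a' ⊆ Ioi T := fun t ht => ha.trans_lt ht.1
  obtain ⟨K, hK0, hK⟩ := S.exists_norm_smoothedRhs_le (t₂ := t₂) (hsubT ht₁)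
  have hGb : ∀ᵐ t, t ∈ Icc t₁ t₂ → ‖smoothedRhs φhat t (v t)‖ ≤ K * |Λ| := by
    filter_upwards [(ae_restrict_iff' measurableSet_Ioo).1 hv.bdd] with t h1 h2
    exact (hK t h2 _).trans (mul_le_mul_of_nonneg_left ((h1 (hsub h2)).trans (le_abs_self Λ)) hK0)
  have hGm : AEStronglyMeasurable (fun t => smoothedRhs φhat t (v t)) (volume.restrict (Icc t₁ t₂)) :=
    (S.aestronglyMeasurable_smoothedRhs measurableSet_Ioo hsubT hv.meas).mono_measure
      (Measure.restrict_mono hsub le_rfl)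
  refine ⟨?_, K * |Λ|, by positivity, fun s hs t ht => ?_⟩
  · rw [intervalIntegrable_iff_integrableOn_Icc_of_le h12]
    exact Integrable.of_bound hGm (K * |Λ|) ((ae_restrict_iff' measurableSet_Icc).2 hGb)
  · rw [hv.integ s (hsub hs) t (hsub ht)]
    refine intervalIntegral.norm_integral_le_of_norm_le_const_ae ?_
    filter_upwards [hGb] with x hx hx2
    exact hx ((uIcc_subset_Icc hs ht) (uIoc_subset_uIcc hx2))

/-- The derivative of the energy of a mild solution. -/
theorem hasDerivAt_mild_energy {χ : Rn n → ℝ} (hχ : IsCut χ) {R : ℝ}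
    (hR : ∀ ξ, χ ξ ≠ 0 → jap ξ ≤ R) {σ : ℝ → ℝ} {σ' t : ℝ} (hσ : HasDerivAt σ σ' t) (κ : ℝ)
    {E : ℝ → L2 n} {v : L2 n} (hE : HasDerivAt E (smoothedRhs φhat t v) t)
    (hEv : mulOp (fun ξ => (japSq ξ)⁻¹) v = E t) :
    HasDerivAt (fun t => energy χ ν (σ t) κ (mulOp (fun ξ => lowCut R ξ * japSq ξ) (E t)))
      (2 * σ' * energy χ ν (σ t) (κ + ν / 2) v -
        (2 * t ^ 2)⁻¹ * (2 * (inner ℂ v (kOp (kerJ (φhat t))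
          (mulOp (fun ξ => japSq ξ * (χ ξ * sqW ν (σ t) κ ξ)) v))).re)) t := by
  have hbL := (isCut_lowCut (n := n) R).bddMeas_mul_japSq
  have hPE : HasDerivWithinAt (fun t => mulOp (fun ξ => lowCut R ξ * japSq ξ) (E t))
      (mulOp (fun ξ => lowCut R ξ * japSq ξ) (smoothedRhs φhat t v)) univ t := by
    have := hasDerivWithinAt_clm_apply (hasDerivWithinAt_const t univ
      (mulOp fun ξ : Rn n => lowCut R ξ * japSq ξ)) hE.hasDerivWithinAt
    rwa [zero_apply, zero_add] at this
  have hqd := hasDerivWithinAt_energy hχ ν κ hσ.hasDerivWithinAt hPE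
  rw [hasDerivWithinAt_univ] at hqd
  refine hqd.congr_deriv ?_
  have hχR : ∀ ξ, χ ξ * lowCut R ξ = χ ξ := fun ξ => by
    by_cases h : χ ξ = 0
    · simp [h]
    · simp [lowCut, hR ξ h]
  have hPv : mulOp (fun ξ => lowCut R ξ * japSq ξ) (E t) = mulOp (lowCut R) v := by
    rw [← hEv, mulOp_mulOp hbL bddMeas_invJapSq]
    congr 2; ext ξ
    have := one_le_japSq ξ
    field_simp
  have hsq : sqOp χ ν (σ t) κ (mulOp (lowCut R) v) = sqOp χ ν (σ t) κ v := by
    rw [sqOp, mulOp_mulOp (hχ.bddMeas _ _ _) (bddMeas_lowCut R)]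
    congr 2; ext ξ
    rw [mul_right_comm, hχR]
  rw [energy_mulOp_of_eqv hχ hR (σ t) (κ + ν / 2) hEv, sub_eq_add_neg]
  congr 1
  rw [hPv, smoothedRhs, ← L2.ofReal_smul, map_smul, map_smul, inner_smul_right,
    Complex.re_ofReal_mul]
  have h1 : (inner ℂ (mulOp (lowCut R) v) (sqOp χ ν (σ t) κ (mulOp (fun ξ => lowCut R ξ * japSq ξ)
      (ContinuousLinearMap.adjoint (kOp (kerJ (φhat t))) v)))).re =
      (inner ℂ v (kOp (kerJ (φhat t))
          (mulOp (fun ξ => japSq ξ * (χ ξ * sqW ν (σ t) κ ξ)) v))).re := by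
    rw [sqOp, ← inner_mulOp (hχ.bddMeas _ _ _), ← sqOp, hsq, ← inner_mulOp hbL,
      ContinuousLinearMap.adjoint_inner_right, sqOp, mulOp_mulOp hbL (hχ.bddMeas _ _ _)]
    have h2 : (fun ξ => lowCut R ξ * japSq ξ * (χ ξ * sqW ν (σ t) κ ξ)) =
        fun ξ => japSq ξ * (χ ξ * sqW ν (σ t) κ ξ) := by
      ext ξ
      calc _ = japSq ξ * (χ ξ * lowCut R ξ * sqW ν (σ t) κ ξ) := by ring
        _ = _ := by rw [hχR]
    rw [h2]
    exact inner_re_symm (𝕜 := ℂ) _ _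
  rw [h1]; ring

/-- The energy identity, in differential form almost everywhere together with the fundamental
theorem of calculus. -/
theorem mild_energy (S : Phase) {a a' Λ : ℝ} (ha : T ≤ a)
    {v E : ℝ → L2 n} (hv : IsMild φhat a a' v E Λ) {χ : Rn n → ℝ} (hχ : IsCut χ) {R : ℝ}
    (hR : ∀ ξ, χ ξ ≠ 0 → jap ξ ≤ R) {σ σ' : ℝ → ℝ}
    (hσ : ∀ t ∈ Ioo a a', HasDerivAt σ (σ' t) t) (hσ' : ContinuousOn σ' (Ioo a a')) (κ : ℝ)
    {t₁ t₂ : ℝ} (ht₁ : t₁ ∈ Ioo a a') (ht₂ : t₂ ∈ Ioo a a') (h12 : t₁ ≤ t₂) :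
    ∃ q' : ℝ → ℝ, IntervalIntegrable q' volume t₁ t₂ ∧
      (∀ᵐ t, t ∈ Ioo t₁ t₂ → q' t = 2 * σ' t * energy χ ν (σ t) (κ + ν / 2) (v t) -
        (2 * t ^ 2)⁻¹ * (2 * (inner ℂ (v t) (kOp (kerJ (φhat t))
          (mulOp (fun ξ => japSq ξ * (χ ξ * sqW ν (σ t) κ ξ)) (v t)))).re)) ∧
      energy χ ν (σ t₂) κ (mulOp (fun ξ => lowCut R ξ * japSq ξ) (E t₂)) -
        energy χ ν (σ t₁) κ (mulOp (fun ξ => lowCut R ξ * japSq ξ) (E t₁)) =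
        ∫ t in t₁..t₂, q' t := by
  have hsub : Icc t₁ t₂ ⊆ Ioo a a' := fun t ht => ⟨ht₁.1.trans_le ht.1, ht.2.trans_lt ht₂.2⟩
  obtain ⟨hGi, K, hK0, hElip⟩ := IsMild.intervalIntegrable S ha hv ht₁ ht₂ h12
  obtain ⟨L, hSlip⟩ := hχ.exists_lipschitz_sqOp (ν := ν) κ (fun t ht => hσ t (hsub ht))
    (hσ'.mono hsub)
  have hScont : ContinuousOn (fun t => sqOp χ ν (σ t) κ) (Icc t₁ t₂) :=
    (hχ.continuous_sqOp ν κ).comp_continuousOn fun t ht =>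
      (hσ t (hsub ht)).continuousAt.continuousWithinAt
  obtain ⟨M, hM⟩ := isCompact_Icc.exists_bound_of_continuousOn hScont
  obtain ⟨P, hP⟩ : ∃ P, P = mulOp fun ξ : Rn n => lowCut R ξ * japSq ξ := ⟨_, rfl⟩
  obtain ⟨q, hq⟩ : ∃ q : ℝ → ℝ, q = fun t => energy χ ν (σ t) κ (P (E t)) := ⟨_, rfl⟩
  have hEc : ContinuousOn (fun t => P (E t)) (Icc t₁ t₂) := by
    refine P.continuous.comp_continuousOn ?_
    refine (LipschitzOnWith.of_dist_le_mul (K := Real.toNNReal K) fun x hx y hy => ?_).continuousOn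
    rw [dist_eq_norm, Real.dist_eq, Real.coe_toNNReal _ hK0]
    exact hElip y hy x hx
  obtain ⟨Y, hY⟩ := isCompact_Icc.exists_bound_of_continuousOn hEc
  have hqlip : LipschitzOnWith (Real.toNNReal (2 * (M * Y) * (‖P‖ * K) + Y ^ 2 * L)) q
      (uIcc t₁ t₂) := by
    rw [uIcc_of_le h12]
    refine LipschitzOnWith.of_dist_le' fun x hx y hy => ?_
    rw [Real.dist_eq, Real.dist_eq, hq]
    have hM0 : 0 ≤ M := (norm_nonneg _).trans (hM x hx)
    have hY0 : 0 ≤ Y := (norm_nonneg _).trans (hY x hx)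
    refine (abs_re_inner_sub_le (hY x hx) (hY y hy) (hM x hx) (hM y hy)).trans ?_
    have h1 : ‖P (E x) - P (E y)‖ ≤ ‖P‖ * (K * |x - y|) := by
      rw [← map_sub]
      exact P.le_of_opNorm_le_of_le le_rfl (hElip y hy x hx)
    have h2 := hSlip y hy x hx
    rw [Real.norm_eq_abs] at h2
    calc _ ≤ 2 * (M * Y) * (‖P‖ * (K * |x - y|)) + Y ^ 2 * (L * |x - y|) := by gcongr
      _ = _ := by ring
  have hac := hqlip.absolutelyContinuousOnInterval
  refine ⟨deriv q, hac.intervalIntegrable_deriv, ?_, ?_⟩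
  · filter_upwards [hGi.ae_hasDerivAt_integral, (ae_restrict_iff' measurableSet_Ioo).1 hv.eqv]
      with t hd hEv ht
    have htI : t ∈ Icc t₁ t₂ := Ioo_subset_Icc_self ht
    have hd' := hd (by rwa [uIcc_of_le h12]) t₁ left_mem_uIcc
    have hE' : HasDerivAt E (smoothedRhs φhat t (v t)) t := by
      refine (hd'.const_add (E t₁)).congr_of_eventuallyEq ?_
      filter_upwards [Ioo_mem_nhds ht.1 ht.2] with s hs
      rw [← hv.integ t₁ ht₁ s (hsub (Ioo_subset_Icc_self hs))]; abel
    rw [hq, hP]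
    exact (hasDerivAt_mild_energy hχ hR (hσ t (hsub htI)) κ hE' (hEv (hsub htI))).deriv
  · rw [hac.integral_deriv_eq_sub, hq, hP]

theorem ofReal_form_le (S : Phase) {t : ℝ} (ht : T < t)
    {χ : Rn n → ℝ} (hχ : IsCut χ) (σ κ : ℝ) (w : L2 n) :
    ofReal |2 * (inner ℂ w (kOp (kerJ (φhat t))
        (mulOp (fun ξ => japSq ξ * (χ ξ * sqW ν σ κ ξ)) w))).re| ≤
      ∫⁻ p : Rn n × Rn n, ‖w p.1‖ₑ * (ofReal |χ p.1 * sqW ν σ κ p.1 - χ p.2 * sqW ν σ κ p.2| *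
        ‖aKer (φhat t) p‖ₑ * ‖w p.2‖ₑ) ∂(volume.prod volume) := by
  obtain ⟨D, hD⟩ := S.KBdd_kerJ ht
  set M : Rn n → ℝ := fun ξ => χ ξ * sqW ν σ κ ξ with hM
  have hb : BddMeas fun ξ => japSq ξ * (χ ξ * sqW ν σ κ ξ) := by
    obtain ⟨R, hR⟩ := hχ.bounded
    have h := (isCut_lowCut (n := n) R).bddMeas_mul_japSq.mul (hχ.bddMeas ν σ κ)
    have e : (fun ξ : Rn n => lowCut R ξ * japSq ξ * (χ ξ * sqW ν σ κ ξ)) =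
        fun ξ => japSq ξ * (χ ξ * sqW ν σ κ ξ) := by
      ext ξ
      by_cases h : χ ξ = 0
      · simp [h]
      · simp [lowCut, hR ξ h]
    rwa [e] at h
  have hae : (fun p : Rn n × Rn n => starRingEnd ℂ (w p.1) * (kerJ (φhat t) p *
      (mulOp (fun ξ => japSq ξ * (χ ξ * sqW ν σ κ ξ)) w) p.2))
      =ᵐ[volume.prod volume] fun p => starRingEnd ℂ (w p.1) *
        (aKer (φhat t) p * ((M p.2 : ℂ) * w p.2)) := by
    filter_upwards [ae_snd (coeFn_mulOp hb w)] with p hp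
    rw [hp, kerJ]
    have h1 : ((japSq p.2 : ℝ) : ℂ) ≠ 0 := by
      have := one_le_japSq p.2
      exact_mod_cast (by linarith : japSq p.2 ≠ 0)
    push_cast
    field_simp
    simp only [hM]
    push_cast
    ring
  rw [inner_kOp hD, kform, integral_congr_ae hae]
  exact ofReal_abs_re_form_le (antiHerm_aKer (S.conj_φhat ht.le)) ((hD.integrable _ _).congr hae)

theorem sqW_zero (ν : ℝ) (ξ : Rn n) : sqW ν 0 0 ξ = 1 := by simp [sqW]

/-- The logarithmic cutoffs almost commute with the generator. -/
theorem lintegral_logCut_le {g : Rn n → ℂ} (hg : AEStronglyMeasurable g volume) {ε : ℝ}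
    (hε : 0 < ε) {C : ℝ≥0} (hC : ∫⁻ ζ, ofReal (jap ζ ^ (3 : ℝ)) * ‖g ζ‖ₑ ≤ C) (ν : ℝ)
    (w : L2 n) :
    ∫⁻ p : Rn n × Rn n, ‖w p.1‖ₑ * (ofReal |logCut ε (jap p.1) * sqW ν 0 0 p.1 -
        logCut ε (jap p.2) * sqW ν 0 0 p.2| * ‖aKer g p‖ₑ * ‖w p.2‖ₑ) ∂(volume.prod volume) ≤
      ofReal (4 * ε) * C * (‖w‖ₑ * ‖w‖ₑ) := by
  have hχ := isCut_logCut (n := n) hε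
  set k' : Rn n × Rn n → ℂ := fun p =>
    ((|logCut ε (jap p.1) - logCut ε (jap p.2)| : ℝ) : ℂ) * aKer g p with hk'
  have hm : AEStronglyMeasurable k' (volume.prod volume) := by
    refine AEStronglyMeasurable.mul ?_ (aesm_aKer hg)
    refine (Complex.measurable_ofReal.comp ?_).aestronglyMeasurable
    exact ((hχ.measurable.comp measurable_fst).sub (hχ.measurable.comp measurable_snd)).abs
  have hbd : ∀ p, ‖k' p‖ ≤ 4 * ε * jap (p.1 - p.2) ^ (3 : ℝ) * ‖g (p.1 - p.2)‖ := by
    intro p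
    rw [hk', norm_mul, norm_aKer, Complex.norm_real, Real.norm_eq_abs, abs_abs, ← mul_assoc]
    refine mul_le_mul_of_nonneg_right ?_ (norm_nonneg _)
    have h1 := abs_sqDiff_le p
    have h2 := abs_logCut_sub_mul_le (X := jap p.1) (E := jap p.2)
      (x := 2 * Real.pi * ‖p.1 - p.2‖) hε.le (freq_nonneg _) (one_le_jap _) (one_le_jap _)
      (abs_jap_sub_le _ _)
    refine (mul_le_mul_of_nonneg_left h1 (abs_nonneg _)).trans (h2.trans ?_)
    rw [show (max (2 * Real.pi * ‖p.1 - p.2‖) 1) = jap (p.1 - p.2) from rfl]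
    have h3 := freq_le_jap (p.1 - p.2)
    have h4 : jap (p.1 - p.2) ^ (3 : ℝ) = jap (p.1 - p.2) * jap (p.1 - p.2) ^ 2 := by
      rw [show (3 : ℝ) = ((3 : ℕ) : ℝ) by norm_num, Real.rpow_natCast]; ring
    rw [h4]
    gcongr
  have hK := KBdd_of_norm_le (C := Real.toNNReal (4 * ε) * C) (by positivity) hm hg hbd (by
    rw [ENNReal.coe_mul]
    gcongr
    rfl)
  have h := hK.2 w w
  rw [ENNReal.coe_mul] at h
  refine le_trans (le_of_eq (lintegral_congr fun p => ?_)) h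
  rw [sqW_zero, sqW_zero, mul_one, mul_one, hk', enorm_mul, ← ofReal_norm (((_ : ℝ) : ℂ)),
    Complex.norm_real, Real.norm_eq_abs, abs_abs]

/-- Mild solutions conserve the `L²` norm. -/
theorem mild_norm_eq (S : Phase) {a a' Λ : ℝ} (ha : T ≤ a)
    {v E : ℝ → L2 n} (hv : IsMild φhat a a' v E Λ) {t₁ t₂ : ℝ} (ht₁ : t₁ ∈ Ioo a a')
    (ht₂ : t₂ ∈ Ioo a a') (h1 : mulOp (fun ξ => (japSq ξ)⁻¹) (v t₁) = E t₁)
    (h2 : mulOp (fun ξ => (japSq ξ)⁻¹) (v t₂) = E t₂) : ‖v t₁‖ = ‖v t₂‖ := by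
  wlog h12 : t₁ ≤ t₂ generalizing t₁ t₂
  · exact (this ht₂ ht₁ h2 h1 (not_le.1 h12).le).symm
  have hsub : Icc t₁ t₂ ⊆ Ioo a a' := fun t ht => ⟨ht₁.1.trans_le ht.1, ht.2.trans_lt ht₂.2⟩
  have hT₁ : T < t₁ := ha.trans_lt ht₁.1
  obtain ⟨K, hK0, hK⟩ := exists_jap_rpow_le (n := n) S.hν (S.ρ_pos hT₁) 3
  obtain ⟨C, hC⟩ := lintegral_jap_rpow_le S.hn S.hν S.hδ S.hLow hK0 hK
  obtain ⟨H, hH⟩ := isCompact_Icc.exists_bound_of_continuousOn (s := Icc t₁ t₂)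
    (S.h₀cont.mono fun t ht => hT₁.le.trans ht.1)
  set D : ℝ≥0 := C * (b * Real.toNNReal H)
  have hD : ∀ t ∈ Icc t₁ t₂, ∫⁻ ζ, ofReal (jap ζ ^ (3 : ℝ)) * ‖φhat t ζ‖ₑ ≤ D := by
    intro t ht
    have htT : T ≤ t := hT₁.le.trans ht.1
    refine (hC (φhat t) (S.aesm htT)).trans ?_
    rw [ENNReal.coe_mul, ENNReal.coe_mul]
    gcongr
    refine (yNorm_mono l lLow (S.ρ_mono hT₁.le ht.1) _).trans ((S.bound t htT).trans ?_)
    gcongr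
    exact ENNReal.ofReal_le_ofReal ((le_abs_self _).trans (hH t ht))
  have hΛ : ∀ᵐ t, t ∈ Ioo a a' → ‖v t‖ ≤ |Λ| :=
    ((ae_restrict_iff' measurableSet_Ioo).1 hv.bdd).mono fun t h1 h2 => (h1 h2).trans (le_abs_self Λ)
  have hmain : ∀ ε : ℝ, 0 < ε →
      |energy (fun ξ => logCut ε (jap ξ)) ν 0 0 (v t₂) -
        energy (fun ξ => logCut ε (jap ξ)) ν 0 0 (v t₁)| ≤ (4 * ε * D * (|Λ| * |Λ|)) * |t₂ - t₁| := by
    intro ε hε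
    have hχ := isCut_logCut (n := n) hε
    obtain ⟨R, hR⟩ := hχ.bounded
    obtain ⟨q', -, hq', heq⟩ := S.mild_energy ha hv hχ hR (σ := fun _ => 0) (σ' := fun _ => 0)
      (fun t _ => hasDerivAt_const t 0) continuousOn_const 0 ht₁ ht₂ h12
    rw [energy_mulOp_of_eqv hχ hR 0 0 h1, energy_mulOp_of_eqv hχ hR 0 0 h2] at heq
    rw [heq, ← Real.norm_eq_abs]
    refine intervalIntegral.norm_integral_le_of_norm_le_const_ae ?_
    have hne : ∀ᵐ t : ℝ, t ≠ t₂ := by simp [ae_iff, measure_singleton]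
    filter_upwards [hq', hΛ, hne] with t h3 h4 h5 h6
    rw [uIoc_of_le h12] at h6
    have htI : t ∈ Icc t₁ t₂ := Ioc_subset_Icc_self h6
    have htT : T < t := hT₁.trans_le htI.1
    rw [h3 ⟨h6.1, lt_of_le_of_ne h6.2 h5⟩, mul_zero, zero_mul, zero_sub, norm_neg, Real.norm_eq_abs,
      abs_mul]
    have ht1 : 1 ≤ t := S.hT.trans htT.le
    have h7 : |(2 * t ^ 2)⁻¹| ≤ 1 := by
      rw [abs_of_pos (by positivity)]
      exact inv_le_one_of_one_le₀ (by nlinarith)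
    have h8 := (S.ofReal_form_le htT hχ 0 0 (v t)).trans
      (lintegral_logCut_le (S.aesm htT.le) hε (hD t htI) ν (v t))
    rw [← ofReal_norm, ← ENNReal.ofReal_coe_nnreal, ← ENNReal.ofReal_mul (by positivity),
      ← ENNReal.ofReal_mul (by positivity), ← ENNReal.ofReal_mul (by positivity),
      ENNReal.ofReal_le_ofReal_iff (by positivity)] at h8
    have h9 := h4 (hsub htI)
    calc _ ≤ 1 * (4 * ε * D * (‖v t‖ * ‖v t‖)) := by gcongr
      _ ≤ _ := by rw [one_mul]; gcongr
  have hlim : ∀ w : L2 n, Tendsto (fun j : ℕ => energy (fun ξ => logCut (1 / ((j : ℝ) + 1)) (jap ξ))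
      ν 0 0 w) atTop (𝓝 (‖w‖ ^ 2)) := by
    intro w
    have h3 := tendsto_mulOp (F := atTop) (g := fun (j : ℕ) ξ => logCut (1 / ((j : ℝ) + 1)) (jap ξ) *
      sqW ν 0 0 ξ) (g₀ := fun _ => 1) (C := 1)
      (fun j => (isCut_logCut (by positivity)).bddMeas ν 0 0)
      ⟨measurable_const, 1, fun _ => by simp⟩ (fun j ξ => by
        rw [sqW_zero, mul_one, abs_of_nonneg (logCut_nonneg _ _)]
        exact logCut_le_one (by positivity) (one_le_jap ξ)) (fun ξ => by
        simp only [sqW_zero, mul_one]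
        unfold logCut
        have h4 := ((tendsto_one_div_add_atTop_nhds_zero_nat (𝕜 := ℝ)).mul_const
          (Real.log (jap ξ))).const_sub 1
        have h5 := h4.max (tendsto_const_nhds (x := (0 : ℝ)))
        simpa using h5) w
    rw [mulOp_one] at h3
    have h4 := (Complex.continuous_re.tendsto _).comp ((tendsto_const_nhds (x := w)).inner (𝕜 := ℂ) h3)
    have h5 : (inner ℂ w w).re = ‖w‖ ^ 2 := inner_self_eq_norm_sq (𝕜 := ℂ) w
    rw [h5] at h4
    exact h4
  have h3 := ((hlim (v t₂)).sub (hlim (v t₁))).abs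
  have h4 : Tendsto (fun j : ℕ => (4 * (1 / ((j : ℝ) + 1)) * D * (|Λ| * |Λ|)) * |t₂ - t₁|) atTop
      (𝓝 0) := by
    have := ((((tendsto_one_div_add_atTop_nhds_zero_nat (𝕜 := ℝ)).const_mul 4).mul_const
      (D : ℝ)).mul_const (|Λ| * |Λ|)).mul_const |t₂ - t₁|
    simpa using this
  have h5 := le_of_tendsto_of_tendsto' h3 h4 fun j => hmain _ (by positivity)
  have h6 := sub_eq_zero.1 (abs_eq_zero.1 (le_antisymm h5 (abs_nonneg _)))
  exact ((pow_left_inj₀ (norm_nonneg _) (norm_nonneg _) two_ne_zero).1 h6).symm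

end PhaseSetup

/-! ### Regularity in time of the limit evolution -/

theorem ofReal_integral_le_lintegral {α : Type*} [MeasurableSpace α] {μ : Measure α} {f : α → ℝ}
    (hf : Integrable f μ) : ofReal (∫ x, f x ∂μ) ≤ ∫⁻ x, ofReal (f x) ∂μ := by
  rw [integral_eq_lintegral_pos_part_sub_lintegral_neg_part hf]
  exact (ENNReal.ofReal_le_ofReal (sub_le_self _ ENNReal.toReal_nonneg)).trans
    ENNReal.ofReal_toReal_le

theorem IsMild.sub {φhat : ℝ → Rn n → ℂ} {a a' Λ Λ' : ℝ} {v v' E E' : ℝ → L2 n}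
    (hv : IsMild φhat a a' v E Λ) (hv' : IsMild φhat a a' v' E' Λ')
    (hi : ∀ t₁ ∈ Ioo a a', ∀ t₂ ∈ Ioo a a',
      IntervalIntegrable (fun t => smoothedRhs φhat t (v t)) volume t₁ t₂)
    (hi' : ∀ t₁ ∈ Ioo a a', ∀ t₂ ∈ Ioo a a',
      IntervalIntegrable (fun t => smoothedRhs φhat t (v' t)) volume t₁ t₂) :
    IsMild φhat a a' (v - v') (E - E') (Λ + Λ') where
  meas := hv.meas.sub hv'.meas
  bdd := by
    filter_upwards [hv.bdd, hv'.bdd] with t h1 h2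
    exact (norm_sub_le _ _).trans (add_le_add h1 h2)
  eqv := by
    filter_upwards [hv.eqv, hv'.eqv] with t h1 h2
    rw [Pi.sub_apply, Pi.sub_apply, map_sub, h1, h2]
  integ t₁ ht₁ t₂ ht₂ := by
    have h : ∀ t, smoothedRhs φhat t ((v - v') t) =
        smoothedRhs φhat t (v t) - smoothedRhs φhat t (v' t) := fun t => by
      rw [smoothedRhs, smoothedRhs, smoothedRhs, Pi.sub_apply, map_sub, smul_sub]
    simp_rw [h]
    rw [intervalIntegral.integral_sub (hi t₁ ht₁ t₂ ht₂) (hi' t₁ ht₁ t₂ ht₂),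
      ← hv.integ t₁ ht₁ t₂ ht₂, ← hv'.integ t₁ ht₁ t₂ ht₂, Pi.sub_apply, Pi.sub_apply]
    abel

theorem IsMild.mono {φhat : ℝ → Rn n → ℂ} {a a' c Λ : ℝ} {v E : ℝ → L2 n}
    (hv : IsMild φhat a a' v E Λ) (hc : c ≤ a') : IsMild φhat a c v E Λ where
  meas := hv.meas.mono_measure (Measure.restrict_mono (Ioo_subset_Ioo_right hc) le_rfl)
  bdd := ae_restrict_of_ae_restrict_of_subset (Ioo_subset_Ioo_right hc) hv.bdd
  eqv := ae_restrict_of_ae_restrict_of_subset (Ioo_subset_Ioo_right hc) hv.eqv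
  integ t₁ ht₁ t₂ ht₂ := hv.integ t₁ (Ioo_subset_Ioo_right hc ht₁) t₂ (Ioo_subset_Ioo_right hc ht₂)

namespace PhaseSetup

theorem _root_.IsMild.intervalIntegrable' (S : Phase)
    {a a' Λ : ℝ} (ha : T ≤ a) {v E : ℝ → L2 n} (hv : IsMild φhat a a' v E Λ) :
    ∀ t₁ ∈ Ioo a a', ∀ t₂ ∈ Ioo a a',
      IntervalIntegrable (fun t => smoothedRhs φhat t (v t)) volume t₁ t₂ := by
  intro t₁ ht₁ t₂ ht₂
  rcases le_total t₁ t₂ with h | h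
  · exact (IsMild.intervalIntegrable S ha hv ht₁ ht₂ h).1
  · exact (IsMild.intervalIntegrable S ha hv ht₂ ht₁ h).1.symm

theorem _root_.IsMild.sub' (S : Phase) {a a' Λ Λ' : ℝ}
    (ha : T ≤ a) {v v' E E' : ℝ → L2 n}
    (hv : IsMild φhat a a' v E Λ) (hv' : IsMild φhat a a' v' E' Λ') :
    IsMild φhat a a' (v - v') (E - E') (Λ + Λ') :=
  hv.sub hv' (hv.intervalIntegrable' S ha) (hv'.intervalIntegrable' S ha)

/-- Continuous mild solutions conserve the norm up to the end points. -/
theorem mild_norm_eq_of_continuousOn (S : Phase) {t₀ Λ : ℝ}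
    (ht₀ : T < t₀) {v : ℝ → L2 n} (hc : ContinuousOn v (Icc T t₀))
    (hv : IsMild φhat T t₀ v (fun t => mulOp (fun ξ => (japSq ξ)⁻¹) (v t)) Λ) {t : ℝ}
    (ht : t ∈ Icc T t₀) : ‖v t‖ = ‖v t₀‖ := by
  obtain ⟨m, hm⟩ := exists_between ht₀
  have h1 : EqOn (fun t => ‖v t‖) (fun _ => ‖v m‖) (Ioo T t₀) := fun s hs =>
    S.mild_norm_eq le_rfl hv hs hm rfl rfl
  have h2 : EqOn (fun t => ‖v t‖) (fun _ => ‖v m‖) (Icc T t₀) := by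
    refine h1.of_subset_closure hc.norm continuousOn_const Ioo_subset_Icc_self ?_
    rw [closure_Ioo ht₀.ne]
  exact (h2 ht).trans (h2 (right_mem_Icc.2 ht₀.le)).symm

theorem mild_eqOn (S : Phase) {t₀ Λ Λ' : ℝ}
    (ht₀ : T < t₀) {v v' : ℝ → L2 n} (hc : ContinuousOn v (Icc T t₀))
    (hc' : ContinuousOn v' (Icc T t₀))
    (hv : IsMild φhat T t₀ v (fun t => mulOp (fun ξ => (japSq ξ)⁻¹) (v t)) Λ)
    (hv' : IsMild φhat T t₀ v' (fun t => mulOp (fun ξ => (japSq ξ)⁻¹) (v' t)) Λ')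
    (h : v t₀ = v' t₀) : EqOn v v' (Icc T t₀) := by
  intro t ht
  have hd := hv.sub' S le_rfl hv'
  have e : (fun t => mulOp (fun ξ => (japSq ξ)⁻¹) (v t)) - (fun t => mulOp (fun ξ => (japSq ξ)⁻¹) (v' t))
      = fun t => mulOp (fun ξ => (japSq ξ)⁻¹) ((v - v') t) := by
    ext1 t; rw [Pi.sub_apply, Pi.sub_apply, map_sub]
  rw [e] at hd
  have h1 := S.mild_norm_eq_of_continuousOn ht₀ (hc.sub hc') hd ht
  rw [Pi.sub_apply, Pi.sub_apply, h, sub_self, norm_zero, norm_eq_zero, sub_eq_zero] at h1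
  exact h1

/-- The limit of the truncated evolutions is a mild solution. -/
theorem _root_.IsLimitEvolution.isMild (S : Phase) {t₀ : ℝ}
    {z : L2 n} {v : ℝ → L2 n} (hv : IsLimitEvolution φhat T t₀ z v) :
    IsMild φhat T t₀ v (fun t => mulOp (fun ξ => (japSq ξ)⁻¹) (v t)) ‖z‖ := by
  have hcv := hv.continuousOn.mono Ioo_subset_Icc_self
  refine ⟨hcv.aestronglyMeasurable measurableSet_Ioo,
    (ae_restrict_iff' measurableSet_Ioo).2 (Eventually.of_forall fun t ht =>
      (hv.norm_eq S (Ioo_subset_Icc_self ht)).le), Eventually.of_forall fun _ => rfl,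
    fun t₁ ht₁ t₂ ht₂ => ?_⟩
  have hsub : uIcc t₁ t₂ ⊆ Ioo T t₀ := ordConnected_Ioo.uIcc_subset ht₁ ht₂
  have hsubT : uIcc t₁ t₂ ⊆ Ioi T := fun t ht => (hsub ht).1
  have hpos : ∀ t ∈ uIcc t₁ t₂, 0 < 2 * t ^ 2 := fun t ht => by
    have : 0 < t := zero_lt_one.trans_le (S.hT.trans (hsubT ht).le)
    positivity
  have hcc : ContinuousOn (fun t : ℝ => (2 * t ^ 2)⁻¹) (uIcc t₁ t₂) :=
    ContinuousOn.inv₀ (by fun_prop) fun t ht => (hpos t ht).ne'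
  have hGc : ContinuousOn (fun t => smoothedRhs φhat t (v t)) (uIcc t₁ t₂) :=
    hcc.neg.smul ((S.continuousOn_adjoint.mono hsubT).clm_apply (hcv.mono hsub))
  obtain ⟨u, hu, hlim⟩ := hv.approx
  have hN0 : ∀ j : ℕ, (0 : ℝ) ≤ (j : ℝ) + 1 := fun j => by positivity
  refine ext_inner_left ℂ fun f => ?_
  obtain ⟨K, hK⟩ := isCompact_uIcc.exists_bound_of_continuousOn
    (S.continuousOn_kOp_kerJ.mono hsubT)
  have hK0 : 0 ≤ K := (norm_nonneg _).trans (hK t₁ left_mem_uIcc)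
  -- the truncated generators in terms of the smoothed one
  have hker : ∀ (j : ℕ) (t : ℝ), T < t → kOp (kerN ((j : ℝ) + 1) (φhat t))
      (mulOp (fun ξ => (japSq ξ)⁻¹) f) = mulOp (lowCut ((j : ℝ) + 1)) (kOp (kerJ (φhat t))
        (mulOp (lowCut ((j : ℝ) + 1)) f)) := by
    intro j t ht
    obtain ⟨D, hD⟩ := S.KBdd_kerN (hN0 j) ht.le
    obtain ⟨D', hD'⟩ := S.KBdd_kerJ ht
    refine ext_inner_left ℂ fun w => ?_
    rw [← inner_mulOp (bddMeas_lowCut _), inner_kOp hD, inner_kOp hD']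
    refine integral_congr_ae ?_
    filter_upwards [ae_fst (coeFn_mulOp (bddMeas_lowCut ((j : ℝ) + 1)) w),
      ae_snd (coeFn_mulOp (bddMeas_lowCut ((j : ℝ) + 1)) f),
      ae_snd (coeFn_mulOp bddMeas_invJapSq f)] with p h1 h2 h3
    rw [h1, h2, h3, map_mul, Complex.conj_ofReal, kerN, kerJ]
    push_cast; ring
  set g : ℕ → ℝ → ℂ := fun j t => inner ℂ (mulOp (fun ξ => (japSq ξ)⁻¹) f)
    ((2 * t ^ 2)⁻¹ • kOp (kerN ((j : ℝ) + 1) (φhat t)) (u j t)) with hg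
  have hg' : ∀ j, ∀ t ∈ uIcc t₁ t₂, g j t = -((((2 * t ^ 2)⁻¹ : ℝ) : ℂ) *
      inner ℂ (mulOp (lowCut ((j : ℝ) + 1)) (kOp (kerJ (φhat t))
        (mulOp (lowCut ((j : ℝ) + 1)) f))) (u j t)) := by
    intro j t ht
    have htT : T < t := hsubT ht
    obtain ⟨D, hD⟩ := S.KBdd_kerN (hN0 j) htT.le
    rw [← hker j t htT]
    change inner ℂ (mulOp (fun ξ => (japSq ξ)⁻¹) f)
      ((2 * t ^ 2)⁻¹ • kOp (kerN ((j : ℝ) + 1) (φhat t)) (u j t)) = _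
    rw [← L2.ofReal_smul, inner_smul_right,
      (antiHerm_kerN _ (S.conj_φhat htT.le)).inner_kOp_left hD]
    ring
  have hFTC : ∀ j, ∫ t in t₁..t₂, g j t = inner ℂ f (mulOp (fun ξ => (japSq ξ)⁻¹) (u j t₂)) -
      inner ℂ f (mulOp (fun ξ => (japSq ξ)⁻¹) (u j t₁)) := by
    intro j
    have hgc : ContinuousOn (g j) (uIcc t₁ t₂) :=
      continuousOn_const.inner (hcc.smul (((S.continuousOn_kOp_kerN (hN0 j)).mono
        fun t ht => mem_Ici.2 (le_of_lt (hsubT ht))).clm_apply ((hu j).1.continuousOn.mono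
          (hsub.trans Ioo_subset_Icc_self))))
    rw [← inner_mulOp bddMeas_invJapSq, ← inner_mulOp bddMeas_invJapSq]
    refine intervalIntegral.integral_eq_sub_of_hasDerivAt (f := fun t =>
      inner ℂ (mulOp (fun ξ => (japSq ξ)⁻¹) f) (u j t)) (fun t ht => ?_) hgc.intervalIntegrable
    have h1 := ((hu j).1.deriv t (Ioo_subset_Icc_self (hsub ht))).hasDerivAt
      (Icc_mem_nhds (hsub ht).1 (hsub ht).2)
    have h2 := (hasDerivAt_const t (mulOp (fun ξ => (japSq ξ)⁻¹) f)).inner ℂ h1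
    simpa [hg] using h2
  have hlimg : Tendsto (fun j => ∫ t in t₁..t₂, g j t) atTop
      (𝓝 (∫ t in t₁..t₂, inner ℂ f (smoothedRhs φhat t (v t)))) := by
    refine intervalIntegral.tendsto_integral_filter_of_dominated_convergence
      (fun _ => K * ‖f‖ * ‖z‖) ?_ ?_ intervalIntegrable_const ?_
    · refine Eventually.of_forall fun j => ?_
      have hgc : ContinuousOn (g j) (uIcc t₁ t₂) :=
        continuousOn_const.inner (hcc.smul (((S.continuousOn_kOp_kerN (hN0 j)).mono
          fun t ht => mem_Ici.2 (le_of_lt (hsubT ht))).clm_apply ((hu j).1.continuousOn.mono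
            (hsub.trans Ioo_subset_Icc_self))))
      exact (hgc.mono uIoc_subset_uIcc).aestronglyMeasurable measurableSet_uIoc
    · refine Eventually.of_forall fun j => Eventually.of_forall fun t ht => ?_
      have ht' := uIoc_subset_uIcc ht
      rw [hg' j t ht', norm_neg, norm_mul, Complex.norm_real,
        Real.norm_of_nonneg (inv_pos.2 (hpos t ht')).le]
      have h1 : (2 * t ^ 2)⁻¹ ≤ 1 := inv_le_one_of_one_le₀ (by
        have : 1 ≤ t := S.hT.trans (hsubT ht').le
        nlinarith)
      have h2 : ‖u j t‖ ≤ ‖z‖ := by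
        rw [S.norm_approx (hN0 j) (hu j).1 (Ioo_subset_Icc_self (hsub ht')), (hu j).2]
        exact norm_mulOp_lowCut_le _ _
      have h3 : ‖mulOp (lowCut ((j : ℝ) + 1)) (kOp (kerJ (φhat t))
          (mulOp (lowCut ((j : ℝ) + 1)) f))‖ ≤ K * ‖f‖ :=
        (norm_mulOp_lowCut_le _ _).trans ((kOp (kerJ (φhat t))).le_of_opNorm_le_of_le (hK t ht')
          (norm_mulOp_lowCut_le _ _))
      calc _ ≤ 1 * ((K * ‖f‖) * ‖z‖) := by
            gcongr
            exact (norm_inner_le_norm _ _).trans (by gcongr)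
        _ = _ := one_mul _
    · refine Eventually.of_forall fun t ht => ?_
      have ht' := uIoc_subset_uIcc ht
      have e1 : inner ℂ f (smoothedRhs φhat t (v t)) = -((((2 * t ^ 2)⁻¹ : ℝ) : ℂ) *
          inner ℂ (kOp (kerJ (φhat t)) f) (v t)) := by
        rw [smoothedRhs, ← L2.ofReal_smul, inner_smul_right,
          ContinuousLinearMap.adjoint_inner_right]
        push_cast; ring
      rw [e1]
      refine Tendsto.congr (fun j => (hg' j t ht').symm) ?_
      refine (Tendsto.const_mul _ (Tendsto.inner ?_ (hlim t (Ioo_subset_Icc_self (hsub ht'))))).neg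
      have h1 := ((kOp (kerJ (φhat t))).continuous.tendsto f).comp (tendsto_mulOp_lowCut_nat f)
      have h2 := tendsto_mulOp_lowCut_nat (kOp (kerJ (φhat t)) f)
      rw [tendsto_iff_norm_sub_tendsto_zero] at h1 h2 ⊢
      refine squeeze_zero (fun _ => norm_nonneg _) (fun j => ?_) (by simpa using h1.add h2)
      have e2 : mulOp (lowCut ((j : ℝ) + 1)) (kOp (kerJ (φhat t)) (mulOp (lowCut ((j : ℝ) + 1)) f)) -
          kOp (kerJ (φhat t)) f = mulOp (lowCut ((j : ℝ) + 1)) (kOp (kerJ (φhat t))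
            (mulOp (lowCut ((j : ℝ) + 1)) f) - kOp (kerJ (φhat t)) f) +
          (mulOp (lowCut ((j : ℝ) + 1)) (kOp (kerJ (φhat t)) f) - kOp (kerJ (φhat t)) f) := by
        rw [map_sub]; abel
      rw [e2]
      exact (norm_add_le _ _).trans (add_le_add (norm_mulOp_lowCut_le _ _) le_rfl)
  have hlim2 : Tendsto (fun j => ∫ t in t₁..t₂, g j t) atTop
      (𝓝 (inner ℂ f (mulOp (fun ξ => (japSq ξ)⁻¹) (v t₂)) -
      inner ℂ f (mulOp (fun ξ => (japSq ξ)⁻¹) (v t₁)))) := by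
    simp_rw [hFTC]
    have hB : ∀ t ∈ Ioo T t₀, Tendsto (fun j => inner ℂ f (mulOp (fun ξ => (japSq ξ)⁻¹) (u j t)))
        atTop (𝓝 (inner ℂ f (mulOp (fun ξ => (japSq ξ)⁻¹) (v t)))) := fun t ht =>
      tendsto_const_nhds.inner (((mulOp fun ξ : Rn n => (japSq ξ)⁻¹).continuous.tendsto _).comp
        (hlim t (Ioo_subset_Icc_self ht)))
    exact (hB t₂ ht₂).sub (hB t₁ ht₁)
  have hfin := tendsto_nhds_unique hlim2 hlimg
  rw [inner_sub_right, hfin]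
  exact (innerSL ℂ f).intervalIntegral_comp_comm hGc.intervalIntegrable

/-- Growth of the norm of a continuous mild solution, for cut off energies. -/
theorem mild_cut_energy_le (S : Phase) {κ : ℝ} {C : ℝ≥0}
    (hC : CommutatorBound n ν l lLow κ C) (hsmall : C * b * h₁ T ≤ 2) {t₀ Λ : ℝ} {v : ℝ → L2 n}
    (hv : IsMild φhat T t₀ v (fun t => mulOp (fun ξ => (japSq ξ)⁻¹) (v t)) Λ) {ε : ℝ}
    (hε : 0 < ε) (hε1 : ε ≤ 1) {t₁ t₂ : ℝ} (ht₁ : t₁ ∈ Ioo T t₀) (ht₂ : t₂ ∈ Ioo T t₀)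
    (h12 : t₁ ≤ t₂) :
    ofReal (energy (fun ξ => logCut ε (jap ξ)) ν (ρ t₂) κ (v t₂) -
      energy (fun ξ => logCut ε (jap ξ)) ν (ρ t₁) κ (v t₁)) ≤
      ∫⁻ t, 3 * kN ν (ρ t) (κ + ν / 2) (v t) ^ 2 ∂(rateMeasure r (Icc t₁ t₂)) := by
  have hχ := isCut_logCut (n := n) hε
  obtain ⟨R, hR⟩ := hχ.bounded
  obtain ⟨q', hqi, hq', heq⟩ := S.mild_energy le_rfl hv hχ hR (σ := ρ) (σ' := r)
    (fun t ht => S.ρderiv t ht.1) (S.rcont.mono fun t ht => ht.1.le) κ ht₁ ht₂ h12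
  rw [energy_mulOp_of_eqv hχ hR _ κ rfl, energy_mulOp_of_eqv hχ hR _ κ rfl] at heq
  have hrc : ContinuousOn r (Icc t₁ t₂) := S.rcont.mono fun t ht => ht₁.1.le.trans ht.1
  rw [heq, intervalIntegral.integral_of_le h12, integral_Ioc_eq_integral_Ioo,
    lintegral_rateMeasure measurableSet_Icc hrc]
  have hqi' : IntegrableOn q' (Ioo t₁ t₂) :=
    ((intervalIntegrable_iff_integrableOn_Ioc_of_le h12).1 hqi).mono_set Ioo_subset_Ioc_self
  refine (ofReal_integral_le_lintegral hqi').trans ?_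
  refine le_trans ?_ (lintegral_mono_set Ioo_subset_Icc_self)
  refine lintegral_mono_ae ?_
  refine (ae_restrict_iff' measurableSet_Ioo).2 ?_
  filter_upwards [hq'] with t h1 ht
  have htT : T < t := ht₁.1.trans ht.1
  rw [h1 ht]
  obtain ⟨hc1, hc2⟩ := S.two_mul_sq_inv htT.le
  have hr := S.rpos t htT.le
  have he := hχ.energy_nonneg ν (ρ t) (κ + ν / 2) (v t)
  have hX := S.ofReal_form_le htT hχ (ρ t) κ (v t)
  set X := 2 * (inner ℂ (v t) (kOp (kerJ (φhat t))
        (mulOp (fun ξ => japSq ξ * (logCut ε (jap ξ) * sqW ν (ρ t) κ ξ)) (v t)))).re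
  have hX2 : ofReal |X| ≤ C * yNorm ν (ρ t) l lLow (φhat t) *
      kN ν (ρ t) (κ + ν / 2) (v t) ^ 2 := by
    refine hX.trans (le_trans (lintegral_mono fun p => ?_)
      (hC (ρ t) (fun ξ => logCut ε (jap ξ)) (φhat t) (v t) (S.ρ_nonneg t htT.le) hχ.nonneg hχ.le_one
        (fun ξ η => (abs_logCut_sub_le hε.le _ _).trans
          (mul_le_of_le_one_left (abs_nonneg _) hε1)) (S.aesm htT.le) (L2.measurable _)))
    rw [enorm_aKer, ENNReal.ofReal_mul (abs_nonneg _)]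
    exact le_of_eq (by ring)
  have hh : h₁ t ≤ h₁ T := S.h₁anti self_mem_Ici htT.le htT.le
  have hh0 := S.h₀pos t htT.le
  have hcr : (2 * t ^ 2)⁻¹ * (C * b * h₀ t) ≤ r t := by
    calc (2 * t ^ 2)⁻¹ * (C * b * h₀ t) = C * b * ((2 * t ^ 2)⁻¹ * h₀ t) := by ring
      _ ≤ C * b * (r t * h₁ t / 2) := by gcongr
      _ = r t * ((C * b * h₁ t) / 2) := by ring
      _ ≤ r t * ((C * b * h₁ T) / 2) := by gcongr
      _ ≤ r t * 1 := by gcongr; linarith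
      _ = r t := mul_one _
  set N2 := kN ν (ρ t) (κ + ν / 2) (v t) ^ 2
  calc ofReal (2 * r t * energy (fun ξ => logCut ε (jap ξ)) ν (ρ t) (κ + ν / 2) (v t) -
        (2 * t ^ 2)⁻¹ * X)
      ≤ ofReal (2 * r t * energy (fun ξ => logCut ε (jap ξ)) ν (ρ t) (κ + ν / 2) (v t) +
        (2 * t ^ 2)⁻¹ * |X|) := by
        refine ENNReal.ofReal_le_ofReal ?_
        nlinarith [neg_abs_le X]
    _ ≤ 2 * ofReal (r t) * N2 + ofReal (r t) * N2 := by
        rw [ENNReal.ofReal_add (by positivity) (by positivity), ENNReal.ofReal_mul (by positivity),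
          ENNReal.ofReal_mul (by positivity), ENNReal.ofReal_ofNat, ENNReal.ofReal_mul hc2.le]
        refine add_le_add (mul_le_mul' le_rfl (hχ.ofReal_energy_le _ _ _ _)) ?_
        · calc ofReal (2 * t ^ 2)⁻¹ * ofReal |X|
              ≤ ofReal (2 * t ^ 2)⁻¹ * (ofReal (C * b * h₀ t) * N2) := by
                gcongr
                exact hX2.trans (mul_le_mul' (S.yNorm_le_ofReal htT.le C) le_rfl)
            _ = ofReal ((2 * t ^ 2)⁻¹ * (C * b * h₀ t)) * N2 := by
                rw [← mul_assoc, ← ENNReal.ofReal_mul hc2.le]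
            _ ≤ _ := mul_le_mul' (ENNReal.ofReal_le_ofReal hcr) le_rfl
    _ = ofReal (r t) * (3 * N2) := by ring

theorem logCut_mono_nat (ξ : Rn n) : Monotone fun j : ℕ => logCut (1 / ((j : ℝ) + 1)) (jap ξ) := by
  intro i j hij
  unfold logCut
  have h1 : (0 : ℝ) ≤ Real.log (jap ξ) := Real.log_nonneg (one_le_jap ξ)
  have h2 : (1 : ℝ) / ((j : ℝ) + 1) ≤ 1 / ((i : ℝ) + 1) := by gcongr
  have h3 := mul_le_mul_of_nonneg_right h2 h1
  exact max_le_max (by linarith) le_rfl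

theorem tendsto_logCut (ξ : Rn n) :
    Tendsto (fun j : ℕ => logCut (1 / ((j : ℝ) + 1)) (jap ξ)) atTop (𝓝 1) := by
  unfold logCut
  have h4 := ((tendsto_one_div_add_atTop_nhds_zero_nat (𝕜 := ℝ)).mul_const
    (Real.log (jap ξ))).const_sub 1
  have h5 := h4.max (tendsto_const_nhds (x := (0 : ℝ)))
  simpa using h5

/-- Growth of the norm of a continuous mild solution. -/
theorem mild_kN_sq_le (S : Phase) {κ : ℝ} {C : ℝ≥0}
    (hC : CommutatorBound n ν l lLow κ C) (hsmall : C * b * h₁ T ≤ 2) {t₀ Λ : ℝ} {v : ℝ → L2 n}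
    (hc : ContinuousOn v (Icc T t₀))
    (hv : IsMild φhat T t₀ v (fun t => mulOp (fun ξ => (japSq ξ)⁻¹) (v t)) Λ)
    {t₁ t₂ : ℝ} (ht₁ : T ≤ t₁) (h12 : t₁ ≤ t₂) (ht₂ : t₂ ≤ t₀) :
    kN ν (ρ t₂) κ (v t₂) ^ 2 ≤ kN ν (ρ t₁) κ (v t₁) ^ 2 +
      ∫⁻ t, 3 * kN ν (ρ t) (κ + ν / 2) (v t) ^ 2 ∂(rateMeasure r (Icc t₁ t₂)) := by
  rcases h12.eq_or_lt with h | h12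
  · rw [h]; exact le_self_add
  set I := ∫⁻ t, 3 * kN ν (ρ t) (κ + ν / 2) (v t) ^ 2 ∂(rateMeasure r (Icc t₁ t₂))
  by_cases hI : I = ⊤
  · rw [hI]; simp
  have hcut : ∀ j : ℕ, IsCut fun ξ : Rn n => logCut (1 / ((j : ℝ) + 1)) (jap ξ) := fun j =>
    isCut_logCut (by positivity)
  rw [kN_sq_eq_iSup hcut logCut_mono_nat tendsto_logCut]
  refine iSup_le fun j => ?_
  have hε : (0 : ℝ) < 1 / ((j : ℝ) + 1) := by positivity
  have hε1 : 1 / ((j : ℝ) + 1) ≤ 1 := by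
    rw [div_le_one (by positivity)]
    have : (0 : ℝ) ≤ j := Nat.cast_nonneg j
    linarith
  set e : ℝ → ℝ := fun t => energy (fun ξ => logCut (1 / ((j : ℝ) + 1)) (jap ξ)) ν (ρ t) κ (v t)
  have hsubI : Icc t₁ t₂ ⊆ Icc T t₀ := Icc_subset_Icc ht₁ ht₂
  have hec : ContinuousOn e (Icc t₁ t₂) :=
    (hcut j).continuousOn_energy ν κ (S.ρcont.mono fun t ht => ht₁.trans ht.1) (hc.mono hsubI)
  have key : ∀ s₁ ∈ Ioo t₁ t₂, ∀ s₂ ∈ Ioo t₁ t₂, s₁ ≤ s₂ → e s₂ - e s₁ ≤ I.toReal := by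
    intro s₁ hs₁ s₂ hs₂ hs
    have hin : ∀ s ∈ Ioo t₁ t₂, s ∈ Ioo T t₀ := fun s hs =>
      ⟨ht₁.trans_lt hs.1, hs.2.trans_le ht₂⟩
    have h1 := S.mild_cut_energy_le hC hsmall hv hε hε1 (hin s₁ hs₁) (hin s₂ hs₂) hs
    refine (ENNReal.ofReal_le_iff_le_toReal hI).1 (h1.trans ?_)
    have hm : Icc s₁ s₂ ⊆ Icc t₁ t₂ := Icc_subset_Icc hs₁.1.le hs₂.2.le
    have hrc : ContinuousOn r (Icc t₁ t₂) := S.rcont.mono fun t ht => ht₁.trans ht.1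
    change _ ≤ ∫⁻ t, 3 * kN ν (ρ t) (κ + ν / 2) (v t) ^ 2 ∂(rateMeasure r (Icc t₁ t₂))
    rw [lintegral_rateMeasure measurableSet_Icc (hrc.mono hm),
      lintegral_rateMeasure measurableSet_Icc hrc]
    exact lintegral_mono_set hm
  obtain ⟨m, hm⟩ := exists_between h12
  have k1 : ∀ s₂ ∈ Ioo m t₂, e s₂ - e t₁ ≤ I.toReal := by
    intro s₂ hs₂
    have hs₂' : s₂ ∈ Ioo t₁ t₂ := ⟨hm.1.trans hs₂.1, hs₂.2⟩
    have hl : Tendsto (fun s => e s₂ - e s) (𝓝[>] t₁) (𝓝 (e s₂ - e t₁)) :=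
      tendsto_const_nhds.sub ((hec t₁ (left_mem_Icc.2 h12.le)).mono_left
        (nhdsWithin_le_of_mem (mem_of_superset (Ioo_mem_nhdsGT h12) Ioo_subset_Icc_self)))
    refine le_of_tendsto hl ?_
    filter_upwards [Ioo_mem_nhdsGT hs₂'.1] with s hs
    exact key s ⟨hs.1, hs.2.trans hs₂'.2⟩ s₂ hs₂' hs.2.le
  have k2 : e t₂ - e t₁ ≤ I.toReal := by
    have hl : Tendsto (fun s => e s - e t₁) (𝓝[<] t₂) (𝓝 (e t₂ - e t₁)) :=
      ((hec t₂ (right_mem_Icc.2 h12.le)).mono_left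
        (nhdsWithin_le_of_mem (mem_of_superset (Ioo_mem_nhdsLT h12) Ioo_subset_Icc_self))).sub
        tendsto_const_nhds
    refine le_of_tendsto hl ?_
    filter_upwards [Ioo_mem_nhdsLT hm.2] with s hs
    exact k1 s hs
  calc ofReal (e t₂) ≤ ofReal (e t₁ + I.toReal) :=
        ENNReal.ofReal_le_ofReal (by linarith)
    _ ≤ ofReal (e t₁) + ofReal I.toReal := ENNReal.ofReal_add_le
    _ ≤ _ := by
        rw [ENNReal.ofReal_toReal hI]
        gcongr
        exact (hcut j).ofReal_energy_le _ _ _ _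

end PhaseSetup

/-! ### Weighted functions -/

/-- `v` multiplied by the weight whose `L²` norm is `kN ν ρ κ v`; zero if that norm is infinite. -/
def weighted (ν ρ κ : ℝ) (v : L2 n) : L2 n := by
  classical
  exact if h : MemLp (fun ξ => ((jap ξ ^ κ * exp (ρ * jap ξ ^ ν) : ℝ) : ℂ) * v ξ) 2 volume
    then h.toLp _ else 0

theorem enorm_weight_mul (ν ρ κ : ℝ) (ξ : Rn n) (c : ℂ) :
    ‖((jap ξ ^ κ * exp (ρ * jap ξ ^ ν) : ℝ) : ℂ) * c‖ₑ =
      ofReal (jap ξ ^ κ * exp (ρ * jap ξ ^ ν)) * ‖c‖ₑ := by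
  have := Real.rpow_pos_of_pos (jap_pos ξ) κ
  rw [enorm_mul]
  congr 1
  rw [← ofReal_norm, Complex.norm_real, Real.norm_of_nonneg (by positivity)]

theorem eLpNorm_weight_mul (ν ρ κ : ℝ) (v : Rn n → ℂ) :
    eLpNorm (fun ξ => ((jap ξ ^ κ * exp (ρ * jap ξ ^ ν) : ℝ) : ℂ) * v ξ) 2 volume =
      kN ν ρ κ v := by
  rw [eLpNorm_two_eq_n2, kN]
  congr 1
  ext1 ξ
  exact enorm_weight_mul ν ρ κ ξ _

theorem memLp_weight_mul {ν ρ κ : ℝ} {v : L2 n} (h : kN ν ρ κ v < ⊤) :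
    MemLp (fun ξ => ((jap ξ ^ κ * exp (ρ * jap ξ ^ ν) : ℝ) : ℂ) * v ξ) 2 volume := by
  refine ⟨?_, by rwa [eLpNorm_weight_mul]⟩
  have hj := measurable_jap (n := n)
  exact ((Complex.measurable_ofReal.comp (by fun_prop)).mul (L2.measurable v)).aestronglyMeasurable

theorem coeFn_weighted {ν ρ κ : ℝ} {v : L2 n} (h : kN ν ρ κ v < ⊤) :
    weighted ν ρ κ v =ᵐ[volume]
      fun ξ => ((jap ξ ^ κ * exp (ρ * jap ξ ^ ν) : ℝ) : ℂ) * v ξ := by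
  rw [weighted, dif_pos (memLp_weight_mul h)]
  exact MemLp.coeFn_toLp _

theorem enorm_weighted {ν ρ κ : ℝ} {v : L2 n} (h : kN ν ρ κ v < ⊤) :
    ‖weighted ν ρ κ v‖ₑ = kN ν ρ κ v := by
  rw [Lp.enorm_def, eLpNorm_congr_ae (coeFn_weighted h), eLpNorm_weight_mul]

theorem mulOp_lowCut_weighted {ν ρ κ : ℝ} {v : L2 n} (h : kN ν ρ κ v < ⊤) (N : ℝ) :
    mulOp (lowCut N) (weighted ν ρ κ v) = sqOp (lowCut N) ν (ρ / 2) (κ / 2) v := by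
  ext1
  refine (coeFn_mulOp (bddMeas_lowCut N) _).trans ?_
  refine EventuallyEq.trans ?_ (coeFn_mulOp ((isCut_lowCut N).bddMeas ν (ρ / 2) (κ / 2)) v).symm
  filter_upwards [coeFn_weighted h] with ξ hξ
  rw [hξ, sqW_eq, show 2 * (κ / 2) = κ by ring, show ρ / 2 * (2 * jap ξ ^ ν) = ρ * jap ξ ^ ν by ring]
  push_cast; ring

theorem norm_sub_mulOp_lowCut_sq (N : ℝ) (F : L2 n) :
    ‖F - mulOp (lowCut N) F‖ ^ 2 = ‖F‖ ^ 2 - ‖mulOp (lowCut N) F‖ ^ 2 := by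
  have h1 : inner ℂ F (mulOp (lowCut N) F) = inner ℂ (mulOp (lowCut N) F) (mulOp (lowCut N) F) := by
    conv_lhs => rw [← mulOp_lowCut_idem]
    rw [inner_mulOp (bddMeas_lowCut N)]
  rw [@norm_sub_sq ℂ, h1, inner_self_eq_norm_sq]
  ring

/-- Convergence of all cut off functions and of the norms implies convergence. -/
theorem tendsto_of_tendsto_lowCut {ι : Type*} {l : Filter ι} {F : ι → L2 n} {F₀ : L2 n}
    (hcut : ∀ N : ℝ, Tendsto (fun i => mulOp (lowCut N) (F i)) l (𝓝 (mulOp (lowCut N) F₀)))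
    (hnorm : Tendsto (fun i => ‖F i‖) l (𝓝 ‖F₀‖)) : Tendsto F l (𝓝 F₀) := by
  rw [tendsto_iff_norm_sub_tendsto_zero]
  refine Metric.tendsto_nhds.2 fun ε hε => ?_
  have h0 : Tendsto (fun N : ℝ => ‖F₀ - mulOp (lowCut N) F₀‖) atTop (𝓝 0) := by
    have h := (tendsto_iff_norm_sub_tendsto_zero.1 (tendsto_mulOp_lowCut F₀))
    simpa only [norm_sub_rev] using h
  obtain ⟨N, hN⟩ := (h0.eventually (gt_mem_nhds (show (0 : ℝ) < ε / 4 by positivity))).exists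
  have h1 : Tendsto (fun i => ‖F i - mulOp (lowCut N) (F i)‖) l
      (𝓝 ‖F₀ - mulOp (lowCut N) F₀‖) := by
    have e : ∀ G : L2 n, ‖G - mulOp (lowCut N) G‖ =
        Real.sqrt (‖G‖ ^ 2 - ‖mulOp (lowCut N) G‖ ^ 2) := fun G => by
      rw [← norm_sub_mulOp_lowCut_sq, Real.sqrt_sq (norm_nonneg _)]
    simp_rw [e]
    exact (Real.continuous_sqrt.tendsto _).comp ((hnorm.pow 2).sub ((hcut N).norm.pow 2))
  have h2 := tendsto_iff_norm_sub_tendsto_zero.1 (hcut N)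
  filter_upwards [h1.eventually (gt_mem_nhds hN),
    h2.eventually (gt_mem_nhds (show (0 : ℝ) < ε / 4 by positivity))] with i hi1 hi2
  rw [Real.dist_eq, sub_zero, abs_of_nonneg (norm_nonneg _)]
  have e : F i - F₀ = (F i - mulOp (lowCut N) (F i)) +
      (mulOp (lowCut N) (F i) - mulOp (lowCut N) F₀) - (F₀ - mulOp (lowCut N) F₀) := by abel
  rw [e]
  refine (norm_sub_le _ _).trans_lt ?_
  have := norm_add_le (F i - mulOp (lowCut N) (F i)) (mulOp (lowCut N) (F i) - mulOp (lowCut N) F₀)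
  linarith

theorem tendsto_weighted {ν κ : ℝ} {ι : Type*} {F : Filter ι} {ρ : ι → ℝ} {ρ₀ : ℝ} {v : ι → L2 n}
    {v₀ : L2 n} (hρ : Tendsto ρ F (𝓝 ρ₀)) (hv : Tendsto v F (𝓝 v₀))
    (hfin : ∀ᶠ i in F, kN ν (ρ i) κ (v i) < ⊤) (hfin₀ : kN ν ρ₀ κ v₀ < ⊤)
    (hN : Tendsto (fun i => kN ν (ρ i) κ (v i)) F (𝓝 (kN ν ρ₀ κ v₀))) :
    Tendsto (fun i => weighted ν (ρ i) κ (v i)) F (𝓝 (weighted ν ρ₀ κ v₀)) := by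
  refine tendsto_of_tendsto_lowCut (fun N => ?_) ?_
  · rw [mulOp_lowCut_weighted hfin₀]
    refine Tendsto.congr' (hfin.mono fun i hi => (mulOp_lowCut_weighted hi N).symm) ?_
    exact tendsto_clm_apply ((((isCut_lowCut N).continuous_sqOp ν (κ / 2)).tendsto _).comp
      (hρ.div_const 2)) hv
  · have h := (ENNReal.tendsto_toReal hfin₀.ne).comp hN
    rw [← enorm_weighted hfin₀, toReal_enorm] at h
    refine h.congr' (hfin.mono fun i hi => ?_)
    rw [Function.comp_apply, ← enorm_weighted hi, toReal_enorm]

theorem gevreyWeight_mul_ae_eq {ν : ℝ} (hν : 0 < ν) {ρ κ : ℝ} {v : L2 n} (h : kN ν ρ κ v < ⊤) :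
    (fun ξ => (gevreyWeight ν ρ κ 0 ξ : ℂ) * v ξ) =ᵐ[volume] weighted ν ρ κ v := by
  filter_upwards [coeFn_weighted h] with ξ hξ
  rw [hξ, gevreyWeight_zero hν]

theorem l2ContinuousOn_of_continuousOn_kN {ν κ : ℝ} (hν : 0 < ν) {ρ : ℝ → ℝ} {I : Set ℝ}
    {v : ℝ → L2 n} (hρ : ContinuousOn ρ I) (hv : ContinuousOn v I)
    (hfin : ∀ t ∈ I, kN ν (ρ t) κ (v t) < ⊤)
    (hN : ContinuousOn (fun t => kN ν (ρ t) κ (v t)) I) :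
    L2ContinuousOn I (fun t ξ => (gevreyWeight ν (ρ t) κ 0 ξ : ℂ) * v t ξ) := by
  intro t ht
  have h := tendsto_weighted (ν := ν) (κ := κ) (hρ t ht) (hv t ht)
    (eventually_mem_nhdsWithin.mono hfin) (hfin t ht) (hN t ht)
  have h2 := (ENNReal.continuous_ofReal.tendsto _).comp (tendsto_iff_norm_sub_tendsto_zero.1 h)
  rw [ENNReal.ofReal_zero] at h2
  refine h2.congr' (eventually_mem_nhdsWithin.mono fun s hs => ?_)
  rw [Function.comp_apply, ofReal_norm, Lp.enorm_def]
  refine eLpNorm_congr_ae ((Lp.coeFn_sub _ _).trans ?_)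
  exact (gevreyWeight_mul_ae_eq hν (hfin s hs)).symm.sub (gevreyWeight_mul_ae_eq hν (hfin t ht)).symm

theorem L2ContinuousOn.continuousOn_weighted {ν κ : ℝ} (hν : 0 < ν) {ρ : ℝ → ℝ} {I : Set ℝ}
    {v : ℝ → L2 n} (hfin : ∀ t ∈ I, kN ν (ρ t) κ (v t) < ⊤)
    (h : L2ContinuousOn I (fun t ξ => (gevreyWeight ν (ρ t) κ 0 ξ : ℂ) * v t ξ)) :
    ContinuousOn (fun t => weighted ν (ρ t) κ (v t)) I := by
  intro t ht
  refine tendsto_iff_norm_sub_tendsto_zero.2 ?_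
  have h2 := (ENNReal.tendsto_toReal ENNReal.zero_ne_top).comp (h t ht)
  rw [ENNReal.toReal_zero] at h2
  refine h2.congr' (eventually_mem_nhdsWithin.mono fun s hs => ?_)
  change (eLpNorm _ 2 volume).toReal = ‖weighted ν (ρ s) κ (v s) - weighted ν (ρ t) κ (v t)‖
  rw [← toReal_enorm, Lp.enorm_def]
  congr 1
  refine (eLpNorm_congr_ae ((Lp.coeFn_sub _ _).trans ?_)).symm
  exact (gevreyWeight_mul_ae_eq hν (hfin s hs)).symm.sub (gevreyWeight_mul_ae_eq hν (hfin t ht)).symm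

/-- Continuity in the weighted space implies continuity in `L²`. -/
theorem L2ContinuousOn.continuousOn {ν κ : ℝ} (hν : 0 < ν) (hκ : 0 ≤ κ) {ρ : ℝ → ℝ} {I : Set ℝ}
    {v : ℝ → L2 n} (hρ : ContinuousOn ρ I) (hρ0 : ∀ t ∈ I, 0 ≤ ρ t)
    (hfin : ∀ t ∈ I, kN ν (ρ t) κ (v t) < ⊤)
    (h : L2ContinuousOn I (fun t ξ => (gevreyWeight ν (ρ t) κ 0 ξ : ℂ) * v t ξ)) :
    ContinuousOn v I := by
  intro t ht
  set m : ℝ → Rn n → ℝ := fun s ξ => (jap ξ ^ κ * exp (ρ s * jap ξ ^ ν))⁻¹ with hm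
  have hj := measurable_jap (n := n)
  have hm1 : ∀ s ∈ I, ∀ ξ, |m s ξ| ≤ 1 := by
    intro s hs ξ
    have h1 : 1 ≤ jap ξ ^ κ := Real.one_le_rpow (one_le_jap ξ) hκ
    have h2 : 1 ≤ exp (ρ s * jap ξ ^ ν) :=
      Real.one_le_exp (mul_nonneg (hρ0 s hs) (Real.rpow_nonneg (jap_pos ξ).le ν))
    have h3 : 1 ≤ jap ξ ^ κ * exp (ρ s * jap ξ ^ ν) := one_le_mul_of_one_le_of_one_le h1 h2
    rw [abs_of_nonneg (inv_nonneg.2 (zero_le_one.trans h3))]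
    exact inv_le_one_of_one_le₀ h3
  have hmm : ∀ s, Measurable (m s) := fun s => by simp only [hm]; fun_prop
  have hmb : ∀ s ∈ I, BddMeas (m s) := fun s hs => ⟨hmm s, 1, hm1 s hs⟩
  have hmv : ∀ s ∈ I, mulOp (m s) (weighted ν (ρ s) κ (v s)) = v s := by
    intro s hs
    ext1
    filter_upwards [coeFn_mulOp (hmb s hs) (weighted ν (ρ s) κ (v s)),
      coeFn_weighted (hfin s hs)] with ξ h1 h2
    have hp := Real.rpow_pos_of_pos (jap_pos ξ) κ
    have hne : ((jap ξ ^ κ * exp (ρ s * jap ξ ^ ν) : ℝ) : ℂ) ≠ 0 := by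
      rw [Complex.ofReal_ne_zero]; positivity
    rw [h1, h2, hm, Complex.ofReal_inv, inv_mul_cancel_left₀ hne]
  have hw := h.continuousOn_weighted hν hfin t ht
  have h1 := tendsto_iff_norm_sub_tendsto_zero.1 hw
  have h2 : Tendsto (fun s => mulOp (m s) (weighted ν (ρ t) κ (v t))) (𝓝[I] t)
      (𝓝 (mulOp (m t) (weighted ν (ρ t) κ (v t)))) := by
    rw [tendsto_nhdsWithin_iff_subtype ht]
    refine tendsto_mulOp (fun i : I => hmb i i.2) (hmb t ht) (fun i ξ => hm1 i i.2 ξ) (fun ξ => ?_) _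
    have hp := Real.rpow_pos_of_pos (jap_pos ξ) κ
    have hc : ContinuousOn (fun s => m s ξ) I := by
      refine ContinuousOn.inv₀ (continuousOn_const.mul
        (Real.continuous_exp.comp_continuousOn (hρ.mul continuousOn_const))) fun s _ => ?_
      positivity
    exact (tendsto_nhdsWithin_iff_subtype ht _ _).1 (hc t ht)
  rw [hmv t ht] at h2
  have h3 := tendsto_iff_norm_sub_tendsto_zero.1 h2
  refine tendsto_iff_norm_sub_tendsto_zero.2 ?_
  refine squeeze_zero' (Eventually.of_forall fun _ => norm_nonneg _) ?_ (by simpa using h1.add h3)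
  filter_upwards [self_mem_nhdsWithin] with s hs
  have e : v s - v t = mulOp (m s) (weighted ν (ρ s) κ (v s) - weighted ν (ρ t) κ (v t)) +
      (mulOp (m s) (weighted ν (ρ t) κ (v t)) - v t) := by
    rw [map_sub, hmv s hs]; abel
  rw [e]
  refine (norm_add_le _ _).trans (add_le_add ?_ le_rfl)
  have h4 := norm_mulOp_apply_le (hmb s hs) (hm1 s hs) (weighted ν (ρ s) κ (v s) - weighted ν (ρ t) κ (v t))
  rwa [one_mul] at h4

namespace PhaseSetup

/-- A continuous mild solution is the limit evolution of its final value. -/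
theorem isLimitEvolution_of_mild (S : Phase) {kBar : ℝ}
    {C C₀ : ℝ≥0} (hC : CommutatorBound n ν l lLow kBar C) (hsmall : C * b * h₁ T ≤ 2)
    (hC₀ : TransportBound n ν l lLow 0 0 C₀) (hkBar : 1 - ν / 2 ≤ kBar) {t₀ Λ : ℝ} (ht₀ : T < t₀)
    {v : ℝ → L2 n} (hc : ContinuousOn v (Icc T t₀))
    (hv : IsMild φhat T t₀ v (fun t => mulOp (fun ξ => (japSq ξ)⁻¹) (v t)) Λ)
    (hz : kN ν (ρ t₀) kBar (v t₀) < ⊤) : IsLimitEvolution φhat T t₀ (v t₀) v := by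
  obtain ⟨v', hv'⟩ := S.exists_isLimitEvolution hC hsmall hC₀ hkBar ht₀.le hz
  have h := S.mild_eqOn ht₀ hv'.continuousOn hc (hv'.isMild S) hv (hv'.final ht₀.le)
  obtain ⟨u, hu, hlim⟩ := hv'.approx
  exact ⟨hc, u, hu, fun t ht => by rw [← h ht]; exact hlim t ht⟩

theorem _root_.IsLimitEvolution.restart (S : Phase) {kBar : ℝ}
    {C C₀ : ℝ≥0} (hC : CommutatorBound n ν l lLow kBar C) (hsmall : C * b * h₁ T ≤ 2)
    (hC₀ : TransportBound n ν l lLow 0 0 C₀) (hkBar : 1 - ν / 2 ≤ kBar) {t₀ : ℝ}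
    {z : L2 n} (hz : kN ν (ρ t₀) kBar z < ⊤) {v : ℝ → L2 n} (hv : IsLimitEvolution φhat T t₀ z v)
    {t₁ : ℝ} (h1 : T < t₁) (h2 : t₁ ≤ t₀) : IsLimitEvolution φhat T t₁ (v t₁) v :=
  S.isLimitEvolution_of_mild hC hsmall hC₀ hkBar h1 (hv.continuousOn.mono (Icc_subset_Icc_right h2))
    ((hv.isMild S).mono h2) ((hv.kN_le S hC hsmall ⟨h1.le, h2⟩).trans_lt hz)

/-- The norm of a limit evolution depends continuously on time. -/
theorem _root_.IsLimitEvolution.continuousOn_kN (S : Phase)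
    {kBar : ℝ} {C C₀ : ℝ≥0} (hC : CommutatorBound n ν l lLow kBar C) (hsmall : C * b * h₁ T ≤ 2)
    (hC₀ : TransportBound n ν l lLow 0 0 C₀) (hkBar : 1 - ν / 2 ≤ kBar) {t₀ : ℝ} (ht₀ : T ≤ t₀)
    {z : L2 n} (hz : kN ν (ρ t₀) kBar z < ⊤) {v : ℝ → L2 n}
    (hv : IsLimitEvolution φhat T t₀ z v) :
    ContinuousOn (fun t => kN ν (ρ t) kBar (v t)) (Icc T t₀) := by
  have hfin : ∀ t ∈ Icc T t₀, kN ν (ρ t) kBar (v t) < ⊤ := fun t ht =>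
    (hv.kN_le S hC hsmall ht).trans_lt hz
  have hmono : ∀ t₁ t₂, T ≤ t₁ → t₁ ≤ t₂ → t₂ ≤ t₀ →
      kN ν (ρ t₁) kBar (v t₁) ≤ kN ν (ρ t₂) kBar (v t₂) := by
    intro t₁ t₂ h1 h12 h2
    rcases (h1.trans h12).eq_or_lt with h | h
    · have : t₁ = t₂ := le_antisymm h12 (h ▸ h1)
      rw [this]
    · exact (hv.restart S hC hsmall hC₀ hkBar hz h h2).kN_le S hC hsmall ⟨h1, h12⟩
  set f : ℝ → ℝ≥0∞ := fun t => ofReal (r t) * (3 * kN ν (ρ t) (kBar + ν / 2) (v t) ^ 2)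
  have hrc : ContinuousOn r (Icc T t₀) := S.rcont.mono Icc_subset_Ici_self
  have hf : ∫⁻ t in Icc T t₀, f t ≠ ⊤ := by
    have h := hv.lintegral_kN_le S hC hsmall ht₀
    rw [lintegral_rateMeasure measurableSet_Icc hrc] at h
    have e : ∀ t, f t = 3 * (ofReal (r t) * kN ν (ρ t) (kBar + ν / 2) (v t) ^ 2) :=
      fun t => by simp only [f]; ring
    simp_rw [e]
    rw [lintegral_const_mul' _ _ (by simp)]
    exact ENNReal.mul_ne_top (by simp) (h.trans_lt (ENNReal.pow_lt_top hz)).ne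
  have hgrow : ∀ t₁ t₂, T ≤ t₁ → t₁ ≤ t₂ → t₂ ≤ t₀ →
      kN ν (ρ t₂) kBar (v t₂) ^ 2 ≤ kN ν (ρ t₁) kBar (v t₁) ^ 2 +
        ∫⁻ t in uIcc t₁ t₂, f t ∂(volume.restrict (Icc T t₀)) := by
    intro t₁ t₂ h1 h12 h2
    have h := S.mild_kN_sq_le hC hsmall hv.continuousOn (hv.isMild S) h1 h12 h2
    have hsub : Icc t₁ t₂ ⊆ Icc T t₀ := Icc_subset_Icc h1 h2
    rw [lintegral_rateMeasure measurableSet_Icc (hrc.mono hsub)] at h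
    rwa [uIcc_of_le h12, Measure.restrict_restrict_of_subset hsub]
  have hsq : ContinuousOn (fun t => kN ν (ρ t) kBar (v t) ^ 2) (Icc T t₀) := by
    intro t ht
    have hJ : Tendsto (fun s => ∫⁻ x in uIcc s t, f x ∂(volume.restrict (Icc T t₀)))
        (𝓝[Icc T t₀] t) (𝓝 0) := by
      refine tendsto_setLIntegral_zero hf ?_
      have hv0 : Tendsto (fun s : ℝ => ofReal |t - s|) (𝓝[Icc T t₀] t) (𝓝 0) := by
        have : Tendsto (fun s : ℝ => ofReal |t - s|) (𝓝 t) (𝓝 (ofReal |t - t|)) :=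
          (ENNReal.continuous_ofReal.comp (by fun_prop : Continuous fun s : ℝ => |t - s|)).tendsto t
        simp only [sub_self, abs_zero, ENNReal.ofReal_zero] at this
        exact this.mono_left nhdsWithin_le_nhds
      refine tendsto_of_tendsto_of_tendsto_of_le_of_le tendsto_const_nhds hv0
        (fun _ => zero_le) fun s => ?_
      refine (Measure.restrict_apply_le _ _).trans ?_
      change volume (Icc (min s t) (max s t)) ≤ _
      rw [Real.volume_Icc, max_sub_min_eq_abs]
    have hup : Tendsto (fun s => kN ν (ρ t) kBar (v t) ^ 2 +
        ∫⁻ x in uIcc s t, f x ∂(volume.restrict (Icc T t₀))) (𝓝[Icc T t₀] t)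
        (𝓝 (kN ν (ρ t) kBar (v t) ^ 2)) := by
      simpa using hJ.const_add (kN ν (ρ t) kBar (v t) ^ 2)
    have hlow : Tendsto (fun s => kN ν (ρ t) kBar (v t) ^ 2 -
        ∫⁻ x in uIcc s t, f x ∂(volume.restrict (Icc T t₀))) (𝓝[Icc T t₀] t)
        (𝓝 (kN ν (ρ t) kBar (v t) ^ 2)) := by
      have := ENNReal.Tendsto.sub (tendsto_const_nhds (x := kN ν (ρ t) kBar (v t) ^ 2)
        (f := 𝓝[Icc T t₀] t)) hJ (Or.inr ENNReal.zero_ne_top)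
      simpa using this
    refine tendsto_of_tendsto_of_tendsto_of_le_of_le' hlow hup ?_ ?_
    · filter_upwards [self_mem_nhdsWithin] with s hs
      rw [tsub_le_iff_right]
      rcases le_total s t with h | h
      · exact hgrow s t hs.1 h ht.2
      · exact (pow_le_pow_left' (hmono t s ht.1 h hs.2) 2).trans le_self_add
    · filter_upwards [self_mem_nhdsWithin] with s hs
      rcases le_total s t with h | h
      · exact (pow_le_pow_left' (hmono s t hs.1 h ht.2) 2).trans le_self_add
      · rw [uIcc_comm]; exact hgrow t s ht.1 h hs.2
  have e : (fun t => kN ν (ρ t) kBar (v t)) =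
      fun t => (kN ν (ρ t) kBar (v t) ^ 2) ^ (1 / 2 : ℝ) := by
    ext1 t
    rw [← ENNReal.rpow_natCast, ← ENNReal.rpow_mul]
    norm_num
  rw [e]
  exact ENNReal.continuous_rpow_const.comp_continuousOn hsq

theorem _root_.IsLimitEvolution.l2ContinuousOn (S : Phase)
    {kBar : ℝ} {C C₀ : ℝ≥0} (hC : CommutatorBound n ν l lLow kBar C) (hsmall : C * b * h₁ T ≤ 2)
    (hC₀ : TransportBound n ν l lLow 0 0 C₀) (hkBar : 1 - ν / 2 ≤ kBar) {t₀ : ℝ} (ht₀ : T ≤ t₀)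
    {z : L2 n} (hz : kN ν (ρ t₀) kBar z < ⊤) {v : ℝ → L2 n}
    (hv : IsLimitEvolution φhat T t₀ z v) :
    L2ContinuousOn (Icc T t₀) (fun t ξ => (gevreyWeight ν (ρ t) kBar 0 ξ : ℂ) * v t ξ) :=
  l2ContinuousOn_of_continuousOn_kN S.hν (S.ρcont.mono Icc_subset_Ici_self) hv.continuousOn
    (fun _ ht => (hv.kN_le S hC hsmall ht).trans_lt hz)
    (hv.continuousOn_kN S hC hsmall hC₀ hkBar ht₀ hz)

end PhaseSetup

/-! ### The transport operator on the Fourier side -/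

open Laplacian in
theorem laplacian_mul {f g : Rn n → ℝ} (hf : ContDiff ℝ 2 f) (hg : ContDiff ℝ 2 g) (x : Rn n) :
    Δ (fun y => f y * g y) x =
      f x * Δ g x + (2 * inner ℝ (gradient f x) (gradient g x) + Δ f x * g x) := by
  set e := stdOrthonormalBasis ℝ (Rn n)
  have hdf : Differentiable ℝ f := hf.differentiable (by norm_num)
  have hdg : Differentiable ℝ g := hg.differentiable (by norm_num)
  have hf' : Differentiable ℝ (fderiv ℝ f) :=
    (hf.fderiv_right (m := 1) (by norm_num)).differentiable (by norm_num)
  have hg' : Differentiable ℝ (fderiv ℝ g) :=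
    (hg.fderiv_right (m := 1) (by norm_num)).differentiable (by norm_num)
  have h1 : fderiv ℝ (fun y => f y * g y) = fun y => f y • fderiv ℝ g y + g y • fderiv ℝ f y := by
    ext1 y
    exact fderiv_fun_mul (hdf y) (hdg y)
  have h2 : ∀ v : Rn n, iteratedFDeriv ℝ 2 (fun y => f y * g y) x ![v, v] =
      f x * iteratedFDeriv ℝ 2 g x ![v, v] + 2 * (fderiv ℝ f x v * fderiv ℝ g x v) +
        iteratedFDeriv ℝ 2 f x ![v, v] * g x := by
    intro v
    simp only [iteratedFDeriv_two_apply, h1, Matrix.cons_val_zero, Matrix.cons_val_one]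
    rw [fderiv_fun_add ((hdf x).fun_smul (hg' x)) ((hdg x).fun_smul (hf' x)),
      fderiv_fun_smul (hdf x) (hg' x), fderiv_fun_smul (hdg x) (hf' x)]
    simp
    ring
  have h3 : inner ℝ (gradient f x) (gradient g x) =
      ∑ i, fderiv ℝ f x (e i) * fderiv ℝ g x (e i) := by
    rw [← e.sum_inner_mul_inner]
    refine Finset.sum_congr rfl fun i _ => ?_
    rw [real_inner_comm (gradient g x) (e i)]
    simp [gradient]
  simp only [InnerProductSpace.laplacian_eq_iteratedFDeriv_orthonormalBasis _ e, h2, h3]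
  simp only [Finset.sum_add_distrib, Finset.mul_sum, Finset.sum_mul]
  ring

open Laplacian in
theorem fourier_laplacian (f : 𝓢(Rn n, ℂ)) (ξ : Rn n) :
    (𝓕 (Δ f) : 𝓢(Rn n, ℂ)) ξ = -((2 * Real.pi * ‖ξ‖) ^ 2 : ℝ) * (𝓕 f : 𝓢(Rn n, ℂ)) ξ := by
  rw [SchwartzMap.laplacian_eq_fourierMultiplierCLM, FourierTransform.fourier_smul,
    SchwartzMap.fourierMultiplierCLM_apply, FourierTransform.fourier_fourierInv_eq]
  have h : (fun x : Rn n => ‖x‖ ^ 2).HasTemperateGrowth := by fun_prop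
  rw [smul_apply]
  change _ • (SchwartzMap.smulLeftCLM ℂ (fun x : Rn n => ‖x‖ ^ 2) (𝓕 f)) ξ = _
  rw [SchwartzMap.smulLeftCLM_apply_apply h]
  simp only [Complex.real_smul]
  push_cast; ring

theorem schwartz_fourier_sub (f g : 𝓢(Rn n, ℂ)) :
    (𝓕 (f - g) : 𝓢(Rn n, ℂ)) = 𝓕 f - 𝓕 g :=
  map_sub (FourierTransform.fourierCLM ℂ 𝓢(Rn n, ℂ)) f g

/-- The Fourier transform of a product is a convolution. -/
theorem fourier_fourierInv_mul {g : Rn n → ℂ} (hg : Integrable g) (χ : 𝓢(Rn n, ℂ)) (ξ : Rn n) :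
    𝓕 (fun x => 𝓕⁻ g x * χ x) ξ = ∫ η, g (ξ - η) * (𝓕 χ : 𝓢(Rn n, ℂ)) η := by
  set h : Rn n → ℂ := fun x => Complex.exp ((2 * Real.pi * inner ℝ x ξ : ℝ) * Complex.I) * χ (-x) with hh
  have hhi : Integrable h := by
    refine (χ.integrable.comp_neg).bdd_mul (c := 1) ?_ ?_
    · exact Continuous.aestronglyMeasurable (by fun_prop)
    · exact Eventually.of_forall fun x => (Complex.norm_exp_ofReal_mul_I _).le
  have e1 : 𝓕 (fun x => 𝓕⁻ g x * χ x) ξ = ∫ x, 𝓕 g x * h x := by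
    rw [Real.fourier_eq', ← integral_neg_eq_self]
    refine integral_congr_ae (Eventually.of_forall fun x => ?_)
    simp only [hh]
    rw [Real.fourierInv_eq_fourier_neg, neg_neg, inner_neg_left, smul_eq_mul]
    rw [show -2 * Real.pi * -inner ℝ x ξ = 2 * Real.pi * inner ℝ x ξ by ring]
    ring
  have e2 : ∀ η, 𝓕 h η = (𝓕 χ : 𝓢(Rn n, ℂ)) (ξ - η) := by
    intro η
    rw [SchwartzMap.fourier_coe, Real.fourier_eq', Real.fourier_eq', ← integral_neg_eq_self]
    refine integral_congr_ae (Eventually.of_forall fun x => ?_)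
    simp only [hh, smul_eq_mul]
    rw [neg_neg, ← mul_assoc, ← Complex.exp_add, inner_neg_left,
      inner_neg_left, inner_sub_right]
    congr 2
    push_cast; ring
  rw [e1, integral_fourier_mul hg hhi]
  simp_rw [e2]
  rw [← integral_sub_left_eq_self _ volume ξ]
  simp

namespace PhaseSetup

theorem phase_eq (S : Phase) {t : ℝ} (ht : T ≤ t) (x : Rn n) :
    (φ t x : ℂ) = 𝓕⁻ (φhat t) x :=
  eq_fourierInv_of_hasFourierTransform (S.phase.1 t ht).1 (S.phase.1 t ht).2 (S.integrable_φhat ht) x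

theorem contDiff_phase (S : Phase) {t : ℝ} (ht : T < t) :
    ContDiff ℝ ∞ (φ t) := by
  have h1 : ContDiff ℝ ∞ (𝓕 (φhat t)) := by
    refine Real.contDiff_fourier (N := ⊤) fun m _ => ?_
    refine ⟨(continuous_norm.pow m).aestronglyMeasurable.mul (S.aesm ht.le).norm, ?_⟩
    refine lt_of_le_of_lt (lintegral_mono fun ξ => ?_) (S.lintegral_jap_rpow_lt_top ht m)
    rw [enorm_mul, enorm_norm]
    gcongr
    rw [Real.enorm_of_nonneg (by positivity), Real.rpow_natCast]
    gcongr
    refine le_trans ?_ (freq_le_jap ξ)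
    have := Real.pi_gt_three
    nlinarith [norm_nonneg ξ]
  have h2 : φ t = fun x => (𝓕 (φhat t) (-x)).re := by
    ext1 x
    rw [← Real.fourierInv_eq_fourier_neg, ← S.phase_eq ht.le, Complex.ofReal_re]
  rw [h2]
  exact Complex.reCLM.contDiff.comp (h1.comp contDiff_neg)

end PhaseSetup

/-! ### Test functions -/

/-- A real function as an element of `L²`; zero if it is not square integrable. -/
def toL2 (f : Rn n → ℝ) : L2 n := by
  classical exact if h : MemLp (fun x => (f x : ℂ)) 2 volume then h.toLp _ else 0

theorem coeFn_toL2 {f : Rn n → ℝ} (h : MemLp (fun x => (f x : ℂ)) 2 volume) :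
    toL2 f =ᵐ[volume] fun x => (f x : ℂ) := by
  rw [toL2, dif_pos h]; exact h.coeFn_toLp

theorem toL2_eq_toLp {f : Rn n → ℝ} (F : 𝓢(Rn n, ℂ)) (hF : ∀ x, F x = f x) :
    toL2 f = F.toLp 2 := by
  have h : MemLp (fun x => (f x : ℂ)) 2 volume := (F.memLp 2 volume).ae_eq
    (Eventually.of_forall hF)
  ext1
  filter_upwards [coeFn_toL2 h, F.coeFn_toLp 2 volume] with x h1 h2
  rw [h1, h2, hF]

theorem inner_toL2 {f : Rn n → ℝ} (h : MemLp (fun x => (f x : ℂ)) 2 volume) (V : L2 n) :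
    inner ℂ (toL2 f) V = ∫ x, f x • V x := by
  rw [L2.inner_def]
  refine integral_congr_ae ?_
  filter_upwards [coeFn_toL2 h] with x hx
  rw [hx, RCLike.inner_apply, Complex.conj_ofReal, Complex.real_smul, mul_comm]

theorem memLp_of_hasCompactSupport {f : Rn n → ℝ} (hf : Continuous f) (hc : HasCompactSupport f) :
    MemLp (fun x => (f x : ℂ)) 2 volume :=
  (Complex.continuous_ofReal.comp hf).memLp_of_hasCompactSupport
    (hc.comp_left Complex.ofReal_zero)

open Laplacian in
theorem laplacian_schwartzOfReal {ψ : Rn n → ℝ} (h : ContDiff ℝ ∞ ψ) (hc : HasCompactSupport ψ)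
    (x : Rn n) : (Δ (schwartzOfReal ψ h hc) : 𝓢(Rn n, ℂ)) x = (Δ ψ x : ℝ) := by
  rw [SchwartzMap.laplacian_apply]
  have := ContDiffAt.laplacian_CLM_comp_left (l := Complex.ofRealCLM) (f := ψ) (x := x)
    (contDiff_infty.1 h 2).contDiffAt
  exact this

open Laplacian in
theorem contDiff_laplacian {ψ : Rn n → ℝ} (h : ContDiff ℝ ∞ ψ) (hc : HasCompactSupport ψ) :
    ContDiff ℝ ∞ (Δ ψ) := by
  have e : Δ ψ = fun x => ((Δ (schwartzOfReal ψ h hc) : 𝓢(Rn n, ℂ)) x).re := by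
    ext1 x; rw [laplacian_schwartzOfReal, Complex.ofReal_re]
  rw [e]
  exact Complex.reCLM.contDiff.comp (SchwartzMap.smooth _ ⊤)

open Laplacian in
theorem hasCompactSupport_laplacian {ψ : Rn n → ℝ} (hc : HasCompactSupport ψ) :
    HasCompactSupport (Δ ψ) := by
  refine HasCompactSupport.intro hc fun x hx => ?_
  have h : ψ =ᶠ[𝓝 x] fun _ => 0 := notMem_tsupport_iff_eventuallyEq.1 hx
  rw [(InnerProductSpace.laplacian_congr_nhds h).eq_of_nhds]
  simp

open Laplacian in
/-- The Fourier transform of `(1 - Δ) ψ`. -/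
def jTest (ψ : Rn n → ℝ) : L2 n := 𝓕 (toL2 fun x => ψ x - Δ ψ x)

open Laplacian in
theorem jTest_eq {ψ : Rn n → ℝ} (h : ContDiff ℝ ∞ ψ) (hc : HasCompactSupport ψ) :
    jTest ψ = (𝓕 (schwartzOfReal ψ h hc - Δ (schwartzOfReal ψ h hc)) : 𝓢(Rn n, ℂ)).toLp 2 := by
  rw [jTest, toL2_eq_toLp (schwartzOfReal ψ h hc - Δ (schwartzOfReal ψ h hc)) fun x => ?_,
    SchwartzMap.toLp_fourier_eq]
  rw [sub_apply, laplacian_schwartzOfReal]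
  push_cast; rfl

theorem coeFn_jTest {ψ : Rn n → ℝ} (h : ContDiff ℝ ∞ ψ) (hc : HasCompactSupport ψ) :
    jTest ψ =ᵐ[volume] fun ξ => (japSq ξ : ℂ) * (𝓕 (schwartzOfReal ψ h hc) : 𝓢(Rn n, ℂ)) ξ := by
  rw [jTest_eq h hc]
  filter_upwards [SchwartzMap.coeFn_toLp (𝓕 (schwartzOfReal ψ h hc -
    Laplacian.laplacian (schwartzOfReal ψ h hc)) : 𝓢(Rn n, ℂ)) 2 volume] with ξ hξ
  rw [hξ, schwartz_fourier_sub, sub_apply, fourier_laplacian, japSq]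
  push_cast; ring

theorem integral_test_smul {ψ : Rn n → ℝ} (h : ContDiff ℝ ∞ ψ) (hc : HasCompactSupport ψ)
    (V : L2 n) : ∫ x, ψ x • V x =
      inner ℂ (jTest ψ) (mulOp (fun ξ => (japSq ξ)⁻¹) (𝓕 V : L2 n)) := by
  rw [← inner_toL2 (memLp_of_hasCompactSupport h.continuous hc), ← Lp.inner_fourier_eq,
    ← inner_mulOp bddMeas_invJapSq, toL2_eq_toLp (schwartzOfReal ψ h hc) fun x => rfl,
    SchwartzMap.toLp_fourier_eq]
  congr 1
  ext1
  filter_upwards [coeFn_mulOp bddMeas_invJapSq (jTest ψ), coeFn_jTest h hc,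
    SchwartzMap.coeFn_toLp (𝓕 (schwartzOfReal ψ h hc) : 𝓢(Rn n, ℂ)) 2 volume] with ξ h1 h2 h3
  have : (japSq ξ : ℂ) ≠ 0 := by
    rw [Complex.ofReal_ne_zero]; unfold japSq; positivity
  rw [h1, h2, h3, Complex.ofReal_inv, inv_mul_cancel_left₀ this]

namespace PhaseSetup

open Laplacian in
/-- The transport operator applied to a test function, on the Fourier side. -/
theorem fourier_transportOp (S : Phase) {t : ℝ} (ht : T < t)
    {ψ : Rn n → ℝ} (h : ContDiff ℝ ∞ ψ) (hc : HasCompactSupport ψ) :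
    (𝓕 (toL2 (transportOp t (φ t) ψ)) : L2 n) =
      (2 * t ^ 2)⁻¹ • kOp (kerJ (φhat t)) (jTest ψ) := by
  have hφ := S.contDiff_phase ht
  set Ψ := schwartzOfReal ψ h hc with hΨ
  set Q := schwartzOfReal (fun x => φ t x * ψ x) (hφ.mul h) hc.mul_left with hQ
  set P := schwartzOfReal (fun x => φ t x * Δ ψ x) (hφ.mul (contDiff_laplacian h hc))
    (hasCompactSupport_laplacian hc).mul_left with hP
  have hD : ∀ x, (((2 * t ^ 2)⁻¹ : ℝ) • (Δ Q - P)) x = (transportOp t (φ t) ψ x : ℂ) := by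
    intro x
    rw [smul_apply, sub_apply, hQ, laplacian_schwartzOfReal,
      laplacian_mul (contDiff_infty.1 hφ 2) (contDiff_infty.1 h 2),
      hP, schwartzOfReal_apply, transportOp, Complex.real_smul]
    push_cast; ring
  have hint := S.integrable_φhat ht.le
  have hQ' : ∀ ξ, (𝓕 Q : 𝓢(Rn n, ℂ)) ξ = ∫ η, φhat t (ξ - η) * (𝓕 Ψ : 𝓢(Rn n, ℂ)) η := by
    intro ξ
    rw [← fourier_fourierInv_mul hint, SchwartzMap.fourier_coe]
    refine congrFun (congrArg _ (funext fun x => ?_)) ξ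
    rw [hQ, schwartzOfReal_apply, Complex.ofReal_mul, S.phase_eq ht.le]; rfl
  have hP' : ∀ ξ, (𝓕 P : 𝓢(Rn n, ℂ)) ξ = ∫ η, φhat t (ξ - η) * (𝓕 (Δ Ψ) : 𝓢(Rn n, ℂ)) η := by
    intro ξ
    rw [← fourier_fourierInv_mul hint, SchwartzMap.fourier_coe]
    refine congrFun (congrArg _ (funext fun x => ?_)) ξ
    rw [hP, schwartzOfReal_apply, Complex.ofReal_mul, S.phase_eq ht.le, laplacian_schwartzOfReal]
  have hi : ∀ (χ : 𝓢(Rn n, ℂ)) (ξ : Rn n), Integrable fun η => φhat t (ξ - η) * χ η := by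
    intro χ ξ
    obtain ⟨M, hM⟩ := χ.toBoundedContinuousFunction.isBounded_range.exists_norm_le
    exact (hint.comp_sub_left ξ).mul_bdd (c := M) χ.continuous.aestronglyMeasurable
      (Eventually.of_forall fun η => hM _ (mem_range_self η))
  have hF : ∀ ξ, (𝓕 (((2 * t ^ 2)⁻¹ : ℝ) • (Δ Q - P)) : 𝓢(Rn n, ℂ)) ξ =
      (((2 * t ^ 2)⁻¹ : ℝ) : ℂ) * ∫ η, aKer (φhat t) (ξ, η) * (𝓕 Ψ : 𝓢(Rn n, ℂ)) η := by
    intro ξ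
    rw [FourierTransform.fourier_smul, smul_apply, schwartz_fourier_sub, sub_apply,
      fourier_laplacian, hQ', hP', ← integral_const_mul, ← integral_sub ((hi _ ξ).const_mul _) (hi _ ξ),
      Complex.real_smul]
    congr 1
    refine integral_congr_ae (Eventually.of_forall fun η => ?_)
    simp only [fourier_laplacian, aKer, sqDiff]
    push_cast; ring
  obtain ⟨D, hD'⟩ := S.KBdd_kerJ ht
  rw [toL2_eq_toLp _ hD, SchwartzMap.toLp_fourier_eq]
  refine ext_inner_left ℂ fun w => ?_
  rw [← L2.ofReal_smul, inner_smul_right, inner_kOp hD', kform,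
    integral_prod _ (hD'.integrable w (jTest ψ)), L2.inner_def, ← integral_const_mul]
  refine integral_congr_ae ?_
  filter_upwards [SchwartzMap.coeFn_toLp (𝓕 (((2 * t ^ 2)⁻¹ : ℝ) • (Δ Q - P)) : 𝓢(Rn n, ℂ)) 2
    volume] with ξ hξ
  rw [hξ, hF, RCLike.inner_apply, integral_const_mul, mul_assoc]
  rw [mul_comm (∫ η, aKer (φhat t) (ξ, η) * _)]
  congr 2
  refine integral_congr_ae ?_
  filter_upwards [coeFn_jTest h hc] with η hη
  have : (japSq η : ℂ) ≠ 0 := by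
    rw [Complex.ofReal_ne_zero]; unfold japSq; positivity
  rw [hη, kerJ, Complex.ofReal_inv, hΨ]
  field_simp

theorem memLp_transportOp (S : Phase) {t : ℝ} (ht : T < t)
    {ψ : Rn n → ℝ} (h : ContDiff ℝ ∞ ψ) (hc : HasCompactSupport ψ) :
    MemLp (fun x => (transportOp t (φ t) ψ x : ℂ)) 2 volume := by
  have hφ := S.contDiff_phase ht
  have e : transportOp t (φ t) ψ = fun x => (2 * t ^ 2)⁻¹ *
      (Laplacian.laplacian (fun y => φ t y * ψ y) x - φ t x * Laplacian.laplacian ψ x) := by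
    ext1 x
    rw [transportOp,
      laplacian_mul (contDiff_infty.1 hφ 2) (contDiff_infty.1 h 2)]
    ring
  rw [e]
  have h1 := contDiff_laplacian (hφ.mul h) hc.mul_left
  have h2 := contDiff_laplacian h hc
  refine memLp_of_hasCompactSupport ?_ ?_
  · exact continuous_const.mul (h1.continuous.sub (hφ.continuous.mul h2.continuous))
  · exact ((hasCompactSupport_laplacian hc.mul_left).sub
      (hasCompactSupport_laplacian hc).mul_left).mul_left

theorem integral_transportOp_smul (S : Phase) {t : ℝ}
    (ht : T < t) {ψ : Rn n → ℝ} (h : ContDiff ℝ ∞ ψ) (hc : HasCompactSupport ψ) (V : L2 n) :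
    ∫ x, transportOp t (φ t) ψ x • V x = -inner ℂ (jTest ψ) (smoothedRhs φhat t (𝓕 V : L2 n)) := by
  rw [← inner_toL2 (S.memLp_transportOp ht h hc), ← Lp.inner_fourier_eq,
    S.fourier_transportOp ht h hc, smoothedRhs, ← L2.ofReal_smul, ← L2.ofReal_smul,
    inner_smul_left, inner_smul_right, ContinuousLinearMap.adjoint_inner_right, Complex.conj_ofReal]
  push_cast; ring

end PhaseSetup

/-! ### Weak derivatives in time -/

section Vector

variable {E : Type*} [NormedAddCommGroup E] [NormedSpace ℝ E]

theorem lipschitzOnWith_primitive {Q : ℝ → E} {a b K : ℝ} (hab : a ≤ b)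
    (hQ : IntervalIntegrable Q volume a b) (hK : ∀ᵐ t, t ∈ Icc a b → ‖Q t‖ ≤ K) :
    LipschitzOnWith K.toNNReal (fun t => ∫ s in a..t, Q s) (uIcc a b) := by
  rw [uIcc_of_le hab]
  refine LipschitzOnWith.of_dist_le' fun x hx y hy => ?_
  have hi : ∀ z ∈ Icc a b, IntervalIntegrable Q volume a z := fun z hz =>
    hQ.mono_set (by rw [uIcc_of_le hz.1, uIcc_of_le hab]; exact Icc_subset_Icc_right hz.2)
  rw [dist_eq_norm, intervalIntegral.integral_interval_sub_left (hi x hx) (hi y hy), Real.dist_eq]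
  refine intervalIntegral.norm_integral_le_of_norm_le_const_ae ?_
  filter_upwards [hK] with t ht ht2
  exact ht (uIcc_subset_Icc hy hx (uIoc_subset_uIcc ht2))

variable [CompleteSpace E]

/-- Integration by parts against the primitive of a bounded function. -/
theorem integral_deriv_smul_add_smul {g : ℝ → ℝ} (hg : ContDiff ℝ 1 g) {R P : ℝ → E} {a b K : ℝ}
    (hab : a ≤ b) (hR : IntervalIntegrable R volume a b) (hK : ∀ᵐ t, t ∈ Icc a b → ‖R t‖ ≤ K)
    (hP : ∀ t ∈ Icc a b, P t = P a + ∫ s in a..t, R s) :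
    IntervalIntegrable (fun t => deriv g t • P t + g t • R t) volume a b ∧
      ∫ t in a..b, (deriv g t • P t + g t • R t) = g b • P b - g a • P a := by
  set P' : ℝ → E := fun t => P a + ∫ s in a..t, R s with hP'
  have hPlip : LipschitzOnWith K.toNNReal P' (uIcc a b) := by
    intro x hx y hy
    rw [hP', edist_add_left]
    exact lipschitzOnWith_primitive hab hR hK hx hy
  have hPc : ContinuousOn P' (uIcc a b) := hPlip.continuousOn
  have hgc : Continuous g := hg.continuous
  have hgd : Continuous (deriv g) := hg.continuous_deriv le_rfl
  have hQi : IntervalIntegrable (fun t => deriv g t • P' t + g t • R t) volume a b :=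
    (hgd.continuousOn.smul hPc).intervalIntegrable.add (hR.continuousOn_smul hgc.continuousOn)
  have hcongr : ∀ t ∈ Icc a b, deriv g t • P t + g t • R t = deriv g t • P' t + g t • R t :=
    fun t ht => by rw [hP t ht]
  obtain ⟨M₁, hM₁⟩ := isCompact_uIcc.exists_bound_of_continuousOn (hgd.continuousOn.smul hPc)
  obtain ⟨M₂, hM₂⟩ := isCompact_uIcc.exists_bound_of_continuousOn (hgc.continuousOn (s := uIcc a b))
  have hQb : ∀ᵐ t, t ∈ Icc a b → ‖deriv g t • P' t + g t • R t‖ ≤ M₁ + M₂ * K := by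
    filter_upwards [hK] with t ht ht2
    have ht3 : t ∈ uIcc a b := by rwa [uIcc_of_le hab]
    refine (norm_add_le _ _).trans (add_le_add (hM₁ t ht3) ?_)
    rw [norm_smul]
    exact mul_le_mul (hM₂ t ht3) (ht ht2) (norm_nonneg _) ((norm_nonneg _).trans (hM₂ t ht3))
  have hac : AbsolutelyContinuousOnInterval
      (fun t => g t • P' t - ∫ s in a..t, (deriv g s • P' s + g s • R s)) a b :=
    (hg.contDiffOn.absolutelyContinuousOnInterval.smul
      hPlip.absolutelyContinuousOnInterval).sub
      (lipschitzOnWith_primitive hab hQi hQb).absolutelyContinuousOnInterval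
  obtain ⟨c, hc⟩ := hac.const_of_ae_hasDerivAt_zero (by
    filter_upwards [hR.ae_hasDerivAt_integral, hQi.ae_hasDerivAt_integral] with t h1 h2 ht
    have h3 := (h1 ht a left_mem_uIcc).const_add (P a)
    have h4 := ((hg.differentiable one_ne_zero t).hasDerivAt.smul h3).sub (h2 ht a left_mem_uIcc)
    have e : g t • R t + deriv g t • P' t - (deriv g t • P' t + g t • R t) = 0 := by abel
    rw [← e]; exact h4)
  have ha := hc a left_mem_uIcc
  have hb := hc b right_mem_uIcc
  rw [intervalIntegral.integral_same, sub_zero] at ha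
  refine ⟨(intervalIntegrable_congr fun t ht => hcongr t
    (by rw [uIoc_of_le hab] at ht; exact Ioc_subset_Icc_self ht)).2 hQi, ?_⟩
  rw [intervalIntegral.integral_congr (g := fun t => deriv g t • P' t + g t • R t)
    (fun t ht => hcongr t (by rwa [uIcc_of_le hab] at ht)), hP b (right_mem_Icc.2 hab)]
  have e1 : P' a = P a := by simp [hP']
  rw [e1] at ha
  rw [← ha] at hb
  rw [sub_eq_iff_eq_add] at hb
  rw [hb]; abel

/-- A function with vanishing weak derivative is constant. -/
theorem exists_ae_eq_const {F : ℝ → E} {a b : ℝ} (hab : a < b)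
    (hF : LocallyIntegrableOn F (Ioo a b))
    (h : ∀ g : ℝ → ℝ, ContDiff ℝ ∞ g → HasCompactSupport g → tsupport g ⊆ Ioo a b →
      ∫ t, deriv g t • F t = 0) : ∃ c, ∀ᵐ t, t ∈ Ioo a b → F t = c := by
  have hr : 0 < (b - a) / 8 := by linarith
  let η₀ : ContDiffBump ((a + b) / 2) := ⟨(b - a) / 8, (b - a) / 4, hr, by linarith⟩
  set η := η₀.normed volume with hη
  have hηsupp : tsupport η ⊆ Ioo a b := by
    rw [hη, η₀.tsupport_normed_eq, Real.closedBall_eq_Icc]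
    change Icc ((a + b) / 2 - (b - a) / 4) ((a + b) / 2 + (b - a) / 4) ⊆ _
    exact Icc_subset_Ioo (by linarith) (by linarith)
  have hηs : ContDiff ℝ ∞ η := η₀.contDiff_normed
  have hηc : HasCompactSupport η := η₀.hasCompactSupport_normed
  have hint : ∀ χ : ℝ → ℝ, Continuous χ → HasCompactSupport χ → tsupport χ ⊆ Ioo a b →
      Integrable fun t => χ t • F t := by
    intro χ h1 h2 h3
    have h4 : IntegrableOn (fun t => χ t • F t) (tsupport χ) :=
      (hF.integrableOn_compact_subset h3 h2).continuousOn_smul h1.continuousOn h2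
    refine (integrableOn_iff_integrable_of_support_subset fun t ht => ?_).1 h4
    exact subset_tsupport _ (left_ne_zero_of_smul ht)
  refine ⟨∫ t, η t • F t, ?_⟩
  have hc : LocallyIntegrableOn (fun t => F t - ∫ t, η t • F t) (Ioo a b) :=
    hF.sub ((locallyIntegrable_const _).locallyIntegrableOn _)
  have key := isOpen_Ioo.ae_eq_zero_of_integral_contDiff_smul_eq_zero hc fun χ h1 h2 h3 => ?_
  · filter_upwards [key] with t ht ht2 using sub_eq_zero.1 (ht ht2)
  set q : ℝ → ℝ := fun t => χ t - (∫ s, χ s) * η t with hq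
  have hqs : ContDiff ℝ ∞ q := h1.sub (contDiff_const.mul hηs)
  set K := tsupport χ ∪ tsupport η with hK
  have hKc : IsCompact K := h2.isCompact.union hηc.isCompact
  have hKne : K.Nonempty := by
    refine Nonempty.inr ?_
    rw [hη, η₀.tsupport_normed_eq]
    exact ⟨_, Metric.mem_closedBall_self η₀.rOut_pos.le⟩
  have hKsub : K ⊆ Ioo a b := union_subset h3 hηsupp
  have ha' := hKsub (hKc.sInf_mem hKne)
  have hb' := hKsub (hKc.sSup_mem hKne)
  have hq0 : ∀ t, t ∉ Icc (sInf K) (sSup K) → q t = 0 := by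
    intro t ht
    have htK : t ∉ K := fun hh => ht ⟨csInf_le hKc.bddBelow hh, le_csSup hKc.bddAbove hh⟩
    simp only [hq]
    rw [image_eq_zero_of_notMem_tsupport fun hh => htK (Or.inl hh),
      image_eq_zero_of_notMem_tsupport fun hh => htK (Or.inr hh)]
    simp
  have hqi : Integrable q := (h1.continuous.integrable_of_hasCompactSupport h2).sub
    ((hηs.continuous.integrable_of_hasCompactSupport hηc).const_mul _)
  have hqint : ∫ t, q t = 0 := by
    simp only [hq]
    rw [integral_sub (h1.continuous.integrable_of_hasCompactSupport h2)
      ((hηs.continuous.integrable_of_hasCompactSupport hηc).const_mul _), integral_const_mul, hη,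
      η₀.integral_normed]
    ring
  set G : ℝ → ℝ := fun t => ∫ s in Iic t, q s with hG
  have hGd : ∀ t, HasDerivAt G (q t) t := by
    intro t
    have e : G = fun t => (∫ s in Iic (0 : ℝ), q s) + ∫ s in (0 : ℝ)..t, q s := by
      ext1 t
      rw [hG, ← intervalIntegral.integral_Iic_sub_Iic hqi.integrableOn hqi.integrableOn,
        add_sub_cancel]
    rw [e]
    exact (intervalIntegral.integral_hasDerivAt_right hqi.intervalIntegrable
      (hqs.continuous.stronglyMeasurableAtFilter _ _) hqs.continuous.continuousAt).const_add _
  have hG' : deriv G = q := funext fun t => (hGd t).deriv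
  have hGs : ContDiff ℝ ∞ G := contDiff_infty_iff_deriv.2
    ⟨fun t => (hGd t).differentiableAt, by rwa [hG']⟩
  have hGsupp : ∀ t, t ∉ Icc (sInf K) (sSup K) → G t = 0 := by
    intro t ht
    rw [mem_Icc, not_and_or, not_le, not_le] at ht
    simp only [hG]
    rcases ht with ht | ht
    · exact setIntegral_eq_zero_of_forall_eq_zero fun s hs => hq0 s fun hh =>
        absurd (hh.1.trans hs) (not_le.2 ht)
    · rw [← hqint]
      refine setIntegral_eq_integral_of_forall_compl_eq_zero fun s hs => hq0 s fun hh => ?_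
      exact hs (hh.2.trans ht.le)
  have hGt : tsupport G ⊆ Icc (sInf K) (sSup K) :=
    closure_minimal (fun t ht => by_contra fun hh => ht (hGsupp t hh)) isClosed_Icc
  have hfin := h G hGs (HasCompactSupport.intro isCompact_Icc hGsupp)
    (hGt.trans (Icc_subset_Ioo ha'.1 hb'.2))
  rw [hG'] at hfin
  have e2 : ∀ t, q t • F t = χ t • F t - (∫ s, χ s) • (η t • F t) := fun t => by
    simp only [hq, sub_smul, mul_smul]
  simp_rw [e2] at hfin
  have hi2 : Integrable fun t => (∫ s, χ s) • (η t • F t) :=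
    (hint η hηs.continuous hηc hηsupp).smul _
  rw [integral_sub (hint χ h1.continuous h2 h3) hi2, integral_smul] at hfin
  simp_rw [smul_sub]
  rw [integral_sub (hint χ h1.continuous h2 h3)
    ((h1.continuous.integrable_of_hasCompactSupport h2).smul_const _), integral_smul_const]
  exact hfin

end Vector

/-! ### Test functions separate points -/

theorem ae_eq_zero_of_fourier_eq_zero {H : Rn n → ℂ} (hH : Integrable H) (h : ∀ y, 𝓕 H y = 0) :
    ∀ᵐ ξ, H ξ = 0 := by
  refine ae_eq_zero_of_integral_contDiff_smul_eq_zero hH.locallyIntegrable fun g hs hc => ?_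
  have h1 := integral_fourier_mul (𝓕⁻ (schwartzOfReal g hs hc) : 𝓢(Rn n, ℂ)).integrable hH
  simp_rw [h, mul_zero, integral_zero, ← SchwartzMap.fourier_coe,
    FourierTransform.fourier_fourierInv_eq, schwartzOfReal_apply] at h1
  simp_rw [Complex.real_smul]
  exact h1

theorem mul_eq_zero_of_inner_jTest_eq_zero {X : L2 n}
    (h : ∀ ψ : Rn n → ℝ, ContDiff ℝ ∞ ψ → HasCompactSupport ψ → inner ℂ (jTest ψ) X = 0)
    {ψ : Rn n → ℝ} (hs : ContDiff ℝ ∞ ψ) (hc : HasCompactSupport ψ) :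
    ∀ᵐ ξ, X ξ = 0 ∨ 𝓕 (fun x => (ψ x : ℂ)) ξ = 0 := by
  have h0 : ∀ᵐ ξ, inner ℂ (jTest ψ ξ) (X ξ) = 0 := by
    refine ae_eq_zero_of_fourier_eq_zero (L2.integrable_inner _ _) fun y => ?_
    have hs' : ContDiff ℝ ∞ fun x => ψ (x + y) := hs.comp (contDiff_id.add contDiff_const)
    have hc' : HasCompactSupport fun x => ψ (x + y) := hc.comp_homeomorph (Homeomorph.addRight y)
    have h1 := h _ hs' hc'
    rw [L2.inner_def] at h1
    rw [← h1, Real.fourier_eq]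
    refine integral_congr_ae ?_
    filter_upwards [coeFn_jTest hs hc, coeFn_jTest hs' hc'] with ξ h2 h3
    have h4 : 𝓕 (fun x => (ψ (x + y) : ℂ)) ξ =
        Real.fourierChar (inner ℝ y ξ) • 𝓕 (fun x => (ψ x : ℂ)) ξ :=
      congrFun (VectorFourier.fourierIntegral_comp_add_right Real.fourierChar volume
        (innerₗ (Rn n)) (fun x => (ψ x : ℂ)) y) ξ
    have h5 : (𝓕 (schwartzOfReal _ hs' hc') : 𝓢(Rn n, ℂ)) ξ =
        Real.fourierChar (inner ℝ y ξ) • (𝓕 (schwartzOfReal ψ hs hc) : 𝓢(Rn n, ℂ)) ξ := by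
      rw [SchwartzMap.fourier_coe, SchwartzMap.fourier_coe]; exact h4
    rw [h2, h3, h5, real_inner_comm, RCLike.inner_apply, RCLike.inner_apply, Circle.smul_def,
      Circle.smul_def, smul_eq_mul, smul_eq_mul, AddChar.map_neg_eq_inv, Circle.coe_inv_eq_conj]
    simp only [map_mul]
    ring
  filter_upwards [h0, coeFn_jTest hs hc] with ξ h1 h2
  rw [h2, SchwartzMap.fourier_coe, RCLike.inner_apply, mul_eq_zero, map_eq_zero, mul_eq_zero] at h1
  refine h1.imp_right fun h3 => h3.resolve_left ?_
  exact Complex.ofReal_ne_zero.2 (by unfold japSq; positivity)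

open scoped Convolution in
theorem eq_zero_of_inner_jTest_eq_zero {X : L2 n}
    (h : ∀ ψ : Rn n → ℝ, ContDiff ℝ ∞ ψ → HasCompactSupport ψ → inner ℂ (jTest ψ) X = 0) :
    X = 0 := by
  let χ : ℕ → ContDiffBump (0 : Rn n) := fun m =>
    ⟨1 / ((m : ℝ) + 1) / 2, 1 / ((m : ℝ) + 1), by positivity, half_lt_self (by positivity)⟩
  ext1
  filter_upwards [ae_all_iff.2 fun m => mul_eq_zero_of_inner_jTest_eq_zero h
    ((χ m).contDiff_normed (μ := volume)) (χ m).hasCompactSupport_normed,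
    Lp.coeFn_zero ℂ 2 (volume : Measure (Rn n))] with ξ hξ h0
  rw [h0]
  by_contra hX
  have h1 := ContDiffBump.convolution_tendsto_right_of_continuous (φ := χ) (μ := volume)
    (g := fun x : Rn n => (Real.fourierChar (inner ℝ x ξ) : ℂ)) tendsto_one_div_add_atTop_nhds_zero_nat
    (by fun_prop) 0
  have h2 : ∀ m, ((χ m).normed volume ⋆[ContinuousLinearMap.lsmul ℝ ℝ, volume]
      fun x : Rn n => (Real.fourierChar (inner ℝ x ξ) : ℂ)) 0 = 0 := fun m => by
    rw [← (hξ m).resolve_left hX, Real.fourier_eq, convolution_def]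
    refine integral_congr_ae (Eventually.of_forall fun x => ?_)
    simp [Circle.smul_def, mul_comm]
  simp_rw [h2] at h1
  simpa using tendsto_nhds_unique h1 tendsto_const_nhds

/-! ### Time dependent test functions -/

theorem MemLp.ofReal_sub {f g : Rn n → ℝ} (hf : MemLp (fun x => (f x : ℂ)) 2 volume)
    (hg : MemLp (fun x => (g x : ℂ)) 2 volume) :
    MemLp (fun x => ((f x - g x : ℝ) : ℂ)) 2 volume :=
  (hf.sub hg).ae_eq (Eventually.of_forall fun x => by simp)

theorem toL2_sub {f g : Rn n → ℝ} (hf : MemLp (fun x => (f x : ℂ)) 2 volume)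
    (hg : MemLp (fun x => (g x : ℂ)) 2 volume) :
    toL2 (fun x => f x - g x) = toL2 f - toL2 g := by
  ext1
  filter_upwards [coeFn_toL2 (MemLp.ofReal_sub hf hg), coeFn_toL2 hf, coeFn_toL2 hg, Lp.coeFn_sub (toL2 f) (toL2 g)]
    with x h1 h2 h3 h4
  rw [h1, h4, Pi.sub_apply, h2, h3, Complex.ofReal_sub]

theorem toL2_const_mul {f : Rn n → ℝ} (hf : MemLp (fun x => (f x : ℂ)) 2 volume) (c : ℝ) :
    toL2 (fun x => c * f x) = c • toL2 f := by
  have h : MemLp (fun x => ((c * f x : ℝ) : ℂ)) 2 volume := by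
    simpa only [Complex.ofReal_mul] using hf.const_mul (c : ℂ)
  ext1
  filter_upwards [coeFn_toL2 h, coeFn_toL2 hf, Lp.coeFn_smul c (toL2 f)] with x h1 h2 h3
  rw [h1, h3, Pi.smul_apply, h2, Complex.ofReal_mul, Complex.real_smul]

theorem norm_toL2_le {f : Rn n → ℝ} (hf : MemLp (fun x => (f x : ℂ)) 2 volume) {K : Set (Rn n)}
    (hK : IsCompact K) (hs : ∀ x ∉ K, f x = 0) {C : ℝ} (hC : ∀ x, |f x| ≤ C) :
    ‖toL2 f‖ ≤ (volume K ^ (1 / 2 : ℝ)).toReal * C := by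
  have hC0 : 0 ≤ C := (abs_nonneg _).trans (hC 0)
  rw [← toReal_enorm, Lp.enorm_def, eLpNorm_congr_ae (coeFn_toL2 hf),
    ← eLpNorm_restrict_eq_of_support_subset (s := K)]
  · have h1 := eLpNorm_le_of_ae_bound (p := 2) (μ := volume.restrict K)
      (f := fun x => (f x : ℂ)) (C := C) (Eventually.of_forall fun x => by
        rw [Complex.norm_real]; exact hC x)
    have h2 : (volume K) ^ (1 / 2 : ℝ) ≠ ⊤ :=
      ENNReal.rpow_ne_top_of_nonneg (by norm_num) hK.measure_lt_top.ne
    refine (ENNReal.toReal_mono (ENNReal.mul_ne_top ?_ ENNReal.ofReal_ne_top) h1).trans (le_of_eq ?_)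
    · simpa using h2
    · rw [ENNReal.toReal_mul, ENNReal.toReal_ofReal hC0]
      simp
  · intro x hx
    by_contra h
    exact hx (by simp [hs x h])

/-- The derivative of `Θ` in the direction `v`. -/
def dirDeriv {E : Type*} [NormedAddCommGroup E] [NormedSpace ℝ E] (v : E) (Θ : E → ℝ) (p : E) : ℝ :=
  fderiv ℝ Θ p v

section DirDeriv

variable {E : Type*} [NormedAddCommGroup E] [NormedSpace ℝ E]

theorem ContDiff.dirDeriv {Θ : E → ℝ} (h : ContDiff ℝ ∞ Θ) (v : E) :
    ContDiff ℝ ∞ (dirDeriv v Θ) :=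
  (h.fderiv_right (m := ∞) (by simp)).clm_apply contDiff_const

theorem HasCompactSupport.dirDeriv {Θ : E → ℝ} (h : HasCompactSupport Θ) (v : E) :
    HasCompactSupport (dirDeriv v Θ) :=
  (h.fderiv ℝ).comp_left (g := fun L : E →L[ℝ] ℝ => L v) rfl

theorem dirDeriv_comm {Θ : E → ℝ} (h : ContDiff ℝ ∞ Θ) (v w : E) :
    dirDeriv v (dirDeriv w Θ) = dirDeriv w (dirDeriv v Θ) := by
  ext p
  have hd : DifferentiableAt ℝ (fderiv ℝ Θ) p :=
    (h.fderiv_right (m := ∞) (by simp)).differentiable (by simp) p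
  have e : ∀ a b : E, _root_.dirDeriv a (_root_.dirDeriv b Θ) p = fderiv ℝ (fderiv ℝ Θ) p a b := by
    intro a b
    unfold _root_.dirDeriv
    rw [fderiv_clm_apply hd (differentiableAt_const b)]
    simp
  rw [e, e]
  exact ((contDiff_infty.1 h 2).contDiffAt.isSymmSndFDerivAt (by simp)) v w

theorem dirDeriv_sub {f g : E → ℝ} (hf : Differentiable ℝ f) (hg : Differentiable ℝ g) (v : E) :
    dirDeriv v (fun p => f p - g p) = fun p => dirDeriv v f p - dirDeriv v g p := by
  ext p
  unfold _root_.dirDeriv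
  rw [fderiv_fun_sub (hf p) (hg p)]; rfl

theorem dirDeriv_sum {ι : Type*} (s : Finset ι) {f : ι → E → ℝ}
    (hf : ∀ i ∈ s, Differentiable ℝ (f i)) (v : E) :
    dirDeriv v (fun p => ∑ i ∈ s, f i p) = fun p => ∑ i ∈ s, dirDeriv v (f i) p := by
  ext p
  unfold _root_.dirDeriv
  rw [fderiv_fun_sum fun i hi => hf i hi p, sum_apply]

end DirDeriv

theorem hasDerivAt_slice {Θ : ℝ × Rn n → ℝ} (h : Differentiable ℝ Θ) (t : ℝ) (x : Rn n) :
    HasDerivAt (fun s => Θ (s, x)) (dirDeriv (1, 0) Θ (t, x)) t := by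
  have h1 : HasDerivAt (fun s : ℝ => (s, x)) ((1 : ℝ), (0 : Rn n)) t :=
    (hasDerivAt_id t).prodMk (hasDerivAt_const t x)
  exact (h (t, x)).hasFDerivAt.comp_hasDerivAt t h1

theorem HasCompactSupport.slice {Θ : ℝ × Rn n → ℝ} (hc : HasCompactSupport Θ) (t : ℝ) :
    HasCompactSupport fun x => Θ (t, x) :=
  HasCompactSupport.intro (hc.isCompact.image continuous_snd) fun x hx =>
    image_eq_zero_of_notMem_tsupport fun h => hx ⟨(t, x), h, rfl⟩

theorem ContDiff.slice {Θ : ℝ × Rn n → ℝ} (h : ContDiff ℝ ∞ Θ) (t : ℝ) :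
    ContDiff ℝ ∞ fun x => Θ (t, x) :=
  h.comp (contDiff_const.prodMk contDiff_id)

theorem hasDerivAt_toL2_slice {Θ : ℝ × Rn n → ℝ} (h : ContDiff ℝ ∞ Θ) (hc : HasCompactSupport Θ)
    (t : ℝ) : HasDerivAt (fun s => toL2 fun x => Θ (s, x))
      (toL2 fun x => dirDeriv (1, 0) Θ (t, x)) t := by
  set g := dirDeriv (1, 0) Θ with hg
  have hgs : ContDiff ℝ ∞ g := h.dirDeriv _
  have hgc : HasCompactSupport g := hc.dirDeriv _
  set K := Prod.snd '' tsupport Θ with hKdef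
  have hK : IsCompact K := hc.isCompact.image continuous_snd
  have hmem : ∀ {Θ' : ℝ × Rn n → ℝ}, ContDiff ℝ ∞ Θ' → HasCompactSupport Θ' → ∀ s,
      MemLp (fun x => (Θ' (s, x) : ℂ)) 2 volume := fun h1 h2 s =>
    memLp_of_hasCompactSupport (h1.slice s).continuous (h2.slice s)
  have hu : UniformContinuous g := hgc.uniformContinuous_of_continuous hgs.continuous
  set A := (volume K ^ (1 / 2 : ℝ)).toReal with hA
  have hA0 : 0 ≤ A := ENNReal.toReal_nonneg
  rw [hasDerivAt_iff_isLittleO, Asymptotics.isLittleO_iff]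
  intro ε hε
  obtain ⟨δ, hδ, hδ2⟩ := Metric.uniformContinuous_iff.1 hu (ε / (A + 1)) (by positivity)
  filter_upwards [Metric.ball_mem_nhds t hδ] with s hs
  have hkey : ∀ x, |Θ (s, x) - Θ (t, x) - (s - t) * g (t, x)| ≤ ε / (A + 1) * |s - t| := by
    intro x
    have hd : ∀ y ∈ Metric.ball t δ, HasDerivWithinAt (fun y => Θ (y, x) - y * g (t, x))
        (g (y, x) - g (t, x)) (Metric.ball t δ) y := fun y _ => by
      have := (hasDerivAt_slice (h.differentiable (by simp)) y x).fun_sub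
        ((hasDerivAt_id y).mul_const (g (t, x)))
      simpa [hg] using this.hasDerivWithinAt
    have hb : ∀ y ∈ Metric.ball t δ, ‖g (y, x) - g (t, x)‖ ≤ ε / (A + 1) := fun y hy => by
      rw [← dist_eq_norm]
      refine (hδ2 ?_).le
      rw [Prod.dist_eq, dist_self]
      exact max_lt hy hδ
    have := (convex_ball t δ).norm_image_sub_le_of_norm_hasDerivWithin_le hd hb
      (Metric.mem_ball_self hδ) hs
    rw [Real.norm_eq_abs, Real.norm_eq_abs] at this
    refine le_trans (le_of_eq ?_) this
    congr 1; ring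
  have m1 := hmem h hc s
  have m2 := hmem h hc t
  have m3 := hmem hgs hgc t
  have m12 := MemLp.ofReal_sub m1 m2
  have m3' : MemLp (fun x => (((s - t) * g (t, x) : ℝ) : ℂ)) 2 volume := by
    simpa only [Complex.ofReal_mul] using m3.const_mul ((s - t : ℝ) : ℂ)
  have m4 := MemLp.ofReal_sub m12 m3'
  rw [← toL2_sub m1 m2, ← toL2_const_mul m3, ← toL2_sub m12 m3', Real.norm_eq_abs]
  refine (norm_toL2_le m4 hK (fun x hx => ?_) hkey).trans ?_
  · have h0 : ∀ s, (s, x) ∉ tsupport Θ := fun s hh => hx ⟨(s, x), hh, rfl⟩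
    have h1 : g (t, x) = 0 := by
      have : fderiv ℝ Θ (t, x) = 0 := image_eq_zero_of_notMem_tsupport fun hh =>
        h0 t (tsupport_fderiv_subset ℝ hh)
      rw [hg, dirDeriv, this]; rfl
    rw [image_eq_zero_of_notMem_tsupport (h0 s), image_eq_zero_of_notMem_tsupport (h0 t), h1]
    ring
  · rw [← mul_assoc, mul_div_assoc']
    gcongr
    rw [div_le_iff₀ (by positivity)]
    nlinarith

/-- `(1 - Δ) θ` for a time dependent function, `Δ` acting in the space variable. -/
def spaceOp (θ : ℝ × Rn n → ℝ) (p : ℝ × Rn n) : ℝ :=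
  θ p - ∑ i, dirDeriv (0, EuclideanSpace.basisFun (Fin n) ℝ i)
    (dirDeriv (0, EuclideanSpace.basisFun (Fin n) ℝ i) θ) p

theorem spaceOp_eq {θ : ℝ × Rn n → ℝ} (h : ContDiff ℝ ∞ θ) (t : ℝ) (x : Rn n) :
    spaceOp θ (t, x) = θ (t, x) - Laplacian.laplacian (fun y => θ (t, y)) x := by
  have e : ∀ (Θ : ℝ × Rn n → ℝ), Differentiable ℝ Θ → ∀ (v y : Rn n),
      fderiv ℝ (fun y => Θ (t, y)) y v = dirDeriv (0, v) Θ (t, y) := by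
    intro Θ hΘ v y
    have h1 : HasFDerivAt (fun y : Rn n => (t, y)) (ContinuousLinearMap.inr ℝ ℝ (Rn n)) y :=
      (hasFDerivAt_const t y).prodMk (hasFDerivAt_id y)
    exact congrArg (fun L : Rn n →L[ℝ] ℝ => L v) ((hΘ (t, y)).hasFDerivAt.comp y h1).fderiv
  rw [spaceOp, InnerProductSpace.laplacian_eq_iteratedFDeriv_orthonormalBasis _
    (EuclideanSpace.basisFun (Fin n) ℝ)]
  congr 1
  refine Finset.sum_congr rfl fun i _ => ?_
  set v := EuclideanSpace.basisFun (Fin n) ℝ i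
  simp only [iteratedFDeriv_two_apply, Matrix.cons_val_zero, Matrix.cons_val_one]
  rw [← e _ ((h.dirDeriv _).differentiable (by simp))]
  have hs : DifferentiableAt ℝ (fderiv ℝ fun y => θ (t, y)) x :=
    ((h.slice t).fderiv_right (m := ∞) (by simp)).differentiable (by simp) x
  have e2 : (fun y => dirDeriv (0, v) θ (t, y)) = fun y => fderiv ℝ (fun y => θ (t, y)) y v :=
    funext fun y => (e θ (h.differentiable (by simp)) v y).symm
  rw [e2, fderiv_clm_apply hs (differentiableAt_const v)]
  simp

theorem ContDiff.spaceOp {θ : ℝ × Rn n → ℝ} (h : ContDiff ℝ ∞ θ) : ContDiff ℝ ∞ (spaceOp θ) :=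
  h.sub (ContDiff.sum fun _ _ => (h.dirDeriv _).dirDeriv _)

theorem HasCompactSupport.spaceOp {θ : ℝ × Rn n → ℝ} (h : HasCompactSupport θ) :
    HasCompactSupport (spaceOp θ) := by
  refine HasCompactSupport.intro h fun p hp => ?_
  have h0 : ∀ Θ : ℝ × Rn n → ℝ, p ∉ tsupport Θ → ∀ v, p ∉ tsupport (_root_.dirDeriv v Θ) := by
    intro Θ hΘ v hh
    refine hΘ (tsupport_fderiv_subset ℝ (closure_mono ?_ hh))
    intro q hq hq2
    exact hq (by unfold _root_.dirDeriv; rw [hq2]; rfl)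
  unfold _root_.spaceOp
  rw [image_eq_zero_of_notMem_tsupport hp, Finset.sum_eq_zero fun i _ =>
    image_eq_zero_of_notMem_tsupport (h0 _ (h0 _ hp _) _), sub_zero]

theorem dirDeriv_spaceOp {θ : ℝ × Rn n → ℝ} (h : ContDiff ℝ ∞ θ) (v : ℝ × Rn n) :
    dirDeriv v (spaceOp θ) = spaceOp (dirDeriv v θ) := by
  have hd : ∀ {f : ℝ × Rn n → ℝ}, ContDiff ℝ ∞ f → Differentiable ℝ f := fun h =>
    h.differentiable (by simp)
  have h1 := fun i : Fin n => (h.dirDeriv (0, EuclideanSpace.basisFun (Fin n) ℝ i)).dirDeriv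
    (0, EuclideanSpace.basisFun (Fin n) ℝ i)
  unfold spaceOp
  rw [dirDeriv_sub (hd h) (hd (ContDiff.sum fun i _ => h1 i)),
    dirDeriv_sum _ fun i _ => hd (h1 i)]
  ext p
  congr 1
  refine Finset.sum_congr rfl fun i _ => ?_
  rw [dirDeriv_comm (h.dirDeriv _), dirDeriv_comm h]

theorem jTest_slice {θ : ℝ × Rn n → ℝ} (h : ContDiff ℝ ∞ θ) (t : ℝ) :
    jTest (fun x => θ (t, x)) = 𝓕 (toL2 fun x => spaceOp θ (t, x)) := by
  rw [jTest]
  simp_rw [spaceOp_eq h]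

theorem hasDerivAt_jTest {θ : ℝ × Rn n → ℝ} (h : ContDiff ℝ ∞ θ) (hc : HasCompactSupport θ)
    (t : ℝ) : HasDerivAt (fun s => jTest fun x => θ (s, x))
      (jTest fun x => dirDeriv (1, 0) θ (t, x)) t := by
  simp_rw [jTest_slice h, jTest_slice (h.dirDeriv (1, 0))]
  rw [← dirDeriv_spaceOp h]
  exact ((Lp.fourierTransformₗᵢ (Rn n) ℂ).toContinuousLinearEquiv.toContinuousLinearMap.restrictScalars
    ℝ).hasFDerivAt.comp_hasDerivAt t (hasDerivAt_toL2_slice h.spaceOp hc.spaceOp t)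

theorem jTest_const_mul {ψ : Rn n → ℝ} (h : ContDiff ℝ ∞ ψ) (hc : HasCompactSupport ψ) (c : ℝ) :
    jTest (fun x => c * ψ x) = c • jTest ψ := by
  have e : ∀ x, c * ψ x - Laplacian.laplacian (fun x => c * ψ x) x =
      c * (ψ x - Laplacian.laplacian ψ x) := fun x => by
    rw [show (fun x => c * ψ x) = c • ψ from rfl,
      InnerProductSpace.laplacian_smul c (contDiff_infty.1 h 2).contDiffAt, smul_eq_mul]
    ring
  rw [jTest, jTest]
  simp_rw [e]
  rw [toL2_const_mul (f := fun x => ψ x - Laplacian.laplacian ψ x) (memLp_of_hasCompactSupport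
    (h.continuous.sub (contDiff_laplacian h hc).continuous)
    (hc.sub (hasCompactSupport_laplacian hc))), ← L2.ofReal_smul, ← L2.ofReal_smul,
    FourierTransform.fourier_smul]

/-! ### Weak and mild solutions -/

theorem IsCompact.exists_subset_Ioo {K : Set ℝ} (hK : IsCompact K) {a b : ℝ} (hab : a < b)
    (h : K ⊆ Ioo a b) : ∃ t₁ ∈ Ioo a b, ∃ t₂ ∈ Ioo a b, t₁ < t₂ ∧ K ⊆ Ioo t₁ t₂ := by
  rcases K.eq_empty_or_nonempty with rfl | hne
  · obtain ⟨s, hs⟩ := exists_between hab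
    obtain ⟨s', hs'⟩ := exists_between hs.2
    exact ⟨s, hs, s', ⟨hs.1.trans hs'.1, hs'.2⟩, hs'.1, empty_subset _⟩
  · obtain ⟨x, hx⟩ := hK.exists_isLeast hne
    obtain ⟨y, hy⟩ := hK.exists_isGreatest hne
    obtain ⟨s, hs⟩ := exists_between (h hx.1).1
    obtain ⟨s', hs'⟩ := exists_between (h hy.1).2
    have hxy := hx.2 hy.1
    have hx2 := (h hx.1).2
    have hy1 := (h hy.1).1
    exact ⟨s, ⟨hs.1, hs.2.trans hx2⟩, s', ⟨hy1.trans hs'.1, hs'.2⟩,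
      hs.2.trans (hxy.trans_lt hs'.1), fun z hz => ⟨hs.2.trans_le (hx.2 hz), (hy.2 hz).trans_lt hs'.1⟩⟩

theorem integrable_smul_L2 {f : Rn n → ℝ} (hf : MemLp (fun x => (f x : ℂ)) 2 volume) (V : L2 n) :
    Integrable (fun x => f x • V x) volume := by
  simp_rw [← Complex.coe_smul]
  exact hf.integrable_mul (Lp.memLp V)

theorem setIntegral_eq_intervalIntegral {E : Type*} [NormedAddCommGroup E] [NormedSpace ℝ E]
    {I : Set ℝ} (hI : MeasurableSet I) {t₁ t₂ : ℝ} (h : t₁ ≤ t₂) (hs : Icc t₁ t₂ ⊆ I) {G : ℝ → E}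
    (hG : ∀ t ∉ Ioo t₁ t₂, G t = 0) : ∫ t in I, G t = ∫ t in t₁..t₂, G t := by
  rw [intervalIntegral.integral_of_le h]
  exact setIntegral_eq_of_subset_of_forall_sdiff_eq_zero hI
    (Ioc_subset_Icc_self.trans hs) fun t ht => hG t fun h2 => ht.2 (Ioo_subset_Ioc_self h2)

/-- The integrand in the weak form of the transport equation. -/
def weakIntegrand (φ : ℝ → Rn n → ℝ) (θ : ℝ × Rn n → ℝ) (V : ℝ → L2 n) (t : ℝ) : ℂ :=
  ∫ x, (deriv (fun s => θ (s, x)) t - transportOp t (φ t) (fun y => θ (t, y)) x) • V t x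

theorem weakIntegrand_eq_zero (φ : ℝ → Rn n → ℝ) {θ : ℝ × Rn n → ℝ} (h : ContDiff ℝ ∞ θ)
    (V : ℝ → L2 n) {t : ℝ} (ht : t ∉ Prod.fst '' tsupport θ) : weakIntegrand φ θ V t = 0 := by
  have h0 : ∀ x, (t, x) ∉ tsupport θ := fun x hx => ht ⟨_, hx, rfl⟩
  have h1 : (fun y => θ (t, y)) = fun _ => 0 :=
    funext fun y => image_eq_zero_of_notMem_tsupport (h0 y)
  refine integral_eq_zero_of_ae (Eventually.of_forall fun x => ?_)
  have h2 : fderiv ℝ θ (t, x) = 0 := image_eq_zero_of_notMem_tsupport fun hh =>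
    h0 x (tsupport_fderiv_subset ℝ hh)
  have h3 : gradient (fun _ : Rn n => (0 : ℝ)) x = 0 := by simp
  simp only [(hasDerivAt_slice (h.differentiable (by simp)) t x).deriv, dirDeriv, h2, h1,
    transportOp, h3]
  simp [image_eq_zero_of_notMem_tsupport (h0 x)]

namespace PhaseSetup

theorem weakIntegrand_eq (S : Phase) {t : ℝ} (ht : T < t)
    {θ : ℝ × Rn n → ℝ} (h : ContDiff ℝ ∞ θ) (hc : HasCompactSupport θ) (V : ℝ → L2 n) :
    weakIntegrand φ θ V t =
      inner ℂ (jTest fun x => θ (t, x)) (smoothedRhs φhat t (𝓕 (V t) : L2 n)) +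
      inner ℂ (jTest fun x => dirDeriv (1, 0) θ (t, x))
        (mulOp (fun ξ => (japSq ξ)⁻¹) (𝓕 (V t) : L2 n)) := by
  have hd := h.dirDeriv (1, 0)
  have hdc := hc.dirDeriv (1, 0)
  rw [weakIntegrand, ← integral_test_smul (hd.slice t) (hdc.slice t), ← neg_neg (inner ℂ _ _),
    ← S.integral_transportOp_smul ht (h.slice t) (hc.slice t), neg_add_eq_sub, ← integral_sub]
  · refine integral_congr_ae (Eventually.of_forall fun x => ?_)
    simp only [(hasDerivAt_slice (h.differentiable (by simp)) t x).deriv, sub_smul]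
  · exact integrable_smul_L2 (memLp_of_hasCompactSupport (hd.slice t).continuous (hdc.slice t)) _
  · exact integrable_smul_L2 (S.memLp_transportOp ht (h.slice t) (hc.slice t)) _

theorem continuousOn_smoothedRhs (S : Phase) {J : Set ℝ}
    (hJT : J ⊆ Ioi T) {v : ℝ → L2 n} (hv : ContinuousOn v J) :
    ContinuousOn (fun t => smoothedRhs φhat t (v t)) J := by
  have h1 : ContinuousOn (fun t : ℝ => -(2 * t ^ 2)⁻¹) J := by
    refine (ContinuousOn.inv₀ (by fun_prop) fun t ht => ?_).neg
    have : 0 < t := zero_lt_one.trans_le (S.hT.trans (hJT ht).le)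
    positivity
  exact h1.smul ((S.continuousOn_adjoint.mono hJT).clm_apply hv)

/-- Continuous mild solutions are weak solutions. -/
theorem setIntegral_weakIntegrand (S : Phase) {t₀ Λ : ℝ}
    (ht₀ : T < t₀) {V : ℝ → L2 n} (hcv : ContinuousOn (fun t => (𝓕 (V t) : L2 n)) (Ioo T t₀))
    (hv : IsMild φhat T t₀ (fun t => 𝓕 (V t))
      (fun t => mulOp (fun ξ => (japSq ξ)⁻¹) (𝓕 (V t) : L2 n)) Λ)
    {I : Set ℝ} (hI : MeasurableSet I) (hIt : Ioo T t₀ ⊆ I) {θ : ℝ × Rn n → ℝ}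
    (h : ContDiff ℝ ∞ θ) (hc : HasCompactSupport θ) (hs : tsupport θ ⊆ Ioo T t₀ ×ˢ univ) :
    ∫ t in I, weakIntegrand φ θ V t = 0 := by
  have hK : IsCompact (Prod.fst '' tsupport θ) := hc.isCompact.image continuous_fst
  obtain ⟨t₁, h1, t₂, h2, h12, hsub⟩ := hK.exists_subset_Ioo ht₀ (by
    rintro _ ⟨p, hp, rfl⟩; exact (hs hp).1)
  have hIcc : Icc t₁ t₂ ⊆ Ioo T t₀ := ordConnected_Ioo.out h1 h2
  rw [setIntegral_eq_intervalIntegral hI h12.le (hIcc.trans hIt) fun t ht =>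
    weakIntegrand_eq_zero φ h V fun hh => ht (hsub hh)]
  set B := mulOp fun ξ : Rn n => (japSq ξ)⁻¹ with hB
  set R : ℝ → L2 n := fun t => smoothedRhs φhat t (𝓕 (V t) : L2 n) with hR
  have hRc : ContinuousOn R (Ioo T t₀) := S.continuousOn_smoothedRhs (fun t ht => ht.1) hcv
  have hE : ∀ t ∈ Ioo T t₀, HasDerivAt (fun t => B (𝓕 (V t) : L2 n)) (R t) t := by
    intro t ht
    have hi := hv.intervalIntegrable' S le_rfl t₁ h1 t ht
    have hd := (intervalIntegral.integral_hasDerivAt_right hi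
      (hRc.stronglyMeasurableAtFilter isOpen_Ioo t ht) (hRc.continuousAt (isOpen_Ioo.mem_nhds ht))).const_add
      (B (𝓕 (V t₁) : L2 n))
    refine hd.congr_of_eventuallyEq ?_
    filter_upwards [isOpen_Ioo.mem_nhds ht] with s hs
    rw [← hv.integ t₁ h1 s hs, add_sub_cancel]
  have hjd : ∀ t, HasDerivAt (fun s => jTest fun x => θ (s, x)) _ t := hasDerivAt_jTest h hc
  have hjd' : ∀ t, HasDerivAt (fun s => jTest fun x => dirDeriv (1, 0) θ (s, x)) _ t :=
    hasDerivAt_jTest (h.dirDeriv _) (hc.dirDeriv _)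
  have hF : ∀ t ∈ uIcc t₁ t₂, HasDerivAt
      (fun t => inner ℂ (jTest fun x => θ (t, x)) (B (𝓕 (V t) : L2 n))) (weakIntegrand φ θ V t) t := by
    intro t ht
    rw [uIcc_of_le h12.le] at ht
    rw [S.weakIntegrand_eq (hIcc ht).1 h hc]
    exact (hjd t).inner ℂ (hE t (hIcc ht))
  have hint : IntervalIntegrable (weakIntegrand φ θ V) volume t₁ t₂ := by
    refine ContinuousOn.intervalIntegrable (ContinuousOn.congr (f := fun t => _) ?_ fun t ht =>
      S.weakIntegrand_eq (hIcc (by rwa [uIcc_of_le h12.le] at ht)).1 h hc V)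
    rw [uIcc_of_le h12.le]
    intro t ht
    exact ((hjd t).continuousAt.continuousWithinAt.inner ((hRc.mono hIcc) t ht)).add
      ((hjd' t).continuousAt.continuousWithinAt.inner
        (hE t (hIcc ht)).continuousAt.continuousWithinAt)
  rw [intervalIntegral.integral_eq_sub_of_hasDerivAt hF hint]
  have h0 : ∀ t ∉ Ioo t₁ t₂, jTest (fun x => θ (t, x)) = 0 := by
    intro t ht
    have : (fun x => θ (t, x)) = fun x => 0 * θ (t, x) := funext fun x => by
      rw [image_eq_zero_of_notMem_tsupport fun hh => ht (hsub ⟨_, hh, rfl⟩), mul_zero]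
    rw [this, jTest_const_mul (h.slice t) (hc.slice t), zero_smul]
  rw [h0 t₁ (by simp), h0 t₂ (by simp), inner_zero_left, inner_zero_left, sub_zero]

theorem isTransportSolution_Icc (S : Phase) {t₀ Λ : ℝ}
    (ht₀ : T < t₀) {V : ℝ → L2 n} (hcv : ContinuousOn (fun t => (𝓕 (V t) : L2 n)) (Icc T t₀))
    (hv : IsMild φhat T t₀ (fun t => 𝓕 (V t))
      (fun t => mulOp (fun ξ => (japSq ξ)⁻¹) (𝓕 (V t) : L2 n)) Λ) :
    IsTransportSolution φ (Icc T t₀) V := by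
  intro θ h hc hs
  rw [interior_Icc] at hs
  exact S.setIntegral_weakIntegrand ht₀ (hcv.mono Ioo_subset_Icc_self) hv measurableSet_Icc
    Ioo_subset_Icc_self h hc hs

theorem isTransportSolution_Ici (S : Phase)
    {V : ℝ → L2 n} (hcv : ContinuousOn (fun t => (𝓕 (V t) : L2 n)) (Ici T))
    (hv : ∀ t₀, T < t₀ → ∃ Λ, IsMild φhat T t₀ (fun t => 𝓕 (V t))
      (fun t => mulOp (fun ξ => (japSq ξ)⁻¹) (𝓕 (V t) : L2 n)) Λ) :
    IsTransportSolution φ (Ici T) V := by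
  intro θ h hc hs
  rw [interior_Ici] at hs
  obtain ⟨M, hM⟩ := (hc.isCompact.image continuous_fst).bddAbove
  have ht₀ : T < max T M + 1 := (le_max_left T M).trans_lt (lt_add_one _)
  obtain ⟨Λ, hΛ⟩ := hv _ ht₀
  exact S.setIntegral_weakIntegrand ht₀ (hcv.mono fun t ht => ht.1.le) hΛ measurableSet_Ici
    (fun t ht => ht.1.le) h hc fun p hp => ⟨⟨(hs hp).1,
      ((hM ⟨p, hp, rfl⟩).trans (le_max_right T M)).trans_lt (lt_add_one _)⟩, mem_univ _⟩

/-- The weak formulation tested with products. -/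
theorem setIntegral_product_test (S : Phase) {t₀ : ℝ}
    {I : Set ℝ} (hI : MeasurableSet I) (hIt : Ioo T t₀ ⊆ I) {V : ℝ → L2 n}
    (hV : IsTransportSolution φ I V) {g : ℝ → ℝ} (hg : ContDiff ℝ ∞ g) (hgc : HasCompactSupport g)
    {t₁ t₂ : ℝ} (h1 : t₁ ∈ Ioo T t₀) (h2 : t₂ ∈ Ioo T t₀) (h12 : t₁ < t₂)
    (hgs : tsupport g ⊆ Ioo t₁ t₂)
    (hQ : IntervalIntegrable (fun t => deriv g t • mulOp (fun ξ => (japSq ξ)⁻¹) (𝓕 (V t) : L2 n) +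
      g t • smoothedRhs φhat t (𝓕 (V t) : L2 n)) volume t₁ t₂) :
    ∫ t in t₁..t₂, (deriv g t • mulOp (fun ξ => (japSq ξ)⁻¹) (𝓕 (V t) : L2 n) +
      g t • smoothedRhs φhat t (𝓕 (V t) : L2 n)) = 0 := by
  have hIcc : Icc t₁ t₂ ⊆ Ioo T t₀ := ordConnected_Ioo.out h1 h2
  refine eq_zero_of_inner_jTest_eq_zero fun ψ hψ hψc => ?_
  set θ : ℝ × Rn n → ℝ := fun p => g p.1 * ψ p.2 with hθ
  have hθs : ContDiff ℝ ∞ θ := (hg.comp contDiff_fst).mul (hψ.comp contDiff_snd)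
  have hθc : HasCompactSupport θ := by
    refine HasCompactSupport.intro (hgc.isCompact.prod hψc.isCompact) fun p hp => ?_
    by_cases h : p.1 ∈ tsupport g
    · rw [hθ]
      simp only
      rw [image_eq_zero_of_notMem_tsupport fun h3 => hp ⟨h, h3⟩, mul_zero]
    · rw [hθ]
      simp only
      rw [image_eq_zero_of_notMem_tsupport h, zero_mul]
  have hθt : tsupport θ ⊆ tsupport g ×ˢ univ := by
    refine closure_minimal (fun p hp => ⟨subset_tsupport g fun h => hp ?_, mem_univ _⟩)
      ((isClosed_tsupport g).prod isClosed_univ)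
    rw [hθ]
    simp only
    rw [h, zero_mul]
  have hw := hV θ hθs hθc fun p hp => ⟨interior_maximal hIt isOpen_Ioo
    (hIcc (Ioo_subset_Icc_self (hgs (hθt hp).1))), mem_univ _⟩
  change ∫ t in I, weakIntegrand φ θ V t = 0 at hw
  rw [setIntegral_eq_intervalIntegral hI h12.le (hIcc.trans hIt) fun t ht =>
    weakIntegrand_eq_zero φ hθs V fun hh => ht (by
      obtain ⟨p, hp, rfl⟩ := hh; exact hgs (hθt hp).1)] at hw
  rw [← hw, intervalIntegral.integral_of_le h12.le, intervalIntegral.integral_of_le h12.le,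
    ← integral_inner ((intervalIntegrable_iff_integrableOn_Ioc_of_le h12.le).1 hQ)]
  refine setIntegral_congr_fun measurableSet_Ioc fun t ht => ?_
  have htT : T < t := h1.1.trans ht.1
  have e : ∀ x, dirDeriv (1, 0) θ (t, x) = deriv g t * ψ x := fun x =>
    (hasDerivAt_slice (hθs.differentiable (by simp)) t x).unique
      ((hg.differentiable (by simp) t).hasDerivAt.mul_const (ψ x))
  simp only [S.weakIntegrand_eq htT hθs hθc, e]
  rw [jTest_const_mul hψ hψc, hθ]
  simp only
  rw [jTest_const_mul hψ hψc]
  simp only [← L2.ofReal_smul, inner_smul_left, inner_add_right, inner_smul_right,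
    Complex.conj_ofReal]
  ring

/-- Bounded weak solutions are mild solutions. -/
theorem exists_isMild (S : Phase) {t₀ Λ : ℝ}
    (ht₀ : T < t₀) {I : Set ℝ} (hI : MeasurableSet I) (hIt : Ioo T t₀ ⊆ I) {V : ℝ → L2 n}
    (hV : IsTransportSolution φ I V)
    (hm : AEStronglyMeasurable (fun t => (𝓕 (V t) : L2 n)) (volume.restrict (Ioo T t₀)))
    (hb : ∀ᵐ t ∂(volume.restrict (Ioo T t₀)), ‖(𝓕 (V t) : L2 n)‖ ≤ Λ) :
    ∃ E, IsMild φhat T t₀ (fun t => 𝓕 (V t)) E Λ := by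
  set B := mulOp fun ξ : Rn n => (japSq ξ)⁻¹ with hB
  set v : ℝ → L2 n := fun t => 𝓕 (V t) with hv
  set R : ℝ → L2 n := fun t => smoothedRhs φhat t (v t) with hR
  have hRm : AEStronglyMeasurable R (volume.restrict (Ioo T t₀)) :=
    S.aestronglyMeasurable_smoothedRhs measurableSet_Ioo (fun t ht => ht.1) hm
  have hRb : ∀ t₁ ∈ Ioo T t₀, ∀ t₂ ∈ Ioo T t₀, ∃ K, ∀ᵐ t, t ∈ Icc t₁ t₂ → ‖R t‖ ≤ K := by
    intro t₁ h1 t₂ h2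
    obtain ⟨K, hK0, hK⟩ := S.exists_norm_smoothedRhs_le (t₂ := t₂) h1.1
    refine ⟨K * Λ, ?_⟩
    filter_upwards [(ae_restrict_iff' measurableSet_Ioo).1 hb] with t h3 h4
    exact (hK t h4 _).trans (mul_le_mul_of_nonneg_left (h3 (ordConnected_Ioo.out h1 h2 h4)) hK0)
  have hint : ∀ {X : ℝ → L2 n} {K : ℝ} {t₁ t₂ : ℝ}, t₁ ∈ Ioo T t₀ → t₂ ∈ Ioo T t₀ →
      AEStronglyMeasurable X (volume.restrict (Ioo T t₀)) →
      (∀ᵐ t, t ∈ Icc t₁ t₂ → ‖X t‖ ≤ K) → IntegrableOn X (Icc t₁ t₂) := by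
    intro X K t₁ t₂ h1 h2 hXm hX
    exact Integrable.of_bound (hXm.mono_measure (Measure.restrict_mono
      (ordConnected_Ioo.out h1 h2) le_rfl)) K ((ae_restrict_iff' measurableSet_Icc).2 hX)
  have hRi : ∀ t₁ ∈ Ioo T t₀, ∀ t₂ ∈ Ioo T t₀, IntervalIntegrable R volume t₁ t₂ := by
    have key : ∀ t₁ ∈ Ioo T t₀, ∀ t₂ ∈ Ioo T t₀, t₁ ≤ t₂ → IntervalIntegrable R volume t₁ t₂ := by
      intro t₁ h1 t₂ h2 h12
      obtain ⟨K, hK⟩ := hRb t₁ h1 t₂ h2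
      rw [intervalIntegrable_iff_integrableOn_Icc_of_le h12]
      exact hint h1 h2 hRm hK
    intro t₁ h1 t₂ h2
    rcases le_total t₁ t₂ with h | h
    exacts [key t₁ h1 t₂ h2 h, (key t₂ h2 t₁ h1 h).symm]
  have hBi : ∀ t₁ ∈ Ioo T t₀, ∀ t₂ ∈ Ioo T t₀, IntegrableOn (fun t => B (v t)) (Icc t₁ t₂) := by
    intro t₁ h1 t₂ h2
    refine hint (K := ‖B‖ * Λ) h1 h2 (B.continuous.comp_aestronglyMeasurable hm) ?_
    filter_upwards [(ae_restrict_iff' measurableSet_Ioo).1 hb] with t h3 h4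
    exact B.le_opNorm_of_le (h3 (ordConnected_Ioo.out h1 h2 h4))
  obtain ⟨m, hm0⟩ := exists_between ht₀
  set P : ℝ → L2 n := fun t => ∫ s in m..t, R s with hP
  have hPd : ∀ t₁ ∈ Ioo T t₀, ∀ t₂ ∈ Ioo T t₀, P t₂ - P t₁ = ∫ s in t₁..t₂, R s :=
    fun t₁ h1 t₂ h2 =>
      intervalIntegral.integral_interval_sub_left (hRi m hm0 t₂ h2) (hRi m hm0 t₁ h1)
  have hPi : ∀ t₁ ∈ Ioo T t₀, ∀ t₂ ∈ Ioo T t₀, t₁ ≤ t₂ → IntegrableOn P (Icc t₁ t₂) := by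
    intro t₁ h1 t₂ h2 h12
    obtain ⟨K, hK⟩ := hRb t₁ h1 t₂ h2
    have hc := (lipschitzOnWith_primitive h12 (hRi t₁ h1 t₂ h2) hK).continuousOn
    rw [uIcc_of_le h12] at hc
    refine ((hc.const_add (P t₁)).congr fun t ht => ?_).integrableOn_Icc
    rw [← hPd t₁ h1 t (ordConnected_Ioo.out h1 h2 ht), add_sub_cancel]
  obtain ⟨c, hc⟩ := exists_ae_eq_const (F := fun t => B (v t) - P t) ht₀ (by
    rw [locallyIntegrableOn_iff isOpen_Ioo.isLocallyClosed]
    intro K hK hKc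
    obtain ⟨t₁, h1, t₂, h2, h12, hsub⟩ := hKc.exists_subset_Ioo ht₀ hK
    exact ((hBi t₁ h1 t₂ h2).sub (hPi t₁ h1 t₂ h2 h12.le)).mono_set (hsub.trans Ioo_subset_Icc_self))
    (by
    intro g hg hgc hgs
    obtain ⟨t₁, h1, t₂, h2, h12, hsub⟩ := hgc.isCompact.exists_subset_Ioo ht₀ hgs
    have hg0 : ∀ t ∉ Ioo t₁ t₂, g t = 0 := fun t ht =>
      image_eq_zero_of_notMem_tsupport fun hh => ht (hsub hh)
    have hdg0 : ∀ t ∉ Ioo t₁ t₂, deriv g t = 0 := fun t ht =>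
      image_eq_zero_of_notMem_tsupport fun hh => ht (hsub (tsupport_deriv_subset hh))
    obtain ⟨K, hK⟩ := hRb t₁ h1 t₂ h2
    have hg1 : ContDiff ℝ 1 g := contDiff_infty.1 hg 1
    obtain ⟨hpi, hp⟩ := integral_deriv_smul_add_smul hg1 (P := P) h12.le (hRi t₁ h1 t₂ h2) hK
      fun t ht => by rw [← hPd t₁ h1 t (ordConnected_Ioo.out h1 h2 ht), add_sub_cancel]
    have hq : IntervalIntegrable (fun t => deriv g t • B (v t) + g t • R t) volume t₁ t₂ :=
      (((intervalIntegrable_iff_integrableOn_Icc_of_le h12.le).2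
        (hBi t₁ h1 t₂ h2)).continuousOn_smul (hg1.continuous_deriv le_rfl).continuousOn).add
        ((hRi t₁ h1 t₂ h2).continuousOn_smul hg.continuous.continuousOn)
    have hq0 := S.setIntegral_product_test hI hIt hV hg hgc h1 h2 h12 hsub hq
    rw [hg0 t₁ (by simp), hg0 t₂ (by simp), zero_smul, zero_smul, sub_zero] at hp
    rw [← setIntegral_univ, setIntegral_eq_intervalIntegral MeasurableSet.univ h12.le
      (subset_univ _) fun t ht => by rw [hdg0 t ht, zero_smul]]
    have h3 := intervalIntegral.integral_sub hq hpi
    rw [hq0, hp, sub_zero] at h3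
    rw [← h3]
    refine intervalIntegral.integral_congr fun t _ => ?_
    simp only [smul_sub]
    abel)
  refine ⟨fun t => P t + c, hm, hb, ?_, fun t₁ h1 t₂ h2 => ?_⟩
  · refine (ae_restrict_iff' measurableSet_Ioo).2 (hc.mono fun t h1 h2 => ?_)
    rw [← h1 h2, add_sub_cancel]
  · rw [add_sub_add_right_eq_sub]
    exact hPd t₁ h1 t₂ h2

/-- For a continuous solution the continuous representative is the pointwise one. -/
theorem _root_.IsMild.of_continuousOn (S : Phase) {t₀ Λ : ℝ}
    {v E : ℝ → L2 n} (hv : IsMild φhat T t₀ v E Λ) (hc : ContinuousOn v (Ioo T t₀)) :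
    IsMild φhat T t₀ v (fun t => mulOp (fun ξ => (japSq ξ)⁻¹) (v t)) Λ := by
  have hE : ContinuousOn E (Ioo T t₀) := by
    intro t ht
    obtain ⟨s₁, h1⟩ := exists_between ht.1
    obtain ⟨s₂, h2⟩ := exists_between ht.2
    obtain ⟨-, K, hK0, hK⟩ := hv.intervalIntegrable S le_rfl (t₁ := s₁) (t₂ := s₂)
      ⟨h1.1, h1.2.trans ht.2⟩ ⟨ht.1.trans h2.1, h2.2⟩ (h1.2.trans h2.1).le
    have : ContinuousOn E (Icc s₁ s₂) :=
      (LipschitzOnWith.of_dist_le' (K := K) fun x hx y hy => by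
        rw [dist_eq_norm, Real.dist_eq]; exact hK y hy x hx).continuousOn
    exact (this.continuousAt (Icc_mem_nhds h1.2 h2.1)).continuousWithinAt
  have h := Measure.eqOn_open_of_ae_eq hv.eqv isOpen_Ioo
    ((mulOp fun ξ : Rn n => (japSq ξ)⁻¹).continuous.comp_continuousOn hc) hE
  refine ⟨hv.meas, hv.bdd, Eventually.of_forall fun _ => rfl, fun t₁ h1 t₂ h2 => ?_⟩
  rw [← hv.integ t₁ h1 t₂ h2, ← h h1, ← h h2]

/-- Weak solutions that are continuous up to the end points are mild solutions. -/
theorem exists_isMild_of_continuousOn (S : Phase) {t₀ : ℝ}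
    (ht₀ : T < t₀) {I : Set ℝ} (hI : MeasurableSet I) (hIt : Icc T t₀ ⊆ I) {V : ℝ → L2 n}
    (hV : IsTransportSolution φ I V) (hc : ContinuousOn (fun t => (𝓕 (V t) : L2 n)) I) :
    ∃ Λ, IsMild φhat T t₀ (fun t => 𝓕 (V t))
      (fun t => mulOp (fun ξ => (japSq ξ)⁻¹) (𝓕 (V t) : L2 n)) Λ := by
  have hc' := hc.mono hIt
  obtain ⟨Λ, hΛ⟩ := isCompact_Icc.exists_bound_of_continuousOn hc'
  have hs := Ioo_subset_Icc_self (a := T) (b := t₀)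
  obtain ⟨E, hE⟩ := S.exists_isMild ht₀ hI (hs.trans hIt) hV
    ((hc'.mono hs).aestronglyMeasurable measurableSet_Ioo)
    ((ae_restrict_iff' measurableSet_Ioo).2 (Eventually.of_forall fun t ht => hΛ t (hs ht)))
  exact ⟨Λ, hE.of_continuousOn S (hc'.mono hs)⟩

end PhaseSetup

/-! ### Norms of functions of time -/

theorem fourier_L2_sub (v w : L2 n) : (𝓕 (v - w) : L2 n) = 𝓕 v - 𝓕 w :=
  map_sub (Lp.fourierTransformₗᵢ (Rn n) ℂ) v w

theorem enorm_le_kN {ν ρ κ : ℝ} (hρ : 0 ≤ ρ) (hκ : 0 ≤ κ) (v : L2 n) : ‖v‖ₑ ≤ kN ν ρ κ v := by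
  rw [enorm_eq_n2]
  refine n2_mono (Eventually.of_forall fun ξ => ?_)
  have h1 := Real.one_le_rpow (one_le_jap ξ) hκ
  have h2 := Real.one_le_exp (mul_nonneg hρ (Real.rpow_nonneg (jap_pos ξ).le ν))
  refine le_mul_of_one_le_left' ?_
  rw [← ENNReal.ofReal_one]
  exact ENNReal.ofReal_le_ofReal (one_le_mul_of_one_le_of_one_le h1 h2)

theorem kN_sub_le (ν ρ κ : ℝ) (v w : L2 n) :
    kN ν ρ κ (v - w : L2 n) ≤ kN ν ρ κ v + kN ν ρ κ w := by
  have hm : ∀ v : L2 n, AEStronglyMeasurable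
      (fun ξ => ((jap ξ ^ κ * exp (ρ * jap ξ ^ ν) : ℝ) : ℂ) * v ξ) volume := fun v => by
    have := measurable_jap (n := n)
    exact (Complex.measurable_ofReal.comp (by fun_prop)).aestronglyMeasurable.mul
      (Lp.aestronglyMeasurable v)
  rw [← eLpNorm_weight_mul, ← eLpNorm_weight_mul, ← eLpNorm_weight_mul]
  refine le_trans (le_of_eq (eLpNorm_congr_ae ?_)) (eLpNorm_sub_le (hm v) (hm w) (by norm_num))
  filter_upwards [Lp.coeFn_sub v w] with ξ hξ
  rw [hξ, Pi.sub_apply, Pi.sub_apply, mul_sub]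

theorem exists_kN_sq_interpolation {k' kBar : ℝ} (h : k' < kBar) (k : ℝ) {ε : ℝ≥0∞} (hε : 0 < ε) :
    ∃ A : ℝ≥0, ∀ (ν ρ κ : ℝ) (v : Rn n → ℂ), Measurable v → kN ν ρ (k' + κ) v ^ 2 ≤
      A * kN ν ρ (k + κ) v ^ 2 + ε * kN ν ρ (kBar + κ) v ^ 2 := by
  have hlim : Tendsto (fun R : ℝ => ofReal (R ^ (-(2 * (kBar - k'))))) atTop (𝓝 0) := by
    rw [← ENNReal.ofReal_zero]
    exact (ENNReal.continuous_ofReal.tendsto _).comp (tendsto_rpow_neg_atTop (by linarith))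
  obtain ⟨R, hR1, hR⟩ := ((eventually_ge_atTop 1).and (hlim.eventually (gt_mem_nhds hε))).exists
  refine ⟨(R ^ (2 * max (k' - k) 0)).toNNReal, fun ν ρ κ v hv => ?_⟩
  have hm : ∀ p, Measurable fun ξ => ofReal (sqW ν ρ p ξ) * ‖v ξ‖ₑ ^ 2 := fun p =>
    (ENNReal.measurable_ofReal.comp (measurable_sqW ν ρ p)).mul (hv.enorm.pow_const 2)
  rw [kN_sq, kN_sq, kN_sq, ← lintegral_const_mul _ (hm _), ← lintegral_const_mul _ (hm _),
    ← lintegral_add_left ((hm _).const_mul _)]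
  refine lintegral_mono fun ξ => ?_
  simp only
  rw [← mul_assoc, ← mul_assoc, ← add_mul]
  gcongr
  have hj := jap_pos ξ
  have hR0 : 0 < R := by linarith
  rcases le_total (jap ξ) R with h1 | h1
  · refine le_trans ?_ le_self_add
    change _ ≤ ofReal _ * _
    rw [← ENNReal.ofReal_mul (Real.rpow_nonneg hR0.le _)]
    refine ENNReal.ofReal_le_ofReal ?_
    rw [sqW, sqW, ← mul_assoc]
    gcongr
    rw [show 2 * (k' + κ) = 2 * (k' - k) + 2 * (k + κ) by ring, Real.rpow_add hj]
    gcongr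
    exact (Real.rpow_le_rpow_of_exponent_le (one_le_jap ξ)
      (mul_le_mul_of_nonneg_left (le_max_left _ _) two_pos.le)).trans
      (Real.rpow_le_rpow hj.le h1 (mul_nonneg two_pos.le (le_max_right _ _)))
  · refine le_trans ?_ le_add_self
    refine le_trans ?_ (mul_le_mul_left hR.le _)
    rw [← ENNReal.ofReal_mul (Real.rpow_nonneg hR0.le _)]
    refine ENNReal.ofReal_le_ofReal ?_
    rw [sqW, sqW, ← mul_assoc]
    gcongr
    rw [show 2 * (k' + κ) = -(2 * (kBar - k')) + 2 * (kBar + κ) by ring, Real.rpow_add hj]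
    exact mul_le_mul_of_nonneg_right (Real.rpow_le_rpow_of_nonpos hR0 h1 (by linarith))
      (Real.rpow_nonneg hj.le _)

theorem yMax_le {ν κ : ℝ} (hν : 0 < ν) {r ρ H : ℝ → ℝ} {V : ℝ → L2 n} {I : Set ℝ} {M : ℝ≥0∞}
    (h1 : ∀ t ∈ I, (ofReal (H t))⁻¹ * kN ν (ρ t) κ (𝓕 (V t) : L2 n) ≤ M)
    (h2 : ∫⁻ t, ((ofReal (H t))⁻¹ * kN ν (ρ t) (κ + ν / 2) (𝓕 (V t) : L2 n)) ^ 2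
      ∂(rateMeasure r I) ≤ M ^ 2) : yMax ν r ρ V I H κ ≤ M := by
  refine max_le (iSup₂_le fun t ht => ?_) ?_
  · rw [kNorm_eq_kN hν]; exact h1 t ht
  · simp_rw [yInt, kNorm_eq_kN hν]
    refine (ENNReal.rpow_le_rpow h2 (by norm_num)).trans (le_of_eq ?_)
    rw [← ENNReal.rpow_natCast, ← ENNReal.rpow_mul]
    norm_num

theorem kN_le_of_yMax_le {ν κ : ℝ} (hν : 0 < ν) {r ρ H : ℝ → ℝ} {V : ℝ → L2 n} {I : Set ℝ}
    {M : ℝ≥0∞} (h : yMax ν r ρ V I H κ ≤ M) {t : ℝ} (ht : t ∈ I) (hH : 0 < H t) :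
    kN ν (ρ t) κ (𝓕 (V t) : L2 n) ≤ M * ofReal (H t) := by
  rw [← ENNReal.div_le_iff (by simpa using hH) ENNReal.ofReal_ne_top, div_eq_mul_inv, mul_comm,
    ← kNorm_eq_kN hν]
  exact (le_iSup₂_of_le t ht le_rfl).trans ((le_max_left _ _).trans h)

theorem lintegral_rateMeasure_Ici_le (r : ℝ → ℝ) {T : ℝ} {f : ℝ → ℝ≥0∞} {M : ℝ≥0∞}
    (h : ∀ t₀, T < t₀ → ∫⁻ t, f t ∂(rateMeasure r (Icc T t₀)) ≤ M) :
    ∫⁻ t, f t ∂(rateMeasure r (Ici T)) ≤ M := by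
  have e : Ici T = ⋃ j : ℕ, Icc T (T + 1 + j) := by
    ext t
    simp only [mem_Ici, mem_iUnion, mem_Icc, exists_and_left, iff_self_and]
    intro _
    obtain ⟨j, hj⟩ := exists_nat_ge (t - T - 1)
    exact ⟨j, by linarith⟩
  simp_rw [rateMeasure, ← restrict_withDensity measurableSet_Icc] at h
  rw [rateMeasure, ← restrict_withDensity measurableSet_Ici, e, setLIntegral_iUnion_of_directed]
  · exact iSup_le fun j => h _ (by have : (0 : ℝ) ≤ j := j.cast_nonneg; linarith)
  · refine Monotone.directed_le fun i j hij => Icc_subset_Icc_right ?_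
    have : (i : ℝ) ≤ j := by exact_mod_cast hij
    linarith

theorem tendsto_of_kN_le {ν k T : ℝ} (hk : 0 ≤ k) {ρ h₁ : ℝ → ℝ} (hρ : ∀ t, T ≤ t → 0 ≤ ρ t)
    (hh : Tendsto h₁ atTop (𝓝 0)) {v : ℝ → L2 n} {z : L2 n} {M : ℝ≥0∞} (hM : M ≠ ⊤)
    (h : ∀ t, T ≤ t → kN ν (ρ t) k (v t - z : L2 n) ≤ M * ofReal (h₁ t)) :
    Tendsto v atTop (𝓝 z) := by
  have h1 : Tendsto (fun t => M * ofReal (h₁ t)) atTop (𝓝 0) := by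
    have h2 := ENNReal.Tendsto.const_mul ((ENNReal.continuous_ofReal.tendsto _).comp hh)
      (Or.inr hM)
    rwa [ENNReal.ofReal_zero, mul_zero] at h2
  rw [tendsto_iff_edist_tendsto_0]
  refine tendsto_of_tendsto_of_tendsto_of_le_of_le' tendsto_const_nhds h1
    (Eventually.of_forall fun _ => zero_le) ?_
  filter_upwards [eventually_ge_atTop T] with t ht
  rw [edist_eq_enorm_sub]
  exact (enorm_le_kN (hρ t ht) hk _).trans (h t ht)

/-! ### Weak convergence -/

/-- Low frequencies of the pairing are controlled by the `L²` norm. -/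
theorem enorm_pairing_le {ν : ℝ} (hν : 0 < ν) {ρ κ N K : ℝ}
    (hK : ∀ ξ : Rn n, jap ξ ≤ N → jap ξ ^ κ * exp (ρ * jap ξ ^ ν) ≤ K) (g : L2 n) (d : L2 n) :
    ‖∫ ξ, starRingEnd ℂ (g ξ) * ((gevreyWeight ν ρ κ 0 ξ : ℂ) * d ξ)‖ₑ ≤
      ‖g - mulOp (lowCut N) g‖ₑ * kN ν ρ κ d + ofReal K * ‖d‖ₑ * ‖g‖ₑ := by
  set w : Rn n → ℝ := fun ξ => jap ξ ^ κ * exp (ρ * jap ξ ^ ν) with hw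
  have hj := measurable_jap (n := n)
  have hwm : Measurable w := by fun_prop
  have hgm : ∀ g : L2 n, AEMeasurable fun ξ => ‖g ξ‖ₑ := fun g =>
    (Lp.aestronglyMeasurable g).enorm
  refine (enorm_integral_le_lintegral_enorm _).trans ?_
  have h1 : ∀ᵐ ξ, ‖starRingEnd ℂ (g ξ) * ((gevreyWeight ν ρ κ 0 ξ : ℂ) * d ξ)‖ₑ ≤
      ‖(g - mulOp (lowCut N) g : L2 n) ξ‖ₑ * (ofReal (w ξ) * ‖d ξ‖ₑ) +
        ofReal K * (‖d ξ‖ₑ * ‖g ξ‖ₑ) := by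
    filter_upwards [Lp.coeFn_sub g (mulOp (lowCut N) g), coeFn_mulOp (bddMeas_lowCut N) g]
      with ξ h2 h3
    rw [h2, Pi.sub_apply, h3, gevreyWeight_zero hν, enorm_mul, enorm_weight_mul, RCLike.enorm_conj]
    by_cases hN : jap ξ ≤ N
    · refine le_trans ?_ le_add_self
      rw [mul_left_comm, mul_comm ‖d ξ‖ₑ]
      gcongr
      exact hK ξ hN
    · refine le_trans (le_of_eq ?_) le_self_add
      simp [lowCut, hN, hw]
  refine (lintegral_mono_ae h1).trans ?_
  have hdg : AEMeasurable fun ξ => ‖d ξ‖ₑ * ‖g ξ‖ₑ := (hgm d).mul (hgm g)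
  rw [lintegral_add_right' _ (hdg.const_mul _), lintegral_const_mul'' _ hdg, enorm_eq_n2, enorm_eq_n2, enorm_eq_n2, mul_assoc]
  exact add_le_add (lintegral_mul_le_n2 (hgm _) ((ENNReal.measurable_ofReal.comp
    hwm).aemeasurable.mul (hgm d))) (by gcongr; exact lintegral_mul_le_n2 (hgm d) (hgm g))

theorem tendsto_integral_pairing {ν : ℝ} (hν : 0 < ν) {κ ρM p : ℝ} (hp : 0 < p) {ρ : ℝ → ℝ}
    {μ : Measure ℝ} (hρ : ∀ᵐ t ∂μ, ρ t ≤ ρM) {g : ℝ → L2 n} (hg : AEStronglyMeasurable g μ)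
    (hgp : ∫⁻ t, ‖g t‖ₑ ^ p ∂μ ≠ ⊤) (hg1 : ∫⁻ t, ‖g t‖ₑ ∂μ ≠ ⊤) {d : ℝ → ℝ → L2 n}
    {A : ℝ≥0∞} (hA : A ≠ ⊤)
    (hd : ∀ f : ℝ → ℝ≥0∞, AEMeasurable f μ → ∀ᶠ τ in atTop,
      ∫⁻ t, f t * kN ν (ρ t) κ (d τ t) ∂μ ≤ (∫⁻ t, f t ^ p ∂μ) ^ (1 / p) * A)
    {s : ℝ → ℝ≥0∞} (hs : Tendsto s atTop (𝓝 0)) (hds : ∀ᶠ τ in atTop, ∀ᵐ t ∂μ, ‖d τ t‖ₑ ≤ s τ) :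
    Tendsto (fun τ => ∫ t, (∫ ξ, starRingEnd ℂ (g t ξ) *
      ((gevreyWeight ν (ρ t) κ 0 ξ : ℂ) * d τ t ξ)) ∂μ) atTop (𝓝 0) := by
  set f : ℕ → ℝ → ℝ≥0∞ := fun N t => ‖g t - mulOp (lowCut N) (g t)‖ₑ with hf
  have hfm : ∀ N, AEMeasurable (f N) μ := fun N =>
    (hg.sub ((mulOp (lowCut N)).continuous.comp_aestronglyMeasurable hg)).enorm
  have hfl : Tendsto (fun N => (∫⁻ t, f N t ^ p ∂μ) ^ (1 / p) * A) atTop (𝓝 0) := by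
    have h1 : Tendsto (fun N => ∫⁻ t, f N t ^ p ∂μ) atTop (𝓝 (∫⁻ _, 0 ∂μ)) := by
      refine tendsto_lintegral_of_dominated_convergence' (fun t => ‖g t‖ₑ ^ p)
        (fun N => (hfm N).pow_const p) (fun N => Eventually.of_forall fun t => ?_) hgp
        (Eventually.of_forall fun t => ?_)
      · refine ENNReal.rpow_le_rpow ?_ hp.le
        rw [hf]
        simp only
        rw [← ofReal_norm, ← ofReal_norm]
        refine ENNReal.ofReal_le_ofReal (abs_le_of_sq_le_sq' ?_ (norm_nonneg _)).2
        rw [norm_sub_mulOp_lowCut_sq]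
        exact sub_le_self _ (sq_nonneg _)
      · have h2 := (tendsto_const_nhds (x := g t)).sub
          ((tendsto_mulOp_lowCut (g t)).comp tendsto_natCast_atTop_atTop)
        rw [sub_self] at h2
        have h3 := (ENNReal.continuous_rpow_const (y := p)).tendsto _ |>.comp h2.enorm
        rwa [enorm_zero, ENNReal.zero_rpow_of_pos hp] at h3
    rw [lintegral_zero] at h1
    have h2 := ENNReal.Tendsto.mul_const (((ENNReal.continuous_rpow_const
      (y := 1 / p)).tendsto _).comp h1) (Or.inr hA)
    rwa [ENNReal.zero_rpow_of_pos (by positivity), zero_mul] at h2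
  rw [tendsto_iff_edist_tendsto_0]
  simp_rw [edist_zero_right]
  refine ENNReal.tendsto_nhds_zero.2 fun ε hε => ?_
  obtain ⟨N, hN⟩ := (hfl.eventually (ge_mem_nhds (ENNReal.half_pos hε.ne'))).exists
  set K := (max (N : ℝ) 1) ^ |κ| * exp (|ρM| * (max (N : ℝ) 1) ^ ν) with hK
  have hKb : ∀ t, ρ t ≤ ρM → ∀ ξ : Rn n, jap ξ ≤ N →
      jap ξ ^ κ * exp (ρ t * jap ξ ^ ν) ≤ K := by
    intro t ht ξ hξ
    have h1 := jap_pos ξ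
    have h2 : jap ξ ≤ max (N : ℝ) 1 := hξ.trans (le_max_left _ _)
    have h3 : jap ξ ^ κ ≤ jap ξ ^ |κ| :=
      Real.rpow_le_rpow_of_exponent_le (one_le_jap ξ) (le_abs_self κ)
    have h4 : ρ t ≤ |ρM| := ht.trans (le_abs_self ρM)
    have h5 : jap ξ ^ ν ≤ max (N : ℝ) 1 ^ ν := by gcongr
    have h6 : jap ξ ^ |κ| ≤ max (N : ℝ) 1 ^ |κ| := by gcongr
    exact mul_le_mul (h3.trans h6) (Real.exp_le_exp.2 (mul_le_mul h4 h5 (by positivity)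
      (abs_nonneg _))) (Real.exp_pos _).le (by positivity)
  have hs2 : Tendsto (fun τ => ofReal K * s τ * ∫⁻ t, ‖g t‖ₑ ∂μ) atTop (𝓝 0) := by
    have h2 := ENNReal.Tendsto.mul_const (ENNReal.Tendsto.const_mul hs
      (Or.inr (ENNReal.ofReal_ne_top (r := K)))) (Or.inr hg1)
    rwa [mul_zero, zero_mul] at h2
  filter_upwards [hd _ (hfm N), hds, hs2.eventually (ge_mem_nhds (ENNReal.half_pos hε.ne'))]
    with τ h1 h2 h3
  refine (enorm_integral_le_lintegral_enorm _).trans ?_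
  calc _ ≤ ∫⁻ t, (f N t * kN ν (ρ t) κ (d τ t) + ofReal K * s τ * ‖g t‖ₑ) ∂μ := by
        refine lintegral_mono_ae ?_
        filter_upwards [h2, hρ] with t h4 h5
        refine (enorm_pairing_le hν (hKb t h5) (g t) (d τ t)).trans ?_
        gcongr
    _ = (∫⁻ t, f N t * kN ν (ρ t) κ (d τ t) ∂μ) + ofReal K * s τ * ∫⁻ t, ‖g t‖ₑ ∂μ := by
        rw [lintegral_add_right' _ (hg.enorm.const_mul _), lintegral_const_mul'' _ hg.enorm]
    _ ≤ ε / 2 + ε / 2 := add_le_add (h1.trans hN) h3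
    _ = ε := ENNReal.add_halves ε

/-! ### The solution with prescribed limit at infinity -/

/-- The phase together with the estimates that control the evolution at the levels `kBar` and `k`. -/
structure EvolutionSetup (ν l lLow : ℝ) (r ρ : ℝ → ℝ) (T : ℝ) (h₀ h₁ : ℝ → ℝ)
    (φ : ℝ → Rn n → ℝ) (φhat : ℝ → Rn n → ℂ) (b : ℝ≥0) (kBar k : ℝ) (C : ℝ≥0) : Prop extends
    PhaseSetup ν l lLow r ρ T h₀ h₁ φ φhat b where
  high : ∃ C₁ : ℝ≥0, CommutatorBound n ν l lLow kBar C₁ ∧ C₁ * b * h₁ T ≤ 2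
  low : ∃ C₁ : ℝ≥0, CommutatorBound n ν l lLow k C₁ ∧ C₁ * b * h₁ T ≤ 2
  base : ∃ C₁ : ℝ≥0, TransportBound n ν l lLow 0 0 C₁
  drift : TransportBound n ν l lLow k (ν / 2) C
  hk : 0 ≤ k
  hkBar : 1 - ν / 2 ≤ kBar
  hkk : k + 1 - ν ≤ kBar
  h₁lim : Tendsto h₁ atTop (𝓝 0)

theorem IsLimitEvolution.congr {φhat : ℝ → Rn n → ℂ} {T t₀ : ℝ} {z : L2 n} {v v' : ℝ → L2 n}
    (h : IsLimitEvolution φhat T t₀ z v) (he : EqOn v' v (Icc T t₀)) :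
    IsLimitEvolution φhat T t₀ z v' := by
  obtain ⟨u, hu, hlim⟩ := h.approx
  exact ⟨h.continuousOn.congr he, u, hu, fun t ht => by rw [he ht]; exact hlim t ht⟩

theorem rateMeasure_Icc_mono (r : ℝ → ℝ) {T t₁ t₂ : ℝ} (h : t₁ ≤ t₂) :
    rateMeasure r (Icc T t₁) ≤ rateMeasure r (Icc T t₂) := by
  rw [rateMeasure, rateMeasure, ← restrict_withDensity measurableSet_Icc,
    ← restrict_withDensity measurableSet_Icc]
  exact Measure.restrict_mono (Icc_subset_Icc_right h) le_rfl

namespace EvolutionSetup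

variable {kBar k : ℝ} {C : ℝ≥0}

theorem exists_evolution (S : EvolutionSetup ν l lLow r ρ T h₀ h₁ φ φhat b kBar k C) {t₀ : ℝ}
    (ht₀ : T ≤ t₀) {z : L2 n} (hz : kN ν (ρ t₀) kBar z < ⊤) :
    ∃ v, IsLimitEvolution φhat T t₀ z v := by
  obtain ⟨C₁, h1, h2⟩ := S.high
  obtain ⟨C₀, h3⟩ := S.base
  exact S.exists_isLimitEvolution h1 h2 h3 S.hkBar ht₀ hz

/-- The solution on `[T, ∞)` with limit `z` at infinity. -/
theorem exists_global (S : EvolutionSetup ν l lLow r ρ T h₀ h₁ φ φhat b kBar k C) {z : L2 n}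
    {a : ℝ≥0∞} (ha : a ≠ ⊤) (hz : ∀ t, T ≤ t → kN ν (ρ t) kBar z ≤ a) :
    ∃ v : ℝ → L2 n, (∀ t₀, T < t₀ → IsLimitEvolution φhat T t₀ (v t₀) v) ∧
      (∀ t, T ≤ t → kN ν (ρ t) kBar (v t) ≤ a) ∧
      (∀ t, T ≤ t → kN ν (ρ t) k (v t - z : L2 n) ≤ C * b * a * ofReal (h₁ t)) ∧
      ∀ t₀, T < t₀ → ∫⁻ t, ofReal ((h₁ t ^ 2)⁻¹) *
        kN ν (ρ t) (k + ν / 2) (v t - z : L2 n) ^ 2 ∂(rateMeasure r (Icc T t₀)) ≤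
        (C * b * a) ^ 2 := by
  obtain ⟨C₁, hC₁, hsmall⟩ := S.high
  obtain ⟨C₀, hC₀⟩ := S.base
  set τ : ℕ → ℝ := fun j => T + 1 + j with hτ
  have hτT : ∀ j, T < τ j := fun j => by
    have : (0 : ℝ) ≤ j := j.cast_nonneg
    rw [hτ]; simp only; linarith
  have hτlim : Tendsto τ atTop atTop := tendsto_atTop_add_const_left _ _ tendsto_natCast_atTop_atTop
  have hzf : ∀ j, kN ν (ρ (τ j)) kBar z < ⊤ := fun j => (hz _ (hτT j).le).trans_lt ha.lt_top
  choose u hu using fun j => S.exists_evolution (hτT j).le (hzf j)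
  have hD : C * b * a ≠ ⊤ := ENNReal.mul_ne_top (by simp [ENNReal.mul_eq_top]) ha
  have hdr : ∀ j, ∀ t ∈ Icc T (τ j),
      kN ν (ρ t) k (u j t - z : L2 n) ≤ C * b * a * ofReal (h₁ t) := by
    intro j t ht
    have h1 := (hu j).drift_le S.toPhaseSetup hC₁ hsmall S.drift S.hkk ht
    rw [mul_comm, ← div_eq_mul_inv, ENNReal.div_le_iff (by simpa using S.h₁pos t ht.1)
      ENNReal.ofReal_ne_top] at h1
    refine h1.trans ?_
    gcongr
    exact hz _ (hτT j).le
  have hdiff : ∀ i j, i ≤ j → ∀ t ∈ Icc T (τ i), edist (u j t) (u i t) ≤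
      C * b * a * ofReal (h₁ (τ i)) := by
    intro i j hij t ht
    have hij' : τ i ≤ τ j := by
      have : (i : ℝ) ≤ j := by exact_mod_cast hij
      rw [hτ]; simp only; linarith
    have h1 := (((hu j).restart S.toPhaseSetup hC₁ hsmall hC₀ S.hkBar (hzf j) (hτT i) hij').sub
      (hu i)).norm_eq S.toPhaseSetup ht
    rw [edist_eq_enorm_sub, ← ofReal_norm, ← Pi.sub_apply, h1, ofReal_norm]
    exact (enorm_le_kN (S.ρ_nonneg _ (hτT i).le) S.hk _).trans (hdr j _ ⟨(hτT i).le, hij'⟩)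
  have hconv : ∀ t, T ≤ t → ∃ x, Tendsto (fun j => u j t) atTop (𝓝 x) := by
    intro t ht
    refine cauchySeq_tendsto_of_complete (EMetric.cauchySeq_iff'.2 fun ε hε => ?_)
    have h1 := ENNReal.Tendsto.const_mul ((ENNReal.continuous_ofReal.tendsto _).comp
      (S.h₁lim.comp hτlim)) (Or.inr hD)
    rw [ENNReal.ofReal_zero, mul_zero] at h1
    obtain ⟨i, hi, hti⟩ := ((h1.eventually (gt_mem_nhds hε)).and
      (hτlim.eventually_ge_atTop t)).exists
    exact ⟨i, fun j hj => (hdiff i j hj t ⟨ht, hti⟩).trans_lt hi⟩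
  choose! v hv using hconv
  have hbd : ∀ t, T ≤ t → kN ν (ρ t) kBar (v t) ≤ a := by
    intro t ht
    refine kN_le_of_tendsto ν kBar tendsto_const_nhds (hv t ht) ?_
    filter_upwards [hτlim.eventually_ge_atTop t] with j hj
    exact ((hu j).kN_le S.toPhaseSetup hC₁ hsmall ⟨ht, hj⟩).trans (hz _ (hτT j).le)
  refine ⟨v, fun t₀ ht₀ => ?_, hbd, fun t ht => ?_, fun t₀ ht₀ => ?_⟩
  · obtain ⟨u', hu'⟩ := S.exists_evolution ht₀.le ((hbd t₀ ht₀.le).trans_lt ha.lt_top)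
    refine hu'.congr fun t ht => ?_
    refine tendsto_nhds_unique (hv t ht.1) (tendsto_iff_norm_sub_tendsto_zero.2 ?_)
    refine (tendsto_iff_norm_sub_tendsto_zero.1 (hv t₀ ht₀.le)).congr' ?_
    filter_upwards [hτlim.eventually_ge_atTop t₀] with j hj
    exact ((((hu j).restart S.toPhaseSetup hC₁ hsmall hC₀ S.hkBar (hzf j) ht₀ hj).sub
      hu').norm_eq S.toPhaseSetup ht).symm
  · refine kN_le_of_tendsto ν k tendsto_const_nhds ((hv t ht).sub_const z) ?_
    filter_upwards [hτlim.eventually_ge_atTop t] with j hj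
    exact hdr j t ⟨ht, hj⟩
  · obtain ⟨i, hi⟩ := (hτlim.eventually_ge_atTop t₀).exists
    have hle : ∀ j, t₀ ≤ τ (j + i) := fun j => hi.trans (by rw [hτ]; simp)
    refine (lintegral_kN_sq_le_liminf ν (k + ν / 2) (H := fun t => (h₁ t ^ 2)⁻¹)
      (u := fun j t => u (j + i) t - z) measurableSet_Icc
      (S.rcont.mono Icc_subset_Ici_self) (S.ρcont.mono Icc_subset_Ici_self)
      (ContinuousOn.inv₀ ((S.h₁cont.mono Icc_subset_Ici_self).pow 2) fun t ht =>
        (pow_pos (S.h₁pos t ht.1) 2).ne')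
      (fun j => ((hu (j + i)).continuousOn.mono (Icc_subset_Icc_right (hle j))).sub continuousOn_const)
      (fun t ht => ((hv t ht.1).comp (tendsto_add_atTop_nat i)).sub_const z)).trans ?_
    refine (liminf_le_liminf (Eventually.of_forall fun j => ?_)).trans (liminf_const _).le
    refine le_trans ?_ (((hu (j + i)).lintegral_drift_le S.toPhaseSetup hC₁ hsmall S.drift S.hkk
      (hτT _).le).trans (pow_le_pow_left' (mul_le_mul_right (hz _ (hτT _).le) _) 2))
    exact lintegral_mono' (rateMeasure_Icc_mono r (hle j)) le_rfl

theorem eqOn_of_tendsto (S : EvolutionSetup ν l lLow r ρ T h₀ h₁ φ φhat b kBar k C) {z : L2 n}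
    {v v' : ℝ → L2 n} (hv : ∀ t₀, T < t₀ → IsLimitEvolution φhat T t₀ (v t₀) v)
    (hv' : ∀ t₀, T < t₀ → IsLimitEvolution φhat T t₀ (v' t₀) v')
    (h : Tendsto v atTop (𝓝 z)) (h' : Tendsto v' atTop (𝓝 z)) : EqOn v v' (Ici T) := by
  intro t ht
  have h1 := (h.sub h').norm
  rw [sub_self, norm_zero] at h1
  have h2 : ‖v t - v' t‖ = 0 := by
    refine tendsto_nhds_unique (tendsto_const_nhds.congr' ?_) h1
    filter_upwards [eventually_gt_atTop T, eventually_ge_atTop t] with t₀ h3 h4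
    exact ((hv t₀ h3).sub (hv' t₀ h3)).norm_eq S.toPhaseSetup ⟨ht, h4⟩
  rwa [norm_eq_zero, sub_eq_zero] at h2

theorem isLimitEvolution_of_memX (S : EvolutionSetup ν l lLow r ρ T h₀ h₁ φ φhat b kBar k C)
    {I : Set ℝ} (hI : MeasurableSet I) (hIT : I ⊆ Ici T) {V : ℝ → L2 n}
    (hV : IsTransportSolution φ I V) (hX : MemX ν r ρ kBar I V) {t₀ : ℝ} (ht₀ : T < t₀)
    (hIt : Icc T t₀ ⊆ I) : IsLimitEvolution φhat T t₀ (𝓕 (V t₀) : L2 n) fun t => 𝓕 (V t) := by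
  obtain ⟨C₁, hC₁, hsmall⟩ := S.high
  obtain ⟨C₀, hC₀⟩ := S.base
  have hfin : ∀ t ∈ I, kN ν (ρ t) kBar (𝓕 (V t) : L2 n) < ⊤ := fun t ht =>
    (kN_le_of_yMax_le (r := r) (H := fun _ => 1) S.hν le_rfl ht one_pos).trans_lt (by simpa using hX.2)
  have hν1 := S.hν1
  have hc := L2ContinuousOn.continuousOn S.hν (by linarith [S.hkBar]) (S.ρcont.mono hIT)
    (fun t ht => S.ρ_nonneg t (hIT ht)) hfin hX.1
  obtain ⟨Λ, hΛ⟩ := S.exists_isMild_of_continuousOn ht₀ hI hIt hV hc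
  exact S.isLimitEvolution_of_mild hC₁ hsmall hC₀ S.hkBar ht₀ (hc.mono hIt) hΛ
    (hfin t₀ (hIt (right_mem_Icc.2 ht₀.le)))

theorem yMax_Icc_le (S : EvolutionSetup ν l lLow r ρ T h₀ h₁ φ φhat b kBar k C) {κ : ℝ}
    (hκ : ∃ C₁ : ℝ≥0, CommutatorBound n ν l lLow κ C₁ ∧ C₁ * b * h₁ T ≤ 2) {t₀ : ℝ} (ht₀ : T ≤ t₀)
    {z : L2 n} {V : ℝ → L2 n} (hv : IsLimitEvolution φhat T t₀ z fun t => 𝓕 (V t)) :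
    yMax ν r ρ V (Icc T t₀) (fun _ => 1) κ ≤ kN ν (ρ t₀) κ z := by
  obtain ⟨C₁, hC₁, hsmall⟩ := hκ
  refine yMax_le S.hν (fun t ht => ?_) ?_ <;> simp only [ENNReal.ofReal_one, inv_one, one_mul]
  exacts [hv.kN_le S.toPhaseSetup hC₁ hsmall ht, hv.lintegral_kN_le S.toPhaseSetup hC₁ hsmall ht₀]

theorem l2ContinuousOn (S : EvolutionSetup ν l lLow r ρ T h₀ h₁ φ φhat b kBar k C) {t₀ : ℝ}
    (ht₀ : T ≤ t₀) {z : L2 n} (hz : kN ν (ρ t₀) kBar z < ⊤) {V : ℝ → L2 n}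
    (hv : IsLimitEvolution φhat T t₀ z fun t => 𝓕 (V t)) :
    L2ContinuousOn (Icc T t₀) (fun t => kLift ν (ρ t) kBar (V t)) := by
  obtain ⟨C₁, hC₁, hsmall⟩ := S.high
  obtain ⟨C₀, hC₀⟩ := S.base
  exact hv.l2ContinuousOn S.toPhaseSetup hC₁ hsmall hC₀ S.hkBar ht₀ hz

theorem solution_Icc (S : EvolutionSetup ν l lLow r ρ T h₀ h₁ φ φhat b kBar k C) {t₀ : ℝ}
    (ht₀ : T < t₀) {z : L2 n} (hz : kN ν (ρ t₀) kBar z < ⊤) {V : ℝ → L2 n}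
    (hv : IsLimitEvolution φhat T t₀ z fun t => 𝓕 (V t)) :
    IsTransportSolution φ (Icc T t₀) V ∧ MemX ν r ρ kBar (Icc T t₀) V :=
  ⟨S.isTransportSolution_Icc ht₀ hv.continuousOn (hv.isMild S.toPhaseSetup),
    S.l2ContinuousOn ht₀.le hz hv, (S.yMax_Icc_le S.high ht₀.le hv).trans_lt hz⟩

theorem nhdsWithin_Ici_le {T t : ℝ} : 𝓝[Ici T] t ≤ 𝓝[Icc T (t + 1)] t :=
  nhdsWithin_le_of_mem (inter_mem self_mem_nhdsWithin
    (mem_nhdsWithin_of_mem_nhds (Iic_mem_nhds (lt_add_one t))))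

theorem solution_Ici (S : EvolutionSetup ν l lLow r ρ T h₀ h₁ φ φhat b kBar k C) {a : ℝ≥0∞}
    (ha : a ≠ ⊤) {V : ℝ → L2 n}
    (hv : ∀ t₀, T < t₀ → IsLimitEvolution φhat T t₀ (𝓕 (V t₀) : L2 n) fun t => 𝓕 (V t))
    (hb : ∀ t, T ≤ t → kN ν (ρ t) kBar (𝓕 (V t) : L2 n) ≤ a) :
    IsTransportSolution φ (Ici T) V ∧ MemX ν r ρ kBar (Ici T) V ∧
      yMax ν r ρ V (Ici T) (fun _ => 1) kBar ≤ a := by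
  obtain ⟨C₁, hC₁, hsmall⟩ := S.high
  have hT : ∀ {t}, t ∈ Ici T → T < t + 1 := fun ht => (mem_Ici.1 ht).trans_lt (lt_add_one _)
  have hy : yMax ν r ρ V (Ici T) (fun _ => 1) kBar ≤ a := by
    refine yMax_le S.hν (fun t ht => ?_) (lintegral_rateMeasure_Ici_le r fun t₀ ht₀ => ?_) <;>
      simp only [ENNReal.ofReal_one, inv_one, one_mul]
    · exact hb t ht
    · exact ((hv t₀ ht₀).lintegral_kN_le S.toPhaseSetup hC₁ hsmall ht₀.le).trans
        (pow_le_pow_left' (hb t₀ ht₀.le) 2)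
  refine ⟨S.isTransportSolution_Ici (fun t ht => ?_) fun t₀ ht₀ =>
    ⟨_, (hv t₀ ht₀).isMild S.toPhaseSetup⟩, ⟨fun t ht => ?_, hy.trans_lt ha.lt_top⟩, hy⟩
  · exact ((hv _ (hT ht)).continuousOn t ⟨ht, (lt_add_one t).le⟩).mono_left nhdsWithin_Ici_le
  · exact (S.l2ContinuousOn (hT ht).le ((hb _ (hT ht).le).trans_lt ha.lt_top) (hv _ (hT ht)) t
      ⟨ht, (lt_add_one t).le⟩).mono_left nhdsWithin_Ici_le

theorem neBot_atTop_inf_ae : (atTop ⊓ ae (volume : Measure ℝ)).NeBot := by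
  rw [inf_neBot_iff]
  intro s hs s' hs'
  obtain ⟨M, hM⟩ := mem_atTop_sets.1 hs
  by_contra h
  have h1 : Ici M ⊆ s'ᶜ := fun x hx hx' => h ⟨x, hM x hx, hx'⟩
  have h2 := measure_mono_null h1 (mem_ae_iff.1 hs')
  simp at h2

/-- Bounded solutions are determined by their limit at infinity. -/
theorem ae_eq_of_tendsto (S : EvolutionSetup ν l lLow r ρ T h₀ h₁ φ φhat b kBar k C) {z : L2 n}
    {V V' : ℝ → L2 n}
    (hv : ∀ t₀, T < t₀ → IsLimitEvolution φhat T t₀ (𝓕 (V t₀) : L2 n) fun t => 𝓕 (V t))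
    (h : Tendsto V atTop (𝓝 z)) (hV' : IsTransportSolution φ (Ici T) V')
    (hm : MemLp V' ⊤ (volume.restrict (Ici T))) (h' : Tendsto V' (atTop ⊓ ae volume) (𝓝 z)) :
    ∀ᵐ t ∂(volume.restrict (Ici T)), V' t = V t := by
  have hF := (Lp.fourierTransformₗᵢ (Rn n) ℂ).continuous
  obtain ⟨Λ, hΛ⟩ : ∃ Λ : ℝ, ∀ᵐ t ∂(volume.restrict (Ici T)), ‖V' t‖ ≤ Λ :=
    ⟨_, (ae_le_eLpNormEssSup (f := V')).mono fun t ht => by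
      have h2 := hm.2
      rw [eLpNorm_exponent_top] at h2
      rw [← toReal_enorm]
      exact ENNReal.toReal_mono h2.ne ht⟩
  have hsub : ∀ t₀, Ioo T t₀ ⊆ Ici T := fun t₀ t ht => ht.1.le
  have hmild : ∀ j : ℕ, ∃ E, IsMild φhat T (T + 1 + j) (fun t => 𝓕 (V' t)) E Λ := fun j =>
    S.exists_isMild (by have : (0 : ℝ) ≤ j := j.cast_nonneg; linarith) measurableSet_Ici (hsub _) hV'
      (hF.comp_aestronglyMeasurable (hm.1.mono_measure (Measure.restrict_mono (hsub _) le_rfl)))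
      ((ae_restrict_of_ae_restrict_of_subset (hsub _) hΛ).mono fun t ht => by
        rwa [Lp.norm_fourier_eq])
  choose E hE using hmild
  have hgood : ∀ᵐ t, ∀ j : ℕ, t ∈ Ioo T (T + 1 + j) →
      mulOp (fun ξ => (japSq ξ)⁻¹) (𝓕 (V' t) : L2 n) = E j t :=
    ae_all_iff.2 fun j => (ae_restrict_iff' measurableSet_Ioo).1 (hE j).eqv
  have key : ∀ t s, T < t → T < s → (∀ j : ℕ, t ∈ Ioo T (T + 1 + j) →
      mulOp (fun ξ => (japSq ξ)⁻¹) (𝓕 (V' t) : L2 n) = E j t) → (∀ j : ℕ, s ∈ Ioo T (T + 1 + j) →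
      mulOp (fun ξ => (japSq ξ)⁻¹) (𝓕 (V' s) : L2 n) = E j s) → ‖V' t - V t‖ = ‖V' s - V s‖ := by
    intro t s ht hs h1 h2
    obtain ⟨j, hj⟩ := exists_nat_gt (max t s - T)
    have ht' : t ∈ Ioo T (T + 1 + j) := ⟨ht, by linarith [le_max_left t s]⟩
    have hs' : s ∈ Ioo T (T + 1 + j) := ⟨hs, by linarith [le_max_right t s]⟩
    have h3 := S.mild_norm_eq le_rfl ((hE j).sub' S.toPhaseSetup le_rfl
      ((hv _ (ht'.1.trans ht'.2)).isMild S.toPhaseSetup)) ht' hs'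
      (by rw [Pi.sub_apply, Pi.sub_apply, map_sub, h1 j ht'])
      (by rw [Pi.sub_apply, Pi.sub_apply, map_sub, h2 j hs'])
    rwa [Pi.sub_apply, Pi.sub_apply, ← fourier_L2_sub, ← fourier_L2_sub, Lp.norm_fourier_eq,
      Lp.norm_fourier_eq] at h3
  have hlim := (h'.sub (h.mono_left inf_le_left)).norm
  rw [sub_self, norm_zero] at hlim
  have hne := neBot_atTop_inf_ae
  rw [← restrict_Ioi_eq_restrict_Ici, ae_restrict_iff' measurableSet_Ioi]
  filter_upwards [hgood] with t h1 ht
  rw [← sub_eq_zero, ← norm_eq_zero]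
  refine tendsto_nhds_unique (tendsto_const_nhds.congr' ?_) hlim
  filter_upwards [mem_inf_of_left (Ioi_mem_atTop T), mem_inf_of_right hgood] with s h2 h3
  exact key t s ht h2 h1 h3

theorem tendsto_yMax (S : EvolutionSetup ν l lLow r ρ T h₀ h₁ φ φhat b kBar k C) {M A : ℝ≥0∞}
    (hM : M ≠ ⊤) (hA : A ≠ ⊤) {d : ℝ → ℝ → L2 n} {z : ℝ → L2 n}
    (hd : ∀ τ, T < τ → IsLimitEvolution φhat T τ (z τ) fun t => 𝓕 (d τ t))
    (hz : ∀ τ, T < τ → kN ν (ρ τ) k (z τ) ≤ M * ofReal (h₁ τ))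
    (hzA : ∀ τ, T < τ → kN ν (ρ τ) kBar (z τ) ≤ A) (T₁ : ℝ) {k' : ℝ} (hk' : k' < kBar) :
    Tendsto (fun τ => yMax ν r ρ (d τ) (Icc T T₁) (fun _ => 1) k') atTop (𝓝 0) := by
  obtain ⟨C₁, hC₁, hs₁⟩ := S.high
  obtain ⟨C₂, hC₂, hs₂⟩ := S.low
  refine ENNReal.tendsto_nhds_zero.2 fun ε hε => ?_
  have hε2 : 0 < ε ^ 2 / 2 := ENNReal.half_pos (pow_ne_zero 2 hε.ne')
  have hη : 0 < ε ^ 2 / 2 / (A ^ 2 + 1) :=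
    ENNReal.div_pos hε2.ne' (by simp [ENNReal.pow_eq_top_iff, hA])
  obtain ⟨B, hB⟩ := exists_kN_sq_interpolation (n := n) hk' k hη
  have h1 : Tendsto (fun τ => B * (M * ofReal (h₁ τ)) ^ 2) atTop (𝓝 0) := by
    have h2 := ENNReal.Tendsto.const_mul ((ENNReal.continuous_ofReal.tendsto _).comp S.h₁lim)
      (Or.inr hM)
    have h3 := ENNReal.Tendsto.const_mul (((ENNReal.continuous_pow 2).tendsto _).comp h2)
      (Or.inr (ENNReal.coe_ne_top (r := B)))
    simpa using h3
  filter_upwards [eventually_gt_atTop T, eventually_ge_atTop T₁, h1.eventually (ge_mem_nhds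
    hε2)] with τ h2 h3 h4
  have hsub : Icc T T₁ ⊆ Icc T τ := Icc_subset_Icc_right h3
  have hsum : B * kN ν (ρ τ) k (z τ) ^ 2 + ε ^ 2 / 2 / (A ^ 2 + 1) * kN ν (ρ τ) kBar (z τ) ^ 2 ≤
      ε ^ 2 := by
    refine (add_le_add (le_trans ?_ h4) ?_).trans (ENNReal.add_halves (ε ^ 2)).le
    · gcongr; exact hz τ h2
    · calc _ ≤ ε ^ 2 / 2 / (A ^ 2 + 1) * (A ^ 2 + 1) := by
            gcongr; exact (pow_le_pow_left' (hzA τ h2) 2).trans le_self_add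
        _ ≤ _ := by rw [mul_comm]; exact ENNReal.mul_div_le
  have hI := hd τ h2
  refine yMax_le S.hν (fun t ht => ?_) ?_ <;> simp only [ENNReal.ofReal_one, inv_one, one_mul]
  · rw [← ENNReal.pow_le_pow_left_iff two_ne_zero]
    refine le_trans ?_ hsum
    have h5 := hB ν (ρ t) 0 _ (L2.measurable (𝓕 (d τ t) : L2 n))
    simp only [add_zero] at h5
    refine h5.trans ?_
    gcongr
    exacts [hI.kN_le S.toPhaseSetup hC₂ hs₂ (hsub ht), hI.kN_le S.toPhaseSetup hC₁ hs₁ (hsub ht)]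
  · refine le_trans (lintegral_mono' (rateMeasure_Icc_mono r h3)
      fun t => hB ν (ρ t) (ν / 2) _ (L2.measurable (𝓕 (d τ t) : L2 n))) ?_
    have hm : ∀ κ, AEMeasurable (fun t => kN ν (ρ t) κ (𝓕 (d τ t) : L2 n) ^ 2)
        (rateMeasure r (Icc T τ)) := fun κ => (aemeasurable_kN_sq ν κ measurableSet_Icc
      (S.ρcont.mono Icc_subset_Ici_self) hI.continuousOn).mono_ac (withDensity_absolutelyContinuous _ _)
    rw [lintegral_add_left' ((hm _).const_mul _), lintegral_const_mul'' _ (hm _),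
      lintegral_const_mul'' _ (hm _)]
    refine le_trans ?_ hsum
    gcongr
    exacts [hI.lintegral_kN_le S.toPhaseSetup hC₂ hs₂ h2.le,
      hI.lintegral_kN_le S.toPhaseSetup hC₁ hs₁ h2.le]

end EvolutionSetup

theorem tendsto_fourier_iff {ι : Type*} {F : Filter ι} {V : ι → L2 n} {w : L2 n} :
    Tendsto (fun i => (𝓕 (V i) : L2 n)) F (𝓝 (𝓕 w)) ↔ Tendsto V F (𝓝 w) :=
  ((Lp.fourierTransformₗᵢ (Rn n) ℂ).toHomeomorph.isInducing.tendsto_nhds_iff).symm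

theorem ae_rateMeasure_mem (r : ℝ → ℝ) {I : Set ℝ} (hI : MeasurableSet I) :
    ∀ᵐ t ∂(rateMeasure r I), t ∈ I :=
  (withDensity_absolutelyContinuous _ _).ae_le (ae_restrict_mem hI)

namespace EvolutionSetup

variable {kBar k : ℝ} {C : ℝ≥0}

theorem weakStarTendstoX (S : EvolutionSetup ν l lLow r ρ T h₀ h₁ φ φhat b kBar k C) {M A : ℝ≥0∞}
    (hM : M ≠ ⊤) (hA : A ≠ ⊤) {U : ℝ → ℝ → L2 n} {V : ℝ → L2 n} {z : ℝ → L2 n}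
    (hd : ∀ τ, T < τ → IsLimitEvolution φhat T τ (z τ) fun t => 𝓕 (U τ t - V t))
    (hz : ∀ τ, T < τ → kN ν (ρ τ) k (z τ) ≤ M * ofReal (h₁ τ))
    (hzA : ∀ τ, T < τ → kN ν (ρ τ) kBar (z τ) ≤ A) (T₁ : ℝ) :
    WeakStarTendstoX ν r ρ kBar (Icc T T₁) U V := by
  obtain ⟨C₁, hC₁, hs₁⟩ := S.high
  have hs : Tendsto (fun τ => M * ofReal (h₁ τ)) atTop (𝓝 0) := by
    have h2 := ENNReal.Tendsto.const_mul ((ENNReal.continuous_ofReal.tendsto _).comp S.h₁lim)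
      (Or.inr hM)
    rwa [ENNReal.ofReal_zero, mul_zero] at h2
  have hds : ∀ᶠ τ in atTop, ∀ t ∈ Icc T T₁,
      ‖(𝓕 (U τ t - V t) : L2 n)‖ₑ ≤ M * ofReal (h₁ τ) := by
    filter_upwards [eventually_gt_atTop T, eventually_ge_atTop T₁] with τ h1 h2 t ht
    rw [← ofReal_norm, (hd τ h1).norm_eq S.toPhaseSetup ⟨ht.1, ht.2.trans h2⟩, ofReal_norm]
    exact (enorm_le_kN (S.ρ_nonneg τ h1.le) S.hk _).trans (hz τ h1)
  have hρ : ∀ t ∈ Icc T T₁, ρ t ≤ ρ T₁ := fun t ht => S.ρ_mono ht.1 ht.2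
  have hmem := ae_restrict_mem (μ := volume) (measurableSet_Icc (a := T) (b := T₁))
  have hmem' := ae_rateMeasure_mem r (measurableSet_Icc (a := T) (b := T₁))
  constructor
  · intro g hg
    refine tendsto_integral_pairing S.hν one_pos (hmem.mono hρ) hg.1
      (by simpa only [ENNReal.rpow_one] using hg.2.ne) hg.2.ne hA (fun f hf => ?_) hs
      (hds.mono fun τ h => hmem.mono h)
    simp only [ENNReal.rpow_one, div_one]
    filter_upwards [eventually_gt_atTop T, eventually_ge_atTop T₁] with τ h1 h2
    rw [← lintegral_mul_const'' _ hf]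
    refine lintegral_mono_ae (hmem.mono fun t ht => mul_le_mul_right ?_ _)
    exact ((hd τ h1).kN_le S.toPhaseSetup hC₁ hs₁ ⟨ht.1, ht.2.trans h2⟩).trans (hzA τ h1)
  · intro g hg
    have : IsFiniteMeasure (rateMeasure r (Icc T T₁)) := isFiniteMeasure_withDensity_ofReal
      (S.rcont.mono Icc_subset_Ici_self).integrableOn_Icc.2
    have hg2 := lintegral_rpow_enorm_lt_top_of_eLpNorm_lt_top two_ne_zero ENNReal.ofNat_ne_top hg.2
    rw [ENNReal.toReal_ofNat] at hg2
    refine tendsto_integral_pairing S.hν two_pos (hmem'.mono hρ) hg.1 hg2.ne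
      (hg.integrable one_le_two).2.ne hA (fun f hf => ?_) hs (hds.mono fun τ h => hmem'.mono h)
    filter_upwards [eventually_gt_atTop T, eventually_ge_atTop T₁] with τ h1 h2
    have hI := hd τ h1
    have hm := (aemeasurable_kN_sq ν (kBar + ν / 2) measurableSet_Icc (S.ρcont.mono
      Icc_subset_Ici_self) (hI.continuousOn.mono (Icc_subset_Icc_right h2))).mono_ac
        (withDensity_absolutelyContinuous _ fun t => ofReal (r t))
    have hm' := hm.pow_const (1 / 2 : ℝ)
    have e : ∀ x : ℝ≥0∞, (x ^ 2) ^ (1 / 2 : ℝ) = x := fun x => by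
      rw [← ENNReal.rpow_natCast, ← ENNReal.rpow_mul]; norm_num
    simp only [e] at hm'
    refine (ENNReal.lintegral_mul_le_Lp_mul_Lq _ Real.HolderConjugate.two_two hf hm').trans ?_
    refine mul_le_mul_right ?_ _
    rw [← e A]
    refine ENNReal.rpow_le_rpow ?_ (by norm_num)
    simp only [ENNReal.rpow_two]
    exact (lintegral_mono' (rateMeasure_Icc_mono r h2) le_rfl).trans
      ((hI.lintegral_kN_le S.toPhaseSetup hC₁ hs₁ h1.le).trans (pow_le_pow_left' (hzA τ h1) 2))

theorem yMax_sub_le (S : EvolutionSetup ν l lLow r ρ T h₀ h₁ φ φhat b kBar k C) {V : ℝ → L2 n}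
    {w : L2 n} {D : ℝ≥0∞}
    (h1 : ∀ t, T ≤ t → kN ν (ρ t) k (𝓕 (V t) - 𝓕 w : L2 n) ≤ D * ofReal (h₁ t))
    (h2 : ∀ t₀, T < t₀ → ∫⁻ t, ofReal ((h₁ t ^ 2)⁻¹) *
      kN ν (ρ t) (k + ν / 2) (𝓕 (V t) - 𝓕 w : L2 n) ^ 2 ∂(rateMeasure r (Icc T t₀)) ≤ D ^ 2) :
    yMax ν r ρ (fun t => V t - w) (Ici T) h₁ k ≤ D := by
  refine yMax_le S.hν (fun t ht => ?_) (lintegral_rateMeasure_Ici_le r fun t₀ ht₀ => ?_)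
  · rw [mul_comm, ← div_eq_mul_inv, ENNReal.div_le_iff (by simpa using S.h₁pos t ht)
      ENNReal.ofReal_ne_top, fourier_L2_sub]
    exact h1 t ht
  · refine le_trans (lintegral_mono_ae ?_) (h2 t₀ ht₀)
    filter_upwards [ae_rateMeasure_mem r measurableSet_Icc] with t ht
    have := ofReal_inv_sq_mul (e := 1) (S.h₁pos t ht.1)
    rw [mul_one, ENNReal.ofReal_one, mul_one] at this
    rw [this, mul_pow, fourier_L2_sub]

end EvolutionSetup

end

theorem proposition6p1 (n : ℕ) (hn : 1 ≤ n) (ν γ lLow kTil lTil kBar k : ℝ)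
    (hν : 0 < ν) (hν1 : ν ≤ 1) (hγ : 0 < γ) (hγ1 : γ ≤ 1)
    (hlLow : 0 ≤ lLow) (hlLow' : lLow < (n : ℝ) / 2)
    (hlTil : (n : ℝ) / 2 - ν < lTil) (hkBar : kBar ≤ min kTil (lTil + ν / 2))
    (hkk : k + 1 - ν ≤ kBar) (hk : ν / 2 ≤ k)
    (r : ℝ → ℝ) (hr : IsGevreyRate γ r) :
    ∃ c C : ℝ≥0, 0 < c ∧
      ∀ (ρinf T : ℝ) (ρ : ℝ → ℝ), ρ = gevreyRadius r ρinf → 1 ≤ T → (∀ t, T ≤ t → 0 ≤ ρ t) →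
      ∀ h₀ h₁ : ℝ → ℝ, ContDiffOn ℝ 1 h₀ (Ici T) → ContDiffOn ℝ 1 h₁ (Ici T) →
      (∀ t, T ≤ t → 0 < h₀ t) → (∀ t, T ≤ t → 0 < h₁ t) →
      MonotoneOn h₀ (Ici T) → AntitoneOn h₁ (Ici T) → Tendsto h₁ atTop (𝓝 0) →
      (∀ t, T ≤ t → (t ^ 2)⁻¹ * (r t)⁻¹ * h₀ t ≤ h₁ t) →
      ∀ wPlus : L2 n, kNorm ν ρinf kTil wPlus < ⊤ →
      ∀ (W : ℝ → L2 n) (φ : ℝ → Rn n → ℝ) (φhat : ℝ → Rn n → ℂ),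
      MemYAmplitude ν ρ kTil (Ici T) W →
      MemYPhase ν ρ lTil lLow (Ici T) h₀ φ φhat →
      ∀ c₁ : ℝ≥0,
      (∀ t, T ≤ t → kNorm ν (ρ t) k (W t - wPlus) ≤ c₁ * ENNReal.ofReal (h₁ t)) →
      ∀ a b : ℝ≥0∞,
      a = ⨆ t ∈ Ici T, kNorm ν (ρ t) kTil (W t) →
      b = ⨆ t ∈ Ici T, (ENNReal.ofReal (h₀ t))⁻¹ * yNorm ν (ρ t) lTil lLow (φhat t) →
      b * ENNReal.ofReal (h₁ T) ≤ c →
      ∃ V : ℝ → L2 n,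
        -- Part (1)
        (IsTransportSolution φ (Ici T) V ∧ MemX ν r ρ kBar (Ici T) V ∧
          yMax ν r ρ V (Ici T) (fun _ => 1) kBar ≤ C * a ∧
          yMax ν r ρ (fun t => V t - wPlus) (Ici T) h₁ k ≤ C * a * b ∧
          Tendsto V atTop (𝓝 wPlus)) ∧
        (∀ V' : ℝ → L2 n, IsTransportSolution φ (Ici T) V' → MemX ν r ρ kBar (Ici T) V' →
          yMax ν r ρ V' (Ici T) (fun _ => 1) kBar ≤ C * a →
          yMax ν r ρ (fun t => V' t - wPlus) (Ici T) h₁ k ≤ C * a * b →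
          EqOn V' V (Ici T)) ∧
        (∀ V' : ℝ → L2 n, IsTransportSolution φ (Ici T) V' → MemX ν r ρ kBar (Ici T) V' →
          Tendsto V' atTop (𝓝 wPlus) → EqOn V' V (Ici T)) ∧
        -- Part (2)
        (∀ t₀, T < t₀ → ∃ U : ℝ → L2 n, IsTransportSolution φ (Icc T t₀) U ∧
          U t₀ = W t₀ ∧ MemX ν r ρ kBar (Icc T t₀) U) ∧
        (∀ U : ℝ → ℝ → L2 n,
          (∀ t₀, T < t₀ → IsTransportSolution φ (Icc T t₀) (U t₀) ∧
            U t₀ t₀ = W t₀ ∧ MemX ν r ρ kBar (Icc T t₀) (U t₀)) →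
          (∀ T₁, T < T₁ → ∀ k' < kBar,
            Tendsto (fun t₀ => yMax ν r ρ (fun t => U t₀ t - V t) (Icc T T₁) (fun _ => 1) k')
              atTop (𝓝 0)) ∧
          (∀ T₁, T < T₁ → WeakStarTendstoX ν r ρ kBar (Icc T T₁) U V) ∧
          (∀ t₀, T < t₀ →
            yMax ν r ρ (fun t => V t - U t₀ t) (Icc T t₀) (fun _ => 1) k ≤
              C * (a * b + c₁) * ENNReal.ofReal (h₁ t₀))) ∧
        -- Part (3)
        (∀ V' : ℝ → L2 n, MemLp V' ⊤ (volume.restrict (Ici T)) →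
          IsTransportSolution φ (Ici T) V' →
          Tendsto V' (atTop ⊓ ae volume) (𝓝 wPlus) →
          ∀ᵐ t ∂(volume.restrict (Ici T)), V' t = V t) := by
  have hkBar1 : kBar ≤ kTil := hkBar.trans (min_le_left _ _)
  have hkBar2 : kBar ≤ lTil + ν / 2 := hkBar.trans (min_le_right _ _)
  have hδ : (n : ℝ) / 2 < lTil + ν := by linarith
  have hk0 : 0 ≤ k := by linarith
  have hl0 : 0 ≤ lTil := by linarith
  obtain ⟨C₁, hC₁⟩ := lintegral_commutator_le hn hν hν1 hδ hlLow' (by linarith) hkBar2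
  obtain ⟨C₂, hC₂⟩ := lintegral_commutator_le hn (κ := k) hν hν1 hδ hlLow' hk0 (by linarith)
  obtain ⟨C₀, hC₀⟩ := lintegral_transport_le hn (k := 0) (σ := 0) hν hν1 hδ hlLow' le_rfl le_rfl
    zero_le_one (by linarith) hl0 (by linarith)
  obtain ⟨C, hC⟩ := lintegral_transport_le hn (k := k) (σ := ν / 2) hν hν1 hδ hlLow' hk0
    (by linarith) (by linarith) (by linarith) hl0 (by linarith)
  refine ⟨2 / (C₁ + C₂ + 1), C + 1, by positivity, ?_⟩
  intro ρinf T ρ hρ hT hρ0 h₀ h₁ hh₀ hh₁ h₀pos h₁pos _ h₁anti h₁lim couple w hw W φ φhat hW hφ c₁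
    hc₁ a b ha hb hbc
  have hat : a ≠ ⊤ := ha ▸ hW.2.ne
  have hbt : b ≠ ⊤ := hb ▸ hφ.2.2.ne
  lift b to ℝ≥0 using hbt
  have hsub : Ici T ⊆ Ici 1 := Ici_subset_Ici.2 hT
  have hsmall : ∀ C' : ℝ≥0, C' ≤ C₁ + C₂ + 1 → C' * b * h₁ T ≤ 2 := by
    intro C' hC'
    have h1 := ENNReal.toReal_mono ENNReal.coe_ne_top hbc
    rw [ENNReal.toReal_mul, ENNReal.toReal_ofReal (h₁pos T le_rfl).le, ENNReal.coe_toReal,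
      ENNReal.coe_toReal, NNReal.coe_div, le_div_iff₀ (by positivity)] at h1
    have h2 : (C' : ℝ) ≤ ((C₁ + C₂ + 1 : ℝ≥0) : ℝ) := by exact_mod_cast hC'
    have h3 : 0 ≤ b * h₁ T := mul_nonneg b.2 (h₁pos T le_rfl).le
    calc C' * b * h₁ T = b * h₁ T * C' := by ring
      _ ≤ b * h₁ T * ((C₁ + C₂ + 1 : ℝ≥0) : ℝ) := by gcongr
      _ ≤ 2 := by simpa using h1
  have S : EvolutionSetup ν lTil lLow r ρ T h₀ h₁ φ φhat b kBar k C :=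
    { hn := hn, hν := hν, hν1 := hν1, hδ := hδ, hLow := hlLow', hT := hT
      rpos := fun t ht => hr.pos t (hT.trans ht)
      rcont := hr.contDiffOn.continuousOn.mono hsub
      ρ_nonneg := hρ0
      ρcont := hρ ▸ (continuousOn_gevreyRadius hr ρinf).mono hsub
      ρderiv := fun t ht => hρ ▸ hasDerivAt_gevreyRadius hr ρinf (hT.trans_lt ht)
      h₀pos := h₀pos, h₀cont := hh₀.continuousOn, h₁pos := h₁pos, h₁cont := hh₁.continuousOn
      h₁diff := fun t ht => (hh₁.contDiffAt (Ici_mem_nhds ht)).differentiableAt (by simp)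
      h₁anti := h₁anti
      couple := fun t ht => by
        have h1 := hr.pos t (hT.trans ht)
        calc _ = r t * ((t ^ 2)⁻¹ * (r t)⁻¹ * h₀ t) := by field_simp
          _ ≤ _ := mul_le_mul_of_nonneg_left (couple t ht) h1.le
      phase := hφ
      bound := fun t ht => by
        rw [← ENNReal.div_le_iff (by simpa using h₀pos t ht) ENNReal.ofReal_ne_top, div_eq_mul_inv,
          mul_comm, hb]
        exact le_iSup₂_of_le t ht le_rfl
      high := ⟨C₁, hC₁, hsmall C₁ (le_self_add.trans le_self_add)⟩
      low := ⟨C₂, hC₂, hsmall C₂ (le_add_self.trans le_self_add)⟩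
      base := ⟨C₀, hC₀⟩, drift := hC, hk := hk0, hkBar := by linarith, hkk := hkk, h₁lim := h₁lim }
  have hWa : ∀ t, T ≤ t → kN ν (ρ t) kBar (𝓕 (W t) : L2 n) ≤ a := fun t ht => by
    refine (kN_mono_right hkBar1 _ _ _).trans ?_
    rw [ha, ← kNorm_eq_kN hν]
    exact le_iSup₂_of_le t ht le_rfl
  have hWk : ∀ t, T ≤ t → kN ν (ρ t) k (𝓕 (W t) - 𝓕 w : L2 n) ≤ c₁ * ENNReal.ofReal (h₁ t) :=
    fun t ht => by rw [← fourier_L2_sub, ← kNorm_eq_kN hν]; exact hc₁ t ht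
  have hz : ∀ t, T ≤ t → kN ν (ρ t) kBar (𝓕 w : L2 n) ≤ a := by
    intro t ht
    refine kN_le_of_tendsto ν kBar tendsto_const_nhds
      (tendsto_of_kN_le hk0 hρ0 h₁lim ENNReal.coe_ne_top hWk) ?_
    filter_upwards [eventually_ge_atTop t] with s hs
    exact (kN_mono_left (S.ρ_mono ht hs) _ _ _).trans (hWa s (ht.trans hs))
  obtain ⟨v, hv, hva, hvk, hvi⟩ := S.exists_global hat hz
  obtain ⟨V, rfl⟩ : ∃ V : ℝ → L2 n, v = fun t => 𝓕 (V t) :=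
    ⟨fun t => 𝓕⁻ (v t), funext fun t => (FourierTransform.fourier_fourierInv_eq (v t)).symm⟩
  have hD : (C * b * a : ℝ≥0∞) ≠ ⊤ := ENNReal.mul_ne_top (by simp [ENNReal.mul_eq_top]) hat
  have hlim := tendsto_of_kN_le hk0 hρ0 h₁lim hD hvk
  obtain ⟨hsol, hX, hy⟩ := S.solution_Ici hat hv hva
  have hCC : (C : ℝ≥0∞) ≤ ((C + 1 : ℝ≥0) : ℝ≥0∞) := by exact_mod_cast le_self_add
  have h1C : (1 : ℝ≥0∞) ≤ ((C + 1 : ℝ≥0) : ℝ≥0∞) := by exact_mod_cast le_add_self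
  have hDle : C * b * a ≤ ((C + 1 : ℝ≥0) : ℝ≥0∞) * a * b := by
    rw [mul_right_comm]; gcongr
  have hev : ∀ V', IsTransportSolution φ (Ici T) V' → MemX ν r ρ kBar (Ici T) V' →
      ∀ t₀, T < t₀ → IsLimitEvolution φhat T t₀ (𝓕 (V' t₀) : L2 n) fun t => 𝓕 (V' t) :=
    fun V' h1 h2 t₀ ht₀ => S.isLimitEvolution_of_memX measurableSet_Ici le_rfl h1 h2 ht₀
      Icc_subset_Ici_self
  have huniq : ∀ V', IsTransportSolution φ (Ici T) V' → MemX ν r ρ kBar (Ici T) V' →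
      Tendsto (fun t => (𝓕 (V' t) : L2 n)) atTop (𝓝 (𝓕 w)) → EqOn V' V (Ici T) :=
    fun V' h1 h2 h3 t ht => (Lp.fourierTransformₗᵢ (Rn n) ℂ).injective
      (S.eqOn_of_tendsto (hev V' h1 h2) hv h3 hlim ht)
  refine ⟨V, ⟨hsol, hX, hy.trans (le_mul_of_one_le_left' h1C), (S.yMax_sub_le hvk hvi).trans hDle,
    tendsto_fourier_iff.1 hlim⟩, fun V' h1 h2 _ h3 => huniq V' h1 h2 ?_,
    fun V' h1 h2 h3 => huniq V' h1 h2 (tendsto_fourier_iff.2 h3), fun t₀ ht₀ => ?_, fun U hU => ?_,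
    fun V' h1 h2 h3 => S.ae_eq_of_tendsto hv (tendsto_fourier_iff.1 hlim) h2 h1 h3⟩
  · refine tendsto_of_kN_le (ν := ν) (M := ((C + 1 : ℝ≥0) : ℝ≥0∞) * a * b) hk0 hρ0 h₁lim (ENNReal.mul_ne_top (ENNReal.mul_ne_top
      ENNReal.coe_ne_top hat) ENNReal.coe_ne_top) fun t ht => ?_
    rw [← fourier_L2_sub]
    exact kN_le_of_yMax_le hν h3 ht (h₁pos t ht)
  · have hWf := (hWa t₀ ht₀.le).trans_lt hat.lt_top
    obtain ⟨u, hu⟩ := S.exists_evolution ht₀.le hWf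
    obtain ⟨U, rfl⟩ : ∃ U : ℝ → L2 n, u = fun t => 𝓕 (U t) :=
      ⟨fun t => 𝓕⁻ (u t), funext fun t => (FourierTransform.fourier_fourierInv_eq (u t)).symm⟩
    obtain ⟨h1, h2⟩ := S.solution_Icc ht₀ hWf hu
    exact ⟨U, h1, (Lp.fourierTransformₗᵢ (Rn n) ℂ).injective (hu.final ht₀.le), h2⟩
  · have hUev : ∀ τ, T < τ → IsLimitEvolution φhat T τ (𝓕 (W τ) : L2 n) fun t => 𝓕 (U τ t) := by
      intro τ hτ
      obtain ⟨h1, h2, h3⟩ := hU τ hτ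
      rw [← h2]
      exact S.isLimitEvolution_of_memX measurableSet_Icc Icc_subset_Ici_self h1 h3 hτ le_rfl
    have hd : ∀ τ, T < τ → IsLimitEvolution φhat T τ (𝓕 (W τ) - 𝓕 (V τ) : L2 n)
        fun t => 𝓕 (U τ t - V t) := fun τ hτ =>
      ((hUev τ hτ).sub (hv τ hτ)).congr fun t _ => fourier_L2_sub _ _
    have hdM : ∀ τ, T < τ → kN ν (ρ τ) k (𝓕 (W τ) - 𝓕 (V τ) : L2 n) ≤
        (C * b * a + c₁) * ENNReal.ofReal (h₁ τ) := by
      intro τ hτ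
      rw [← sub_sub_sub_cancel_right (𝓕 (W τ) : L2 n) (𝓕 (V τ)) (𝓕 w), add_mul, add_comm]
      exact (kN_sub_le _ _ _ _ _).trans (add_le_add (hWk τ hτ.le) (hvk τ hτ.le))
    have hdA : ∀ τ, T < τ → kN ν (ρ τ) kBar (𝓕 (W τ) - 𝓕 (V τ) : L2 n) ≤ a + a := fun τ hτ =>
      (kN_sub_le _ _ _ _ _).trans (add_le_add (hWa τ hτ.le) (hva τ hτ.le))
    have hMt : (C * b * a + c₁ : ℝ≥0∞) ≠ ⊤ := ENNReal.add_ne_top.2 ⟨hD, ENNReal.coe_ne_top⟩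
    have hAt := ENNReal.add_ne_top.2 ⟨hat, hat⟩
    refine ⟨fun T₁ _ k' hk' => S.tendsto_yMax hMt hAt hd hdM hdA T₁ hk',
      fun T₁ _ => S.weakStarTendstoX hMt hAt hd hdM hdA T₁, fun t₀ ht₀ => ?_⟩
    have h1 := S.yMax_Icc_le S.low ht₀.le (V := fun t => V t - U t₀ t)
      (((hv t₀ ht₀).sub (hUev t₀ ht₀)).congr fun t _ => fourier_L2_sub _ _)
    refine h1.trans ?_
    rw [← sub_sub_sub_cancel_right (𝓕 (V t₀) : L2 n) (𝓕 (W t₀)) (𝓕 w)]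
    refine ((kN_sub_le _ _ _ _ _).trans (add_le_add (hvk t₀ ht₀.le) (hWk t₀ ht₀.le))).trans ?_
    rw [← add_mul, mul_add]
    gcongr ?_ * _
    exact add_le_add (hDle.trans (mul_assoc _ _ _).le) (le_mul_of_one_le_left' h1C)
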